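/- Let $k$ be a field of characteristic zero (for instance $k=\mathbb{C}$). **OCHAs.** An open-closed homotopy algebra (OCHA) $(\mathcal H=\mathcal H_c\oplus\mathcal H_o,\mathfrak l,\mathfrak n)$ over $k$ consists of two $\mathbb Z$-graded $k$-vector spaces $\mathcal H_c,\mathcal H_o$ and multilinear maps of degree one $$l_p:\mathcal H_c^{\otimes p}\to\mathcal H_c\ (p\ge1),\qquad n_{p,q}:\mathcal H_c^{\otimes p}\otimes\mathcal H_o^{\otimes q}\to\mathcal H_o\ (p,q\ge0,\ (p,q)\ne(0,0)),$$ graded symmetric in the arguments from $\mathcal H_c$, such that for all homogeneous $c_1,\dots,c_n\in\mathcal H_c$ and $o_1,\dots,o_m\in\mathcal H_o$ (with $l_0=0$, $n_{0,0}=0$) $$\sum_{\sigma\in\mathfrak S_{p+r=n}}(-1)^{\epsilon(\sigma)}\,l_{1+r}(l_p(c_{\sigma(1)},\dots,c_{\sigma(p)}),c_{\sigma(p+1)},\dots,c_{\sigma(n)})=0\quad(n\ge1),$$ $$\sum_{\sigma\in\mathfrak S_{p+r=n}}(-1)^{\epsilon(\sigma)}n_{1+r,m}(l_p(c_{\sigma(1)},\dots,c_{\sigma(p)}),c_{\sigma(p+1)},\dots,c_{\sigma(n)};o_1,\dots,o_m)$$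 $$+\sum_{\substack{\sigma\in\mathfrak S_{p+r=n}\\ i+s+j=m}}(-1)^{\mu}\,n_{p,i+1+j}(c_{\sigma(1)},\dots,c_{\sigma(p)};o_1,\dots,o_i,n_{r,s}(c_{\sigma(p+1)},\dots,c_{\sigma(n)};o_{i+1},\dots,o_{i+s}),o_{i+s+1},\dots,o_m)=0\quad((n,m)\neq(0,0)).$$ Here $\mathfrak S_{k_1+\cdots+k_j=n}$ denotes the set of all $(k_1,\dots,k_j)$-unshuffles (permutations increasing on each of the consecutive blocks of sizes $k_1,\dots,k_j$) for all $k_1+\cdots+k_j=n$, $(-1)^{\epsilon(\sigma)}$ is the Koszul sign of the permutation of the graded elements $c_1,\dots,c_n$, and, letters standing for their degrees in exponents, $\mu=\epsilon(\sigma)+(c_{\sigma(1)}+\cdots+c_{\sigma(p)})+(o_1+\cdots+o_i)+(o_1+\cdots+o_i)(c_{\sigma(p+1)}+\cdots+c_{\sigma(n)})$. **Morphisms.** An OCHA-morphism $\mathfrak f:(\mathcal H,\mathfrak l,\mathfrak n)\to(\mathcal H',\mathfrak l',\mathfrak n')$ consists of multilinear maps of degree zero $f_p:\mathcal H_c^{\otimes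 p}\to\mathcal H'_c$ and $f_{p,q}:\mathcal H_c^{\otimes p}\otimes\mathcal H_o^{\otimes q}\to\mathcal H'_o$ ($p,q\ge0$), graded symmetric in the arguments from $\mathcal H_c$, with $f_0=0$ and $f_{0,0}=0$, such that, for homogeneous arguments, $$\sum_{\sigma\in\mathfrak S_{p+r=n}}(-1)^{\epsilon(\sigma)}f_{1+r}(l_p\otimes\mathbf 1^{\otimes r})(c_{\sigma(1)},\dots,c_{\sigma(n)})=\sum_{\sigma\in\mathfrak S_{k_1+\cdots+k_j=n}}\frac{(-1)^{\epsilon(\sigma)}}{j!}\,l'_j(f_{k_1}\otimes\cdots\otimes f_{k_j})(c_{\sigma(1)},\dots,c_{\sigma(n)}),$$ and such that the left-hand side of the second OCHA relation, with the outer maps $n_{1+r,m}$, $n_{p,i+1+j}$ replaced by $f_{1+r,m}$, $f_{p,i+1+j}$, equals $$\sum_{\substack{\sigma\in\mathfrak S_{(r_1+\cdots+r_i)+(p_1+\cdots+p_j)=n}\\ q_1+\cdots+q_j=m}}\frac{(-1)^{\epsilon(\sigma)}}{i!}\,n'_{i,j}\big((f_{r_1}\otimes\cdots\otimes f_{r_i}\otimes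 f_{p_1,q_1}\otimes\cdots\otimes f_{p_j,q_j})(c_{\sigma(1)},\dots,c_{\sigma(n)};o_1,\dots,o_m)\big),$$ where each map is evaluated on the next block of the $c_{\sigma(\cdot)}$ and the next segment of the $o$'s, and the Koszul sign of moving these $c$'s past the preceding $o$'s is included. **Quasi-isomorphisms.** The map $d=l_1+n_{0,1}$ is a differential on $\mathcal H=\mathcal H_c\oplus\mathcal H_o$, and $f_1+f_{0,1}:(\mathcal H,d)\to(\mathcal H',d')$ is a map of complexes. The morphism $\mathfrak f$ is an OCHA-quasi-isomorphism if $f_1+f_{0,1}$ induces an isomorphism $H(\mathfrak f)$ on cohomology. **Corollary (existence of an inverse quasi-isomorphism).** If $\mathfrak f:(\mathcal H,\mathfrak l,\mathfrak n)\to(\mathcal H',\mathfrak l',\mathfrak n')$ is an OCHA-quasi-isomorphism, then there is an OCHA-quasi-isomorphism $\mathfrak g:(\mathcal H',\mathfrak l',\mathfrak n')\to(\mathcal H,\mathfrak l,\mathfrak n)$ which is inverse to $\mathfrak f$ on cohomology, that is, $H(\mathfrak g)=H(\mathfrak f)^{-1}$. Moreover, the relation "there is an OCHA-quasi-isomorphism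 $\mathcal H\to\mathcal H'$" is an equivalence relation on OCHAs over $k$. -/

import Mathlib

open scoped BigOperators

universe u v w

noncomputable section

namespace Ocha

/-- A `ℤ`-graded vector space `V = ⨁ᵣ Vʳ`, with `V.deg r` the subspace of elements of degree `r`. -/
structure GradedSpace (k : Type u) [Field k] : Type (max u (v + 1)) where
  carrier : Type v
  [addCommGroup : AddCommGroup carrier]
  [module : Module k carrier]
  deg : ℤ → Submodule k carrier
  isInternal : DirectSum.IsInternal deg

attribute [instance] GradedSpace.addCommGroup GradedSpace.module

instance {k : Type*} [Field k] : CoeSort (GradedSpace k) (Type _) := ⟨GradedSpace.carrier⟩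

/-! ## Unshuffles and Koszul signs

An unshuffle `σ` of `n` letters with consecutive blocks of sizes `k₁, …, kⱼ` (empty blocks allowed)
is recorded by the map `b : Fin n → Fin j` which sends each letter to the block it is put in: the
block sizes are the sizes of the fibres of `b`, and `σ` lists the fibres `b⁻¹(0), b⁻¹(1), …` one
after the other, each in increasing order. So a sum over all `(k₁, …, kⱼ)` with `k₁ + ⋯ + kⱼ = n`
and all `(k₁, …, kⱼ)`-unshuffles is a sum over all maps `b : Fin n → Fin j`. In the same way a
decomposition `q₁ + ⋯ + qⱼ = m` of an ordered list of `m` letters into consecutive segments is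
recorded by a monotone map `h : Fin m → Fin j`. -/

/-- The block `b⁻¹(a)`. -/
def block {n j : ℕ} (b : Fin n → Fin j) (a : Fin j) : Finset (Fin n) :=
  Finset.univ.filter fun x => b x = a

/-- The size of the block `b⁻¹(a)`. -/
def size {n j : ℕ} (b : Fin n → Fin j) (a : Fin j) : ℕ := (block b a).card

/-- The entries of the list `c` which lie in block `a`, in their original order. -/
def part {n j : ℕ} {α : Type*} (b : Fin n → Fin j) (a : Fin j) (c : Fin n → α) :
    Fin (size b a) → α :=
  fun t => c ((block b a).orderEmbOfFin rfl t)

/-- The decompositions of an ordered list of length `m` into `j` consecutive (possibly empty)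
segments. -/
def segments (m j : ℕ) : Finset (Fin m → Fin j) := Finset.univ.filter fun h => Monotone h

/-- The total degree of the letters lying in block `a`. -/
def blockDegree {n j : ℕ} (b : Fin n → Fin j) (a : Fin j) (d : Fin n → ℤ) : ℤ :=
  ∑ x ∈ block b a, d x

/-- The exponent `ε(σ)` of the Koszul sign of a permutation of letters of degrees `d`: one
contribution for each pair of letters whose order is reversed in `c_{σ(1)}, …, c_{σ(n)}`. -/
def permSign {n : ℕ} (d : Fin n → ℤ) (σ : Equiv.Perm (Fin n)) : ℤ :=
  ∑ x, ∑ y, if x < y ∧ σ y < σ x then d (σ x) * d (σ y) else 0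

/-- The exponent `ε(σ)` of the Koszul sign of the unshuffle recorded by `b`: one contribution for
each pair of letters whose order is reversed. -/
def shuffleSign {n j : ℕ} (d : Fin n → ℤ) (b : Fin n → Fin j) : ℤ :=
  ∑ x, ∑ y, if x < y ∧ b y < b x then d x * d y else 0

/-! ## Families of multilinear maps -/

/-- A family of multilinear maps `V^{⊗p} → W`, `p ≥ 0`. -/
abbrev ClosedMaps (k : Type*) [Field k] (V W : GradedSpace k) : Type _ :=
  ∀ p : ℕ, MultilinearMap k (fun _ : Fin p => V) W

/-- A family of multilinear maps `V^{⊗p} ⊗ U^{⊗q} → W`, `p, q ≥ 0`. -/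
abbrev MixedMaps (k : Type*) [Field k] (V U W : GradedSpace k) : Type _ :=
  ∀ p q : ℕ, MultilinearMap k (fun _ : Fin p => V) (MultilinearMap k (fun _ : Fin q => U) W)

section Families

variable {k : Type*} [Field k] {V U W V' U' W' : GradedSpace k}

/-- All maps of the family are homogeneous of degree `s`. -/
def ClosedMaps.HasDegree (f : ClosedMaps k V W) (s : ℤ) : Prop :=
  ∀ (p : ℕ) (d : Fin p → ℤ) (c : Fin p → V), (∀ x, c x ∈ V.deg (d x)) →
    f p c ∈ W.deg ((∑ x, d x) + s)

/-- All maps of the family are homogeneous of degree `s`. -/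
def MixedMaps.HasDegree (f : MixedMaps k V U W) (s : ℤ) : Prop :=
  ∀ (p q : ℕ) (d : Fin p → ℤ) (e : Fin q → ℤ) (c : Fin p → V) (o : Fin q → U),
    (∀ x, c x ∈ V.deg (d x)) → (∀ y, o y ∈ U.deg (e y)) →
    f p q c o ∈ W.deg ((∑ x, d x) + (∑ y, e y) + s)

/-- All maps of the family are graded symmetric. -/
def ClosedMaps.IsSymmetric (f : ClosedMaps k V W) : Prop :=
  ∀ (p : ℕ) (d : Fin p → ℤ) (c : Fin p → V), (∀ x, c x ∈ V.deg (d x)) →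
    ∀ σ : Equiv.Perm (Fin p), f p c = (permSign d σ).negOnePow • f p (fun x => c (σ x))

/-- All maps of the family are graded symmetric in the arguments from `V`. -/
def MixedMaps.IsSymmetric (f : MixedMaps k V U W) : Prop :=
  ∀ (p q : ℕ) (d : Fin p → ℤ) (c : Fin p → V) (o : Fin q → U), (∀ x, c x ∈ V.deg (d x)) →
    ∀ σ : Equiv.Perm (Fin p), f p q c o = (permSign d σ).negOnePow • f p q (fun x => c (σ x)) o

/-- `∑_{σ ∈ S_{p+r=n}} (-1)^{ε(σ)} f_{1+r} (l_p ⊗ 1^{⊗r}) (c_{σ(1)}, …, c_{σ(n)})`,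
for homogeneous `c` of degrees `d`. -/
def closedInsert (f : ClosedMaps k V W) (l : ClosedMaps k V V) {n : ℕ}
    (d : Fin n → ℤ) (c : Fin n → V) : W :=
  ∑ b : Fin n → Fin 2, (shuffleSign d b).negOnePow •
    f (size b 1 + 1) (Fin.cons (l (size b 0) (part b 0 c)) (part b 1 c))

/-- `∑_j ∑_{σ ∈ S_{k₁+⋯+kⱼ=n}} ((-1)^{ε(σ)} / j!) l'_j (f_{k₁} ⊗ ⋯ ⊗ f_{kⱼ}) (c_{σ(1)}, …, c_{σ(n)})`,
for homogeneous `c` of degrees `d`. When `f₀ = 0` all terms with `j > n` vanish, so that the sum is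
taken over `j ≤ n`. -/
def closedCompose (l' : ClosedMaps k V' W) (f : ClosedMaps k V V') {n : ℕ}
    (d : Fin n → ℤ) (c : Fin n → V) : W :=
  ∑ j ∈ Finset.range (n + 1), ∑ b : Fin n → Fin j,
    ((j.factorial : k)⁻¹) • (shuffleSign d b).negOnePow •
      l' j (fun a => f (size b a) (part b a c))

/-- The exponent
`ε(σ) + (c_{σ(1)} + ⋯ + c_{σ(p)}) + (o₁ + ⋯ + oᵢ) + (o₁ + ⋯ + oᵢ)(c_{σ(p+1)} + ⋯ + c_{σ(n)})`
(letters stand for their degrees), for the unshuffle recorded by `b` and the decomposition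
`i + s + j = m` recorded by `h`. -/
def mixedInsertSign {n m : ℕ} (d : Fin n → ℤ) (e : Fin m → ℤ) (b : Fin n → Fin 2)
    (h : Fin m → Fin 3) : ℤ :=
  shuffleSign d b + blockDegree b 0 d + blockDegree h 0 e + blockDegree h 0 e * blockDegree b 1 d

/-- The sum
`∑_{σ ∈ S_{p+r=n}} (-1)^{ε(σ)} f_{1+r,m} (l_p ⊗ 1_c^{⊗r} ⊗ 1_o^{⊗m}) (c_{σ(1)}, …, c_{σ(n)}; o₁, …, oₘ)`
plus the sum over `σ ∈ S_{p+r=n}` and `i + s + j = m` of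
`(-1)^{ε(σ)} f_{p,i+1+j} (1_c^{⊗p} ⊗ 1_o^{⊗i} ⊗ n_{r,s} ⊗ 1_o^{⊗j}) (c_{σ(1)}, …, c_{σ(n)}; o₁, …, oₘ)`,
with all signs written out, for homogeneous `c`, `o` of degrees `d`, `e`. -/
def mixedInsert (f : MixedMaps k V U W) (l : ClosedMaps k V V) (ν : MixedMaps k V U U) {n m : ℕ}
    (d : Fin n → ℤ) (e : Fin m → ℤ) (c : Fin n → V) (o : Fin m → U) : W :=
  (∑ b : Fin n → Fin 2, (shuffleSign d b).negOnePow •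
    f (size b 1 + 1) m (Fin.cons (l (size b 0) (part b 0 c)) (part b 1 c)) o) +
  ∑ b : Fin n → Fin 2, ∑ h ∈ segments m 3, (mixedInsertSign d e b h).negOnePow •
    f (size b 0) (size h 0 + 1 + size h 2) (part b 0 c)
      (Fin.append
        (Fin.append (part h 0 o)
          (fun _ : Fin 1 => ν (size b 1) (size h 1) (part b 1 c) (part h 1 o)))
        (part h 2 o))

/-- The exponent `ε(σ) + τ(σ)` for an unshuffle of `c₁, …, cₙ` into `i` blocks followed by `j`
blocks, and a decomposition of `o₁, …, oₘ` into `j` segments: `τ(σ)` has one contribution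
`c_x · o_y` for each pair with `c_x` in one of the last `j` blocks and `o_y` in a segment of smaller
number. -/
def mixedComposeSign {n m i j : ℕ} (d : Fin n → ℤ) (e : Fin m → ℤ) (b : Fin n → Fin (i + j))
    (h : Fin m → Fin j) : ℤ :=
  shuffleSign d b +
    ∑ a : Fin j, ∑ a' : Fin j,
      if a' < a then blockDegree b (Fin.natAdd i a) d * blockDegree h a' e else 0

/-- The sum over all `i`, `j`, all unshuffles `σ ∈ S_{(r₁+⋯+rᵢ)+(p₁+⋯+pⱼ)=n}` and all
`q₁ + ⋯ + qⱼ = m` of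
`((-1)^{ε(σ)} / i!) n'_{i,j} (f_{r₁} ⊗ ⋯ ⊗ f_{rᵢ} ⊗ f_{p₁,q₁} ⊗ ⋯ ⊗ f_{pⱼ,qⱼ})
(c_{σ(1)}, …, c_{σ(n)}; o₁, …, oₘ)`,
with all signs written out, for homogeneous `c`, `o` of degrees `d`, `e`. When `f₀ = 0` and
`f_{0,0} = 0` all terms with `i > n` or `j > n + m` vanish, so that the sum is taken over `i ≤ n`
and `j ≤ n + m`. -/
def mixedCompose (ν' : MixedMaps k V' U' W) (f : ClosedMaps k V V') (g : MixedMaps k V U U')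
    {n m : ℕ} (d : Fin n → ℤ) (e : Fin m → ℤ) (c : Fin n → V) (o : Fin m → U) : W :=
  ∑ i ∈ Finset.range (n + 1), ∑ j ∈ Finset.range (n + m + 1),
    ∑ b : Fin n → Fin (i + j), ∑ h ∈ segments m j,
      ((i.factorial : k)⁻¹) • (mixedComposeSign d e b h).negOnePow •
        ν' i j
          (fun a => f (size b (Fin.castAdd j a)) (part b (Fin.castAdd j a) c))
          (fun a => g (size b (Fin.natAdd i a)) (size h a) (part b (Fin.natAdd i a) c)
            (part h a o))

/-- The linear map `f₁ : V → W`. -/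
def ClosedMaps.linear (f : ClosedMaps k V W) : V →ₗ[k] W :=
  (MultilinearMap.ofSubsingleton k V W (0 : Fin 1)).symm (f 1)

/-- The linear map `f_{0,1} : U → W`. -/
def MixedMaps.linear (f : MixedMaps k V U W) : U →ₗ[k] W :=
  (MultilinearMap.ofSubsingleton k U W (0 : Fin 1)).symm (f 0 1 Fin.elim0)

end Families

/-! ## Open-closed homotopy algebras and their morphisms -/

/-- An open-closed homotopy algebra `(H = C ⊕ O, l, n)`: the maps `l_p`, `p ≥ 1`, make `C` into an
`L_∞`-algebra, and the maps `n_{p,q} : C^{⊗p} ⊗ O^{⊗q} → O`, `(p,q) ≠ (0,0)`, satisfy the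
compatibility relations. The components `l₀` and `n_{0,0}`, which are absent, are put to `0`; with
this convention the relations without any inputs hold trivially. -/
structure OCHA (k : Type u) [Field k] : Type (max u (v + 1)) where
  C : GradedSpace.{u, v} k
  O : GradedSpace.{u, v} k
  l : ClosedMaps k C C
  n : MixedMaps k C O O
  l_zero : l 0 = 0
  n_zero : n 0 0 = 0
  l_degree : l.HasDegree 1
  n_degree : n.HasDegree 1
  l_symm : l.IsSymmetric
  n_symm : n.IsSymmetric
  l_rel : ∀ (p : ℕ) (d : Fin p → ℤ) (c : Fin p → C), (∀ x, c x ∈ C.deg (d x)) →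
    closedInsert l l d c = 0
  n_rel : ∀ (p q : ℕ) (d : Fin p → ℤ) (e : Fin q → ℤ) (c : Fin p → C) (o : Fin q → O),
    (∀ x, c x ∈ C.deg (d x)) → (∀ y, o y ∈ O.deg (e y)) →
    mixedInsert n l n d e c o = 0

/-- An OCHA-morphism `H → H'`: the maps `f_p`, `p ≥ 1`, form an `L_∞`-morphism `C → C'`, and the
maps `f_{p,q} : C^{⊗p} ⊗ O^{⊗q} → O'`, `(p,q) ≠ (0,0)`, satisfy the compatibility relations. The
components `f₀` and `f_{0,0}` are `0`. -/
structure OCHA.Hom {k : Type u} [Field k] (H : OCHA.{u, v} k) (H' : OCHA.{u, w} k) :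
    Type (max u v w) where
  f : ClosedMaps k H.C H'.C
  g : MixedMaps k H.C H.O H'.O
  f_zero : f 0 = 0
  g_zero : g 0 0 = 0
  f_degree : f.HasDegree 0
  g_degree : g.HasDegree 0
  f_symm : f.IsSymmetric
  g_symm : g.IsSymmetric
  f_rel : ∀ (p : ℕ) (d : Fin p → ℤ) (c : Fin p → H.C), (∀ x, c x ∈ H.C.deg (d x)) →
    closedInsert f H.l d c = closedCompose H'.l f d c
  g_rel : ∀ (p q : ℕ) (d : Fin p → ℤ) (e : Fin q → ℤ) (c : Fin p → H.C) (o : Fin q → H.O),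
    (∀ x, c x ∈ H.C.deg (d x)) → (∀ y, o y ∈ H.O.deg (e y)) →
    mixedInsert g H.l H.n d e c o = mixedCompose H'.n f g d e c o

section Cohomology

section Arity

variable {k : Type*} [Field k] {V U W : GradedSpace k}

theorem ClosedMaps.apply_zero (f : ClosedMaps k V W) (hf : f 0 = 0) {p : ℕ} (hp : p = 0)
    (c : Fin p → V) : f p c = 0 := by
  subst hp; simp [hf]

theorem ClosedMaps.apply_one (f : ClosedMaps k V W) {p : ℕ} (hp : p = 1) (c : Fin p → V) (x : V)
    (hx : ∀ i, c i = x) : f p c = f.linear x := by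
  subst hp
  rw [show c = fun _ => x from funext hx]
  rfl

theorem MixedMaps.apply_zero (f : MixedMaps k V U W) (hf : f 0 0 = 0) {p q : ℕ} (hp : p = 0)
    (hq : q = 0) (c : Fin p → V) (o : Fin q → U) : f p q c o = 0 := by
  subst hp hq; simp [hf]

theorem MixedMaps.apply_one (f : MixedMaps k V U W) {p q : ℕ} (hp : p = 0) (hq : q = 1)
    (c : Fin p → V) (o : Fin q → U) (x : U) (hx : ∀ i, o i = x) : f p q c o = f.linear x := by
  subst hp hq
  rw [show o = fun _ => x from funext hx, show c = Fin.elim0 from Subsingleton.elim _ _]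
  rfl

theorem MixedMaps.eq_zero_of_mem (f : MixedMaps k V U W) {p q : ℕ} (c : Fin p → V) (o : Fin q → U)
    (i : Fin p) (hi : c i = 0) : f p q c o = 0 := by
  rw [(f p q).map_coord_zero i hi]; rfl

theorem size_const {n j : ℕ} (a a' : Fin j) :
    size (fun _ : Fin n => a) a' = if a = a' then n else 0 := by
  unfold size block
  split_ifs with h <;> simp [h]

theorem sum_fun_one {M : Type*} [AddCommMonoid M] {j : ℕ} (F : (Fin 1 → Fin j) → M) :
    ∑ b, F b = ∑ a : Fin j, F (fun _ => a) :=
  Fintype.sum_equiv (Equiv.funUnique (Fin 1) (Fin j)) _ _ fun b => by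
    congr 1; funext x; rw [Subsingleton.elim x 0]; rfl

theorem segments_one (j : ℕ) : segments 1 j = Finset.univ := by
  ext h; simp [segments, Subsingleton.monotone]

theorem shuffleSign_one {j : ℕ} (d : Fin 1 → ℤ) (b : Fin 1 → Fin j) : shuffleSign d b = 0 := by
  simp [shuffleSign]

theorem closedInsert_one (f : ClosedMaps k V W) (l : ClosedMaps k V V) (hl : l 0 = 0)
    (d : Fin 1 → ℤ) (x : V) : closedInsert f l d (fun _ => x) = f.linear (l.linear x) := by
  unfold closedInsert
  rw [sum_fun_one, Fin.sum_univ_two]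
  rw [f.apply_one (by simp [size_const]) _ (l.linear x), (f _).map_coord_zero 0]
  · simp [shuffleSign_one]
  · exact l.apply_zero hl (by simp [size_const]) _
  · intro i
    have : i = 0 := by
      apply Fin.ext
      have h := i.2
      have h2 : size (fun _ : Fin 1 => (0 : Fin 2)) 1 = 0 := by simp [size_const]
      simp only [Fin.val_zero]
      omega
    subst this
    exact l.apply_one (by simp [size_const]) _ _ (fun _ => rfl)

theorem closedCompose_one {V' : GradedSpace k} (l' : ClosedMaps k V' W) (f : ClosedMaps k V V')
    (d : Fin 1 → ℤ) (x : V) : closedCompose l' f d (fun _ => x) = l'.linear (f.linear x) := by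
  unfold closedCompose
  rw [Finset.sum_range_succ, Finset.sum_range_one, sum_fun_one, sum_fun_one]
  rw [Fin.sum_univ_zero, Fin.sum_univ_one, l'.apply_one rfl _ (f.linear x)]
  · simp [shuffleSign_one]
  · intro i
    refine f.apply_one ?_ _ _ fun _ => rfl
    rw [size_const, if_pos (Subsingleton.elim _ _)]

theorem mixedInsert_one (f : MixedMaps k V U W) (l : ClosedMaps k V V) (ν : MixedMaps k V U U)
    (hl : l 0 = 0) (hν : ν 0 0 = 0) (d : Fin 0 → ℤ) (e : Fin 1 → ℤ) (c : Fin 0 → V) (x : U) :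
    mixedInsert f l ν d e c (fun _ => x) = f.linear (ν.linear x) := by
  have h0 : ∀ (b : Fin 0 → Fin 2) (a : Fin 2), size b a = 0 := by
    intro b a; simp [size, block]
  have hs : ∀ (h : Fin 1 → Fin 3) (a : Fin 3), size h a = if h 0 = a then 1 else 0 := by
    intro h a
    rw [show h = fun _ => h 0 from funext fun t => by rw [Subsingleton.elim t 0], size_const]
  unfold mixedInsert
  rw [segments_one, Fintype.sum_unique, Fintype.sum_unique, sum_fun_one, Fin.sum_univ_three]
  rw [f.eq_zero_of_mem _ _ 0 (l.apply_zero hl (h0 _ _) _), smul_zero, zero_add]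
  have key : ∀ (b : Fin 0 → Fin 2) (a : Fin 3), a ≠ 1 → ∀ (y z : _),
      f (size b 0) (size (fun _ : Fin 1 => a) 0 + 1 + size (fun _ : Fin 1 => a) 2) (part b 0 c)
      (Fin.append (Fin.append y (fun _ : Fin 1 => ν (size b 1) (size (fun _ : Fin 1 => a) 1)
          (part b 1 c) (part (fun _ : Fin 1 => a) 1 (fun _ : Fin 1 => x)))) z) = 0 := by
    intro b a ha y z
    refine (f _ _ _).map_coord_zero (Fin.castAdd _ (Fin.natAdd _ 0)) ?_
    rw [Fin.append_left, Fin.append_right]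
    exact ν.apply_zero hν (h0 _ _) (by simp [hs, ha]) _ _
  rw [key _ 0 (by decide), key _ 2 (by decide), smul_zero, smul_zero, zero_add, add_zero]
  rw [f.apply_one (h0 _ _) (by simp [hs]) _ _ (ν.linear x)]
  · simp [mixedInsertSign, blockDegree, block, shuffleSign]
  · intro i
    have : i = Fin.castAdd _ (Fin.natAdd _ 0) := by
      apply Fin.ext
      have h := i.2
      have h1 : size (fun _ : Fin 1 => (1 : Fin 3)) 0 = 0 := by simp [size_const]
      have h2 : size (fun _ : Fin 1 => (1 : Fin 3)) 2 = 0 := by simp [size_const]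
      simp only [Fin.val_castAdd, Fin.val_natAdd, Fin.val_zero]
      omega
    rw [this, Fin.append_left, Fin.append_right]
    exact ν.apply_one (h0 _ _) (by simp [hs]) _ _ _ (fun _ => rfl)

theorem mixedCompose_one {V' U' : GradedSpace k} (ν' : MixedMaps k V' U' W)
    (f : ClosedMaps k V V') (g : MixedMaps k V U U')
    (d : Fin 0 → ℤ) (e : Fin 1 → ℤ) (c : Fin 0 → V) (x : U) :
    mixedCompose ν' f g d e c (fun _ => x) = ν'.linear (g.linear x) := by
  unfold mixedCompose
  rw [Finset.sum_range_one, Finset.sum_range_succ, Finset.sum_range_one]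
  simp only [segments_one, sum_fun_one]
  simp only [Fin.sum_univ_zero, Finset.sum_const_zero, Fin.sum_univ_one]
  rw [zero_add, Fintype.sum_unique]
  rw [ν'.apply_one rfl rfl _ _ (g.linear x)]
  · simp [mixedComposeSign, shuffleSign]
  · intro a
    refine g.apply_one ?_ ?_ _ _ _ fun _ => rfl
    · simp [size, block]
    · rw [size_const, if_pos (Subsingleton.elim _ _)]

theorem GradedSpace.ext_hom {A : Type*} [AddCommGroup A] [Module k A] (F G : V →ₗ[k] A)
    (h : ∀ r, ∀ x ∈ V.deg r, F x = G x) : F = G := by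
  ext x
  have hx : x ∈ ⨆ r, V.deg r := by rw [V.isInternal.submodule_iSup_eq_top]; trivial
  induction hx using Submodule.iSup_induction' with
  | mem r x hx => exact h r x hx
  | zero => simp
  | add x y _ _ hx hy => rw [map_add, map_add, hx, hy]

end Arity


variable {k : Type u} [Field k]

/-- The differential `d = l₁ + n_{0,1}` on `H = C ⊕ O`. -/
def OCHA.differential (H : OCHA k) : (H.C × H.O) →ₗ[k] (H.C × H.O) :=
  H.l.linear.prodMap H.n.linear

/-- The cohomology `ker d / im d` of the complex `(H, d)`. -/
abbrev OCHA.Cohomology (H : OCHA k) : Type _ :=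
  LinearMap.ker H.differential ⧸
    (LinearMap.range H.differential).submoduleOf (LinearMap.ker H.differential)

/-- The linear part `f₁ + f_{0,1} : H → H'`. -/
def OCHA.Hom.linear {H H' : OCHA k} (F : OCHA.Hom H H') : (H.C × H.O) →ₗ[k] (H'.C × H'.O) :=
  F.f.linear.prodMap F.g.linear

/-- `d ∘ d = 0`. -/
theorem OCHA.differential_comp_self (H : OCHA.{u, v} k) :
    H.differential ∘ₗ H.differential = 0 := by
  have h1 : H.l.linear ∘ₗ H.l.linear = 0 := GradedSpace.ext_hom _ _ fun r x hx => by
    have := H.l_rel 1 (fun _ => r) (fun _ => x) (fun _ => hx)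
    rwa [closedInsert_one _ _ H.l_zero] at this
  have h2 : H.n.linear ∘ₗ H.n.linear = 0 := GradedSpace.ext_hom _ _ fun r x hx => by
    have := H.n_rel 0 1 Fin.elim0 (fun _ => r) Fin.elim0 (fun _ => x) (fun i => i.elim0)
      (fun _ => hx)
    rwa [mixedInsert_one _ _ _ H.l_zero H.n_zero] at this
  unfold OCHA.differential
  rw [LinearMap.prodMap_comp, h1, h2, LinearMap.prodMap_zero]

/-- The linear part of an OCHA-morphism is a map of complexes. -/
theorem OCHA.Hom.linear_comp_differential {H : OCHA.{u, v} k} {H' : OCHA.{u, w} k}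
    (F : OCHA.Hom H H') : F.linear ∘ₗ H.differential = H'.differential ∘ₗ F.linear := by
  have h1 : F.f.linear ∘ₗ H.l.linear = H'.l.linear ∘ₗ F.f.linear :=
    GradedSpace.ext_hom _ _ fun r x hx => by
      have := F.f_rel 1 (fun _ => r) (fun _ => x) (fun _ => hx)
      rwa [closedInsert_one _ _ H.l_zero, closedCompose_one] at this
  have h2 : F.g.linear ∘ₗ H.n.linear = H'.n.linear ∘ₗ F.g.linear :=
    GradedSpace.ext_hom _ _ fun r x hx => by
      have := F.g_rel 0 1 Fin.elim0 (fun _ => r) Fin.elim0 (fun _ => x) (fun i => i.elim0)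
        (fun _ => hx)
      rwa [mixedInsert_one _ _ _ H.l_zero H.n_zero, mixedCompose_one] at this
  unfold OCHA.differential OCHA.Hom.linear
  rw [LinearMap.prodMap_comp, LinearMap.prodMap_comp, h1, h2]

/-- The restriction of the linear part of an OCHA-morphism to cocycles. -/
def OCHA.Hom.cocycleMap {H : OCHA.{u, v} k} {H' : OCHA.{u, w} k} (F : OCHA.Hom H H') :
    LinearMap.ker H.differential →ₗ[k] LinearMap.ker H'.differential :=
  F.linear.restrict fun x hx => by
    have := LinearMap.congr_fun F.linear_comp_differential x
    simp only [LinearMap.comp_apply, LinearMap.mem_ker.1 hx, map_zero] at this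
    exact LinearMap.mem_ker.2 this.symm

/-- The map `H(F)` induced on cohomology by the linear part of an OCHA-morphism `F`. -/
def OCHA.Hom.cohomologyMap {H : OCHA.{u, v} k} {H' : OCHA.{u, w} k} (F : OCHA.Hom H H') :
    H.Cohomology →ₗ[k] H'.Cohomology :=
  Submodule.mapQ _ _ F.cocycleMap (by
    rintro ⟨x, hx⟩ ⟨y, hy⟩
    exact ⟨F.linear y, by
      have := LinearMap.congr_fun F.linear_comp_differential y
      simp only [LinearMap.comp_apply] at this
      rw [← this, hy]; rfl⟩)

/-- `F` is an OCHA-quasi-isomorphism: the linear part induces an isomorphism on cohomology. -/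
def OCHA.Hom.IsQuasiIso {H : OCHA.{u, v} k} {H' : OCHA.{u, w} k} (F : OCHA.Hom H H') : Prop :=
  Function.Bijective F.cohomologyMap

/-- `H` is quasi-isomorphic to `H'`: there is an OCHA-quasi-isomorphism `H → H'`. -/
def OCHA.QuasiIsomorphic (H : OCHA.{u, v} k) (H' : OCHA.{u, w} k) : Prop :=
  ∃ F : OCHA.Hom H H', F.IsQuasiIso

end Cohomology

end Ocha
end

-- Graded symmetric families are replaced by honest functions. A test algebra (`TestAlg`) has closed
-- coefficients, which supercommute with all coefficients, open coefficients, on which no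
-- commutation rule among themselves is imposed, and an ideal in which products of length `N`
-- vanish. A point is a pair of sums of tensors `a ⊗ v` with `a` in that ideal and with `a` and `v`
-- of equal degree, closed vectors carrying closed coefficients and open vectors open ones. A family
-- takes on a point `(x, y)` the values `∑ f_p(x, …, x) / p!` and `∑ f_{p,q}(x, …, x; y, …, y) / p!`
-- (`ev`); open arguments are ordered, hence have no factorial. The series are finite by nilpotence.
--
-- The signs in the defining relations are exactly those produced by sorting coefficients
-- (`prod_compose`, `prod_insertC`, `prod_insertO`), so on points they disappear. Composition of
-- families becomes composition of functions (`evF_composeF`). Insertion of an odd family `Q`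
-- becomes its infinitesimal flow: `F (z + θ • Q z) = F z + θ • (F.ins Q) z` for an odd `θ` of
-- square zero (`evF_insertF`). A family is determined by its values on all points (`Fam.ext_ev`),
-- and identities may be tested after multiplication with a freshly adjoined letter
-- (`letter_smul_inj`). Thus an OCHA is a vector field `Q` of degree one and square zero, and a
-- morphism is a map carrying the flow of `Q` to that of `Q'` (`eq_comp_of_flow`,
-- `flow_of_eq_comp`). Equations between families are solved degree by degree for a weight
-- filtration (`Fam.Agree`, `Fam.exists_limit`); in particular a family of degree zero with identity
-- linear part is invertible (`Fam.exists_inverse`).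
--
-- Let `d`, `d'` be the linear parts of `Q`, `Q'`. Over a field one finds `h` of degree -1 with `h h
-- = 0`, `d h d = d`, `h d h = h`; then `π = 1 - d h - h d` projects onto representatives of
-- cohomology, and similarly `h'`, `π'`. A quasi-isomorphism with linear part `f` yields a linear
-- inverse `b` on representatives (`Hom.exists_linearInverse`). The nonlinear inverse is built in
-- three moves.
--
-- Minimal model (`Contraction.exists_minimal_model`): the locus `h y = 0`, `h Q y = 0` is preserved
-- by the flow because `Q` has square zero. The coordinate change `W = π + d h + h Q` parametrizes
-- it by the image of `π`, giving an embedding `I` and a vector field `M` with `I` carrying the flow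
-- of `M` to that of `Q`.
--
-- Straightening: `F ∘ I` has linear part `f π`, so a coordinate change `U` of the target turns it
-- into the linear embedding `f π`. In the new coordinates `Q'` becomes a vector field `P` of square
-- zero which restricts to `M` on the image of `f π`.
--
-- Projection: a map `p` with `P p = M ∘ p` extending `b` is wanted. Let `N` be the graded
-- commutator of `P` with the linear contraction `h' (1 - f b)`. Its leading part is the derivation
-- defined by the projection complementary to `f b`, which multiplies by the number of arguments
-- lying in the image of that complementary projection. In characteristic zero this is invertible on
-- families vanishing on the image of `f b`, so `N p = 0` has exactly one solution with prescribed
-- restriction to that image (`Retract.exists_extension`, `Retract.eq_zero_of_N`). Both `P p` and `M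
-- ∘ p` are killed by `N` and agree on the image, hence are equal.
--
-- The inverse is `I ∘ p ∘ U⁻¹`, with linear part `b`. Symmetry of the relation follows from it;
-- reflexivity and transitivity come from the identity and from composition of maps on points.

universe x y

noncomputable section

open scoped TensorProduct

namespace Ocha

/-! ## Blocks and updates -/

theorem part_update_ne {n j : ℕ} {α : Type*} (b : Fin n → Fin j) (a : Fin j) (c : Fin n → α)
    (x : Fin n) (hx : b x ≠ a) (v : α) : part b a (Function.update c x v) = part b a c := by
  funext t
  unfold part
  rw [Function.update_of_ne]
  intro h
  have := (block b a).orderEmbOfFin_mem rfl t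
  rw [h] at this
  simp [block] at this
  exact hx this

theorem exists_orderEmbOfFin {n j : ℕ} (b : Fin n → Fin j) (x : Fin n) :
    ∃ t, (block b (b x)).orderEmbOfFin rfl t = x := by
  have : x ∈ Set.range ((block b (b x)).orderEmbOfFin rfl) := by
    rw [Finset.range_orderEmbOfFin]; simp [block]
  exact this

/-- The position `t` is chosen before `c` and `v`: changing one letter changes one entry of its
block, always the same one. Linearity of block terms in that letter needs this uniformity. -/
theorem part_update_eq {n j : ℕ} {α : Type*} (b : Fin n → Fin j) (x : Fin n) (a : Fin j)
    (ha : b x = a) : ∃ t, ∀ (c : Fin n → α) (v : α),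
      part b a (Function.update c x v) = Function.update (part b a c) t v := by
  subst ha
  obtain ⟨t, ht⟩ := exists_orderEmbOfFin b x
  refine ⟨t, fun c v => ?_⟩
  funext (s : Fin (block b (b x)).card)
  change Function.update c x v ((block b (b x)).orderEmbOfFin rfl s) =
    Function.update (fun t => c ((block b (b x)).orderEmbOfFin rfl t)) t v s
  by_cases h : s = t
  · subst h; rw [ht]; simp
  · rw [Function.update_of_ne h, Function.update_of_ne]
    intro h'
    exact h (((block b (b x)).orderEmbOfFin rfl).injective (h'.trans ht.symm))

theorem append_update_left {α : Type*} {p q : ℕ} (a : Fin p → α) (b : Fin q → α) (t : Fin p) (v : α) :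
    Fin.append (Function.update a t v) b = Function.update (Fin.append a b) (Fin.castAdd q t) v := by
  funext s
  refine Fin.addCases (fun s => ?_) (fun s => ?_) s
  · rw [Fin.append_left]
    by_cases h : s = t
    · subst h; simp
    · rw [Function.update_of_ne h, Function.update_of_ne (by simpa using h), Fin.append_left]
  · rw [Fin.append_right, Function.update_of_ne, Fin.append_right]
    intro h
    have := congrArg Fin.val h
    simp at this; omega

theorem append_update_right {α : Type*} {p q : ℕ} (a : Fin p → α) (b : Fin q → α) (t : Fin q)
    (v : α) :
    Fin.append a (Function.update b t v) = Function.update (Fin.append a b) (Fin.natAdd p t) v := by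
  funext s
  refine Fin.addCases (fun s => ?_) (fun s => ?_) s
  · rw [Fin.append_left, Function.update_of_ne, Fin.append_left]
    intro h
    have := congrArg Fin.val h
    simp at this; omega
  · rw [Fin.append_right]
    by_cases h : s = t
    · subst h; simp
    · rw [Function.update_of_ne h, Function.update_of_ne (by simpa using h), Fin.append_right]

/-! ### Multilinearity of the terms of compositions and insertions -/

section Terms

variable {k : Type*} [CommRing k] {V U W V' U' : Type*}
  [AddCommGroup V] [Module k V] [AddCommGroup U] [Module k U] [AddCommGroup W] [Module k W]
  [AddCommGroup V'] [Module k V'] [AddCommGroup U'] [Module k U']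

/-- Multilinear maps with `p` arguments in `V`, `q` arguments in `U` and values in `W`. -/
abbrev Bi (k V U W : Type*) [CommRing k] [AddCommGroup V] [Module k V] [AddCommGroup U] [Module k U]
    [AddCommGroup W] [Module k W] (p q : ℕ) : Type _ :=
  MultilinearMap k (fun _ : Fin p => V) (MultilinearMap k (fun _ : Fin q => U) W)

/-- The function `φ` is linear. -/
def IsLin (k : Type*) [CommRing k] {V W : Type*} [AddCommGroup V] [Module k V] [AddCommGroup W]
    [Module k W] (φ : V → W) : Prop := ∃ T : V →ₗ[k] W, ∀ v, φ v = T v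

theorem IsLin.comp {φ : V → W} (h : IsLin k φ) (L : W →ₗ[k] V') : IsLin k (fun v => L (φ v)) := by
  obtain ⟨T, hT⟩ := h
  exact ⟨L ∘ₗ T, fun v => by simp [hT]⟩

/-- The variable enters a single slot `a0`, and there linearly; the other slots are frozen at their
values for `v = 0`. -/
theorem IsLin.multi {n : ℕ} {φ : V → W} (h : IsLin k φ)
    (F : MultilinearMap k (fun _ : Fin n => W) V') (A : V → Fin n → W) (a0 : Fin n)
    (h0 : ∀ v, A v a0 = φ v) (h1 : ∀ v a, a ≠ a0 → A v a = A 0 a) : IsLin k (fun v => F (A v)) := by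
  obtain ⟨T, hT⟩ := h
  refine ⟨F.toLinearMap (A 0) a0 ∘ₗ T, fun v => ?_⟩
  simp only [LinearMap.comp_apply, MultilinearMap.toLinearMap_apply]
  congr 1
  funext a
  by_cases ha : a = a0
  · subst ha; rw [Function.update_self, h0, hT]
  · rw [Function.update_of_ne ha, h1 v a ha]

theorem IsLin.update {n : ℕ} (F : MultilinearMap k (fun _ : Fin n => V) W) (c : Fin n → V)
    (t : Fin n) : IsLin k (fun v => F (Function.update c t v)) :=
  ⟨F.toLinearMap c t, fun _ => rfl⟩

theorem IsLin.apply {m : ℕ} {φ : V → MultilinearMap k (fun _ : Fin m => U) W} (h : IsLin k φ)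
    (o : Fin m → U) : IsLin k (fun v => φ v o) := by
  obtain ⟨T, hT⟩ := h
  exact ⟨⟨⟨fun v => T v o, by simp⟩, by simp⟩, fun v => by simp [hT]⟩

theorem IsLin.part {n j : ℕ} (b : Fin n → Fin j) (x : Fin n) (a : Fin j) (ha : b x = a)
    (F : MultilinearMap k (fun _ : Fin (size b a) => V) W) (c : Fin n → V) :
    IsLin k (fun v => F (Ocha.part b a (Function.update c x v))) := by
  obtain ⟨t, ht⟩ := part_update_eq (α := V) b x a ha
  simp only [ht]
  exact IsLin.update _ _ _

/-- A function of two lists of arguments which is linear in each of them, as a curried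
multilinear map. -/
def mkBi {n m : ℕ} (B : (Fin n → V) → (Fin m → U) → W)
    (h1 : ∀ c o x, IsLin k (fun v => B (Function.update c x v) o))
    (h2 : ∀ c o y, IsLin k (fun v => B c (Function.update o y v))) : Bi k V U W n m :=
  MultilinearMap.mk'
    (fun c => MultilinearMap.mk' (fun o => B c o)
      (fun o y u u' => by obtain ⟨T, hT⟩ := h2 c o y; simp [hT])
      (fun o y r u => by obtain ⟨T, hT⟩ := h2 c o y; simp [hT]))
    (fun c x u u' => by
      ext o; obtain ⟨T, hT⟩ := h1 c o x; simp [hT])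
    (fun c x r u => by
      ext o; obtain ⟨T, hT⟩ := h1 c o x; simp [hT])

@[simp] theorem mkBi_apply {n m : ℕ} (B : (Fin n → V) → (Fin m → U) → W) (h1 h2) (c : Fin n → V)
    (o : Fin m → U) : mkBi (k := k) B h1 h2 c o = B c o := rfl

/-- The term of a composition belonging to given decompositions of the arguments. -/
def compTerm {n m i j : ℕ} (b : Fin n → Fin (i + j)) (h : Fin m → Fin j)
    (ν : Bi k V' U' W i j) (f : ∀ p, MultilinearMap k (fun _ : Fin p => V) V')
    (g : ∀ p q, Bi k V U U' p q) : Bi k V U W n m :=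
  mkBi (fun c o => ν (fun a => f (size b (Fin.castAdd j a)) (part b (Fin.castAdd j a) c))
      (fun a => g (size b (Fin.natAdd i a)) (size h a) (part b (Fin.natAdd i a) c) (part h a o)))
    (fun c o x => by
      -- The letter `x` lies in exactly one block, which feeds either some `f` or some `g`; all
      -- other slots do not see it.
      obtain ⟨a0, hbx⟩ | ⟨a0, hbx⟩ : (∃ a, b x = Fin.castAdd j a) ∨ ∃ a, b x = Fin.natAdd i a :=
        Fin.addCases (motive := fun y => (∃ a, y = Fin.castAdd j a) ∨ ∃ a, y = Fin.natAdd i a)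
          (fun a => Or.inl ⟨a, rfl⟩) (fun a => Or.inr ⟨a, rfl⟩) (b x)
      · have e : ∀ v, (fun a => g (size b (Fin.natAdd i a)) (size h a)
            (part b (Fin.natAdd i a) (Function.update c x v)) (part h a o)) = fun a =>
            g (size b (Fin.natAdd i a)) (size h a) (part b (Fin.natAdd i a) c) (part h a o) := by
          intro v
          funext a
          rw [part_update_ne]
          rw [hbx]
          intro h'
          have := congrArg Fin.val h'
          simp at this; omega
        simp only [e]
        refine IsLin.apply (IsLin.multi (IsLin.part b x _ hbx (f _) c) ν _ a0
          (fun v => rfl) fun v a ha => ?_) _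
        have : b x ≠ Fin.castAdd j a := by rw [hbx]; simpa using ha.symm
        rw [part_update_ne _ _ _ _ this, part_update_ne _ _ _ _ this]
      · have e : ∀ v, (fun a => f (size b (Fin.castAdd j a))
            (part b (Fin.castAdd j a) (Function.update c x v))) = fun a =>
            f (size b (Fin.castAdd j a)) (part b (Fin.castAdd j a) c) := by
          intro v
          funext a
          rw [part_update_ne]
          rw [hbx]
          intro h'
          have := congrArg Fin.val h'
          simp at this; omega
        simp only [e]
        refine IsLin.multi (IsLin.apply (IsLin.part b x _ hbx (g _ _) c) _) _ _ a0
          (fun v => rfl) fun v a ha => ?_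
        have : b x ≠ Fin.natAdd i a := by rw [hbx]; simpa using ha.symm
        rw [part_update_ne _ _ _ _ this, part_update_ne _ _ _ _ this])
    (fun c o y => by
      refine IsLin.multi (IsLin.part h y _ rfl (g _ _ _) o) _ _ (h y)
          (fun v => rfl) fun v a ha => ?_
      rw [part_update_ne _ _ _ _ ha.symm, part_update_ne _ _ _ _ ha.symm])

/-- The term of an insertion of a closed operation. -/
def insTermC {n m : ℕ} (b : Fin n → Fin 2) (f : ∀ p q, Bi k V U W p q)
    (l : ∀ p, MultilinearMap k (fun _ : Fin p => V) V) : Bi k V U W n m :=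
  mkBi (fun c o => f (size b 1 + 1) m (Fin.cons (l (size b 0) (part b 0 c)) (part b 1 c)) o)
    (fun c o x => by
      apply IsLin.apply
      rcases Fin.exists_fin_two.1 ⟨b x, rfl⟩ with hb | hb
      · refine IsLin.multi (IsLin.part b x 0 hb (l _) c) _ _ 0 (fun v => rfl) ?_
        intro v a ha
        obtain ⟨a, rfl⟩ := Fin.exists_succ_eq.2 ha
        simp only [Fin.cons_succ]
        rw [part_update_ne _ _ _ _ (by rw [hb]; simp), part_update_ne _ _ _ _ (by rw [hb]; simp)]
      · have e : ∀ v, part b 0 (Function.update c x v) = part b 0 c := fun v =>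
          part_update_ne _ _ _ _ (by rw [hb]; simp) v
        simp only [e]
        exact IsLin.part b x 1 hb ((f (size b 1 + 1) m).curryLeft (l (size b 0) (part b 0 c))) c)
    (fun c o y => IsLin.update _ _ _)

/-- The term of an insertion of an open operation. -/
def insTermO {n m : ℕ} (b : Fin n → Fin 2) (h : Fin m → Fin 3) (f : ∀ p q, Bi k V U W p q)
    (ν : ∀ p q, Bi k V U U p q) : Bi k V U W n m :=
  mkBi (fun c o => f (size b 0) (size h 0 + 1 + size h 2) (part b 0 c)
      (Fin.append (Fin.append (part h 0 o)
        (fun _ : Fin 1 => ν (size b 1) (size h 1) (part b 1 c) (part h 1 o))) (part h 2 o)))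
    (fun c o x => by
      rcases Fin.exists_fin_two.1 ⟨b x, rfl⟩ with hb | hb
      · have e : ∀ v, part b 1 (Function.update c x v) = part b 1 c := fun v =>
          part_update_ne _ _ _ _ (by rw [hb]; simp) v
        simp only [e]
        exact IsLin.apply (IsLin.part b x 0 hb (f _ _) c) _
      · have e : ∀ v, part b 0 (Function.update c x v) = part b 0 c := fun v =>
          part_update_ne _ _ _ _ (by rw [hb]; simp) v
        simp only [e]
        refine IsLin.multi (IsLin.apply (IsLin.part b x 1 hb (ν _ _) c) (part h 1 o)) _ _
          (Fin.castAdd _ (Fin.natAdd _ 0)) (fun v => ?_) fun v a ha => ?_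
        · rw [Fin.append_left, Fin.append_right]
        · revert ha
          refine Fin.addCases (fun a => ?_) (fun a => ?_) a
          · refine Fin.addCases (fun a => ?_) (fun a => ?_) a
            · simp
            · rw [Subsingleton.elim a 0]; simp
          · simp)
    (fun c o y => by
      have key : h y = 0 ∨ h y = 1 ∨ h y = 2 := by
        generalize h y = z; revert z; decide
      rcases key with hy | hy | hy
      · have e1 : ∀ v, part h 1 (Function.update o y v) = part h 1 o := fun v =>
          part_update_ne _ _ _ _ (by rw [hy]; decide) v
        have e2 : ∀ v, part h 2 (Function.update o y v) = part h 2 o := fun v =>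
          part_update_ne _ _ _ _ (by rw [hy]; decide) v
        obtain ⟨t, ht⟩ := part_update_eq (α := U) h y 0 hy
        simp only [e1, e2, ht, append_update_left]
        exact IsLin.update _ _ _
      · have e1 : ∀ v, part h 0 (Function.update o y v) = part h 0 o := fun v =>
          part_update_ne _ _ _ _ (by rw [hy]; decide) v
        have e2 : ∀ v, part h 2 (Function.update o y v) = part h 2 o := fun v =>
          part_update_ne _ _ _ _ (by rw [hy]; decide) v
        simp only [e1, e2]
        refine IsLin.multi (IsLin.part h y 1 hy (ν _ _ (part b 1 c)) o) _ _
          (Fin.castAdd _ (Fin.natAdd _ 0)) (fun v => ?_) fun v a ha => ?_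
        · rw [Fin.append_left, Fin.append_right]
        · revert ha
          refine Fin.addCases (fun a => ?_) (fun a => ?_) a
          · refine Fin.addCases (fun a => ?_) (fun a => ?_) a
            · simp
            · rw [Subsingleton.elim a 0]; simp
          · simp
      · have e1 : ∀ v, part h 0 (Function.update o y v) = part h 0 o := fun v =>
          part_update_ne _ _ _ _ (by rw [hy]; decide) v
        have e2 : ∀ v, part h 1 (Function.update o y v) = part h 1 o := fun v =>
          part_update_ne _ _ _ _ (by rw [hy]; decide) v
        obtain ⟨t, ht⟩ := part_update_eq (α := U) h y 2 hy
        simp only [e1, e2, ht, append_update_right]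
        exact IsLin.update _ _ _)

/-- Multilinear maps which agree on generators agree on their spans. -/
theorem multilinear_eq_of_span {n : ℕ} (F G : MultilinearMap k (fun _ : Fin n => V) W)
    (S : Set V) (h : ∀ x, (∀ i, x i ∈ S) → F x = G x) (x : Fin n → V)
    (hx : ∀ i, x i ∈ Submodule.span k S) : F x = G x := by
  -- Induction on the set `s` of slots allowed to lie in the span, the remaining slots still being
  -- generators.
  have key : ∀ (s : Finset (Fin n)) (x : Fin n → V), (∀ i ∈ s, x i ∈ Submodule.span k S) →
      (∀ i ∉ s, x i ∈ S) → F x = G x := by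
    intro s
    induction s using Finset.induction_on with
    | empty => exact fun x _ h2 => h x fun i => h2 i (by simp)
    | insert i s his ih =>
      intro x h1 h2
      have : ∀ v ∈ Submodule.span k S, F (Function.update x i v) = G (Function.update x i v) := by
        intro v hv
        induction hv using Submodule.span_induction with
        | mem v hv =>
          refine ih _ (fun a ha => ?_) fun a ha => ?_
          · rw [Function.update_of_ne (by rintro rfl; exact his ha)]
            exact h1 a (Finset.mem_insert_of_mem ha)
          · by_cases hai : a = i
            · subst hai; simpa using hv
            · rw [Function.update_of_ne hai]
              exact h2 a (by simp [hai, ha])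
        | zero => simp
        | add v w _ _ hv hw => rw [F.map_update_add, G.map_update_add, hv, hw]
        | smul r v _ hv => rw [F.map_update_smul, G.map_update_smul, hv]
      have := this (x i) (h1 i (Finset.mem_insert_self _ _))
      simpa using this
  exact key Finset.univ x (fun i _ => hx i) (fun i hi => absurd (Finset.mem_univ i) hi)

theorem bi_eq_of_span {n m : ℕ} (F G : Bi k V U W n m) (S : Set V) (T : Set U)
    (h : ∀ x y, (∀ i, x i ∈ S) → (∀ i, y i ∈ T) → F x y = G x y) (x : Fin n → V) (y : Fin m → U)
    (hx : ∀ i, x i ∈ Submodule.span k S) (hy : ∀ i, y i ∈ Submodule.span k T) : F x y = G x y := by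
  let evy : ∀ (y : Fin m → U), MultilinearMap k (fun _ : Fin m => U) W →ₗ[k] W := fun y =>
    ⟨⟨fun φ => φ y, fun _ _ => rfl⟩, fun _ _ => rfl⟩
  refine multilinear_eq_of_span (F x) (G x) T (fun y hy => ?_) y hy
  exact multilinear_eq_of_span ((evy y).compMultilinearMap F) ((evy y).compMultilinearMap G) S
    (fun x hx => h x y hx hy) x hx

end Terms

/-! ## Koszul signs of products -/

/-- An increasing enumeration of a block is a filter of the list of all letters. In this form the
first letter can be split off, which drives the inductions on `n` below. -/
theorem ofFn_part {n j : ℕ} {α : Type*} (b : Fin n → Fin j) (a : Fin j) (c : Fin n → α) :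
    List.ofFn (part b a c) = ((List.finRange n).filter fun x => b x = a).map c := by
  have h1 : List.ofFn (part b a c) =
      ((List.finRange (block b a).card).map ((block b a).orderEmbOfFin rfl)).map c := by
    rw [List.map_map, ← List.ofFn_eq_map]; rfl
  rw [h1, Finset.listMap_orderEmbOfFin_finRange]
  congr 1
  refine List.Perm.eq_of_pairwise (le := (· ≤ ·)) (fun x y _ _ h1 h2 => le_antisymm h1 h2)
    ((block b a).pairwise_sort (· ≤ ·)) ?_ ?_
  · exact ((List.pairwise_le_finRange n).filter _)
  · rw [List.perm_ext_iff_of_nodup ((block b a).sort_nodup (· ≤ ·))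
      ((List.nodup_finRange n).filter _)]
    intro x
    simp [block]

theorem prod_ofFn_part_succ {n j : ℕ} {A : Type*} [Monoid A] (b : Fin (n + 1) → Fin j) (a : Fin j)
    (c : Fin (n + 1) → A) : (List.ofFn (part b a c)).prod =
      (if b 0 = a then c 0 else 1) *
        (List.ofFn (part (fun x : Fin n => b x.succ) a fun x : Fin n => c x.succ)).prod := by
  rw [ofFn_part, ofFn_part, List.finRange_succ, List.filter_cons, List.filter_map]
  split_ifs with h1 h2 h2 <;> simp_all [Function.comp_def]

section

variable {A : Type*} [Ring A]

theorem mul_list_prod_of_comm (a : A) (d : ℤ) (L : List (A × ℤ))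
    (h : ∀ z ∈ L, a * z.1 = (d * z.2).negOnePow • (z.1 * a)) :
    a * (L.map Prod.fst).prod =
      (d * (L.map Prod.snd).sum).negOnePow • ((L.map Prod.fst).prod * a) := by
  induction L with
  | nil => simp
  | cons z L ih =>
    rw [List.map_cons, List.prod_cons, List.map_cons, List.sum_cons, ← mul_assoc,
      h z (by simp), smul_mul_assoc, mul_assoc, ih fun z hz => h z (by simp [hz]), mul_smul_comm,
      smul_smul, ← Int.negOnePow_add, mul_add, mul_assoc]

theorem list_prod_mul_of_comm (a : A) (d : ℤ) (L : List (A × ℤ))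
    (h : ∀ z ∈ L, z.1 * a = (z.2 * d).negOnePow • (a * z.1)) :
    (L.map Prod.fst).prod * a =
      ((L.map Prod.snd).sum * d).negOnePow • (a * (L.map Prod.fst).prod) := by
  induction L with
  | nil => simp
  | cons z L ih =>
    rw [List.map_cons, List.prod_cons, List.map_cons, List.sum_cons, mul_assoc,
      ih fun z hz => h z (by simp [hz]), mul_smul_comm, ← mul_assoc, h z (by simp), smul_mul_assoc,
      smul_smul, ← Int.negOnePow_add, mul_assoc, add_mul, add_comm]

theorem mul_ofFn_prod {n : ℕ} (a : A) (s : ℤ) (c : Fin n → A) (d : Fin n → ℤ)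
    (h : ∀ x, a * c x = (s * d x).negOnePow • (c x * a)) :
    a * (List.ofFn c).prod = (s * ∑ x, d x).negOnePow • ((List.ofFn c).prod * a) := by
  have := mul_list_prod_of_comm a s (List.ofFn fun x => (c x, d x)) (by
    intro z hz
    obtain ⟨x, rfl⟩ := (List.mem_ofFn' _ _).1 hz
    exact h x)
  simpa [List.map_ofFn, Function.comp_def, List.sum_ofFn] using this

theorem ofFn_prod_mul {n : ℕ} (a : A) (s : ℤ) (c : Fin n → A) (d : Fin n → ℤ)
    (h : ∀ x, c x * a = (d x * s).negOnePow • (a * c x)) :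
    (List.ofFn c).prod * a = ((∑ x, d x) * s).negOnePow • (a * (List.ofFn c).prod) := by
  have := list_prod_mul_of_comm a s (List.ofFn fun x => (c x, d x)) (by
    intro z hz
    obtain ⟨x, rfl⟩ := (List.mem_ofFn' _ _).1 hz
    exact h x)
  simpa [List.map_ofFn, Function.comp_def, List.sum_ofFn] using this

theorem sum_part {n j : ℕ} (b : Fin n → Fin j) (a : Fin j) (d : Fin n → ℤ) :
    ∑ t, part b a d t = blockDegree b a d := by
  unfold blockDegree part
  change ∑ t : Fin (block b a).card, d ((block b a).orderEmbOfFin rfl t) = _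
  conv_rhs => rw [← (block b a).map_orderEmbOfFin_univ rfl, Finset.sum_map]
  rfl

/-- To reach the front from block `t`, the element `a` has to cross the blocks of smaller number,
and only these. -/
theorem prod_insert_of_comm {j : ℕ} (t : Fin j) (a : A) (B : Fin j → A) (s : Fin j → ℤ)
    (h : ∀ α < t, a * B α = (s α).negOnePow • (B α * a)) :
    (List.ofFn fun α => (if t = α then a else 1) * B α).prod =
      (∑ α, if α < t then s α else 0).negOnePow • (a * (List.ofFn B).prod) := by
  induction j with
  | zero => exact t.elim0
  | succ j ih =>
    rw [List.ofFn_succ, List.ofFn_succ, List.prod_cons, List.prod_cons, Fin.sum_univ_succ]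
    refine Fin.cases ?_ (fun t => ?_) t h
    · intro h
      simp [(Fin.succ_ne_zero _).symm, mul_assoc]
    · intro h
      have := ih t (fun α => B α.succ) (fun α => s α.succ) fun α hα => h α.succ (by simpa using hα)
      simp only [Fin.succ_ne_zero, if_false, one_mul, Fin.succ_inj, Fin.succ_lt_succ_iff,
        Fin.succ_pos, if_true]
      rw [this, mul_smul_comm, ← mul_assoc, ← mul_assoc, h 0 (Fin.succ_pos t), smul_mul_assoc,
        smul_smul, Int.negOnePow_add]
      congr 1
      -- The sign `s 0` now occurs twice, once from the sum and once from rewriting `a * B 0`, and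
      -- cancels.
      rw [mul_comm (s 0).negOnePow, mul_assoc, ← Int.negOnePow_add, ← two_mul,
        Int.negOnePow_two_mul, mul_one]

theorem shuffleSign_succ {n j : ℕ} (d : Fin (n + 1) → ℤ) (b : Fin (n + 1) → Fin j) :
    shuffleSign d b = (∑ y : Fin n, if b y.succ < b 0 then d 0 * d y.succ else 0) +
      shuffleSign (fun x => d x.succ) fun x => b x.succ := by
  simp only [shuffleSign]
  rw [Fin.sum_univ_succ, Fin.sum_univ_succ]
  simp only [lt_irrefl, false_and, if_false, zero_add, Fin.succ_pos, true_and]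
  congr 1
  refine Finset.sum_congr rfl fun x _ => ?_
  rw [Fin.sum_univ_succ]
  simp [Fin.succ_lt_succ_iff]

/-- The product of the products over the blocks. -/
theorem prod_blocks {n j : ℕ} (d : Fin n → ℤ) (b : Fin n → Fin j) (a : Fin n → A)
    (h : ∀ x y, x < y → b y < b x → a x * a y = (d x * d y).negOnePow • (a y * a x)) :
    (List.ofFn fun α => (List.ofFn (part b α a)).prod).prod =
      (shuffleSign d b).negOnePow • (List.ofFn a).prod := by
  induction n with
  | zero =>
    have : ∀ α, (List.ofFn (part b α a)).prod = 1 := fun α => by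
      rw [ofFn_part]; simp
    simp [this, shuffleSign, List.ofFn_const]
  | succ n ih =>
    simp only [prod_ofFn_part_succ b]
    -- Crossing block `α` costs the degree of the first letter times the total degree of that block;
    -- this matches the first term of `shuffleSign_succ`.
    rw [prod_insert_of_comm (b 0) (a 0) _
      (fun α => d 0 * blockDegree (fun x : Fin n => b x.succ) α fun x : Fin n => d x.succ),
      ih (fun x => d x.succ) (fun x => b x.succ) (fun x => a x.succ)
        (fun x y hxy => h x.succ y.succ (by simpa using hxy)), mul_smul_comm, smul_smul,
        ← Int.negOnePow_add, List.ofFn_succ, List.prod_cons, shuffleSign_succ]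
    · congr 3
      simp only [blockDegree, block, Finset.sum_filter, Finset.mul_sum]
      rw [← Finset.sum_filter, Finset.sum_comm]
      refine Finset.sum_congr rfl fun y _ => ?_
      rw [Finset.sum_filter]
      rw [Finset.sum_eq_single (b y.succ)]
      · simp
      · intro α _ hα; simp [hα.symm]
      · simp
    · intro α hα
      rw [← sum_part]
      apply mul_ofFn_prod
      intro t
      unfold part
      have hb : b (Fin.succ ((block (fun x : Fin n => b x.succ) α).orderEmbOfFin rfl t)) = α := by
        have := (block (fun x : Fin n => b x.succ) α).orderEmbOfFin_mem rfl t
        simpa [block] using this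
      exact h _ _ (Fin.succ_pos _) (by rw [hb]; exact hα)

/-- A permutation is an unshuffle with one letter per block: the letter `x` goes to block `σ⁻¹ x`,
its new position. -/
theorem shuffleSign_symm {n : ℕ} (d : Fin n → ℤ) (σ : Equiv.Perm (Fin n)) :
    shuffleSign d σ.symm = permSign d σ := by
  unfold shuffleSign permSign
  rw [Finset.sum_comm, ← Equiv.sum_comp σ]
  refine Finset.sum_congr rfl fun x _ => ?_
  rw [← Equiv.sum_comp σ]
  refine Finset.sum_congr rfl fun y _ => ?_
  simp [and_comm, mul_comm]

theorem prod_perm {n : ℕ} (d : Fin n → ℤ) (σ : Equiv.Perm (Fin n)) (a : Fin n → A)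
    (h : ∀ x y, a x * a y = (d x * d y).negOnePow • (a y * a x)) :
    (List.ofFn fun x => a (σ x)).prod = (permSign d σ).negOnePow • (List.ofFn a).prod := by
  rw [← shuffleSign_symm, ← prod_blocks d σ.symm a fun x y _ _ => h x y]
  congr 1
  congr 1
  funext α
  rw [ofFn_part]
  have : (fun x => decide (σ.symm x = α)) = fun x => decide (x = σ α) := by
    funext x; simp [Equiv.symm_apply_eq]
  rw [this]
  have : (List.finRange n).filter (fun x => decide (x = σ α)) = [σ α] := by
    refine List.perm_singleton.1 ((List.perm_ext_iff_of_nodup ((List.nodup_finRange n).filter _)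
      (List.nodup_singleton _)).2 fun x => ?_)
    simp
  rw [this]; simp

/-- No pair is reversed, so no commutation rule is required and the degrees may be taken to be zero.
This covers open coefficients, which do not commute. -/
theorem prod_blocks_of_monotone {m j : ℕ} (h : Fin m → Fin j) (hh : Monotone h) (a : Fin m → A) :
    (List.ofFn fun α => (List.ofFn (part h α a)).prod).prod = (List.ofFn a).prod := by
  rw [prod_blocks (fun _ => 0) h a fun x y hxy hyx => absurd (hh hxy.le) (not_le.2 hyx)]
  simp [shuffleSign]

/-- Separating `P₀ B₀ P₁ B₁ ⋯` into all `P`'s followed by all `B`'s moves `P a` past `B a'` for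
every `a' < a`. These are the crossings of closed letters past preceding open ones. -/
theorem prod_interleave {j : ℕ} (P B : Fin j → A) (D E : Fin j → ℤ)
    (h : ∀ a a', a' < a → B a' * P a = (D a * E a').negOnePow • (P a * B a')) :
    (List.ofFn fun a => P a * B a).prod =
      (∑ a, ∑ a', if a' < a then D a * E a' else 0).negOnePow •
        ((List.ofFn P).prod * (List.ofFn B).prod) := by
  induction j with
  | zero => simp
  | succ j ih =>
    simp only [List.ofFn_succ, List.prod_cons]
    rw [ih (fun a => P a.succ) (fun a => B a.succ) (fun a => D a.succ) (fun a => E a.succ)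
      (fun a a' haa => h _ _ (by simpa using haa))]
    have h0 := mul_ofFn_prod (B 0) (E 0) (fun a => P a.succ) (fun a => D a.succ)
      (fun a => by rw [h _ _ (Fin.succ_pos a), mul_comm])
    rw [mul_smul_comm, ← mul_assoc, mul_assoc (P 0), h0, Fin.sum_univ_succ]
    simp only [mul_smul_comm, smul_mul_assoc, smul_smul, ← Int.negOnePow_add, mul_assoc]
    congr 2
    simp only [Fin.not_lt_zero, if_false, Finset.sum_const_zero, zero_add]
    rw [add_comm, Finset.mul_sum, ← Finset.sum_add_distrib]
    refine Finset.sum_congr rfl fun x _ => ?_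
    rw [Fin.sum_univ_succ]
    simp [mul_comm, Fin.succ_lt_succ_iff]

theorem comm_part {n m j j' : ℕ} (b : Fin n → Fin j) (α : Fin j) (h : Fin m → Fin j') (α' : Fin j')
    (d : Fin n → ℤ) (e : Fin m → ℤ) (a : Fin n → A) (η : Fin m → A)
    (hc : ∀ x y, η y * a x = (e y * d x).negOnePow • (a x * η y)) :
    (List.ofFn (part h α' η)).prod * (List.ofFn (part b α a)).prod =
      (blockDegree b α d * blockDegree h α' e).negOnePow •
        ((List.ofFn (part b α a)).prod * (List.ofFn (part h α' η)).prod) := by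
  rw [mul_comm (blockDegree b α d), ← sum_part b]
  refine mul_ofFn_prod _ _ (part b α a) (part b α d) fun x => ?_
  rw [← sum_part h]
  exact ofFn_prod_mul _ _ (part h α' η) (part h α' e) fun y => hc _ _

/-- `prod_interleave` separates open from closed coefficients, `prod_blocks` then sorts the closed
ones, and the open segments are already in order. The two contributions are the two summands of
`mixedComposeSign`. -/
theorem prod_compose {n m i j : ℕ} (d : Fin n → ℤ) (e : Fin m → ℤ) (b : Fin n → Fin (i + j))
    (h : Fin m → Fin j) (hh : Monotone h) (a : Fin n → A) (η : Fin m → A)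
    (haa : ∀ x y, a x * a y = (d x * d y).negOnePow • (a y * a x))
    (hc : ∀ x y, η y * a x = (e y * d x).negOnePow • (a x * η y)) :
    (List.ofFn fun α : Fin i => (List.ofFn (part b (Fin.castAdd j α) a)).prod).prod *
      (List.ofFn fun α : Fin j => (List.ofFn (part b (Fin.natAdd i α) a)).prod *
        (List.ofFn (part h α η)).prod).prod =
      (mixedComposeSign d e b h).negOnePow • ((List.ofFn a).prod * (List.ofFn η).prod) := by
  rw [prod_interleave _ _ (fun α => blockDegree b (Fin.natAdd i α) d) (fun α => blockDegree h α e)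
    fun α α' _ => comm_part b _ h _ d e a η hc, prod_blocks_of_monotone h hh, mul_smul_comm,
    ← mul_assoc]
  have := prod_blocks d b a fun x y _ _ => haa x y
  rw [List.ofFn_add, List.prod_append] at this
  change (List.ofFn fun α : Fin i => (List.ofFn (part b (Fin.castAdd j α) a)).prod).prod * _ = _
    at this
  rw [this, smul_mul_assoc, smul_smul, ← Int.negOnePow_add, mixedComposeSign, add_comm]

theorem prod_insertC {n m : ℕ} (d : Fin n → ℤ) (b : Fin n → Fin 2) (θ : A) (a : Fin n → A)
    (η : Fin m → A) (haa : ∀ x y, a x * a y = (d x * d y).negOnePow • (a y * a x)) :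
    (List.ofFn (Fin.cons (θ * (List.ofFn (part b 0 a)).prod) (part b 1 a) :
        Fin (size b 1 + 1) → A)).prod * (List.ofFn η).prod =
      (shuffleSign d b).negOnePow • (θ * ((List.ofFn a).prod * (List.ofFn η).prod)) := by
  have := prod_blocks d b a fun x y _ _ => haa x y
  simp only [List.ofFn_succ, List.ofFn_zero, List.prod_cons, List.prod_nil, mul_one,
    Fin.succ_zero_eq_one] at this
  rw [List.ofFn_succ, List.prod_cons]
  simp only [Fin.cons_zero, Fin.cons_succ]
  rw [mul_assoc θ, this, mul_smul_comm, smul_mul_assoc, mul_assoc]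

/-- The odd `θ` stands for the degree one of the inserted map. Bringing it to the front past block
`0` and segment `0` gives the two linear terms of the sign; bringing block `1` past segment `0`
gives the quadratic one, and sorting the closed coefficients the shuffle sign. -/
theorem prod_insertO {n m : ℕ} (d : Fin n → ℤ) (e : Fin m → ℤ) (b : Fin n → Fin 2)
    (h : Fin m → Fin 3) (hh : Monotone h) (θ : A) (a : Fin n → A) (η : Fin m → A)
    (haa : ∀ x y, a x * a y = (d x * d y).negOnePow • (a y * a x))
    (hc : ∀ x y, η y * a x = (e y * d x).negOnePow • (a x * η y))
    (haθ : ∀ x, a x * θ = (d x * 1).negOnePow • (θ * a x))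
    (hηθ : ∀ y, η y * θ = (e y * 1).negOnePow • (θ * η y)) :
    (List.ofFn (part b 0 a)).prod * (List.ofFn (Fin.append (Fin.append (part h 0 η)
        (fun _ : Fin 1 => θ * ((List.ofFn (part b 1 a)).prod * (List.ofFn (part h 1 η)).prod)))
        (part h 2 η))).prod =
      (mixedInsertSign d e b h).negOnePow • (θ * ((List.ofFn a).prod * (List.ofFn η).prod)) := by
  have h1 := prod_blocks d b a fun x y _ _ => haa x y
  have h2 := prod_blocks_of_monotone h hh η
  simp only [List.ofFn_succ, List.ofFn_zero, List.prod_cons, List.prod_nil, mul_one,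
    Fin.succ_zero_eq_one, Fin.succ_one_eq_two] at h1 h2
  rw [List.ofFn_fin_append, List.ofFn_fin_append, List.prod_append, List.prod_append]
  have e1 : (List.ofFn (part b 0 a)).prod * θ =
      (blockDegree b 0 d * 1).negOnePow • (θ * (List.ofFn (part b 0 a)).prod) := by
    rw [← sum_part]
    exact ofFn_prod_mul _ _ (part b 0 a) (part b 0 d) fun y => haθ _
  have e2 : (List.ofFn (part h 0 η)).prod * θ =
      (blockDegree h 0 e * 1).negOnePow • (θ * (List.ofFn (part h 0 η)).prod) := by
    rw [← sum_part]
    exact ofFn_prod_mul _ _ (part h 0 η) (part h 0 e) fun y => hηθ _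
  have e3 := comm_part b 1 h 0 d e a η hc
  generalize (List.ofFn (part b 0 a)).prod = A0 at *
  generalize (List.ofFn (part b 1 a)).prod = A1 at *
  generalize (List.ofFn (part h 0 η)).prod = H0 at *
  generalize (List.ofFn (part h 1 η)).prod = H1 at *
  generalize (List.ofFn (part h 2 η)).prod = H2 at *
  simp only [List.ofFn_succ, List.ofFn_zero, List.prod_cons, List.prod_nil, mul_one] at *
  rw [← h2]
  calc A0 * (H0 * (θ * (A1 * H1)) * H2) = A0 * ((H0 * θ) * (A1 * H1) * H2) := by
        simp only [mul_assoc]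
    _ = (blockDegree h 0 e).negOnePow • ((A0 * θ) * (H0 * A1) * (H1 * H2)) := by
        rw [e2]; simp only [smul_mul_assoc, mul_smul_comm, mul_assoc]
    _ = ((blockDegree h 0 e).negOnePow * (blockDegree b 0 d).negOnePow *
          (blockDegree b 1 d * blockDegree h 0 e).negOnePow) •
          (θ * (A0 * A1) * (H0 * (H1 * H2))) := by
        rw [e1, e3]; simp only [smul_mul_assoc, mul_smul_comm, mul_assoc, smul_smul]
        simp only [mul_comm, mul_left_comm]
    _ = _ := by
        rw [h1]; simp only [smul_mul_assoc, mul_smul_comm, mul_assoc, smul_smul]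
        rw [mixedInsertSign]
        simp only [Int.negOnePow_add]
        congr 1
        simp only [mul_assoc, mul_comm, mul_left_comm]

end

/-! ## Counting decompositions -/

theorem sum_size {n j : ℕ} (b : Fin n → Fin j) : ∑ a, size b a = n := by
  unfold size block
  rw [← Finset.card_eq_sum_card_fiberwise (fun _ _ => Finset.mem_coe.2 (Finset.mem_univ _))]
  simp

/-- Two expansions of `(X₁ + ⋯ + Xⱼ)ⁿ` are compared, one over maps `b` and one by the multinomial
theorem, after applying the linear map which sends the monomial with exponents `κ` to `Φ κ`. -/
theorem sum_fun_size {k M : Type*} [Field k] [AddCommGroup M] [Module k M] {j : ℕ} (n : ℕ)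
    (Φ : (Fin j → ℕ) → M) : ∑ b : Fin n → Fin j, Φ (size b) =
      ∑ κ ∈ Finset.univ.piAntidiag n, (Nat.multinomial Finset.univ κ : k) • Φ κ := by
  let L : MvPolynomial (Fin j) k →ₗ[k] M :=
    (MvPolynomial.basisMonomials (Fin j) k).constr k fun s => Φ s
  have hL : ∀ κ : Fin j → ℕ, L (∏ a, MvPolynomial.X a ^ κ a) = Φ κ := by
    intro κ
    have : (∏ a, MvPolynomial.X a ^ κ a : MvPolynomial (Fin j) k) =
        MvPolynomial.basisMonomials (Fin j) k (Finsupp.equivFunOnFinite.symm κ) := by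
      rw [MvPolynomial.coe_basisMonomials]
      beta_reduce
      rw [MvPolynomial.monomial_eq, Finsupp.prod_fintype]
      · simp
      · simp
    rw [this, Module.Basis.constr_basis]
    simp
  have h1 := Finset.sum_pow_eq_sum_piAntidiag (Finset.univ : Finset (Fin j))
    (fun a => (MvPolynomial.X a : MvPolynomial (Fin j) k)) n
  rw [Fintype.sum_pow] at h1
  have h2 := congrArg L h1
  rw [map_sum, map_sum] at h2
  have h3 : ∀ b : Fin n → Fin j, L (∏ x, MvPolynomial.X (b x)) = Φ (size b) := by
    intro b
    rw [← hL]
    congr 1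
    rw [← Finset.prod_fiberwise' Finset.univ b]
    refine Finset.prod_congr rfl fun a _ => ?_
    rw [Finset.prod_const]; rfl
  simp only [h3] at h2
  rw [h2]
  refine Finset.sum_congr rfl fun κ _ => ?_
  rw [← nsmul_eq_mul, map_nsmul, hL, Nat.cast_smul_eq_nsmul]

/-- The support of `Φ` lies in the box of side `N`, where all totals are at most `j * N < B`. So
summing by total up to `B` is the same as summing over the box. -/
theorem sum_range_piAntidiag {M : Type*} [AddCommMonoid M] {j : ℕ} (N B : ℕ) (hB : j * N < B)
    (Φ : (Fin j → ℕ) → M) (hΦ : ∀ κ x, N ≤ κ x → Φ κ = 0) :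
    ∑ n ∈ Finset.range B, ∑ κ ∈ Finset.univ.piAntidiag n, Φ κ =
      ∑ κ ∈ Fintype.piFinset (fun _ : Fin j => Finset.range N), Φ κ := by
  rw [← Finset.sum_fiberwise_of_maps_to (s := Fintype.piFinset (fun _ : Fin j => Finset.range N))
    (t := Finset.range B) (g := fun κ => ∑ a, κ a)]
  · refine Finset.sum_congr rfl fun n _ => ?_
    symm
    refine Finset.sum_subset (fun κ hκ => ?_) fun κ _ hκ' => ?_
    · simp at hκ ⊢; exact hκ.2
    · simp only [Finset.mem_filter, Fintype.mem_piFinset, Finset.mem_range, not_and] at hκ'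
      by_contra h0
      have hlt : ∀ a, κ a < N := fun a => by
        by_contra h
        exact h0 (hΦ κ a (not_lt.1 h))
      refine hκ' hlt ?_
      simp_all
  · intro κ hκ
    simp only [Fintype.mem_piFinset, Finset.mem_range] at hκ ⊢
    refine lt_of_le_of_lt ?_ hB
    calc ∑ a, κ a ≤ ∑ _a : Fin j, N := Finset.sum_le_sum fun a _ => (hκ a).le
      _ = j * N := by simp

/-- The exponential formula for the sum over all unshuffles. -/
theorem sum_blocks {k M : Type*} [Field k] [CharZero k] [AddCommGroup M] [Module k M] {j : ℕ}
    (N B : ℕ) (hB : j * N < B) (Φ : (Fin j → ℕ) → M) (hΦ : ∀ κ x, N ≤ κ x → Φ κ = 0) :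
    ∑ n ∈ Finset.range B, ((n.factorial : k)⁻¹) • ∑ b : Fin n → Fin j, Φ (size b) =
      ∑ κ ∈ Fintype.piFinset (fun _ : Fin j => Finset.range N),
        (∏ a, ((κ a).factorial : k)⁻¹) • Φ κ := by
  rw [← sum_range_piAntidiag N B hB _ fun κ x hx => by rw [hΦ κ x hx, smul_zero]]
  refine Finset.sum_congr rfl fun n _ => ?_
  rw [sum_fun_size (k := k), Finset.smul_sum]
  refine Finset.sum_congr rfl fun κ hκ => ?_
  rw [smul_smul]
  congr 1
  have h1 : ∑ a, κ a = n := by simpa using hκ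
  have h2 := Nat.multinomial_spec (Finset.univ : Finset (Fin j)) κ
  rw [h1] at h2
  have h3 : (∏ a, ((κ a).factorial : k)) * (Nat.multinomial Finset.univ κ : k) = n.factorial := by
    exact_mod_cast h2
  have h4 : (n.factorial : k) ≠ 0 := Nat.cast_ne_zero.2 n.factorial_ne_zero
  have h5 : (∏ a, ((κ a).factorial : k)) ≠ 0 :=
    Finset.prod_ne_zero_iff.2 fun a _ => Nat.cast_ne_zero.2 (κ a).factorial_ne_zero
  rw [Finset.prod_inv_distrib, ← h3]
  rw [← h3] at h4
  have h6 := right_ne_zero_of_mul h4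
  field_simp

theorem count_ofFn {m j : ℕ} (h : Fin m → Fin j) (a : Fin j) :
    (List.ofFn h).count a = size h a := by
  have := congrArg List.length (ofFn_part h a id)
  rw [List.length_ofFn, List.length_map] at this
  rw [this, List.ofFn_eq_map, List.count, List.countP_map, List.countP_eq_length_filter]
  congr 1

/-- A monotone map is a sorted word, hence is determined by its multiplicities, and sorting any word
realizes given multiplicities. In contrast to unshuffles there is no multinomial coefficient, which
is why open arguments have no factorials. -/
theorem sum_segments {M : Type*} [AddCommMonoid M] {j : ℕ} (m : ℕ) (Φ : (Fin j → ℕ) → M) :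
    ∑ h ∈ segments m j, Φ (size h) = ∑ κ ∈ Finset.univ.piAntidiag m, Φ κ := by
  refine Finset.sum_bij (fun h _ => size h) (fun h _ => ?_) (fun h hh h' hh' he => ?_)
    (fun κ hκ => ?_) (fun h _ => rfl)
  · simp [sum_size]
  · simp only [segments, Finset.mem_filter, Finset.mem_univ, true_and] at hh hh'
    apply List.ofFn_injective
    refine List.Perm.eq_of_pairwise (le := (· ≤ ·)) (fun x y _ _ h1 h2 => le_antisymm h1 h2)
      ?_ ?_ ?_
    · rw [List.pairwise_ofFn]; exact fun i j hij => hh hij.le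
    · rw [List.pairwise_ofFn]; exact fun i j hij => hh' hij.le
    · rw [List.perm_iff_count]
      intro a
      rw [count_ofFn, count_ofFn, he]
  · have h1 : ∑ a, κ a = m := by simpa using hκ
    subst h1
    let b : Fin (∑ a, κ a) → Fin j := fun x => (finSigmaFinEquiv.symm x).1
    have hb : size b = κ := by
      funext a
      unfold size block
      rw [← Fintype.card_subtype]
      have : Fintype.card {x : Σ a, Fin (κ a) // x.1 = a} = κ a := by
        rw [Fintype.card_congr (Equiv.sigmaSubtype a), Fintype.card_fin]
      rw [← this]
      exact Fintype.card_congr (Equiv.subtypeEquiv finSigmaFinEquiv.symm fun x => Iff.rfl)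
    refine ⟨b ∘ Tuple.sort b, ?_, ?_⟩
    · simp [segments, Tuple.monotone_sort]
    · refine Eq.trans ?_ hb
      funext a
      unfold size block
      rw [← Fintype.card_subtype, ← Fintype.card_subtype]
      exact Fintype.card_congr (Equiv.subtypeEquiv (Tuple.sort b) fun x => Iff.rfl)

theorem sum_range_segments {M : Type*} [AddCommMonoid M] {j : ℕ} (N B : ℕ) (hB : j * N < B)
    (Φ : (Fin j → ℕ) → M) (hΦ : ∀ κ x, N ≤ κ x → Φ κ = 0) :
    ∑ m ∈ Finset.range B, ∑ h ∈ segments m j, Φ (size h) =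
      ∑ κ ∈ Fintype.piFinset (fun _ : Fin j => Finset.range N), Φ κ := by
  simp only [sum_segments]
  exact sum_range_piAntidiag N B hB Φ hΦ

/-! ## Reordering the arguments of symmetric functions -/

/-- Two injective enumerations of the same set differ by a permutation. The lengths `p` and `q` are
kept as different variables because block sizes agree only propositionally. -/
theorem symm_reorder {X Y : Type*} (P : Set X) (F : ∀ p, (Fin p → X) → Y)
    (hF : ∀ p (x : Fin p → X), (∀ i, x i ∈ P) → ∀ σ : Equiv.Perm (Fin p), F p (x ∘ σ) = F p x)
    {p q n : ℕ} (e : Fin p → Fin n) (e' : Fin q → Fin n) (he : Function.Injective e)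
    (he' : Function.Injective e') (hr : Set.range e = Set.range e') (x : Fin n → X)
    (hx : ∀ i, x i ∈ P) : F p (x ∘ e) = F q (x ∘ e') := by
  -- This equivalence only yields `p = q`; after the substitution the same construction is a
  -- permutation.
  have τ : Fin p ≃ Fin q :=
    ((Equiv.ofInjective e he).trans (Equiv.setCongr hr)).trans (Equiv.ofInjective e' he').symm
  have hpq : p = q := by simpa using Fintype.card_congr τ
  subst hpq
  let σ : Fin p ≃ Fin p :=
    ((Equiv.ofInjective e he).trans (Equiv.setCongr hr)).trans (Equiv.ofInjective e' he').symm
  have hσ : e = e' ∘ σ := by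
    funext i
    have : Equiv.ofInjective e' he' (σ i) = Equiv.setCongr hr (Equiv.ofInjective e he i) := by
      simp [σ]
    simpa using (congrArg Subtype.val this).symm
  rw [hσ, ← Function.comp_assoc]
  exact hF p (x ∘ e') (fun i => hx _) σ

theorem symm_part {X Y : Type*} (P : Set X) (F : ∀ p, (Fin p → X) → Y)
    (hF : ∀ p (x : Fin p → X), (∀ i, x i ∈ P) → ∀ σ : Equiv.Perm (Fin p), F p (x ∘ σ) = F p x)
    {n j : ℕ} (b : Fin n → Fin j) (a : Fin j) (σ : Equiv.Perm (Fin n)) (x : Fin n → X)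
    (hx : ∀ i, x i ∈ P) :
    F (size (b ∘ σ) a) (part (b ∘ σ) a (x ∘ σ)) = F (size b a) (part b a x) := by
  refine symm_reorder P F hF (σ ∘ (block (b ∘ σ) a).orderEmbOfFin rfl)
    ((block b a).orderEmbOfFin rfl) (σ.injective.comp (RelEmbedding.injective _))
    (RelEmbedding.injective _) ?_ x hx
  rw [Set.range_comp, Finset.range_orderEmbOfFin, Finset.range_orderEmbOfFin]
  ext y
  simp [block]

/-! ## Parity of signs -/

theorem negOnePow_eq_of_zmod {m n : ℤ} (h : (m : ZMod 2) = n) : m.negOnePow = n.negOnePow := by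
  rw [Int.negOnePow_eq_iff]
  have : ((m - n : ℤ) : ZMod 2) = 0 := by push_cast; rw [h, sub_self]
  rw [even_iff_two_dvd]
  exact_mod_cast (ZMod.intCast_zmod_eq_zero_iff_dvd _ 2).1 this |> fun h => h

/-- The signs see degrees modulo 2 only. Hence finitely many parity patterns suffice to define
compositions and insertions on all arguments in `glue`. -/
theorem shuffleSign_congr {n j : ℕ} (d d' : Fin n → ℤ) (hd : ∀ x, (d x : ZMod 2) = d' x)
    (b : Fin n → Fin j) : ((shuffleSign d b : ℤ) : ZMod 2) = (shuffleSign d' b : ℤ) := by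
  simp only [shuffleSign, Int.cast_sum, apply_ite (Int.cast : ℤ → ZMod 2), Int.cast_mul, hd]

theorem blockDegree_congr {n j : ℕ} (d d' : Fin n → ℤ) (hd : ∀ x, (d x : ZMod 2) = d' x)
    (b : Fin n → Fin j) (a : Fin j) :
    ((blockDegree b a d : ℤ) : ZMod 2) = (blockDegree b a d' : ℤ) := by
  simp only [blockDegree, Int.cast_sum, hd]

theorem mixedComposeSign_congr {n m i j : ℕ} (d d' : Fin n → ℤ) (e e' : Fin m → ℤ)
    (hd : ∀ x, (d x : ZMod 2) = d' x) (he : ∀ x, (e x : ZMod 2) = e' x) (b : Fin n → Fin (i + j))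
    (h : Fin m → Fin j) :
    (mixedComposeSign d e b h).negOnePow = (mixedComposeSign d' e' b h).negOnePow := by
  apply negOnePow_eq_of_zmod
  simp only [mixedComposeSign, Int.cast_add, Int.cast_sum, apply_ite (Int.cast : ℤ → ZMod 2),
    Int.cast_mul, shuffleSign_congr d d' hd, blockDegree_congr d d' hd, blockDegree_congr e e' he]

theorem mixedInsertSign_congr {n m : ℕ} (d d' : Fin n → ℤ) (e e' : Fin m → ℤ)
    (hd : ∀ x, (d x : ZMod 2) = d' x) (he : ∀ x, (e x : ZMod 2) = e' x) (b : Fin n → Fin 2)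
    (h : Fin m → Fin 3) :
    (mixedInsertSign d e b h).negOnePow = (mixedInsertSign d' e' b h).negOnePow := by
  apply negOnePow_eq_of_zmod
  simp only [mixedInsertSign, Int.cast_add,
    Int.cast_mul, shuffleSign_congr d d' hd, blockDegree_congr d d' hd, blockDegree_congr e e' he]

/-! ## Extension of scalars without signs -/

section Ext

variable {k : Type*} [CommRing k] {A : Type*} [Ring A] [Algebra k A] {V U W V' : Type*}
  [AddCommGroup V] [Module k V] [AddCommGroup U] [Module k U] [AddCommGroup W] [Module k W]
  [AddCommGroup V'] [Module k V'] {p : ℕ}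

/-- The bilinear map `(a, v) ↦ a • E v`. -/
def smulBi (E : V →ₗ[k] MultilinearMap k (fun _ : Fin p => A ⊗[k] U) (A ⊗[k] W)) :
    A →ₗ[k] V →ₗ[k] MultilinearMap k (fun _ : Fin p => A ⊗[k] U) (A ⊗[k] W) :=
  LinearMap.mk₂ k (fun a v => (Algebra.lsmul k k (A ⊗[k] W) a).compMultilinearMap (E v))
    (fun a b v => by ext; simp) (fun r a v => by ext; simp)
    (fun a v w => by ext; simp) (fun r a v => by ext c; simp)

theorem smulBi_apply (E : V →ₗ[k] MultilinearMap k (fun _ : Fin p => A ⊗[k] U) (A ⊗[k] W)) (a : A)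
    (v : V) (c : Fin p → A ⊗[k] U) : smulBi E a v c = a • E v c := rfl

/-- One step of the extension of a multilinear map. -/
def extStep {X : Type*} [AddCommGroup X] [Module k X]
    (E : X →ₗ[k] MultilinearMap k (fun _ : Fin p => A ⊗[k] V) (A ⊗[k] W)) :
    (V →ₗ[k] X) →ₗ[k] MultilinearMap k (fun _ : Fin (p + 1) => A ⊗[k] V) (A ⊗[k] W) where
  toFun T := LinearMap.uncurryLeft (TensorProduct.lift (smulBi (E ∘ₗ T)))
  map_add' T T' := by
    have : smulBi (E ∘ₗ (T + T')) = smulBi (E ∘ₗ T) + smulBi (E ∘ₗ T') := by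
      ext a v c; simp [smulBi_apply]
    ext c
    rw [this, add_apply]
    simp only [LinearMap.uncurryLeft_apply]
    induction c 0 using TensorProduct.induction_on with
    | zero => simp
    | tmul a v => simp
    | add x y hx hy => simp only [map_add, add_apply, hx, hy]; abel
  map_smul' r T := by
    have : smulBi (E ∘ₗ (r • T)) = r • smulBi (E ∘ₗ T) := by
      ext a v c; simp [smulBi_apply, smul_comm a r]
    ext c
    rw [this, smul_apply]
    simp only [LinearMap.uncurryLeft_apply, RingHom.id_apply]
    induction c 0 using TensorProduct.induction_on with
    | zero => simp
    | tmul a v => simp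
    | add x y hx hy => simp only [map_add, add_apply, hx, hy, smul_add]

variable (k A V W) in
/-- The extension of a multilinear map to `A ⊗ V`: on pure tensors, the coefficients are multiplied
in order. -/
def extA : ∀ p : ℕ, MultilinearMap k (fun _ : Fin p => V) W →ₗ[k]
    MultilinearMap k (fun _ : Fin p => A ⊗[k] V) (A ⊗[k] W)
  | 0 => (MultilinearMap.constLinearEquivOfIsEmpty k k (fun _ : Fin 0 => A ⊗[k] V) (A ⊗[k] W)).toLinearMap ∘ₗ
      TensorProduct.mk k A W 1 ∘ₗ
      (MultilinearMap.constLinearEquivOfIsEmpty k k (fun _ : Fin 0 => V) W).symm.toLinearMap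
  | p + 1 => extStep (extA p) ∘ₗ
      (multilinearCurryLeftEquiv k (fun _ : Fin (p + 1) => V) W).toLinearMap

theorem extA_zero (f : MultilinearMap k (fun _ : Fin 0 => V) W) (c : Fin 0 → A ⊗[k] V)
    (v : Fin 0 → V) : extA k A V W 0 f c = (1 : A) ⊗ₜ f v := by
  rw [Subsingleton.elim v 0]; rfl

theorem extA_cons (f : MultilinearMap k (fun _ : Fin (p + 1) => V) W)
    (c : Fin p → A ⊗[k] V) (a : A) (v : V) :
    extA k A V W (p + 1) f (Fin.cons (a ⊗ₜ v) c) = a • extA k A V W p (f.curryLeft v) c := by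
  simp only [extA, extStep, LinearMap.comp_apply]
  rfl

theorem extA_tmul (f : MultilinearMap k (fun _ : Fin p => V) W) (a : Fin p → A)
    (v : Fin p → V) : extA k A V W p f (fun i => a i ⊗ₜ v i) = (List.ofFn a).prod ⊗ₜ f v := by
  induction p with
  | zero => rw [extA_zero _ _ v]; simp
  | succ p ih =>
    have : (fun i => a i ⊗ₜ[k] v i) = Fin.cons (a 0 ⊗ₜ v 0) fun i : Fin p => a i.succ ⊗ₜ v i.succ := by
      funext i; refine Fin.cases ?_ (fun i => ?_) i <;> simp
    rw [this, extA_cons, ih, List.ofFn_succ, List.prod_cons, TensorProduct.smul_tmul', smul_eq_mul]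
    congr 1
    rw [MultilinearMap.curryLeft_apply]
    congr 1
    funext i; refine Fin.cases ?_ (fun i => ?_) i <;> simp

variable (k A U W) in
/-- `a ⊗ ψ ↦ a • ψ^A`. -/
def extScalar (q : ℕ) : A ⊗[k] MultilinearMap k (fun _ : Fin q => U) W →ₗ[k]
    MultilinearMap k (fun _ : Fin q => A ⊗[k] U) (A ⊗[k] W) :=
  TensorProduct.lift (smulBi (extA k A U W q))

variable (A) in
/-- The extension of a bi-multilinear map. -/
def extM {p q : ℕ} (φ : Bi k V U W p q) : Bi k (A ⊗[k] V) (A ⊗[k] U) (A ⊗[k] W) p q :=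
  (extScalar k A U W q).compMultilinearMap (extA k A V _ p φ)

theorem extM_tmul {p q : ℕ} (φ : Bi k V U W p q) (a : Fin p → A) (v : Fin p → V) (b : Fin q → A)
    (w : Fin q → U) : extM A φ (fun i => a i ⊗ₜ v i) (fun i => b i ⊗ₜ w i) =
      ((List.ofFn a).prod * (List.ofFn b).prod) ⊗ₜ φ v w := by
  unfold extM
  rw [LinearMap.compMultilinearMap_apply, extA_tmul]
  simp [extScalar, smulBi_apply, extA_tmul, TensorProduct.smul_tmul']

theorem extM_add {p q : ℕ} (φ ψ : Bi k V U W p q) : extM A (φ + ψ) = extM A φ + extM A ψ := by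
  unfold extM; rw [map_add]; ext; simp

theorem extM_smul {p q : ℕ} (r : k) (φ : Bi k V U W p q) : extM A (r • φ) = r • extM A φ := by
  unfold extM; rw [map_smul]; ext; simp

theorem extM_zero {p q : ℕ} : extM A (0 : Bi k V U W p q) = 0 := by
  unfold extM; rw [map_zero]; ext; simp

theorem extM_sum {ι : Type*} (s : Finset ι) {p q : ℕ} (φ : ι → Bi k V U W p q) :
    extM A (∑ i ∈ s, φ i) = ∑ i ∈ s, extM A (φ i) := by
  classical
  induction s using Finset.induction_on with
  | empty => simp [extM_zero]
  | insert i s hi ih => rw [Finset.sum_insert hi, Finset.sum_insert hi, extM_add, ih]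

theorem exists_tmul_of_forall {p : ℕ} (x : Fin p → A ⊗[k] V)
    (h : ∀ i, x i ∈ {z : A ⊗[k] V | ∃ a v, a ⊗ₜ v = z}) :
    ∃ (a : Fin p → A) (v : Fin p → V), x = fun i => a i ⊗ₜ[k] v i := by
  choose a v hav using h
  exact ⟨a, v, funext fun i => (hav i).symm⟩

theorem mem_span_pure (z : A ⊗[k] V) :
    z ∈ Submodule.span k {z : A ⊗[k] V | ∃ a v, a ⊗ₜ v = z} := by
  have := TensorProduct.span_tmul_eq_top k A V
  rw [this]; trivial

/-- Equality of bi-multilinear maps may be tested on pure tensors. -/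
theorem bi_ext_tmul {p q : ℕ} {W : Type*} [AddCommGroup W] [Module k W]
    (F G : Bi k (A ⊗[k] V) (A ⊗[k] U) W p q)
    (h : ∀ (a : Fin p → A) (v : Fin p → V) (b : Fin q → A) (w : Fin q → U), F (fun i => a i ⊗ₜ v i) (fun i => b i ⊗ₜ w i) =
      G (fun i => a i ⊗ₜ v i) (fun i => b i ⊗ₜ w i)) : F = G := by
  ext x y
  refine bi_eq_of_span F G _ _ (fun x y hx hy => ?_) x y (fun i => mem_span_pure _)
    (fun i => mem_span_pure _)
  obtain ⟨a, v, rfl⟩ := exists_tmul_of_forall x hx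
  obtain ⟨b, w, rfl⟩ := exists_tmul_of_forall y hy
  exact h a v b w

/-- Post- and precomposition of a bi-multilinear map with linear maps. -/
def Bi.conj {V U W V₁ U₁ W₁ : Type*} [AddCommGroup V] [Module k V] [AddCommGroup U] [Module k U]
    [AddCommGroup W] [Module k W] [AddCommGroup V₁] [Module k V₁] [AddCommGroup U₁] [Module k U₁]
    [AddCommGroup W₁] [Module k W₁] {p q : ℕ} (φ : Bi k V U W p q) (L : W →ₗ[k] W₁)
    (S : Fin p → V₁ →ₗ[k] V) (T : Fin q → U₁ →ₗ[k] U) : Bi k V₁ U₁ W₁ p q :=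
  mkBi (fun c o => L (φ (fun i => S i (c i)) fun i => T i (o i)))
    (fun c o x => by
      refine IsLin.comp (IsLin.apply (IsLin.multi (φ := S x) ⟨S x, fun _ => rfl⟩ φ _ x (fun v => by simp) ?_) _) L
      intro v a ha
      simp [Function.update_of_ne ha])
    (fun c o y => by
      refine IsLin.comp (IsLin.multi (φ := T y) ⟨T y, fun _ => rfl⟩ _ _ y (fun v => by simp) ?_) L
      intro v a ha
      simp [Function.update_of_ne ha])

@[simp] theorem Bi.conj_apply {V U W V₁ U₁ W₁ : Type*} [AddCommGroup V] [Module k V]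
    [AddCommGroup U] [Module k U] [AddCommGroup W] [Module k W] [AddCommGroup V₁] [Module k V₁]
    [AddCommGroup U₁] [Module k U₁] [AddCommGroup W₁] [Module k W₁] {p q : ℕ} (φ : Bi k V U W p q)
    (L : W →ₗ[k] W₁) (S : Fin p → V₁ →ₗ[k] V) (T : Fin q → U₁ →ₗ[k] U) (c : Fin p → V₁)
    (o : Fin q → U₁) : φ.conj L S T c o = L (φ (fun i => S i (c i)) fun i => T i (o i)) := rfl

theorem extM_conj {V U W V₁ U₁ W₁ : Type*} [AddCommGroup V] [Module k V]
    [AddCommGroup U] [Module k U] [AddCommGroup W] [Module k W] [AddCommGroup V₁] [Module k V₁]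
    [AddCommGroup U₁] [Module k U₁] [AddCommGroup W₁] [Module k W₁] {p q : ℕ} (φ : Bi k V U W p q)
    (L : W →ₗ[k] W₁) (S : Fin p → V₁ →ₗ[k] V) (T : Fin q → U₁ →ₗ[k] U) (x : Fin p → A ⊗[k] V₁)
    (y : Fin q → A ⊗[k] U₁) : extM A (φ.conj L S T) x y =
      L.lTensor A (extM A φ (fun i => (S i).lTensor A (x i)) fun i => (T i).lTensor A (y i)) := by
  have : extM A (φ.conj L S T) = (extM A φ).conj (L.lTensor A) (fun i => (S i).lTensor A)
      (fun i => (T i).lTensor A) := by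
    apply bi_ext_tmul
    intro a v b w
    simp [extM_tmul]
  rw [this]; rfl

/-- Naturality under algebra homomorphisms. -/
theorem extM_algHom {B : Type*} [Ring B] [Algebra k B] (j : A →ₐ[k] B) {p q : ℕ}
    (φ : Bi k V U W p q) (x : Fin p → A ⊗[k] V) (y : Fin q → A ⊗[k] U) :
    j.toLinearMap.rTensor W (extM A φ x y) =
      extM B φ (fun i => j.toLinearMap.rTensor V (x i)) fun i => j.toLinearMap.rTensor U (y i) := by
  have : (extM A φ).conj (j.toLinearMap.rTensor W) (fun _ => LinearMap.id) (fun _ => LinearMap.id) =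
      (extM B φ).conj LinearMap.id (fun _ => j.toLinearMap.rTensor V)
        (fun _ => j.toLinearMap.rTensor U) := by
    apply bi_ext_tmul
    intro a v b w
    simp [extM_tmul, map_list_prod, List.map_ofFn, Function.comp_def]
  exact congrArg (fun F => F x y) this

theorem rTensor_smul {B : Type*} [Ring B] [Algebra k B] (j : A →ₐ[k] B) (a : A) (x : A ⊗[k] V) :
    j.toLinearMap.rTensor V (a • x) = j a • j.toLinearMap.rTensor V x := by
  induction x using TensorProduct.induction_on with
  | zero => simp
  | tmul b v => simp [TensorProduct.smul_tmul']
  | add x y hx hy => rw [smul_add, map_add, hx, hy, map_add, smul_add]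

theorem lTensor_smul (L : V →ₗ[k] W) (a : A) (x : A ⊗[k] V) :
    L.lTensor A (a • x) = a • L.lTensor A x := by
  induction x using TensorProduct.induction_on with
  | zero => simp
  | tmul b v => simp [TensorProduct.smul_tmul']
  | add x y hx hy => rw [smul_add, map_add, hx, hy, map_add, smul_add]

/-- A scalar in the first argument can be pulled out. -/
theorem extM_smul_first {p q : ℕ} (φ : Bi k V U W (p + 1) q) (a : A) (z : A ⊗[k] V)
    (x : Fin p → A ⊗[k] V) (y : Fin q → A ⊗[k] U) :
    extM A φ (Fin.cons (a • z) x) y = a • extM A φ (Fin.cons z x) y := by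
  unfold extM
  rw [LinearMap.compMultilinearMap_apply, LinearMap.compMultilinearMap_apply]
  have : extA k A V _ (p + 1) φ (Fin.cons (a • z) x) = a • extA k A V _ (p + 1) φ (Fin.cons z x) := by
    have hcl : ∀ z, extA k A V _ (p + 1) φ (Fin.cons z x) =
      (extA k A V _ (p + 1) φ).curryLeft z x := fun _ => rfl
    induction z using TensorProduct.induction_on with
    | zero => simp [hcl]
    | tmul b v => rw [TensorProduct.smul_tmul', extA_cons, extA_cons, smul_smul, smul_eq_mul]
    | add z w hz hw =>
      simp only [hcl] at hz hw ⊢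
      rw [smul_add, map_add, map_add, add_apply, add_apply, hz, hw, smul_add]
  rw [this]
  generalize extA k A V _ (p + 1) φ (Fin.cons z x) = t
  induction t using TensorProduct.induction_on with
  | zero => simp
  | tmul b v => simp [TensorProduct.smul_tmul', extScalar, smulBi_apply, mul_smul]
  | add z w hz hw => simp only [smul_add, map_add, add_apply, hz, hw]

/-- Contraction of the first argument. -/
theorem extM_cons_one {p q : ℕ} (φ : Bi k V U W (p + 1) q) (v : V)
    (x : Fin p → A ⊗[k] V) (y : Fin q → A ⊗[k] U) :
    extM A φ (Fin.cons ((1 : A) ⊗ₜ v) x) y = extM A (φ.curryLeft v) x y := by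
  unfold extM
  rw [LinearMap.compMultilinearMap_apply, LinearMap.compMultilinearMap_apply, extA_cons, one_smul]

end Ext

/-! ## Linear maps on graded spaces -/

namespace GradedSpace

variable {k : Type*} [Field k] (V : GradedSpace k) {W : GradedSpace k} {M : Type*} [AddCommGroup M]
  [Module k M]

/-- The linear map which is given by `φ r` on elements of degree `r`. -/
def lift (φ : ℤ → V →ₗ[k] M) : V →ₗ[k] M :=
  DirectSum.toModule k ℤ M (fun r => φ r ∘ₗ (V.deg r).subtype) ∘ₗ
    (LinearEquiv.ofBijective (DirectSum.coeLinearMap V.deg) V.isInternal).symm.toLinearMap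

variable {V}

theorem lift_apply (φ : ℤ → V →ₗ[k] M) {r : ℤ} {x : V} (hx : x ∈ V.deg r) :
    V.lift φ x = φ r x := by
  have : (LinearEquiv.ofBijective (DirectSum.coeLinearMap V.deg) V.isInternal).symm x =
      DirectSum.lof k ℤ (fun i => V.deg i) r ⟨x, hx⟩ := by
    rw [LinearEquiv.symm_apply_eq]
    exact (DirectSum.coeLinearMap_lof V.deg r ⟨x, hx⟩).symm
  simp [lift, this]

variable (V) in
/-- The projection to the component of degree `r`. -/
def proj (r : ℤ) : V →ₗ[k] V := V.lift fun s => if s = r then LinearMap.id else 0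

theorem proj_same {r : ℤ} {x : V} (hx : x ∈ V.deg r) : V.proj r x = x := by
  simp [proj, lift_apply _ hx]

theorem proj_ne {r s : ℤ} (h : s ≠ r) {x : V} (hx : x ∈ V.deg s) : V.proj r x = 0 := by
  simp [proj, lift_apply _ hx, h]

theorem span_homogeneous : Submodule.span k {x : V | ∃ r, x ∈ V.deg r} = ⊤ := by
  rw [← V.isInternal.submodule_iSup_eq_top]
  apply le_antisymm
  · rw [Submodule.span_le]
    rintro x ⟨r, hx⟩
    exact Submodule.mem_iSup_of_mem r hx
  · exact iSup_le fun r x hx => Submodule.subset_span ⟨r, hx⟩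

theorem proj_mem (r : ℤ) (x : V) : V.proj r x ∈ V.deg r := by
  have hx : x ∈ Submodule.span k {x : V | ∃ r, x ∈ V.deg r} := by rw [span_homogeneous]; trivial
  induction hx using Submodule.span_induction with
  | mem x hx =>
    obtain ⟨s, hx⟩ := hx
    by_cases h : s = r
    · subst h; rwa [proj_same hx]
    · rw [proj_ne h hx]; exact zero_mem _
  | zero => simp
  | add x y _ _ hx hy => rw [map_add]; exact add_mem hx hy
  | smul r x _ hx => rw [map_smul]; exact Submodule.smul_mem _ _ hx

variable (V) in
/-- The projection to the even or odd part. -/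
def parity (i : ZMod 2) : V →ₗ[k] V := V.lift fun s => if (s : ZMod 2) = i then LinearMap.id else 0

theorem parity_same {r : ℤ} {x : V} (hx : x ∈ V.deg r) : V.parity r x = x := by
  simp [parity, lift_apply _ hx]

theorem parity_ne {r : ℤ} {i : ZMod 2} (h : (r : ZMod 2) ≠ i) {x : V} (hx : x ∈ V.deg r) :
    V.parity i x = 0 := by
  simp [parity, lift_apply _ hx, h]

/-- The map is homogeneous of degree `s`. -/
def HasDeg (L : V →ₗ[k] W) (s : ℤ) : Prop := ∀ r, ∀ x ∈ V.deg r, L x ∈ W.deg (r + s)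

/-- The part of degree `s` of a linear map. -/
def hpart (L : V →ₗ[k] W) (s : ℤ) : V →ₗ[k] W := V.lift fun r => W.proj (r + s) ∘ₗ L

theorem hpart_apply (L : V →ₗ[k] W) (s : ℤ) {r : ℤ} {x : V} (hx : x ∈ V.deg r) :
    hpart L s x = W.proj (r + s) (L x) := by
  simp [hpart, lift_apply _ hx]

theorem hpart_hasDeg (L : V →ₗ[k] W) (s : ℤ) : HasDeg (hpart L s) s := by
  intro r x hx
  rw [hpart_apply L s hx]
  exact proj_mem _ _

end GradedSpace

theorem multilinear_ext_homogeneous {k : Type*} [Field k] {V : GradedSpace k} {M : Type*}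
    [AddCommGroup M] [Module k M] {n : ℕ} (F G : MultilinearMap k (fun _ : Fin n => V) M)
    (h : ∀ (d : Fin n → ℤ) (x : Fin n → V), (∀ i, x i ∈ V.deg (d i)) → F x = G x) : F = G := by
  ext x
  refine multilinear_eq_of_span F G {x : V | ∃ r, x ∈ V.deg r} (fun x hx => ?_) x fun i => ?_
  · choose d hd using hx
    exact h d x hd
  · rw [GradedSpace.span_homogeneous]; trivial

theorem bi_ext_homogeneous {k : Type*} [Field k] {V U : GradedSpace k} {M : Type*}
    [AddCommGroup M] [Module k M] {n m : ℕ} (F G : Bi k V U M n m)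
    (h : ∀ (d : Fin n → ℤ) (e : Fin m → ℤ) (x : Fin n → V) (y : Fin m → U),
      (∀ i, x i ∈ V.deg (d i)) → (∀ i, y i ∈ U.deg (e i)) → F x y = G x y) : F = G := by
  refine multilinear_ext_homogeneous _ _ fun d x hx => ?_
  exact multilinear_ext_homogeneous _ _ fun e y hy => h d e x y hx hy

/-! ## Test algebras -/

/-- A nonunital-nilpotent test algebra: coefficients `c` for closed and `o` for open arguments, and
an ideal `I` in which all products of length `N` vanish. The coefficients in `c` supercommute with
those in `o`. -/
structure TestAlg (k : Type u) [Field k] : Type (u + 1) where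
  A : Type u
  [ring : Ring A]
  [algebra : Algebra k A]
  c : ℤ → Submodule k A
  o : ℤ → Submodule k A
  I : Submodule k A
  par : A →ₐ[k] A
  one_c : 1 ∈ c 0
  c_le : ∀ r, c r ≤ o r
  mul_c : ∀ {r s a b}, a ∈ c r → b ∈ c s → a * b ∈ c (r + s)
  mul_o : ∀ {r s a b}, a ∈ o r → b ∈ o s → a * b ∈ o (r + s)
  comm : ∀ {r s a b}, a ∈ c r → b ∈ o s → a * b = (r * s).negOnePow • (b * a)
  par_o : ∀ {r a}, a ∈ o r → par a = r.negOnePow • a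
  I_mul : ∀ {r s a b}, a ∈ I → a ∈ o r → b ∈ o s → a * b ∈ I
  mul_I : ∀ {r s a b}, a ∈ o r → b ∈ I → b ∈ o s → a * b ∈ I
  N : ℕ
  nil : ∀ L : List A, (∀ a ∈ L, a ∈ I ∧ ∃ r, a ∈ o r) → N ≤ L.length → L.prod = 0

attribute [instance] TestAlg.ring TestAlg.algebra

namespace TestAlg

variable {k : Type u} [Field k] (𝔸 : TestAlg k)

/-- The `D`-th power of the parity automorphism. -/
def parD (D : ℤ) : 𝔸.A →ₐ[k] 𝔸.A := if Even D then AlgHom.id k _ else 𝔸.par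

variable {𝔸}

theorem parD_o (D : ℤ) {r : ℤ} {a : 𝔸.A} (ha : a ∈ 𝔸.o r) :
    𝔸.parD D a = (D * r).negOnePow • a := by
  unfold parD
  split_ifs with h
  · rw [Int.negOnePow_even _ (h.mul_right r)]; simp
  · rw [𝔸.par_o ha]
    congr 1
    rw [Int.negOnePow_eq_iff]
    have h : Odd D := by simpa using h
    obtain ⟨t, rfl⟩ := h
    exact ⟨-t * r, by ring⟩

theorem parD_parD_comm (D : ℤ) (a : 𝔸.A) : 𝔸.parD D (𝔸.par a) = 𝔸.par (𝔸.parD D a) := by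
  unfold parD
  split_ifs <;> rfl

theorem c_mem_o {r : ℤ} {a : 𝔸.A} (ha : a ∈ 𝔸.c r) : a ∈ 𝔸.o r := 𝔸.c_le r ha

/-! ### Adjoining a letter -/

section Adjoin

variable (𝔸) (D : ℤ)

/-- The element `a + τ b`. -/
def mat (a b : 𝔸.A) : Matrix (Fin 2) (Fin 2) 𝔸.A := !![a, 0; b, 𝔸.parD D a]

/-- The matrices realize the rules `a τ = τ (parD a)` and `τ τ = 0`, where `parD` acts on degree `r`
by the sign of `D * r`; associativity comes for free. -/
theorem mat_mul (a b a' b' : 𝔸.A) :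
    𝔸.mat D a b * 𝔸.mat D a' b' = 𝔸.mat D (a * a') (b * a' + 𝔸.parD D a * b') := by
  simp [mat]

theorem mat_zero : 𝔸.mat D 0 0 = 0 := by
  ext i j; fin_cases i <;> fin_cases j <;> simp [mat]

theorem mat_add (a b a' b' : 𝔸.A) :
    𝔸.mat D a b + 𝔸.mat D a' b' = 𝔸.mat D (a + a') (b + b') := by
  simp [mat]

theorem mat_smul (t : k) (a b : 𝔸.A) : t • 𝔸.mat D a b = 𝔸.mat D (t • a) (t • b) := by
  simp [mat, Matrix.smul_of]

theorem mat_units_smul (t : ℤˣ) (a b : 𝔸.A) : t • 𝔸.mat D a b = 𝔸.mat D (t • a) (t • b) := by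
  rcases Int.units_eq_one_or t with rfl | rfl <;> simp [mat]

theorem mat_one : 𝔸.mat D 1 0 = 1 := by
  simp [mat, Matrix.one_fin_two]

/-- The elements `a + τ b` with `a ∈ S`, `b ∈ S'`. -/
def tri (S S' : Submodule k 𝔸.A) : Submodule k (Matrix (Fin 2) (Fin 2) 𝔸.A) where
  carrier := {M | ∃ a ∈ S, ∃ b ∈ S', M = 𝔸.mat D a b}
  zero_mem' := ⟨0, zero_mem _, 0, zero_mem _, (mat_zero _ _).symm⟩
  add_mem' := by
    rintro _ _ ⟨a, ha, b, hb, rfl⟩ ⟨a', ha', b', hb', rfl⟩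
    exact ⟨_, add_mem ha ha', _, add_mem hb hb', mat_add _ _ _ _ _ _⟩
  smul_mem' := by
    rintro t _ ⟨a, ha, b, hb, rfl⟩
    exact ⟨_, S.smul_mem t ha, _, S'.smul_mem t hb, mat_smul _ _ _ _ _⟩

theorem list_prod_mat (P : 𝔸.A → Prop) (L : List (Matrix (Fin 2) (Fin 2) 𝔸.A))
    (h : ∀ M ∈ L, ∃ a b, M = 𝔸.mat D a b ∧ P a) :
    ∃ (L' : List 𝔸.A) (b : 𝔸.A), L'.length = L.length ∧ (∀ a ∈ L', P a) ∧
      L.prod = 𝔸.mat D L'.prod b := by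
  induction L with
  | nil => exact ⟨[], 0, rfl, by simp, by simp [mat_one]⟩
  | cons M L ih =>
    obtain ⟨a, b, rfl, ha⟩ := h M (by simp)
    obtain ⟨L', b', h1, h2, h3⟩ := ih fun M hM => h M (by simp [hM])
    refine ⟨a :: L', b * L'.prod + 𝔸.parD D a * b', by simp [h1], ?_, ?_⟩
    · intro x hx
      rcases List.mem_cons.1 hx with rfl | hx
      · exact ha
      · exact h2 x hx
    · rw [List.prod_cons, h3, mat_mul, List.prod_cons]

/-- The parity automorphism of the extended algebra. -/
def parAdjoin : Matrix (Fin 2) (Fin 2) 𝔸.A →ₐ[k] Matrix (Fin 2) (Fin 2) 𝔸.A :=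
  AlgHom.ofLinearMap
    { toFun := fun M => !![𝔸.par (M 0 0), D.negOnePow • 𝔸.par (M 0 1);
        D.negOnePow • 𝔸.par (M 1 0), 𝔸.par (M 1 1)]
      map_add' := fun M M' => by
        ext i j; fin_cases i <;> fin_cases j <;> simp
      map_smul' := fun t M => by
        ext i j; fin_cases i <;> fin_cases j <;> simp [smul_comm t D.negOnePow] }
    (by ext i j; fin_cases i <;> fin_cases j <;> simp)
    (fun M M' => by
      rcases Int.units_eq_one_or D.negOnePow with h | h <;>
      ext i j <;> fin_cases i <;> fin_cases j <;> simp [Matrix.mul_apply, h, add_comm])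

theorem mat_comm {r s : ℤ} {a b a' b' : 𝔸.A} (ha : a ∈ 𝔸.c r) (hb : b ∈ 𝔸.c (r - D))
    (ha' : a' ∈ 𝔸.o s) (hb' : b' ∈ 𝔸.o (s - D)) :
    𝔸.mat D a b * 𝔸.mat D a' b' = (r * s).negOnePow • (𝔸.mat D a' b' * 𝔸.mat D a b) := by
  rw [mat_mul, mat_mul, mat_units_smul, parD_o D (c_mem_o ha), parD_o D ha', 𝔸.comm ha ha',
    𝔸.comm hb ha', smul_mul_assoc, 𝔸.comm ha hb', smul_mul_assoc, smul_smul, smul_add, smul_smul,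
    add_comm]
  congr 2
  · rw [← Int.negOnePow_add]
    congr 1
    exact negOnePow_eq_of_zmod (by
      push_cast; ring)
  · rw [← Int.negOnePow_add]
    congr 1
    exact negOnePow_eq_of_zmod (by
      push_cast; linear_combination (-(D : ZMod 2) * s) * (CharP.cast_eq_zero (ZMod 2) 2))

/-- The test algebra `𝔸 ⊕ τ 𝔸` obtained by adjoining a letter `τ` of degree `D`. -/
def adjoin : TestAlg k where
  A := Matrix (Fin 2) (Fin 2) 𝔸.A
  c r := 𝔸.tri D (𝔸.c r) (𝔸.c (r - D))
  o r := 𝔸.tri D (𝔸.o r) (𝔸.o (r - D))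
  I := 𝔸.tri D 𝔸.I ⊤
  par := 𝔸.parAdjoin D
  one_c := ⟨1, 𝔸.one_c, 0, zero_mem _, (mat_one _ _).symm⟩
  c_le r := by
    rintro _ ⟨a, ha, b, hb, rfl⟩
    exact ⟨a, 𝔸.c_le _ ha, b, 𝔸.c_le _ hb, rfl⟩
  mul_c := by
    rintro r s _ _ ⟨a, ha, b, hb, rfl⟩ ⟨a', ha', b', hb', rfl⟩
    refine ⟨_, 𝔸.mul_c ha ha', _, add_mem (?_ : _ ∈ _) ?_, mat_mul _ _ _ _ _ _⟩
    · convert 𝔸.mul_c hb ha' using 2; ring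
    · rw [parD_o D (c_mem_o ha), smul_mul_assoc]
      refine Submodule.smul_of_tower_mem _ _ ?_
      convert 𝔸.mul_c ha hb' using 2; ring
  mul_o := by
    rintro r s _ _ ⟨a, ha, b, hb, rfl⟩ ⟨a', ha', b', hb', rfl⟩
    refine ⟨_, 𝔸.mul_o ha ha', _, add_mem (?_ : _ ∈ _) ?_, mat_mul _ _ _ _ _ _⟩
    · convert 𝔸.mul_o hb ha' using 2; ring
    · rw [parD_o D ha, smul_mul_assoc]
      refine Submodule.smul_of_tower_mem _ _ ?_
      convert 𝔸.mul_o ha hb' using 2; ring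
  comm := by
    rintro r s _ _ ⟨a, ha, b, hb, rfl⟩ ⟨a', ha', b', hb', rfl⟩
    exact mat_comm _ _ ha hb ha' hb'
  par_o := by
    rintro r _ ⟨a, ha, b, hb, rfl⟩
    have e : D.negOnePow • (r - D).negOnePow • b = r.negOnePow • b := by
      rw [smul_smul, ← Int.negOnePow_add]; congr 2; ring
    ext i j
    fin_cases i <;> fin_cases j
    · simp [parAdjoin, mat, 𝔸.par_o ha]
    · simp [parAdjoin, mat]
    · simp [parAdjoin, mat, 𝔸.par_o hb, e]
    · simp [parAdjoin, mat, ← parD_parD_comm, 𝔸.par_o ha]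
  I_mul := by
    rintro r s _ _ ⟨a, ha, b, hb, rfl⟩ ⟨a₁, ha₁, b₁, hb₁, h⟩ ⟨a', ha', b', hb', rfl⟩
    have : a = a₁ := congrFun (congrFun h 0) 0
    subst this
    exact ⟨_, 𝔸.I_mul ha ha₁ ha', _, trivial, mat_mul _ _ _ _ _ _⟩
  mul_I := by
    rintro r s _ _ ⟨a', ha', b', hb', rfl⟩ ⟨a, ha, b, hb, rfl⟩ ⟨a₁, ha₁, b₁, hb₁, h⟩
    have : a = a₁ := congrFun (congrFun h 0) 0
    subst this
    exact ⟨_, 𝔸.mul_I ha' ha ha₁, _, trivial, mat_mul _ _ _ _ _ _⟩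
  -- The first `N` factors multiply to an element without constant term, hence to a multiple of `τ`;
  -- so do the remaining ones, and the product of two multiples of `τ` vanishes.
  N := 𝔸.N + 𝔸.N
  nil := by
    intro L hL hN
    have key : ∀ M ∈ L, ∃ a b, M = 𝔸.mat D a b ∧ (a ∈ 𝔸.I ∧ ∃ r, a ∈ 𝔸.o r) := by
      intro M hM
      obtain ⟨⟨a, ha, b, hb, rfl⟩, r, ⟨a₁, ha₁, b₁, hb₁, h⟩⟩ := hL M hM
      have : a = a₁ := congrFun (congrFun h 0) 0
      subst this
      exact ⟨a, b, rfl, ha, r, ha₁⟩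
    rw [← List.take_append_drop 𝔸.N L, List.prod_append]
    obtain ⟨L₁, b₁, h1, h2, h3⟩ := list_prod_mat 𝔸 D _ (L.take 𝔸.N)
      fun M hM => key M (List.mem_of_mem_take hM)
    obtain ⟨L₂, b₂, h1', h2', h3'⟩ := list_prod_mat 𝔸 D _ (L.drop 𝔸.N)
      fun M hM => key M (List.mem_of_mem_drop hM)
    rw [h3, h3', 𝔸.nil L₁ h2, 𝔸.nil L₂ h2', mat_mul]
    · simp [mat_zero]
    · rw [h1', List.length_drop]; omega
    · rw [h1, List.length_take]; omega

/-- The inclusion of `𝔸` in matrices. -/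
def inclMat : 𝔸.A →ₐ[k] Matrix (Fin 2) (Fin 2) 𝔸.A :=
  AlgHom.ofLinearMap
    { toFun := fun a => 𝔸.mat D a 0
      map_add' := fun a b => by rw [mat_add, add_zero]
      map_smul' := fun t a => by rw [RingHom.id_apply, mat_smul, smul_zero] }
    (mat_one _ _)
    (fun a b => by
      change 𝔸.mat D _ _ = 𝔸.mat D _ _ * 𝔸.mat D _ _
      rw [mat_mul]; simp)

/-- The inclusion of `𝔸`. -/
def incl : 𝔸.A →ₐ[k] (𝔸.adjoin D).A := 𝔸.inclMat D

/-- The new letter. -/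
def letter : (𝔸.adjoin D).A := 𝔸.mat D 0 1

/-- The coefficient of `τ`. -/
def coeff : (𝔸.adjoin D).A →ₗ[k] 𝔸.A := Matrix.entryLinearMap k 𝔸.A (1 : Fin 2) (0 : Fin 2)

variable {D}

theorem incl_c {r : ℤ} {a : 𝔸.A} (ha : a ∈ 𝔸.c r) : 𝔸.incl D a ∈ (𝔸.adjoin D).c r :=
  ⟨a, ha, 0, zero_mem _, rfl⟩

theorem incl_o {r : ℤ} {a : 𝔸.A} (ha : a ∈ 𝔸.o r) : 𝔸.incl D a ∈ (𝔸.adjoin D).o r :=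
  ⟨a, ha, 0, zero_mem _, rfl⟩

theorem incl_I {a : 𝔸.A} (ha : a ∈ 𝔸.I) : 𝔸.incl D a ∈ (𝔸.adjoin D).I :=
  ⟨a, ha, 0, trivial, rfl⟩

theorem letter_c : 𝔸.letter D ∈ (𝔸.adjoin D).c D :=
  ⟨0, zero_mem _, 1, by rw [sub_self]; exact 𝔸.one_c, rfl⟩

theorem letter_I : 𝔸.letter D ∈ (𝔸.adjoin D).I := ⟨0, zero_mem _, 1, trivial, rfl⟩

theorem letter_mul_letter : 𝔸.letter D * 𝔸.letter D = 0 := by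
  change 𝔸.mat D _ _ * 𝔸.mat D _ _ = 0
  rw [mat_mul]
  simp [mat_zero]

theorem coeff_letter_mul (a : 𝔸.A) : 𝔸.coeff D (𝔸.letter D * 𝔸.incl D a) = a := by
  change (𝔸.mat D 0 1 * 𝔸.mat D a 0) 1 0 = a
  rw [mat_mul]; simp [mat]

end Adjoin

end TestAlg

namespace TestAlg
variable {k : Type u} [Field k]

/-! ### Open letters -/

/-- Triangular matrices of degree `r` with respect to the weights `s`. -/
def triangular (k : Type u) [Field k] {m : ℕ} (s : Fin (m + 1) → ℤ) (r : ℤ) :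
    Submodule k (Matrix (Fin (m + 1)) (Fin (m + 1)) k) where
  carrier := {M | ∀ i j, M i j ≠ 0 → i ≤ j ∧ s j - s i = r}
  zero_mem' := fun i j h => absurd rfl h
  add_mem' := by
    intro M M' h h' i j hij
    by_cases h0 : M i j = 0
    · exact h' i j (by simpa [h0] using hij)
    · exact h i j h0
  smul_mem' := by
    intro t M h i j hij
    exact h i j fun h0 => hij (by simp [h0])

/-- Strictly triangular matrices. -/
def strict (k : Type u) [Field k] (m : ℕ) : Submodule k (Matrix (Fin (m + 1)) (Fin (m + 1)) k) where
  carrier := {M | ∀ i j, M i j ≠ 0 → i < j}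
  zero_mem' := fun i j h => absurd rfl h
  add_mem' := by
    intro M M' h h' i j hij
    by_cases h0 : M i j = 0
    · exact h' i j (by simpa [h0] using hij)
    · exact h i j h0
  smul_mem' := by
    intro t M h i j hij
    exact h i j fun h0 => hij (by simp [h0])

theorem exists_mul_ne_zero {n : ℕ} {M M' : Matrix (Fin n) (Fin n) k} {i j : Fin n}
    (h : (M * M') i j ≠ 0) : ∃ l, M i l ≠ 0 ∧ M' l j ≠ 0 := by
  rw [Matrix.mul_apply] at h
  obtain ⟨l, -, hl⟩ := Finset.exists_ne_zero_of_sum_ne_zero h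
  exact ⟨l, left_ne_zero_of_mul hl, right_ne_zero_of_mul hl⟩

/-- The parity automorphism of weighted matrices. -/
def weightPar {n : ℕ} (s : Fin n → ℤ) : Matrix (Fin n) (Fin n) k →ₐ[k] Matrix (Fin n) (Fin n) k :=
  AlgHom.ofLinearMap
    { toFun := fun M => Matrix.of fun i j => (s j - s i).negOnePow • M i j
      map_add' := fun M M' => by ext i j; simp
      map_smul' := fun t M => by
        ext i j; simp only [Matrix.of_apply, Matrix.smul_apply, RingHom.id_apply]
        rw [smul_comm] }
    (by
      ext i j
      by_cases h : i = j
      · subst h; simp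
      · simp [Matrix.one_apply_ne h])
    (fun M M' => by
      ext i j
      simp only [LinearMap.coe_mk, AddHom.coe_mk, Matrix.of_apply, Matrix.mul_apply]
      rw [Finset.smul_sum]
      refine Finset.sum_congr rfl fun l _ => ?_
      rw [smul_mul_smul_comm, ← Int.negOnePow_add]
      congr 2; ring)

/-- The test algebra of triangular matrices, in which only open arguments have nonscalar
coefficients. -/
def openAlg (k : Type u) [Field k] {m : ℕ} (s : Fin (m + 1) → ℤ) : TestAlg k where
  A := Matrix (Fin (m + 1)) (Fin (m + 1)) k
  -- Matrices do not supercommute, so only scalars, in degree zero, are admitted as closed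
  -- coefficients. Nontrivial closed letters are adjoined afterwards.
  c r := Submodule.span k {M | M = 1 ∧ r = 0}
  o := triangular k s
  I := strict k m
  par := weightPar s
  one_c := Submodule.subset_span ⟨rfl, rfl⟩
  c_le r := by
    rw [Submodule.span_le]
    rintro _ ⟨rfl, rfl⟩ i j h
    have : i = j := by
      by_contra h'
      exact h (Matrix.one_apply_ne h')
    subst this
    simp
  mul_c := by
    intro r s a b ha hb
    have := Submodule.mul_mem_mul ha hb
    rw [Submodule.span_mul_span] at this
    refine Submodule.span_mono ?_ this
    rintro _ ⟨_, ⟨rfl, rfl⟩, _, ⟨rfl, rfl⟩, rfl⟩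
    simp
  mul_o := by
    intro r t a b ha hb i j h
    obtain ⟨l, h1, h2⟩ := exists_mul_ne_zero h
    have h1 := ha i l h1
    have h2 := hb l j h2
    exact ⟨h1.1.trans h2.1, by linarith [h1.2, h2.2]⟩
  comm := by
    intro r s a b ha hb
    induction ha using Submodule.span_induction with
    | mem a ha => obtain ⟨rfl, rfl⟩ := ha; simp
    | zero => simp
    | add x y _ _ hx hy => rw [add_mul, mul_add, smul_add, hx, hy]
    | smul t x _ hx => rw [smul_mul_assoc, hx, mul_smul_comm, smul_comm]
  par_o := by
    intro r a ha
    ext i j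
    change (s j - s i).negOnePow • a i j = r.negOnePow • a i j
    by_cases h : a i j = 0
    · rw [h]; simp
    · rw [(ha i j h).2]
  I_mul := by
    intro r t a b ha _ hb i j h
    obtain ⟨l, h1, h2⟩ := exists_mul_ne_zero h
    exact (ha i l h1).trans_le (hb l j h2).1
  mul_I := by
    intro r t a b ha hb _ i j h
    obtain ⟨l, h1, h2⟩ := exists_mul_ne_zero h
    exact (ha i l h1).1.trans_lt (hb l j h2)
  N := m + 1
  nil := by
    -- Each strictly triangular factor raises the index by at least one, so more than `m` factors
    -- leave no nonzero entry.
    have key : ∀ L : List (Matrix (Fin (m + 1)) (Fin (m + 1)) k),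
        (∀ a ∈ L, a ∈ strict k m) → ∀ i j, L.prod i j ≠ 0 → (i : ℕ) + L.length ≤ j := by
      intro L
      induction L with
      | nil =>
        intro _ i j h
        have : i = j := by
          by_contra h'
          exact h (Matrix.one_apply_ne h')
        simp [this]
      | cons a L ih =>
        intro hL i j h
        rw [List.prod_cons] at h
        obtain ⟨l, h1, h2⟩ := exists_mul_ne_zero h
        have h1 := hL a (by simp) i l h1
        have h2 := ih (fun b hb => hL b (by simp [hb])) l j h2
        simp only [List.length_cons]
        have : (i : ℕ) < l := h1
        omega
    intro L hL hN
    ext i j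
    by_contra h
    have := key L (fun a ha => (hL a ha).1) i j h
    omega

/-- The open letters. -/
def openLetter (k : Type u) [Field k] {m : ℕ} (t : Fin m) :
    Matrix (Fin (m + 1)) (Fin (m + 1)) k := Matrix.single t.castSucc t.succ 1

theorem openLetter_I {m : ℕ} (s : Fin (m + 1) → ℤ) (t : Fin m) :
    openLetter k t ∈ (openAlg k s).I := by
  intro i j h
  simp only [openLetter, Matrix.single_apply] at h
  have : t.castSucc = i ∧ t.succ = j := by by_contra h'; exact h (if_neg h')
  obtain ⟨rfl, rfl⟩ := this
  exact Fin.castSucc_lt_succ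

theorem openLetter_o {m : ℕ} (s : Fin (m + 1) → ℤ) (t : Fin m) :
    openLetter k t ∈ (openAlg k s).o (s t.succ - s t.castSucc) := by
  intro i j h
  simp only [openLetter, Matrix.single_apply] at h
  have : t.castSucc = i ∧ t.succ = j := by by_contra h'; exact h (if_neg h')
  obtain ⟨rfl, rfl⟩ := this
  exact ⟨Fin.castSucc_lt_succ.le, rfl⟩

/-- The letters are the elementary matrices from `t` to `t + 1`; a product is nonzero only if they
form a path. Thus the upper right corner detects exactly the product of all letters in their given
order. -/
theorem prod_openLetter {m q : ℕ} (u : Fin q → Fin m) (i j : Fin (m + 1)) :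
    (List.ofFn fun t => openLetter k (u t)).prod i j =
      if (i : ℕ) + q = j ∧ ∀ t, (u t : ℕ) = i + t then 1 else 0 := by
  induction q generalizing i with
  | zero =>
    by_cases h : i = j
    · subst h; simp
    · have h' : (i : ℕ) ≠ j := fun h' => h (Fin.ext h')
      simp [h', Matrix.one_apply_ne h]
  | succ q ih =>
    rw [List.ofFn_succ, List.prod_cons, Matrix.mul_apply]
    rw [Finset.sum_eq_single (u 0).succ]
    · rw [ih]
      simp only [openLetter, Matrix.single_apply, Fin.forall_fin_succ]
      simp only [Fin.val_succ, Fin.val_zero, Fin.ext_iff, Fin.val_castSucc]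
      by_cases h0 : (u 0 : ℕ) = i
      · rw [if_pos ⟨h0, trivial⟩, one_mul]
        refine if_congr ?_ rfl rfl
        rw [h0]
        constructor
        · rintro ⟨h1, h2⟩
          exact ⟨by omega, by omega, fun t => by rw [h2 t]; omega⟩
        · rintro ⟨h1, -, h2⟩
          exact ⟨by omega, fun t => by rw [h2 t]; omega⟩
      · rw [if_neg (fun h => h0 h.1), zero_mul]
        refine (if_neg ?_).symm
        rintro ⟨-, h, -⟩
        exact h0 (by omega)
    · intro l _ hl
      simp only [openLetter, Matrix.single_apply]
      rw [if_neg (fun h => hl h.2.symm), zero_mul]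
    · simp

theorem prod_openLetter_last {m q : ℕ} (u : Fin q → Fin m) :
    (List.ofFn fun t => openLetter k (u t)).prod 0 (Fin.last m) =
      if q = m ∧ ∀ t, (u t : ℕ) = t then 1 else 0 := by
  rw [prod_openLetter]; simp

/-- Weights with prescribed successive differences. -/
def weight {m : ℕ} (e : Fin m → ℤ) (i : Fin (m + 1)) : ℤ :=
  ∑ t : Fin m, if (t : ℕ) < i then e t else 0

theorem weight_succ {m : ℕ} (e : Fin m → ℤ) (t : Fin m) :
    weight e t.succ - weight e t.castSucc = e t := by
  unfold weight
  rw [← Finset.sum_sub_distrib, Finset.sum_eq_single t]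
  · simp
  · intro l _ hl
    have : (l : ℕ) ≠ t := fun h => hl (Fin.ext h)
    simp only [Fin.val_succ, Fin.val_castSucc]
    by_cases h : (l : ℕ) < t
    · simp [h, h.trans (Nat.lt_succ_self _)]
    · rw [if_neg h, if_neg (by omega)]; simp
  · simp

/-- There are test algebras in which a product of letters of prescribed degrees is detected by a
linear form. -/
theorem exists_detecting {n m : ℕ} (d : Fin n → ℤ) (e : Fin m → ℤ) :
    ∃ (𝔸 : TestAlg k) (ε : Fin n → 𝔸.A) (η : Fin m → 𝔸.A) (lam : 𝔸.A →ₗ[k] k),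
      (∀ i, ε i ∈ 𝔸.I ∧ ε i ∈ 𝔸.c (d i)) ∧ (∀ i, η i ∈ 𝔸.I ∧ η i ∈ 𝔸.o (e i)) ∧
      lam ((List.ofFn ε).prod * (List.ofFn η).prod) = 1 := by
  induction n with
  | zero =>
    refine ⟨openAlg k (weight e), Fin.elim0, openLetter k,
      Matrix.entryLinearMap k k 0 (Fin.last m), fun i => i.elim0, fun i => ⟨openLetter_I _ _, ?_⟩, ?_⟩
    · have := openLetter_o (k := k) (weight e) i
      rwa [weight_succ] at this
    · rw [List.ofFn_zero, List.prod_nil, one_mul]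
      have := prod_openLetter_last (k := k) (fun t : Fin m => t)
      simp only [implies_true, and_self, if_true] at this
      exact this
  | succ n ih =>
    obtain ⟨𝔸, ε, η, lam, h1, h2, h3⟩ := ih fun i => d i.succ
    -- The new closed letter stands first in the product, so that taking its coefficient strips it
    -- off and leaves the product of the inductive hypothesis.
    refine ⟨𝔸.adjoin (d 0), Fin.cons (𝔸.letter (d 0)) fun i => 𝔸.incl (d 0) (ε i),
      fun i => 𝔸.incl (d 0) (η i), lam ∘ₗ 𝔸.coeff (d 0), fun i => ?_, fun i => ?_, ?_⟩
    · refine Fin.cases ?_ (fun i => ?_) i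
      · exact ⟨letter_I _, letter_c _⟩
      · exact ⟨incl_I _ (h1 i).1, incl_c _ (h1 i).2⟩
    · exact ⟨incl_I _ (h2 i).1, incl_o _ (h2 i).2⟩
    · rw [List.ofFn_succ, List.prod_cons, mul_assoc]
      simp only [Fin.cons_zero, Fin.cons_succ]
      have e1 : ∀ {p : ℕ} (a : Fin p → 𝔸.A), (List.ofFn fun i => 𝔸.incl (d 0) (a i)).prod =
          𝔸.incl (d 0) (List.ofFn a).prod := by
        intro p a; rw [map_list_prod, List.map_ofFn]; rfl
      rw [e1, e1, ← map_mul, LinearMap.comp_apply, coeff_letter_mul, h3]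

end TestAlg

/-! ## Points -/

section Points

variable {k : Type u} [Field k] (𝔸 : TestAlg k)

/-- The points of degree `s` of `V` with coefficients in the nilpotent part of `S`. -/
def pts (S : ℤ → Submodule k 𝔸.A) (V : GradedSpace k) (s : ℤ) : Submodule k (𝔸.A ⊗[k] V) :=
  Submodule.span k {z | ∃ r a v, a ∈ 𝔸.I ∧ a ∈ S r ∧ v ∈ V.deg (r + s) ∧ a ⊗ₜ[k] v = z}

/-- Points with closed coefficients. -/
abbrev cPts (V : GradedSpace k) (s : ℤ) : Submodule k (𝔸.A ⊗[k] V) := pts 𝔸 𝔸.c V s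

/-- Points with open coefficients. -/
abbrev oPts (V : GradedSpace k) (s : ℤ) : Submodule k (𝔸.A ⊗[k] V) := pts 𝔸 𝔸.o V s

variable {𝔸} {V U W : GradedSpace k}

theorem tmul_mem_pts {S : ℤ → Submodule k 𝔸.A} {r s t : ℤ} {a : 𝔸.A} {v : V} (hI : a ∈ 𝔸.I)
    (ha : a ∈ S r) (hv : v ∈ V.deg t) (h : t = r + s) : a ⊗ₜ[k] v ∈ pts 𝔸 S V s :=
  Submodule.subset_span ⟨r, a, v, hI, ha, h ▸ hv, rfl⟩

theorem smul_mem_pts {S : ℤ → Submodule k 𝔸.A} (hS : ∀ r, S r ≤ 𝔸.o r)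
    {t : ℤ} {b : 𝔸.A} (hb : b ∈ 𝔸.c t) (hSm : ∀ r a, a ∈ S r → b * a ∈ S (t + r)) {s s' : ℤ}
    (hs : s' = s - t) {z : 𝔸.A ⊗[k] V} (hz : z ∈ pts 𝔸 S V s) : b • z ∈ pts 𝔸 S V s' := by
  induction hz using Submodule.span_induction with
  | mem z hz =>
    obtain ⟨r, a, v, h1, h2, h3, rfl⟩ := hz
    rw [TensorProduct.smul_tmul']
    exact tmul_mem_pts (𝔸.mul_I (𝔸.c_le _ hb) h1 (hS _ h2)) (hSm r a h2) h3 (by rw [hs]; ring)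
  | zero => rw [smul_zero]; exact zero_mem _
  | add x y _ _ hx hy => rw [smul_add]; exact add_mem hx hy
  | smul r x _ hx => rw [smul_comm]; exact Submodule.smul_mem _ _ hx

theorem smul_mem_cPts {t : ℤ} {b : 𝔸.A} (hb : b ∈ 𝔸.c t) {s s' : ℤ} (hs : s' = s - t)
    {z : 𝔸.A ⊗[k] V} (hz : z ∈ cPts 𝔸 V s) : b • z ∈ cPts 𝔸 V s' :=
  smul_mem_pts 𝔸.c_le hb (fun _ _ ha => 𝔸.mul_c hb ha) hs hz

theorem smul_mem_oPts {t : ℤ} {b : 𝔸.A} (hb : b ∈ 𝔸.c t) {s s' : ℤ} (hs : s' = s - t)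
    {z : 𝔸.A ⊗[k] V} (hz : z ∈ oPts 𝔸 V s) : b • z ∈ oPts 𝔸 V s' :=
  smul_mem_pts (fun _ => le_rfl) hb (fun _ _ ha => 𝔸.mul_o (𝔸.c_le _ hb) ha) hs hz

theorem lTensor_mem_pts {S : ℤ → Submodule k 𝔸.A} (L : V →ₗ[k] W) {t s s' : ℤ}
    (hL : GradedSpace.HasDeg L t) (hs : s' = s + t) {z : 𝔸.A ⊗[k] V} (hz : z ∈ pts 𝔸 S V s) :
    L.lTensor 𝔸.A z ∈ pts 𝔸 S W s' := by
  induction hz using Submodule.span_induction with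
  | mem z hz =>
    obtain ⟨r, a, v, h1, h2, h3, rfl⟩ := hz
    rw [LinearMap.lTensor_tmul]
    exact tmul_mem_pts h1 h2 (hL _ _ h3) (by rw [hs]; ring)
  | zero => rw [map_zero]; exact zero_mem _
  | add x y _ _ hx hy => rw [map_add]; exact add_mem hx hy
  | smul r x _ hx => rw [map_smul]; exact Submodule.smul_mem _ _ hx

/-- The inclusion of points along the adjunction of a letter. -/
def inclPt (𝔸 : TestAlg k) (D : ℤ) (M : Type*) [AddCommGroup M] [Module k M] :
    𝔸.A ⊗[k] M →ₗ[k] (𝔸.adjoin D).A ⊗[k] M := (𝔸.incl D).toLinearMap.rTensor M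

/-- The coefficient of a letter. -/
def coeffPt (𝔸 : TestAlg k) (D : ℤ) (M : Type*) [AddCommGroup M] [Module k M] :
    (𝔸.adjoin D).A ⊗[k] M →ₗ[k] 𝔸.A ⊗[k] M := (𝔸.coeff D).rTensor M

section Incl

variable {D : ℤ} {M : Type*} [AddCommGroup M] [Module k M]

theorem inclPt_smul (a : 𝔸.A) (z : 𝔸.A ⊗[k] M) :
    inclPt 𝔸 D M (a • z) = 𝔸.incl D a • inclPt 𝔸 D M z := rTensor_smul _ _ _

theorem coeffPt_letter_smul (z : 𝔸.A ⊗[k] M) :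
    coeffPt 𝔸 D M (𝔸.letter D • inclPt 𝔸 D M z) = z := by
  induction z using TensorProduct.induction_on with
  | zero => simp
  | tmul a v =>
    simp only [coeffPt, inclPt, LinearMap.rTensor_tmul, TensorProduct.smul_tmul', smul_eq_mul,
      AlgHom.toLinearMap_apply]
    rw [TestAlg.coeff_letter_mul]
  | add x y hx hy => rw [map_add, smul_add, map_add, hx, hy]

/-- The coefficient of the letter recovers `z`. This allows formulas that are only available after
multiplication with an odd `θ` to be used over any test algebra: a fresh letter plays the role of
`θ`. -/
theorem letter_smul_inj {z z' : 𝔸.A ⊗[k] M}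
    (h : 𝔸.letter D • inclPt 𝔸 D M z = 𝔸.letter D • inclPt 𝔸 D M z') : z = z' := by
  rw [← coeffPt_letter_smul (D := D) z, h, coeffPt_letter_smul]

end Incl

theorem inclPt_mem_cPts {D s : ℤ} {z : 𝔸.A ⊗[k] V} (hz : z ∈ cPts 𝔸 V s) :
    inclPt 𝔸 D V z ∈ cPts (𝔸.adjoin D) V s := by
  induction hz using Submodule.span_induction with
  | mem z hz =>
    obtain ⟨r, a, v, h1, h2, h3, rfl⟩ := hz
    exact tmul_mem_pts (TestAlg.incl_I _ h1) (TestAlg.incl_c _ h2) h3 rfl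
  | zero => rw [map_zero]; exact zero_mem _
  | add x y _ _ hx hy => rw [map_add]; exact add_mem hx hy
  | smul r x _ hx => rw [map_smul]; exact Submodule.smul_mem _ _ hx

theorem inclPt_mem_oPts {D s : ℤ} {z : 𝔸.A ⊗[k] V} (hz : z ∈ oPts 𝔸 V s) :
    inclPt 𝔸 D V z ∈ oPts (𝔸.adjoin D) V s := by
  induction hz using Submodule.span_induction with
  | mem z hz =>
    obtain ⟨r, a, v, h1, h2, h3, rfl⟩ := hz
    exact tmul_mem_pts (TestAlg.incl_I _ h1) (TestAlg.incl_o _ h2) h3 rfl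
  | zero => rw [map_zero]; exact zero_mem _
  | add x y _ _ hx hy => rw [map_add]; exact add_mem hx hy
  | smul r x _ hx => rw [map_smul]; exact Submodule.smul_mem _ _ hx

theorem ofFn_prod_mem_c {p : ℕ} (a : Fin p → 𝔸.A) (r : Fin p → ℤ) (h : ∀ i, a i ∈ 𝔸.c (r i)) :
    (List.ofFn a).prod ∈ 𝔸.c (∑ i, r i) := by
  induction p with
  | zero => simpa using 𝔸.one_c
  | succ p ih =>
    rw [List.ofFn_succ, List.prod_cons, Fin.sum_univ_succ]
    exact 𝔸.mul_c (h 0) (ih _ _ fun i => h i.succ)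

theorem ofFn_prod_mem_o {p : ℕ} (a : Fin p → 𝔸.A) (r : Fin p → ℤ) (h : ∀ i, a i ∈ 𝔸.o (r i)) :
    (List.ofFn a).prod ∈ 𝔸.o (∑ i, r i) := by
  induction p with
  | zero => simpa using 𝔸.c_le _ 𝔸.one_c
  | succ p ih =>
    rw [List.ofFn_succ, List.prod_cons, Fin.sum_univ_succ]
    exact 𝔸.mul_o (h 0) (ih _ _ fun i => h i.succ)

theorem ofFn_prod_mem_I {p : ℕ} (a : Fin p → 𝔸.A) (r : Fin p → ℤ) (hp : p ≠ 0)
    (h : ∀ i, a i ∈ 𝔸.o (r i)) (hI : ∀ i, a i ∈ 𝔸.I) : (List.ofFn a).prod ∈ 𝔸.I := by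
  obtain ⟨p, rfl⟩ := Nat.exists_eq_succ_of_ne_zero hp
  rw [List.ofFn_succ, List.prod_cons]
  exact 𝔸.I_mul (hI 0) (h 0) (ofFn_prod_mem_o _ (fun i => r i.succ) fun i => h i.succ)

/-- The generators of the points of degree zero. -/
def gens (S : ℤ → Submodule k 𝔸.A) (V : GradedSpace k) : Set (𝔸.A ⊗[k] V) :=
  {z | ∃ r a v, a ∈ 𝔸.I ∧ a ∈ S r ∧ v ∈ V.deg (r + 0) ∧ a ⊗ₜ[k] v = z}

theorem exists_gens {S : ℤ → Submodule k 𝔸.A} {p : ℕ} {x : Fin p → 𝔸.A ⊗[k] V}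
    (hx : ∀ i, x i ∈ gens S V) : ∃ (r : Fin p → ℤ) (a : Fin p → 𝔸.A) (v : Fin p → V),
      (∀ i, a i ∈ 𝔸.I) ∧ (∀ i, a i ∈ S (r i)) ∧ (∀ i, v i ∈ V.deg (r i)) ∧
      x = fun i => a i ⊗ₜ[k] v i := by
  choose r a v h using hx
  exact ⟨r, a, v, fun i => (h i).1, fun i => (h i).2.1, fun i => by simpa using (h i).2.2.1,
    funext fun i => (h i).2.2.2.symm⟩

/-- Identities between bi-multilinear maps on points may be tested on generators. -/
theorem bi_eq_on_pts {M : Type*} [AddCommGroup M] [Module k M] {p q : ℕ}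
    (F G : Bi k (𝔸.A ⊗[k] V) (𝔸.A ⊗[k] U) M p q)
    (h : ∀ (r : Fin p → ℤ) (a : Fin p → 𝔸.A) (v : Fin p → V) (s : Fin q → ℤ) (b : Fin q → 𝔸.A)
      (w : Fin q → U), (∀ i, a i ∈ 𝔸.I) → (∀ i, a i ∈ 𝔸.c (r i)) → (∀ i, v i ∈ V.deg (r i)) →
      (∀ i, b i ∈ 𝔸.I) → (∀ i, b i ∈ 𝔸.o (s i)) → (∀ i, w i ∈ U.deg (s i)) →
      F (fun i => a i ⊗ₜ v i) (fun i => b i ⊗ₜ w i) = G (fun i => a i ⊗ₜ v i) (fun i => b i ⊗ₜ w i))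
    {x : Fin p → 𝔸.A ⊗[k] V} {y : Fin q → 𝔸.A ⊗[k] U} (hx : ∀ i, x i ∈ cPts 𝔸 V 0)
    (hy : ∀ i, y i ∈ oPts 𝔸 U 0) : F x y = G x y := by
  refine bi_eq_of_span F G (gens 𝔸.c V) (gens 𝔸.o U) ?_ x y hx hy
  intro x y hx hy
  obtain ⟨r, a, v, h1, h2, h3, rfl⟩ := exists_gens hx
  obtain ⟨s, b, w, h4, h5, h6, rfl⟩ := exists_gens hy
  exact h r a v s b w h1 h2 h3 h4 h5 h6

/-- The condition that a bi-multilinear map is homogeneous of degree `s`. -/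
def BiDegree {p q : ℕ} (φ : Bi k V U W p q) (s : ℤ) : Prop :=
  ∀ (d : Fin p → ℤ) (e : Fin q → ℤ) (c : Fin p → V) (o : Fin q → U),
    (∀ x, c x ∈ V.deg (d x)) → (∀ y, o y ∈ U.deg (e y)) →
    φ c o ∈ W.deg ((∑ x, d x) + (∑ y, e y) + s)

/-- Modulo `S` membership is an identity with the zero map, to which the test on generators applies.
-/
theorem bi_mem_of_gens {M : Type*} [AddCommGroup M] [Module k M] {p q : ℕ} (S : Submodule k M)
    (F : Bi k (𝔸.A ⊗[k] V) (𝔸.A ⊗[k] U) M p q)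
    (h : ∀ (r : Fin p → ℤ) (a : Fin p → 𝔸.A) (v : Fin p → V) (s : Fin q → ℤ) (b : Fin q → 𝔸.A)
      (w : Fin q → U), (∀ i, a i ∈ 𝔸.I) → (∀ i, a i ∈ 𝔸.c (r i)) → (∀ i, v i ∈ V.deg (r i)) →
      (∀ i, b i ∈ 𝔸.I) → (∀ i, b i ∈ 𝔸.o (s i)) → (∀ i, w i ∈ U.deg (s i)) →
      F (fun i => a i ⊗ₜ v i) (fun i => b i ⊗ₜ w i) ∈ S)
    {x : Fin p → 𝔸.A ⊗[k] V} {y : Fin q → 𝔸.A ⊗[k] U} (hx : ∀ i, x i ∈ cPts 𝔸 V 0)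
    (hy : ∀ i, y i ∈ oPts 𝔸 U 0) : F x y ∈ S := by
  have := bi_eq_on_pts (F.conj S.mkQ (fun _ => LinearMap.id) (fun _ => LinearMap.id)) 0
    (fun r a v s b w h1 h2 h3 h4 h5 h6 => by
      have := h r a v s b w h1 h2 h3 h4 h5 h6
      simpa using (Submodule.Quotient.mk_eq_zero S).2 this) hx hy
  exact (Submodule.Quotient.mk_eq_zero S).1 this

theorem extM_mem_oPts {p q : ℕ} (hpq : p + q ≠ 0) {φ : Bi k V U W p q} {s : ℤ}
    (hφ : BiDegree φ s) {x : Fin p → 𝔸.A ⊗[k] V} {y : Fin q → 𝔸.A ⊗[k] U}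
    (hx : ∀ i, x i ∈ cPts 𝔸 V 0) (hy : ∀ i, y i ∈ oPts 𝔸 U 0) : extM 𝔸.A φ x y ∈ oPts 𝔸 W s := by
  refine bi_mem_of_gens _ _ (fun r a v t b w h1 h2 h3 h4 h5 h6 => ?_) hx hy
  rw [extM_tmul]
  refine tmul_mem_pts ?_ (𝔸.mul_o (𝔸.c_le _ (ofFn_prod_mem_c a r h2)) (ofFn_prod_mem_o b t h5))
    (hφ r t v w h3 h6) rfl
  have ho := ofFn_prod_mem_o a r fun i => 𝔸.c_le _ (h2 i)
  by_cases hp : p = 0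
  · exact 𝔸.mul_I ho (ofFn_prod_mem_I b t (by omega) h5 h4) (ofFn_prod_mem_o b t h5)
  · exact 𝔸.I_mul (ofFn_prod_mem_I a r hp (fun i => 𝔸.c_le _ (h2 i)) h1) ho
      (ofFn_prod_mem_o b t h5)

theorem extM_mem_cPts {p : ℕ} (hp : p ≠ 0) {φ : Bi k V U W p 0} {s : ℤ} (hφ : BiDegree φ s)
    {x : Fin p → 𝔸.A ⊗[k] V} (hx : ∀ i, x i ∈ cPts 𝔸 V 0) (y : Fin 0 → 𝔸.A ⊗[k] U) :
    extM 𝔸.A φ x y ∈ cPts 𝔸 W s := by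
  refine bi_mem_of_gens _ _ (fun r a v t b w h1 h2 h3 h4 h5 h6 => ?_) hx (fun i => i.elim0)
  rw [extM_tmul]
  have := hφ r t v w h3 h6
  simp only [List.ofFn_zero, List.prod_nil, mul_one, Finset.univ_eq_empty, Finset.sum_empty,
    add_zero] at this ⊢
  exact tmul_mem_pts (ofFn_prod_mem_I a r hp (fun i => 𝔸.c_le _ (h2 i)) h1)
    (ofFn_prod_mem_c a r h2) this rfl

/-- All `p + q` coefficients lie in the nilpotent ideal, so their product vanishes. This makes the
evaluation series finite. -/
theorem extM_eq_zero_of_le {p q : ℕ} (h : 𝔸.N ≤ p + q) (φ : Bi k V U W p q)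
    {x : Fin p → 𝔸.A ⊗[k] V} {y : Fin q → 𝔸.A ⊗[k] U} (hx : ∀ i, x i ∈ cPts 𝔸 V 0)
    (hy : ∀ i, y i ∈ oPts 𝔸 U 0) : extM 𝔸.A φ x y = 0 := by
  refine bi_eq_on_pts (extM 𝔸.A φ) 0 (fun r a v t b w h1 h2 h3 h4 h5 h6 => ?_) hx hy
  rw [extM_tmul, ← List.prod_append, 𝔸.nil]
  · simp
  · intro z hz
    rcases List.mem_append.1 hz with hz | hz
    · obtain ⟨i, rfl⟩ := (List.mem_ofFn' _ _).1 hz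
      exact ⟨h1 i, _, 𝔸.c_le _ (h2 i)⟩
    · obtain ⟨i, rfl⟩ := (List.mem_ofFn' _ _).1 hz
      exact ⟨h4 i, _, h5 i⟩
  · simpa using h

/-- The condition that a bi-multilinear map is graded symmetric in the closed arguments. -/
def BiSymmetric {p q : ℕ} (φ : Bi k V U W p q) : Prop :=
  ∀ (d : Fin p → ℤ) (c : Fin p → V) (o : Fin q → U), (∀ x, c x ∈ V.deg (d x)) →
    ∀ σ : Equiv.Perm (Fin p), φ c o = (permSign d σ).negOnePow • φ (fun x => c (σ x)) o

theorem units_smul_tmul {M N : Type*} [AddCommGroup M] [Module k M] [AddCommGroup N] [Module k N]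
    (t : ℤˣ) (m : M) (n : N) : (t • m) ⊗ₜ[k] n = t • (m ⊗ₜ[k] n) := by
  rcases Int.units_eq_one_or t with rfl | rfl <;> simp [TensorProduct.neg_tmul]

theorem tmul_units_smul {M N : Type*} [AddCommGroup M] [Module k M] [AddCommGroup N] [Module k N]
    (t : ℤˣ) (m : M) (n : N) : m ⊗ₜ[k] (t • n) = t • (m ⊗ₜ[k] n) := by
  rcases Int.units_eq_one_or t with rfl | rfl <;> simp [TensorProduct.tmul_neg]

/-- On points, graded symmetric maps are symmetric. -/
theorem extM_symm {p q : ℕ} {φ : Bi k V U W p q} (hφ : BiSymmetric φ)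
    {x : Fin p → 𝔸.A ⊗[k] V} {y : Fin q → 𝔸.A ⊗[k] U} (hx : ∀ i, x i ∈ cPts 𝔸 V 0)
    (hy : ∀ i, y i ∈ oPts 𝔸 U 0) (σ : Equiv.Perm (Fin p)) :
    extM 𝔸.A φ (x ∘ σ) y = extM 𝔸.A φ x y := by
  let L : Bi k (𝔸.A ⊗[k] V) (𝔸.A ⊗[k] U) (𝔸.A ⊗[k] W) p q := (extM 𝔸.A φ).domDomCongr σ
  refine bi_eq_on_pts L (extM 𝔸.A φ) (fun r a v t b w h1 h2 h3 h4 h5 h6 => ?_) hx hy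
  change extM 𝔸.A φ (fun i => a (σ i) ⊗ₜ v (σ i)) _ = _
  rw [extM_tmul, extM_tmul, hφ r v w h3 σ,
    prod_perm r σ a fun i j => 𝔸.comm (h2 i) (𝔸.c_le _ (h2 j)), tmul_units_smul, smul_mul_assoc,
    units_smul_tmul]

/-- Graded symmetry may be tested on points. -/
theorem biSymmetric_of_pts {p q : ℕ} (φ : Bi k V U W p q)
    (h : ∀ (𝔸 : TestAlg k) (x : Fin p → 𝔸.A ⊗[k] V) (y : Fin q → 𝔸.A ⊗[k] U),
      (∀ i, x i ∈ cPts 𝔸 V 0) → (∀ i, y i ∈ oPts 𝔸 U 0) → ∀ σ : Equiv.Perm (Fin p),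
      extM 𝔸.A φ (x ∘ σ) y = extM 𝔸.A φ x y) : BiSymmetric φ := by
  intro d c o hc σ
  suffices H : φ c = (permSign d σ).negOnePow • φ (fun x => c (σ x)) by
    rw [H]; rfl
  refine multilinear_ext_homogeneous _ _ fun e o ho => ?_
  -- Tensoring each argument with its own letter and applying `lam`, which is `1` on the ordered
  -- product, turns symmetry on points into graded symmetry of the vectors.
  obtain ⟨𝔸, ε, η, lam, h1, h2, h3⟩ := TestAlg.exists_detecting (k := k) d e
  have key := h 𝔸 (fun i => ε i ⊗ₜ c i) (fun i => η i ⊗ₜ o i)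
    (fun i => tmul_mem_pts (h1 i).1 (h1 i).2 (hc i) (by ring))
    (fun i => tmul_mem_pts (h2 i).1 (h2 i).2 (ho i) (by ring)) σ
  rw [show ((fun i => ε i ⊗ₜ[k] c i) ∘ σ) = fun i => ε (σ i) ⊗ₜ c (σ i) from rfl, extM_tmul,
    extM_tmul, prod_perm d σ ε fun i j => 𝔸.comm (h1 i).2 (𝔸.c_le _ (h1 j).2), smul_mul_assoc,
    units_smul_tmul, ← tmul_units_smul] at key
  have := congrArg (TensorProduct.lid k W ∘ lam.rTensor W) key
  simp only [Function.comp_apply, LinearMap.rTensor_tmul, TensorProduct.lid_tmul, h3,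
    one_smul] at this
  exact this.symm

end Points

/-! ## Composition and insertion of families -/

section Glue

variable {k : Type*} [Field k] {V U W V' U' : GradedSpace k}

theorem bi_sum_apply {V U W : Type*} [AddCommGroup V] [Module k V] [AddCommGroup U] [Module k U]
    [AddCommGroup W] [Module k W] {ι : Type*} (s : Finset ι) {n m : ℕ} (φ : ι → Bi k V U W n m)
    (c : Fin n → V) (o : Fin m → U) : (∑ i ∈ s, φ i) c o = ∑ i ∈ s, φ i c o := by
  rw [sum_apply, sum_apply]

/-- A bi-multilinear map given on homogeneous arguments by `R d e`, where `d` and `e` are the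
parities of the arguments. -/
def glue {n m : ℕ} (R : (Fin n → ℤ) → (Fin m → ℤ) → Bi k V U W n m) : Bi k V U W n m :=
  ∑ δ : Fin n → ZMod 2, ∑ ε : Fin m → ZMod 2,
    (R (fun i => ((δ i).val : ℤ)) fun i => ((ε i).val : ℤ)).conj LinearMap.id
      (fun i => V.parity (δ i)) fun i => U.parity (ε i)

/-- On homogeneous arguments every parity projection is either the identity or zero, and only the
summand with the parities of `d` and `e` survives. -/
theorem glue_apply {n m : ℕ} (R : (Fin n → ℤ) → (Fin m → ℤ) → Bi k V U W n m)
    (hR : ∀ d d' e e', (∀ i, (d i : ZMod 2) = d' i) → (∀ i, (e i : ZMod 2) = e' i) →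
      R d e = R d' e') {d : Fin n → ℤ} {e : Fin m → ℤ} {c : Fin n → V} {o : Fin m → U}
    (hc : ∀ i, c i ∈ V.deg (d i)) (ho : ∀ i, o i ∈ U.deg (e i)) : glue R c o = R d e c o := by
  unfold glue
  rw [bi_sum_apply, Finset.sum_eq_single fun i => (d i : ZMod 2)]
  · rw [bi_sum_apply, Finset.sum_eq_single fun i => (e i : ZMod 2)]
    · rw [Bi.conj_apply, hR _ d _ e (fun i => by simp) (fun i => by simp)]
      simp only [GradedSpace.parity_same (hc _), GradedSpace.parity_same (ho _),
        LinearMap.id_apply]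
    · intro ε _ hε
      obtain ⟨i, hi⟩ := Function.ne_iff.1 hε
      rw [Bi.conj_apply, MultilinearMap.map_coord_zero _ i]
      · simp
      · exact GradedSpace.parity_ne hi.symm (ho i)
    · simp
  · intro δ _ hδ
    obtain ⟨i, hi⟩ := Function.ne_iff.1 hδ
    rw [bi_sum_apply]
    refine Finset.sum_eq_zero fun ε _ => ?_
    rw [Bi.conj_apply, MultilinearMap.map_coord_zero _ i]
    · simp
    · exact GradedSpace.parity_ne hi.symm (hc i)
  · simp

/-- The composition of families of multilinear maps. -/
def composeF (ν : MixedMaps k V' U' W) (f : ClosedMaps k V V') (g : MixedMaps k V U U') :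
    MixedMaps k V U W := fun n m => glue fun d e =>
  ∑ i ∈ Finset.range (n + 1), ∑ j ∈ Finset.range (n + m + 1),
    ∑ b : Fin n → Fin (i + j), ∑ h ∈ segments m j,
      ((i.factorial : k)⁻¹) • (mixedComposeSign d e b h).negOnePow • compTerm b h (ν i j) f g

theorem composeF_apply (ν : MixedMaps k V' U' W) (f : ClosedMaps k V V') (g : MixedMaps k V U U')
    {n m : ℕ} {d : Fin n → ℤ} {e : Fin m → ℤ} {c : Fin n → V} {o : Fin m → U}
    (hc : ∀ i, c i ∈ V.deg (d i)) (ho : ∀ i, o i ∈ U.deg (e i)) :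
    composeF ν f g n m c o = mixedCompose ν f g d e c o := by
  unfold composeF
  rw [glue_apply _ _ hc ho]
  · simp only [bi_sum_apply]
    rfl
  · intro d d' e e' hd he
    simp only [mixedComposeSign_congr d d' e e' hd he]

/-- The insertion of families of multilinear maps. -/
def insertF (f : MixedMaps k V U W) (l : ClosedMaps k V V) (ν : MixedMaps k V U U) :
    MixedMaps k V U W := fun n m => glue fun d e =>
  (∑ b : Fin n → Fin 2, (shuffleSign d b).negOnePow • insTermC b f l) +
  ∑ b : Fin n → Fin 2, ∑ h ∈ segments m 3, (mixedInsertSign d e b h).negOnePow • insTermO b h f ν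

theorem insertF_apply (f : MixedMaps k V U W) (l : ClosedMaps k V V) (ν : MixedMaps k V U U)
    {n m : ℕ} {d : Fin n → ℤ} {e : Fin m → ℤ} {c : Fin n → V} {o : Fin m → U}
    (hc : ∀ i, c i ∈ V.deg (d i)) (ho : ∀ i, o i ∈ U.deg (e i)) :
    insertF f l ν n m c o = mixedInsert f l ν d e c o := by
  unfold insertF
  rw [glue_apply _ _ hc ho]
  · rw [add_apply, add_apply]
    simp only [bi_sum_apply]
    rfl
  · intro d d' e e' hd he
    have : ∀ b : Fin n → Fin 2, (shuffleSign d b).negOnePow = (shuffleSign d' b).negOnePow :=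
      fun b => negOnePow_eq_of_zmod (shuffleSign_congr d d' hd b)
    simp only [mixedInsertSign_congr d d' e e' hd he, this]

/-! ### Degrees -/

theorem sum_blockDegree {n j : ℕ} (b : Fin n → Fin j) (d : Fin n → ℤ) :
    ∑ a, blockDegree b a d = ∑ x, d x := by
  unfold blockDegree block
  exact Finset.sum_fiberwise _ _ _

theorem part_mem_deg {n j : ℕ} (b : Fin n → Fin j) (a : Fin j) {d : Fin n → ℤ} {c : Fin n → V}
    (hc : ∀ i, c i ∈ V.deg (d i)) (t : Fin (size b a)) : part b a c t ∈ V.deg (part b a d t) :=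
  hc _

theorem composeF_degree {ν : MixedMaps k V' U' W} {f : ClosedMaps k V V'} {g : MixedMaps k V U U'}
    {s : ℤ} (hν : ν.HasDegree s) (hf : f.HasDegree 0) (hg : g.HasDegree 0) :
    (composeF ν f g).HasDegree s := by
  intro n m d e c o hc ho
  rw [composeF_apply _ _ _ hc ho]
  unfold mixedCompose
  refine sum_mem fun i _ => sum_mem fun j _ => sum_mem fun b _ => sum_mem fun h _ => ?_
  refine Submodule.smul_mem _ _ (Submodule.smul_of_tower_mem _ _ ?_)
  have := hν i j (fun a => blockDegree b (Fin.castAdd j a) d)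
    (fun a => blockDegree b (Fin.natAdd i a) d + blockDegree h a e) _ _
    (fun a => by
      have := hf _ _ _ (part_mem_deg b (Fin.castAdd j a) hc)
      rwa [sum_part, add_zero] at this)
    (fun a => by
      have := hg _ _ _ _ _ _ (part_mem_deg b (Fin.natAdd i a) hc) (part_mem_deg h a ho)
      rwa [sum_part, sum_part, add_zero] at this)
  rwa [Finset.sum_add_distrib, ← add_assoc, ← Fin.sum_univ_add (fun a => blockDegree b a d),
    sum_blockDegree, sum_blockDegree] at this

theorem insertF_degree {f : MixedMaps k V U W} {l : ClosedMaps k V V} {ν : MixedMaps k V U U}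
    {s t : ℤ} (hf : f.HasDegree s) (hl : l.HasDegree t) (hν : ν.HasDegree t) :
    (insertF f l ν).HasDegree (s + t) := by
  intro n m d e c o hc ho
  rw [insertF_apply _ _ _ hc ho]
  unfold mixedInsert
  refine add_mem (sum_mem fun b _ => Submodule.smul_of_tower_mem _ _ ?_)
    (sum_mem fun b _ => sum_mem fun h _ => Submodule.smul_of_tower_mem _ _ ?_)
  · have := hf _ m (Fin.cons (blockDegree b 0 d + t) (part b 1 d)) e
      (Fin.cons (l (size b 0) (part b 0 c)) (part b 1 c)) o
      (fun x => by
        refine Fin.cases ?_ (fun x => ?_) x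
        · have := hl _ _ _ (part_mem_deg b 0 hc)
          rwa [sum_part] at this
        · exact part_mem_deg b 1 hc x) ho
    rw [Fin.sum_univ_succ] at this
    simp only [Fin.cons_zero, Fin.cons_succ] at this
    rw [sum_part] at this
    convert this using 2
    rw [← sum_blockDegree b d, Fin.sum_univ_two]; ring
  · have := hf (size b 0) _ (part b 0 d) (Fin.append (Fin.append (part h 0 e)
        (fun _ : Fin 1 => blockDegree b 1 d + blockDegree h 1 e + t)) (part h 2 e)) (part b 0 c)
      (Fin.append (Fin.append (part h 0 o)
        (fun _ : Fin 1 => ν (size b 1) (size h 1) (part b 1 c) (part h 1 o))) (part h 2 o))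
      (part_mem_deg b 0 hc) (fun x => by
        refine Fin.addCases (fun x => ?_) (fun x => ?_) x
        · rw [Fin.append_left, Fin.append_left]
          refine Fin.addCases (fun x => ?_) (fun x => ?_) x
          · rw [Fin.append_left, Fin.append_left]; exact part_mem_deg h 0 ho x
          · rw [Fin.append_right, Fin.append_right]
            have := hν _ _ _ _ _ _ (part_mem_deg b 1 hc) (part_mem_deg h 1 ho)
            rwa [sum_part, sum_part] at this
        · rw [Fin.append_right, Fin.append_right]; exact part_mem_deg h 2 ho x)
    rw [Fin.sum_univ_add, Fin.sum_univ_add] at this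
    simp only [Fin.append_left, Fin.append_right] at this
    rw [Fin.sum_univ_one, sum_part, sum_part, sum_part] at this
    convert this using 2
    rw [← sum_blockDegree b d, ← sum_blockDegree h e, Fin.sum_univ_two, Fin.sum_univ_three]; ring

end Glue

/-! ### Compositions and insertions on points, free of signs -/

section OnPoints

variable {k : Type u} [Field k] {𝔸 : TestAlg k} {V U W V' U' : GradedSpace k}

variable (𝔸) in
/-- The extension of a family of closed maps. -/
def extC (f : ClosedMaps k V W) (p : ℕ) :
    MultilinearMap k (fun _ : Fin p => 𝔸.A ⊗[k] V) (𝔸.A ⊗[k] W) := extA k 𝔸.A V W p (f p)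

variable (𝔸) in
/-- The extension of a family of mixed maps. -/
def extF (g : MixedMaps k V U W) (p q : ℕ) : Bi k (𝔸.A ⊗[k] V) (𝔸.A ⊗[k] U) (𝔸.A ⊗[k] W) p q :=
  extM 𝔸.A (g p q)

theorem open_closed_comm {r s : ℤ} {a b : 𝔸.A} (ha : a ∈ 𝔸.c r) (hb : b ∈ 𝔸.o s) :
    b * a = (s * r).negOnePow • (a * b) := by
  rw [𝔸.comm ha hb, smul_smul, ← Int.negOnePow_add, Int.negOnePow_even, one_smul]
  exact ⟨s * r, by ring⟩

/-- The signs of insertion are written for degree one but depend on parity alone. So they serve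
every odd degree: 1 for structure maps and -1 for contractions. -/
theorem negOnePow_mul_odd {D : ℤ} (hD : Odd D) (r : ℤ) :
    (r * D).negOnePow = (r * 1).negOnePow := by
  rw [Int.negOnePow_eq_iff, ← mul_sub]
  exact (hD.sub_odd odd_one).mul_left r

theorem part_tmul {n j : ℕ} {A V : Type*} [Ring A] [Algebra k A] [AddCommGroup V] [Module k V]
    (b : Fin n → Fin j) (α : Fin j) (a : Fin n → A) (v : Fin n → V) :
    part b α (fun i => a i ⊗ₜ[k] v i) = fun t => part b α a t ⊗ₜ part b α v t := rfl

theorem compTerm_tmul {n m i j : ℕ} (b : Fin n → Fin (i + j)) {h : Fin m → Fin j}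
    (hh : Monotone h) (ν : Bi k V' U' W i j) (f : ClosedMaps k V V') (g : MixedMaps k V U U')
    {r : Fin n → ℤ} {a : Fin n → 𝔸.A} (v : Fin n → V) {s : Fin m → ℤ} {β : Fin m → 𝔸.A}
    (w : Fin m → U) (ha : ∀ i, a i ∈ 𝔸.c (r i)) (hβ : ∀ i, β i ∈ 𝔸.o (s i)) :
    compTerm b h (extM 𝔸.A ν) (extC 𝔸 f) (extF 𝔸 g) (fun i => a i ⊗ₜ v i) (fun i => β i ⊗ₜ w i) =
      (mixedComposeSign r s b h).negOnePow •
        extM 𝔸.A (compTerm b h ν f g) (fun i => a i ⊗ₜ v i) (fun i => β i ⊗ₜ w i) := by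
  rw [extM_tmul]
  unfold compTerm
  simp only [mkBi_apply, part_tmul, extC, extF, extA_tmul, extM_tmul]
  rw [prod_compose r s b h hh a β (fun x y => 𝔸.comm (ha x) (𝔸.c_le _ (ha y)))
    (fun x y => open_closed_comm (ha x) (hβ y)), units_smul_tmul]

/-- On points, composition of families has no signs. -/
theorem extM_composeF (ν : MixedMaps k V' U' W) (f : ClosedMaps k V V') (g : MixedMaps k V U U')
    {n m : ℕ} {x : Fin n → 𝔸.A ⊗[k] V} {y : Fin m → 𝔸.A ⊗[k] U} (hx : ∀ i, x i ∈ cPts 𝔸 V 0)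
    (hy : ∀ i, y i ∈ oPts 𝔸 U 0) :
    extM 𝔸.A (composeF ν f g n m) x y =
      ∑ i ∈ Finset.range (n + 1), ∑ j ∈ Finset.range (n + m + 1),
        ∑ b : Fin n → Fin (i + j), ∑ h ∈ segments m j, ((i.factorial : k)⁻¹) •
          compTerm b h (extM 𝔸.A (ν i j)) (extC 𝔸 f) (extF 𝔸 g) x y := by
  have := bi_eq_on_pts (extM 𝔸.A (composeF ν f g n m))
    (∑ i ∈ Finset.range (n + 1), ∑ j ∈ Finset.range (n + m + 1),
        ∑ b : Fin n → Fin (i + j), ∑ h ∈ segments m j, ((i.factorial : k)⁻¹) •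
          compTerm b h (extM 𝔸.A (ν i j)) (extC 𝔸 f) (extF 𝔸 g)) ?_ hx hy
  · rw [this]
    simp only [bi_sum_apply]
    rfl
  intro r a v s β w h1 h2 h3 h4 h5 h6
  rw [extM_tmul, composeF_apply ν f g h3 h6]
  unfold mixedCompose
  simp only [bi_sum_apply, TensorProduct.tmul_sum]
  refine Finset.sum_congr rfl fun i _ => Finset.sum_congr rfl fun j _ =>
    Finset.sum_congr rfl fun b _ => Finset.sum_congr rfl fun h hh => ?_
  rw [smul_apply, smul_apply, compTerm_tmul b (Finset.mem_filter.1 hh).2 _ _ _ _ _ h2 h5,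
    extM_tmul, TensorProduct.tmul_smul, tmul_units_smul]
  rfl

theorem cons_tmul {n : ℕ} {A V : Type*} [Ring A] [Algebra k A] [AddCommGroup V] [Module k V]
    (a₀ : A) (v₀ : V) (a : Fin n → A) (v : Fin n → V) :
    (Fin.cons (a₀ ⊗ₜ[k] v₀) (fun i => a i ⊗ₜ[k] v i) : Fin (n + 1) → A ⊗[k] V) =
      fun i => (Fin.cons a₀ a : Fin (n + 1) → A) i ⊗ₜ (Fin.cons v₀ v : Fin (n + 1) → V) i := by
  funext i; refine Fin.cases ?_ (fun i => ?_) i <;> simp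

theorem append_tmul {n m : ℕ} {A V : Type*} [Ring A] [Algebra k A] [AddCommGroup V] [Module k V]
    (a : Fin n → A) (v : Fin n → V) (a' : Fin m → A) (v' : Fin m → V) :
    Fin.append (fun i => a i ⊗ₜ[k] v i) (fun i => a' i ⊗ₜ[k] v' i) =
      fun i => Fin.append a a' i ⊗ₜ Fin.append v v' i := by
  funext i; refine Fin.addCases (fun i => ?_) (fun i => ?_) i <;> simp

/-- The multiple of the extension of a family of closed maps by a coefficient. -/
def extCθ (θ : 𝔸.A) (l : ClosedMaps k V W) (p : ℕ) :
    MultilinearMap k (fun _ : Fin p => 𝔸.A ⊗[k] V) (𝔸.A ⊗[k] W) :=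
  (Algebra.lsmul k k (𝔸.A ⊗[k] W) θ).compMultilinearMap (extC 𝔸 l p)

/-- The multiple of the extension of a family of mixed maps by a coefficient. -/
def extFθ (θ : 𝔸.A) (g : MixedMaps k V U W) (p q : ℕ) :
    Bi k (𝔸.A ⊗[k] V) (𝔸.A ⊗[k] U) (𝔸.A ⊗[k] W) p q :=
  (extF 𝔸 g p q).conj (Algebra.lsmul k k (𝔸.A ⊗[k] W) θ) (fun _ => LinearMap.id)
    (fun _ => LinearMap.id)

theorem extCθ_apply (θ : 𝔸.A) (l : ClosedMaps k V W) {p : ℕ} (x : Fin p → 𝔸.A ⊗[k] V) :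
    extCθ θ l p x = θ • extC 𝔸 l p x := rfl

theorem extFθ_apply (θ : 𝔸.A) (g : MixedMaps k V U W) {p q : ℕ} (x : Fin p → 𝔸.A ⊗[k] V)
    (y : Fin q → 𝔸.A ⊗[k] U) : extFθ θ g p q x y = θ • extF 𝔸 g p q x y := rfl

theorem insTermC_tmul {n m : ℕ} (b : Fin n → Fin 2) (f : MixedMaps k V U W)
    (l : ClosedMaps k V V) (θ : 𝔸.A) {r : Fin n → ℤ} {a : Fin n → 𝔸.A} (v : Fin n → V)
    (β : Fin m → 𝔸.A) (w : Fin m → U) (ha : ∀ i, a i ∈ 𝔸.c (r i)) :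
    insTermC b (extF 𝔸 f) (extCθ θ l) (fun i => a i ⊗ₜ v i) (fun i => β i ⊗ₜ w i) =
      (shuffleSign r b).negOnePow • θ •
        extM 𝔸.A (insTermC b f l) (fun i => a i ⊗ₜ v i) (fun i => β i ⊗ₜ w i) := by
  rw [extM_tmul]
  unfold insTermC
  simp only [mkBi_apply, part_tmul, extCθ_apply, extC, extF, extA_tmul, TensorProduct.smul_tmul',
    smul_eq_mul, cons_tmul, extM_tmul]
  rw [prod_insertC r b θ a β (fun x y => 𝔸.comm (ha x) (𝔸.c_le _ (ha y))), units_smul_tmul]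

theorem insTermO_tmul {n m : ℕ} (b : Fin n → Fin 2) {h : Fin m → Fin 3} (hh : Monotone h)
    (f : MixedMaps k V U W) (ν : MixedMaps k V U U) {D : ℤ} (hD : Odd D) {θ : 𝔸.A} (hθ : θ ∈ 𝔸.c D)
    {r : Fin n → ℤ} {a : Fin n → 𝔸.A} (v : Fin n → V)
    {s : Fin m → ℤ} {β : Fin m → 𝔸.A} (w : Fin m → U) (ha : ∀ i, a i ∈ 𝔸.c (r i))
    (hβ : ∀ i, β i ∈ 𝔸.o (s i)) :
    insTermO b h (extF 𝔸 f) (extFθ θ ν) (fun i => a i ⊗ₜ v i) (fun i => β i ⊗ₜ w i) =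
      (mixedInsertSign r s b h).negOnePow • θ •
        extM 𝔸.A (insTermO b h f ν) (fun i => a i ⊗ₜ v i) (fun i => β i ⊗ₜ w i) := by
  rw [extM_tmul]
  unfold insTermO
  simp only [mkBi_apply, part_tmul, extFθ_apply, extF, extM_tmul, TensorProduct.smul_tmul',
    smul_eq_mul, append_tmul]
  rw [prod_insertO r s b h hh θ a β (fun x y => 𝔸.comm (ha x) (𝔸.c_le _ (ha y)))
    (fun x y => open_closed_comm (ha x) (hβ y)) (fun x => by
      rw [← negOnePow_mul_odd hD]; exact open_closed_comm hθ (𝔸.c_le _ (ha x)))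
    (fun y => by rw [← negOnePow_mul_odd hD]; exact open_closed_comm hθ (hβ y)), units_smul_tmul]

/-- On points, insertion of families has no signs. -/
theorem smul_extM_insertF (f : MixedMaps k V U W) (l : ClosedMaps k V V) (ν : MixedMaps k V U U)
    {D : ℤ} (hD : Odd D) {θ : 𝔸.A} (hθ : θ ∈ 𝔸.c D) {n m : ℕ} {x : Fin n → 𝔸.A ⊗[k] V} {y : Fin m → 𝔸.A ⊗[k] U}
    (hx : ∀ i, x i ∈ cPts 𝔸 V 0) (hy : ∀ i, y i ∈ oPts 𝔸 U 0) :
    θ • extM 𝔸.A (insertF f l ν n m) x y =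
      (∑ b : Fin n → Fin 2, insTermC b (extF 𝔸 f) (extCθ θ l) x y) +
      ∑ b : Fin n → Fin 2, ∑ h ∈ segments m 3, insTermO b h (extF 𝔸 f) (extFθ θ ν) x y := by
  have := bi_eq_on_pts ((extM 𝔸.A (insertF f l ν n m)).conj
      (Algebra.lsmul k k (𝔸.A ⊗[k] W) θ) (fun _ => LinearMap.id) (fun _ => LinearMap.id))
    ((∑ b : Fin n → Fin 2, insTermC b (extF 𝔸 f) (extCθ θ l)) +
      ∑ b : Fin n → Fin 2, ∑ h ∈ segments m 3, insTermO b h (extF 𝔸 f) (extFθ θ ν)) ?_ hx hy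
  · rw [add_apply, add_apply] at this
    simp only [bi_sum_apply] at this
    exact this
  intro r a v s β w h1 h2 h3 h4 h5 h6
  rw [Bi.conj_apply, add_apply, add_apply]
  simp only [bi_sum_apply, LinearMap.id_apply]
  rw [extM_tmul, insertF_apply f l ν h3 h6]
  unfold mixedInsert
  simp only [TensorProduct.tmul_sum, TensorProduct.tmul_add, map_add, map_sum]
  refine congrArg₂ _ (Finset.sum_congr rfl fun b _ => ?_) (Finset.sum_congr rfl fun b _ =>
    Finset.sum_congr rfl fun h hh => ?_)
  · rw [insTermC_tmul b f l θ _ _ _ h2, extM_tmul, tmul_units_smul, map_zsmul_unit]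
    rfl
  · rw [insTermO_tmul b (Finset.mem_filter.1 hh).2 f ν hD hθ _ _ h2 h5, extM_tmul, tmul_units_smul,
      map_zsmul_unit]
    rfl

end OnPoints

/-! ## Closed families as mixed families, symmetry -/

section ToMixed

/-- A multilinear map as a bi-multilinear map without open arguments. -/
def Bi.ofClosed {k V W : Type*} [CommRing k] [AddCommGroup V] [Module k V] [AddCommGroup W]
    [Module k W] (U : Type*) [AddCommGroup U] [Module k U] {p : ℕ}
    (F : MultilinearMap k (fun _ : Fin p => V) W) : Bi k V U W p 0 :=
  (MultilinearMap.constLinearEquivOfIsEmpty k k (fun _ : Fin 0 => U) W).toLinearMap.compMultilinearMap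
    F

theorem Bi.ofClosed_apply {k V W : Type*} [CommRing k] [AddCommGroup V] [Module k V]
    [AddCommGroup W] [Module k W] (U : Type*) [AddCommGroup U] [Module k U] {p : ℕ}
    (F : MultilinearMap k (fun _ : Fin p => V) W) (c : Fin p → V) (o : Fin 0 → U) :
    Bi.ofClosed U F c o = F c := rfl

variable {k : Type u} [Field k] {𝔸 : TestAlg k} {V U W V' U' : GradedSpace k}

/-- A family of closed maps as a family of mixed maps. -/
def ClosedMaps.toMixed (f : ClosedMaps k V W) (U : GradedSpace k) : MixedMaps k V U W
  | p, 0 => Bi.ofClosed U (f p)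
  | _, _ + 1 => 0

/-- The maps of a mixed family without open arguments. -/
def MixedMaps.toClosed (g : MixedMaps k V U W) : ClosedMaps k V W := fun p =>
  (MultilinearMap.constLinearEquivOfIsEmpty k k (fun _ : Fin 0 => U) W).symm.toLinearMap.compMultilinearMap
    (g p 0)

theorem MixedMaps.toClosed_apply (g : MixedMaps k V U W) {p : ℕ} (c : Fin p → V) (o : Fin 0 → U) :
    g.toClosed p c = g p 0 c o := by
  rw [Subsingleton.elim o 0]; rfl

theorem extM_ofClosed {p : ℕ} (F : MultilinearMap k (fun _ : Fin p => V) W)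
    (x : Fin p → 𝔸.A ⊗[k] V) (y : Fin 0 → 𝔸.A ⊗[k] U) :
    extM 𝔸.A (Bi.ofClosed U F) x y = extA k 𝔸.A V W p F x := by
  have : extM 𝔸.A (Bi.ofClosed U F) = Bi.ofClosed _ (extA k 𝔸.A V W p F) := by
    apply bi_ext_tmul
    intro a v b w
    rw [extM_tmul, Bi.ofClosed_apply, Bi.ofClosed_apply, extA_tmul]
    simp
  rw [this, Bi.ofClosed_apply]

theorem extF_toMixed (f : ClosedMaps k V W) {p : ℕ} (x : Fin p → 𝔸.A ⊗[k] V)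
    (y : Fin 0 → 𝔸.A ⊗[k] U) : extF 𝔸 (f.toMixed U) p 0 x y = extC 𝔸 f p x :=
  extM_ofClosed _ _ _

theorem ClosedMaps.HasDegree.toMixed {f : ClosedMaps k V W} {s : ℤ} (hf : f.HasDegree s) :
    (f.toMixed U).HasDegree s := by
  intro p q d e c o hc ho
  cases q with
  | zero =>
    have := hf p d c hc
    simpa [ClosedMaps.toMixed, Bi.ofClosed_apply] using this
  | succ q => exact zero_mem _

theorem ClosedMaps.IsSymmetric.toMixed {f : ClosedMaps k V W} (hf : f.IsSymmetric) :
    (f.toMixed U).IsSymmetric := by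
  intro p q d c o hc σ
  cases q with
  | zero => exact hf p d c hc σ
  | succ q => simp [ClosedMaps.toMixed]

theorem MixedMaps.HasDegree.toClosed {f : MixedMaps k V U W} {s : ℤ} (hf : f.HasDegree s) :
    f.toClosed.HasDegree s := by
  intro p d c hc
  have := hf p 0 d Fin.elim0 c 0 hc (fun i => i.elim0)
  rwa [Fin.sum_univ_zero, add_zero] at this

theorem MixedMaps.IsSymmetric.toClosed {f : MixedMaps k V U W} (hf : f.IsSymmetric) :
    f.toClosed.IsSymmetric := fun p d c hc σ => hf p 0 d c 0 hc σ

theorem extC_symm {f : ClosedMaps k V W} (hf : f.IsSymmetric) {p : ℕ} {x : Fin p → 𝔸.A ⊗[k] V}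
    (hx : ∀ i, x i ∈ cPts 𝔸 V 0) (σ : Equiv.Perm (Fin p)) : extC 𝔸 f p (x ∘ σ) = extC 𝔸 f p x := by
  rw [← extF_toMixed (U := V) f (x ∘ σ) Fin.elim0, ← extF_toMixed (U := V) f x Fin.elim0]
  exact extM_symm (hf.toMixed p 0) hx (fun i => i.elim0) σ

theorem extC_mem {f : ClosedMaps k V W} {s : ℤ} (hf : f.HasDegree s) (h0 : f 0 = 0) {p : ℕ}
    {x : Fin p → 𝔸.A ⊗[k] V} (hx : ∀ i, x i ∈ cPts 𝔸 V 0) : extC 𝔸 f p x ∈ cPts 𝔸 W s := by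
  by_cases hp : p = 0
  · subst hp
    unfold extC
    rw [h0, map_zero]
    exact zero_mem _
  · rw [← extF_toMixed (U := V) f x Fin.elim0]
    exact extM_mem_cPts hp (hf.toMixed p 0) hx _

theorem extF_mem {g : MixedMaps k V U W} {s : ℤ} (hg : g.HasDegree s) (h0 : g 0 0 = 0) {p q : ℕ}
    {x : Fin p → 𝔸.A ⊗[k] V} {y : Fin q → 𝔸.A ⊗[k] U} (hx : ∀ i, x i ∈ cPts 𝔸 V 0)
    (hy : ∀ i, y i ∈ oPts 𝔸 U 0) : extF 𝔸 g p q x y ∈ oPts 𝔸 W s := by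
  by_cases hp : p + q = 0
  · obtain ⟨rfl, rfl⟩ : p = 0 ∧ q = 0 := by omega
    unfold extF
    rw [h0, extM_zero]
    exact zero_mem _
  · exact extM_mem_oPts hp (hg p q) hx hy

theorem compTerm_comp_perm {n m i j : ℕ} (b : Fin n → Fin (i + j)) (h : Fin m → Fin j)
    (F : Bi k (𝔸.A ⊗[k] V') (𝔸.A ⊗[k] U') (𝔸.A ⊗[k] W) i j)
    {f : ClosedMaps k V V'} {g : MixedMaps k V U U'} (hf : f.IsSymmetric) (hg : g.IsSymmetric)
    {x : Fin n → 𝔸.A ⊗[k] V} {y : Fin m → 𝔸.A ⊗[k] U} (hx : ∀ i, x i ∈ cPts 𝔸 V 0)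
    (hy : ∀ i, y i ∈ oPts 𝔸 U 0) (σ : Equiv.Perm (Fin n)) :
    compTerm (b ∘ σ) h F (extC 𝔸 f) (extF 𝔸 g) (x ∘ σ) y =
      compTerm b h F (extC 𝔸 f) (extF 𝔸 g) x y := by
  unfold compTerm
  simp only [mkBi_apply]
  have e1 : ∀ α, extC 𝔸 f (size (b ∘ σ) α) (part (b ∘ σ) α (x ∘ σ)) =
      extC 𝔸 f (size b α) (part b α x) := fun α =>
    symm_part (cPts 𝔸 V 0 : Set _) (fun p x => extC 𝔸 f p x)
      (fun p x hx σ => extC_symm hf hx σ) b α σ x hx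
  have e2 : ∀ α q (y' : Fin q → 𝔸.A ⊗[k] U), (∀ i, y' i ∈ oPts 𝔸 U 0) →
      extF 𝔸 g (size (b ∘ σ) α) q (part (b ∘ σ) α (x ∘ σ)) y' =
      extF 𝔸 g (size b α) q (part b α x) y' := fun α q y' hy' =>
    symm_part (cPts 𝔸 V 0 : Set _) (fun p x => extF 𝔸 g p q x y')
      (fun p x hx σ => extM_symm (hg p q) hx hy' σ) b α σ x hx
  congr 1
  · congr 1
    funext α
    exact e1 _
  · funext α
    exact e2 _ _ _ fun _ => hy _

theorem sum_comp_perm {M : Type*} [AddCommMonoid M] {n j : ℕ} (σ : Equiv.Perm (Fin n))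
    (F : (Fin n → Fin j) → M) : ∑ b, F (b ∘ σ) = ∑ b, F b :=
  Equiv.sum_comp (σ.symm.arrowCongr (Equiv.refl (Fin j))) F

/-- On points the composition is an unsigned sum over all `b`; permuting the arguments reindexes it
by `b ↦ b ∘ σ`. No symmetry of the outer family is involved. -/
theorem composeF_symm (ν : MixedMaps k V' U' W)
    {f : ClosedMaps k V V'} {g : MixedMaps k V U U'} (hf : f.IsSymmetric) (hg : g.IsSymmetric) :
    (composeF ν f g).IsSymmetric := by
  intro n m
  refine biSymmetric_of_pts _ fun 𝔸 x y hx hy σ => ?_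
  rw [extM_composeF ν f g hx hy, extM_composeF ν f g (x := x ∘ σ) (fun i => hx _) hy]
  refine Finset.sum_congr rfl fun i _ => Finset.sum_congr rfl fun j _ => ?_
  rw [← sum_comp_perm σ]
  refine Finset.sum_congr rfl fun b _ => Finset.sum_congr rfl fun h _ => ?_
  rw [compTerm_comp_perm b h _ hf hg hx hy]

theorem extM_cons_comp_perm {p q : ℕ} {φ : Bi k V U W (p + 1) q} (hφ : BiSymmetric φ)
    {z : 𝔸.A ⊗[k] V} {x : Fin p → 𝔸.A ⊗[k] V} {y : Fin q → 𝔸.A ⊗[k] U} (hz : z ∈ cPts 𝔸 V 0)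
    (hx : ∀ i, x i ∈ cPts 𝔸 V 0) (hy : ∀ i, y i ∈ oPts 𝔸 U 0) (σ : Equiv.Perm (Fin p)) :
    extM 𝔸.A φ (Fin.cons z (x ∘ σ)) y = extM 𝔸.A φ (Fin.cons z x) y := by
  have hzx : ∀ i, (Fin.cons z x : Fin (p + 1) → 𝔸.A ⊗[k] V) i ∈ cPts 𝔸 V 0 := fun i => by
    refine Fin.cases ?_ (fun i => ?_) i
    · exact hz
    · exact hx i
  rw [← extM_symm hφ hzx hy (Equiv.Perm.decomposeFin.symm (0, σ))]
  congr 2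
  funext i
  refine Fin.cases ?_ (fun i => ?_) i
  · simp
  · simp

theorem insTermC_comp_perm {D : ℤ} {n m : ℕ} (b : Fin n → Fin 2) {f : MixedMaps k V U W}
    {l : ClosedMaps k V V} (hf : f.IsSymmetric) (hl : l.IsSymmetric) (hld : l.HasDegree D)
    (hl0 : l 0 = 0) {θ : 𝔸.A} (hθ : θ ∈ 𝔸.c D)
    {x : Fin n → 𝔸.A ⊗[k] V} {y : Fin m → 𝔸.A ⊗[k] U} (hx : ∀ i, x i ∈ cPts 𝔸 V 0)
    (hy : ∀ i, y i ∈ oPts 𝔸 U 0) (σ : Equiv.Perm (Fin n)) :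
    insTermC (b ∘ σ) (extF 𝔸 f) (extCθ θ l) (x ∘ σ) y =
      insTermC b (extF 𝔸 f) (extCθ θ l) x y := by
  unfold insTermC
  simp only [mkBi_apply, extCθ_apply]
  have e1 : extC 𝔸 l (size (b ∘ σ) 0) (part (b ∘ σ) 0 (x ∘ σ)) =
      extC 𝔸 l (size b 0) (part b 0 x) :=
    symm_part (cPts 𝔸 V 0 : Set _) (fun p x => extC 𝔸 l p x)
      (fun p x hx σ => extC_symm hl hx σ) b 0 σ x hx
  rw [e1]
  have hz : θ • extC 𝔸 l (size b 0) (part b 0 x) ∈ cPts 𝔸 V 0 :=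
    smul_mem_cPts hθ (sub_self D).symm (extC_mem hld hl0 fun _ => hx _)
  exact symm_part (cPts 𝔸 V 0 : Set _) (fun p x => extF 𝔸 f (p + 1) m (Fin.cons _ x) y)
      (fun p x hx σ => extM_cons_comp_perm (hf _ _) hz hx hy σ) b 1 σ x hx

theorem insTermO_comp_perm {D : ℤ} {n m : ℕ} (b : Fin n → Fin 2) (h : Fin m → Fin 3) {f : MixedMaps k V U W}
    {ν : MixedMaps k V U U} (hf : f.IsSymmetric) (hν : ν.IsSymmetric) (hνd : ν.HasDegree D)
    (hν0 : ν 0 0 = 0) {θ : 𝔸.A} (hθ : θ ∈ 𝔸.c D)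
    {x : Fin n → 𝔸.A ⊗[k] V} {y : Fin m → 𝔸.A ⊗[k] U} (hx : ∀ i, x i ∈ cPts 𝔸 V 0)
    (hy : ∀ i, y i ∈ oPts 𝔸 U 0) (σ : Equiv.Perm (Fin n)) :
    insTermO (b ∘ σ) h (extF 𝔸 f) (extFθ θ ν) (x ∘ σ) y =
      insTermO b h (extF 𝔸 f) (extFθ θ ν) x y := by
  unfold insTermO
  simp only [mkBi_apply, extFθ_apply]
  have e1 : extF 𝔸 ν (size (b ∘ σ) 1) (size h 1) (part (b ∘ σ) 1 (x ∘ σ)) (part h 1 y) =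
      extF 𝔸 ν (size b 1) (size h 1) (part b 1 x) (part h 1 y) :=
    symm_part (cPts 𝔸 V 0 : Set _) (fun p x => extF 𝔸 ν p (size h 1) x (part h 1 y))
      (fun p x hx σ => extM_symm (hν _ _) hx (fun _ => hy _) σ) b 1 σ x hx
  rw [e1]
  have hz : θ • extF 𝔸 ν (size b 1) (size h 1) (part b 1 x) (part h 1 y) ∈ oPts 𝔸 U 0 :=
    smul_mem_oPts hθ (sub_self D).symm (extF_mem hνd hν0 (fun _ => hx _) fun _ => hy _)
  refine symm_part (cPts 𝔸 V 0 : Set _) (fun p x => extF 𝔸 f p _ x _)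
      (fun p x hx σ => extM_symm (hf _ _) hx (fun t => ?_) σ) b 0 σ x hx
  refine Fin.addCases (fun t => ?_) (fun t => ?_) t
  · rw [Fin.append_left]
    refine Fin.addCases (fun t => ?_) (fun t => ?_) t
    · rw [Fin.append_left]; exact hy _
    · rw [Fin.append_right]; exact hz
  · rw [Fin.append_right]; exact hy _

/-- The unsigned formula holds for the multiple of the insertion by an odd `θ`. A letter of degree
`D` is therefore adjoined, the sum is reindexed as for compositions, and the letter is cancelled. -/
theorem insertF_symm {D : ℤ} (hD : Odd D) {f : MixedMaps k V U W} {l : ClosedMaps k V V} {ν : MixedMaps k V U U}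
    (hf : f.IsSymmetric) (hl : l.IsSymmetric) (hld : l.HasDegree D) (hl0 : l 0 = 0)
    (hν : ν.IsSymmetric) (hνd : ν.HasDegree D) (hν0 : ν 0 0 = 0) :
    (insertF f l ν).IsSymmetric := by
  intro n m
  refine biSymmetric_of_pts _ fun 𝔸 x y hx hy σ => ?_
  apply letter_smul_inj (D := D)
  have hx' : ∀ i, inclPt 𝔸 D V (x i) ∈ cPts (𝔸.adjoin D) V 0 := fun i => inclPt_mem_cPts (hx i)
  have hy' : ∀ i, inclPt 𝔸 D U (y i) ∈ oPts (𝔸.adjoin D) U 0 := fun i => inclPt_mem_oPts (hy i)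
  have hθ : 𝔸.letter D ∈ (𝔸.adjoin D).c D := 𝔸.letter_c
  unfold inclPt
  rw [extM_algHom, extM_algHom]
  have e1 := smul_extM_insertF f l ν hD hθ hx' hy'
  have e2 := smul_extM_insertF f l ν hD hθ (x := fun i => inclPt 𝔸 D V (x (σ i))) (fun i => hx' _) hy'
  refine e2.trans (Eq.trans ?_ e1.symm)
  rw [← sum_comp_perm σ, ← sum_comp_perm σ fun b => ∑ h ∈ segments m 3,
    insTermO b h (extF (𝔸.adjoin D) f) (extFθ (𝔸.letter D) ν) _ _]
  refine congrArg₂ _ (Finset.sum_congr rfl fun b _ => ?_) (Finset.sum_congr rfl fun b _ =>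
    Finset.sum_congr rfl fun h hh => ?_)
  · exact insTermC_comp_perm b hf hl hld hl0 hθ hx' hy' σ
  · exact insTermO_comp_perm b h hf hν hνd hν0 hθ hx' hy' σ

/-! ### Composition and insertion of closed families -/

/-- The composition of closed families. -/
def composeC (ν : ClosedMaps k V' W) (f : ClosedMaps k V V') : ClosedMaps k V W :=
  (composeF (ν.toMixed V') f (0 : MixedMaps k V V V')).toClosed

/-- The insertion of closed families. -/
def insertC (f : ClosedMaps k V W) (l : ClosedMaps k V V) : ClosedMaps k V W :=
  (insertF (f.toMixed V) l (0 : MixedMaps k V V V)).toClosed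

/-- Only `j = 0` contributes. The closed relations thereby become the case of mixed families without
open arguments, and statements about them need no separate proof. -/
theorem mixedCompose_toMixed (ν : ClosedMaps k V' W) (f : ClosedMaps k V V')
    (g : MixedMaps k V U U') {n : ℕ} (d : Fin n → ℤ) (e : Fin 0 → ℤ) (c : Fin n → V)
    (o : Fin 0 → U) : mixedCompose (ν.toMixed U') f g d e c o = closedCompose ν f d c := by
  unfold mixedCompose closedCompose
  refine Finset.sum_congr rfl fun i _ => ?_
  rw [Finset.sum_range_succ', Finset.sum_eq_zero, zero_add]
  · refine Finset.sum_congr rfl fun b _ => ?_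
    have : segments 0 0 = {Fin.elim0} := by
      ext h
      rw [Subsingleton.elim h Fin.elim0]
      exact iff_of_true (Finset.mem_filter.2 ⟨Finset.mem_univ _, Subsingleton.monotone _⟩)
        (Finset.mem_singleton_self _)
    rw [this, Finset.sum_singleton]
    simp only [mixedComposeSign, Finset.univ_eq_empty, Finset.sum_empty, add_zero]
    rfl
  · intro j _
    refine Finset.sum_eq_zero fun b _ => Finset.sum_eq_zero fun h _ => ?_
    simp [ClosedMaps.toMixed]

theorem mixedInsert_toMixed (f : ClosedMaps k V W) (l : ClosedMaps k V V)
    (ν : MixedMaps k V U U) {n : ℕ} (d : Fin n → ℤ) (e : Fin 0 → ℤ) (c : Fin n → V)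
    (o : Fin 0 → U) : mixedInsert (f.toMixed U) l ν d e c o = closedInsert f l d c := by
  unfold mixedInsert closedInsert
  have key : ∀ q (h : q ≠ 0) p c (o : Fin q → U), f.toMixed U p q c o = 0 := by
    intro q h p c o
    obtain ⟨q, rfl⟩ := Nat.exists_eq_succ_of_ne_zero h
    rfl
  rw [add_eq_left.2]
  · rfl
  · refine Finset.sum_eq_zero fun b _ => Finset.sum_eq_zero fun h _ => ?_
    rw [key _ (by omega), smul_zero]

theorem composeC_apply (ν : ClosedMaps k V' W) (f : ClosedMaps k V V') {n : ℕ} {d : Fin n → ℤ}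
    {c : Fin n → V} (hc : ∀ i, c i ∈ V.deg (d i)) : composeC ν f n c = closedCompose ν f d c := by
  unfold composeC
  rw [MixedMaps.toClosed_apply _ c Fin.elim0, composeF_apply _ _ _ hc (e := Fin.elim0)
    (fun i => i.elim0), mixedCompose_toMixed]

theorem insertC_apply (f : ClosedMaps k V W) (l : ClosedMaps k V V) {n : ℕ} {d : Fin n → ℤ}
    {c : Fin n → V} (hc : ∀ i, c i ∈ V.deg (d i)) : insertC f l n c = closedInsert f l d c := by
  unfold insertC
  rw [MixedMaps.toClosed_apply _ c Fin.elim0, insertF_apply _ _ _ hc (e := Fin.elim0)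
    (fun i => i.elim0), mixedInsert_toMixed]

theorem composeC_degree {ν : ClosedMaps k V' W} {f : ClosedMaps k V V'} {s : ℤ}
    (hν : ν.HasDegree s) (hf : f.HasDegree 0) : (composeC ν f).HasDegree s :=
  (composeF_degree hν.toMixed hf fun _ _ _ _ _ _ _ _ => zero_mem _).toClosed

theorem composeC_symm (ν : ClosedMaps k V' W) {f : ClosedMaps k V V'} (hf : f.IsSymmetric) :
    (composeC ν f).IsSymmetric :=
  (composeF_symm _ hf fun _ _ _ _ _ _ _ => by simp).toClosed

theorem insertC_symm {D : ℤ} (hD : Odd D) {f : ClosedMaps k V W} {l : ClosedMaps k V V}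
    (hf : f.IsSymmetric) (hl : l.IsSymmetric) (hld : l.HasDegree D) (hl0 : l 0 = 0) :
    (insertC f l).IsSymmetric :=
  (insertF_symm hD hf.toMixed hl hld hl0 (fun _ _ _ _ _ _ _ => by simp)
    (fun _ _ _ _ _ _ _ _ => zero_mem _) rfl).toClosed

/-- Composition with a closed family. -/
theorem composeF_toMixed (ν : ClosedMaps k V' W) (f : ClosedMaps k V V') (g : MixedMaps k V U U') :
    composeF (ν.toMixed U') f g = (composeC ν f).toMixed U := by
  funext n m
  refine bi_ext_homogeneous _ _ fun d e c o hc ho => ?_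
  rw [composeF_apply _ _ _ hc ho]
  cases m with
  | zero =>
    rw [mixedCompose_toMixed]
    exact (composeC_apply ν f hc).symm
  | succ m =>
    change _ = (0 : W)
    unfold mixedCompose
    refine Finset.sum_eq_zero fun i _ => Finset.sum_eq_zero fun j _ =>
      Finset.sum_eq_zero fun b _ => Finset.sum_eq_zero fun h _ => ?_
    cases j with
    | zero => exact (h 0).elim0
    | succ j => simp [ClosedMaps.toMixed]

/-- Insertion into a closed family. -/
theorem insertF_toMixed (f : ClosedMaps k V W) (l : ClosedMaps k V V) (ν : MixedMaps k V U U) :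
    insertF (f.toMixed U) l ν = (insertC f l).toMixed U := by
  funext n m
  refine bi_ext_homogeneous _ _ fun d e c o hc ho => ?_
  rw [insertF_apply _ _ _ hc ho]
  have key : ∀ q (h : q ≠ 0) p c (o : Fin q → U), f.toMixed U p q c o = 0 := by
    intro q h p c o
    obtain ⟨q, rfl⟩ := Nat.exists_eq_succ_of_ne_zero h
    rfl
  cases m with
  | zero =>
    rw [mixedInsert_toMixed]
    exact (insertC_apply f l hc).symm
  | succ m =>
    change _ = (0 : W)
    unfold mixedInsert
    rw [Finset.sum_eq_zero, Finset.sum_eq_zero, add_zero]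
    · intro b _
      refine Finset.sum_eq_zero fun h _ => ?_
      rw [key _ (by omega), smul_zero]
    · intro b _
      rw [key _ (by omega), smul_zero]

end ToMixed

/-! ## Moving coefficients to the front -/

section Move

variable {k : Type u} [Field k] {𝔸 : TestAlg k}

/-- Only the factors to the left of position `i` are crossed, and each of them is twisted by `P`. -/
theorem prod_move {A : Type*} [Monoid A] {n : ℕ} (θ : A) (P : A → A) (a : Fin n → A) (i : Fin n)
    (h : ∀ l < i, a l * θ = θ * P (a l)) :
    (List.ofFn fun l => if l = i then θ * a l else a l).prod =
      θ * (List.ofFn fun l => if l < i then P (a l) else a l).prod := by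
  induction n with
  | zero => exact i.elim0
  | succ n ih =>
    rw [List.ofFn_succ, List.ofFn_succ, List.prod_cons, List.prod_cons]
    revert h
    refine Fin.cases (fun _ => ?_) (fun i h => ?_) i
    · rw [if_pos rfl, if_neg (lt_irrefl _), mul_assoc]
      congr 3
    · rw [if_neg (Fin.succ_ne_zero i).symm, if_pos (Fin.succ_pos i), ← mul_assoc,
        ← h 0 (Fin.succ_pos i), mul_assoc]
      congr 1
      have := ih (fun l => a l.succ) i fun l hl => h l.succ (Fin.succ_lt_succ_iff.2 hl)
      simpa [Fin.succ_lt_succ_iff] using this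

/-- Elements with homogeneous coefficients in `S`. -/
def hpts (S : ℤ → Submodule k 𝔸.A) (M : Type*) [AddCommGroup M] [Module k M] :
    Submodule k (𝔸.A ⊗[k] M) :=
  Submodule.span k {z | ∃ r a v, a ∈ S r ∧ a ⊗ₜ[k] v = z}

variable (𝔸) in
/-- The parity automorphism acting on coefficients. -/
def parPt (D : ℤ) (M : Type*) [AddCommGroup M] [Module k M] : 𝔸.A ⊗[k] M →ₗ[k] 𝔸.A ⊗[k] M :=
  (𝔸.parD D).toLinearMap.rTensor M

theorem parPt_smul {M : Type*} [AddCommGroup M] [Module k M] (D : ℤ) (a : 𝔸.A) (z : 𝔸.A ⊗[k] M) :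
    parPt 𝔸 D M (a • z) = 𝔸.parD D a • parPt 𝔸 D M z := rTensor_smul _ _ _

section

variable {V : GradedSpace k}

theorem pts_le_hpts (S : ℤ → Submodule k 𝔸.A) (s : ℤ) : pts 𝔸 S V s ≤ hpts S V := by
  refine Submodule.span_mono ?_
  rintro _ ⟨r, a, v, h1, h2, h3, rfl⟩
  exact ⟨r, a, v, h2, rfl⟩

end

variable {V U W : Type*} [AddCommGroup V] [Module k V] [AddCommGroup U] [Module k U]
  [AddCommGroup W] [Module k W]

theorem parPt_mem_hptsC (D : ℤ) {z : 𝔸.A ⊗[k] V} (hz : z ∈ hpts 𝔸.c V) :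
    parPt 𝔸 D V z ∈ hpts 𝔸.c V := by
  induction hz using Submodule.span_induction with
  | mem z hz =>
    obtain ⟨r, a, v, h1, rfl⟩ := hz
    refine Submodule.subset_span ⟨r, _, v, ?_, rfl⟩
    rw [AlgHom.toLinearMap_apply, TestAlg.parD_o D (𝔸.c_le _ h1)]
    exact Submodule.smul_of_tower_mem _ _ h1
  | zero => rw [map_zero]; exact zero_mem _
  | add x y _ _ hx hy => rw [map_add]; exact add_mem hx hy
  | smul r x _ hx => rw [map_smul]; exact Submodule.smul_mem _ _ hx

theorem parPt_mem_hptsO (D : ℤ) {z : 𝔸.A ⊗[k] V} (hz : z ∈ hpts 𝔸.o V) :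
    parPt 𝔸 D V z ∈ hpts 𝔸.o V := by
  induction hz using Submodule.span_induction with
  | mem z hz =>
    obtain ⟨r, a, v, h1, rfl⟩ := hz
    refine Submodule.subset_span ⟨r, _, v, ?_, rfl⟩
    rw [AlgHom.toLinearMap_apply, TestAlg.parD_o D h1]
    exact Submodule.smul_of_tower_mem _ _ h1
  | zero => rw [map_zero]; exact zero_mem _
  | add x y _ _ hx hy => rw [map_add]; exact add_mem hx hy
  | smul r x _ hx => rw [map_smul]; exact Submodule.smul_mem _ _ hx

theorem exists_hpts {S : ℤ → Submodule k 𝔸.A} {p : ℕ} {x : Fin p → 𝔸.A ⊗[k] V}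
    (hx : ∀ i, x i ∈ {z : 𝔸.A ⊗[k] V | ∃ r a v, a ∈ S r ∧ a ⊗ₜ[k] v = z}) :
    ∃ (r : Fin p → ℤ) (a : Fin p → 𝔸.A) (v : Fin p → V),
      (∀ i, a i ∈ S (r i)) ∧ x = fun i => a i ⊗ₜ[k] v i := by
  choose r a v h using hx
  exact ⟨r, a, v, fun i => (h i).1, funext fun i => (h i).2.symm⟩

theorem mul_coeff {D r : ℤ} {θ a : 𝔸.A} (hθ : θ ∈ 𝔸.c D) (ha : a ∈ 𝔸.o r) :
    a * θ = θ * 𝔸.parD D a := by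
  rw [TestAlg.parD_o D ha, mul_smul_comm, 𝔸.comm hθ ha, smul_smul, ← Int.negOnePow_add,
    Int.negOnePow_even, one_smul]
  exact ⟨D * r, rfl⟩

/-- A coefficient of a closed argument can be moved to the front. -/
theorem extM_moveC {p q : ℕ} (φ : Bi k V U W p q) {D : ℤ} {θ : 𝔸.A} (hθ : θ ∈ 𝔸.c D)
    {x : Fin p → 𝔸.A ⊗[k] V} (y : Fin q → 𝔸.A ⊗[k] U) (hx : ∀ i, x i ∈ hpts 𝔸.c V) (i : Fin p) :
    extM 𝔸.A φ (fun l => if l = i then θ • x l else x l) y =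
      θ • extM 𝔸.A φ (fun l => if l < i then parPt 𝔸 D V (x l) else x l) y := by
  have := bi_eq_of_span
    ((extM 𝔸.A φ).conj LinearMap.id
      (fun l => if l = i then Algebra.lsmul k k (𝔸.A ⊗[k] V) θ else LinearMap.id)
      fun _ => LinearMap.id)
    ((extM 𝔸.A φ).conj (Algebra.lsmul k k (𝔸.A ⊗[k] W) θ)
      (fun l => if l < i then parPt 𝔸 D V else LinearMap.id) fun _ => LinearMap.id)
    {z : 𝔸.A ⊗[k] V | ∃ r a v, a ∈ 𝔸.c r ∧ a ⊗ₜ[k] v = z}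
    {z : 𝔸.A ⊗[k] U | ∃ a v, a ⊗ₜ v = z} ?_ x y hx (fun _ => mem_span_pure _)
  · rw [Bi.conj_apply, Bi.conj_apply] at this
    have e1 : (fun l => (if l = i then (Algebra.lsmul k k (𝔸.A ⊗[k] V) θ : 𝔸.A ⊗[k] V →ₗ[k] _)
        else LinearMap.id) (x l)) = fun l => if l = i then θ • x l else x l := by
      funext l; split_ifs <;> rfl
    have e2 : (fun l => (if l < i then parPt 𝔸 D V else LinearMap.id) (x l)) =
        fun l => if l < i then parPt 𝔸 D V (x l) else x l := by
      funext l; split_ifs <;> rfl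
    rw [e1, e2] at this
    exact this
  intro x y hx hy
  obtain ⟨r, a, v, ha, rfl⟩ := exists_hpts hx
  obtain ⟨b, w, rfl⟩ := exists_tmul_of_forall y hy
  rw [Bi.conj_apply, Bi.conj_apply]
  have e1 : (fun l => (if l = i then (Algebra.lsmul k k (𝔸.A ⊗[k] V) θ : 𝔸.A ⊗[k] V →ₗ[k] _)
      else LinearMap.id) (a l ⊗ₜ[k] v l)) = fun l => (if l = i then θ * a l else a l) ⊗ₜ v l := by
    funext l; split_ifs <;> rfl
  have e2 : (fun l => (if l < i then parPt 𝔸 D V else LinearMap.id) (a l ⊗ₜ[k] v l)) =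
      fun l => (if l < i then 𝔸.parD D (a l) else a l) ⊗ₜ v l := by
    funext l; split_ifs <;> rfl
  rw [e1, e2]
  simp only [LinearMap.id_apply]
  rw [extM_tmul, extM_tmul, prod_move θ (𝔸.parD D) a i fun l _ => mul_coeff hθ (𝔸.c_le _ (ha l))]
  rw [Algebra.lsmul_coe]
  beta_reduce
  rw [TensorProduct.smul_tmul', smul_eq_mul, mul_assoc]

/-- A coefficient of an open argument can be moved to the front. -/
theorem extM_moveO {p q : ℕ} (φ : Bi k V U W p q) {D : ℤ} {θ : 𝔸.A} (hθ : θ ∈ 𝔸.c D)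
    {x : Fin p → 𝔸.A ⊗[k] V} {y : Fin q → 𝔸.A ⊗[k] U} (hx : ∀ i, x i ∈ hpts 𝔸.c V)
    (hy : ∀ i, y i ∈ hpts 𝔸.o U) (i : Fin q) :
    extM 𝔸.A φ x (fun l => if l = i then θ • y l else y l) =
      θ • extM 𝔸.A φ (fun l => parPt 𝔸 D V (x l))
        (fun l => if l < i then parPt 𝔸 D U (y l) else y l) := by
  have := bi_eq_of_span
    ((extM 𝔸.A φ).conj LinearMap.id (fun _ => LinearMap.id)
      (fun l => if l = i then Algebra.lsmul k k (𝔸.A ⊗[k] U) θ else LinearMap.id))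
    ((extM 𝔸.A φ).conj (Algebra.lsmul k k (𝔸.A ⊗[k] W) θ) (fun _ => parPt 𝔸 D V)
      (fun l => if l < i then parPt 𝔸 D U else LinearMap.id))
    {z : 𝔸.A ⊗[k] V | ∃ r a v, a ∈ 𝔸.c r ∧ a ⊗ₜ[k] v = z}
    {z : 𝔸.A ⊗[k] U | ∃ r a v, a ∈ 𝔸.o r ∧ a ⊗ₜ[k] v = z} ?_ x y hx hy
  · rw [Bi.conj_apply, Bi.conj_apply] at this
    have e1 : (fun l => (if l = i then (Algebra.lsmul k k (𝔸.A ⊗[k] U) θ : 𝔸.A ⊗[k] U →ₗ[k] _)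
        else LinearMap.id) (y l)) = fun l => if l = i then θ • y l else y l := by
      funext l; split_ifs <;> rfl
    have e2 : (fun l => (if l < i then parPt 𝔸 D U else LinearMap.id) (y l)) =
        fun l => if l < i then parPt 𝔸 D U (y l) else y l := by
      funext l; split_ifs <;> rfl
    rw [e1, e2] at this
    exact this
  intro x y hx hy
  obtain ⟨r, a, v, ha, rfl⟩ := exists_hpts hx
  obtain ⟨s, b, w, hb, rfl⟩ := exists_hpts hy
  rw [Bi.conj_apply, Bi.conj_apply]
  have e1 : (fun l => (if l = i then (Algebra.lsmul k k (𝔸.A ⊗[k] U) θ : 𝔸.A ⊗[k] U →ₗ[k] _)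
      else LinearMap.id) (b l ⊗ₜ[k] w l)) = fun l => (if l = i then θ * b l else b l) ⊗ₜ w l := by
    funext l; split_ifs <;> rfl
  have e2 : (fun l => (if l < i then parPt 𝔸 D U else LinearMap.id) (b l ⊗ₜ[k] w l)) =
      fun l => (if l < i then 𝔸.parD D (b l) else b l) ⊗ₜ w l := by
    funext l; split_ifs <;> rfl
  have e3 : (fun l => parPt 𝔸 D V (a l ⊗ₜ[k] v l)) = fun l => 𝔸.parD D (a l) ⊗ₜ v l := rfl
  rw [e1, e2, e3]
  simp only [LinearMap.id_apply]
  rw [extM_tmul, extM_tmul, prod_move θ (𝔸.parD D) b i fun l _ => mul_coeff hθ (hb l),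
    ← mul_assoc, mul_coeff hθ (𝔸.c_le _ (ofFn_prod_mem_c a r ha)), map_list_prod, List.map_ofFn]
  rw [Algebra.lsmul_coe]
  beta_reduce
  rw [TensorProduct.smul_tmul', smul_eq_mul, mul_assoc]
  rfl

/-! ### Vanishing when a square zero coefficient occurs twice -/

section Zero

variable {D : ℤ} {θ : 𝔸.A} (hθ : θ ∈ 𝔸.c D) (hθθ : θ * θ = 0)
include hθ hθθ

theorem smul_extM_eq_zeroC {p q : ℕ} (φ : Bi k V U W p q)
    {x : Fin p → 𝔸.A ⊗[k] V} (y : Fin q → 𝔸.A ⊗[k] U) (hx : ∀ i, x i ∈ hpts 𝔸.c V) (i : Fin p)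
    {z : 𝔸.A ⊗[k] V} (hz : z ∈ hpts 𝔸.c V) (hxi : x i = θ • z) : θ • extM 𝔸.A φ x y = 0 := by
  have := extM_moveC φ hθ (x := Function.update x i z) y (fun l => by
    by_cases h : l = i
    · subst h; simpa using hz
    · simpa [Function.update_of_ne h] using hx l) i
  have e : (fun l => if l = i then θ • Function.update x i z l else Function.update x i z l) = x := by
    funext l
    by_cases h : l = i
    · subst h; simp [hxi]
    · simp [h]
  rw [e] at this
  rw [this, smul_smul, hθθ, zero_smul]

theorem smul_extM_eq_zeroO {p q : ℕ} (φ : Bi k V U W p q)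
    {x : Fin p → 𝔸.A ⊗[k] V} {y : Fin q → 𝔸.A ⊗[k] U} (hx : ∀ i, x i ∈ hpts 𝔸.c V)
    (hy : ∀ i, y i ∈ hpts 𝔸.o U) (i : Fin q)
    {z : 𝔸.A ⊗[k] U} (hz : z ∈ hpts 𝔸.o U) (hyi : y i = θ • z) : θ • extM 𝔸.A φ x y = 0 := by
  have := extM_moveO φ hθ (y := Function.update y i z) hx (fun l => by
    by_cases h : l = i
    · subst h; simpa using hz
    · simpa [Function.update_of_ne h] using hy l) i
  have e : (fun l => if l = i then θ • Function.update y i z l else Function.update y i z l) = y := by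
    funext l
    by_cases h : l = i
    · subst h; simp [hyi]
    · simp [h]
  rw [e] at this
  rw [this, smul_smul, hθθ, zero_smul]

omit hθθ in
theorem parPt_coeff_smul (z : 𝔸.A ⊗[k] V) : parPt 𝔸 D V (θ • z) =
    θ • ((D * D).negOnePow • parPt 𝔸 D V z) := by
  rw [parPt_smul, TestAlg.parD_o D (𝔸.c_le _ hθ)]
  rcases Int.units_eq_one_or (D * D).negOnePow with h | h
  · rw [h, one_smul, one_smul]
  · rw [h, Units.neg_smul, one_smul, Units.neg_smul, one_smul, smul_neg]
    exact neg_smul θ (parPt 𝔸 D V z)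

/-- The later `θ` is pulled to the front first. This changes the earlier argument `θ • z` to `θ`
times plus or minus a parity twist of `z`, so that it is still a multiple of `θ` and
`smul_extM_eq_zeroC` applies. -/
theorem extM_eq_zeroCC {p q : ℕ} (φ : Bi k V U W p q)
    {x : Fin p → 𝔸.A ⊗[k] V} (y : Fin q → 𝔸.A ⊗[k] U) (hx : ∀ i, x i ∈ hpts 𝔸.c V) {i j : Fin p}
    (hij : i < j) {z z' : 𝔸.A ⊗[k] V} (hz : z ∈ hpts 𝔸.c V) (hz' : z' ∈ hpts 𝔸.c V)
    (hxi : x i = θ • z) (hxj : x j = θ • z') : extM 𝔸.A φ x y = 0 := by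
  have hx' : ∀ l, Function.update x j z' l ∈ hpts 𝔸.c V := fun l => by
    by_cases h : l = j
    · subst h; simpa using hz'
    · simpa [Function.update_of_ne h] using hx l
  have := extM_moveC φ hθ (x := Function.update x j z') y hx' j
  have e : (fun l => if l = j then θ • Function.update x j z' l else Function.update x j z' l) =
      x := by
    funext l
    by_cases h : l = j
    · subst h; simp [hxj]
    · simp [h]
  rw [e] at this
  rw [this]
  refine smul_extM_eq_zeroC hθ hθθ φ y (fun l => ?_) i
    (z := (D * D).negOnePow • parPt 𝔸 D V z)
    (Submodule.smul_of_tower_mem _ _ (parPt_mem_hptsC D hz)) ?_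
  · split_ifs
    · exact parPt_mem_hptsC D (hx' l)
    · exact hx' l
  · rw [if_pos hij, Function.update_of_ne hij.ne, hxi, parPt_coeff_smul hθ]

theorem extM_eq_zeroCO {p q : ℕ} (φ : Bi k V U W p q)
    {x : Fin p → 𝔸.A ⊗[k] V} {y : Fin q → 𝔸.A ⊗[k] U} (hx : ∀ i, x i ∈ hpts 𝔸.c V)
    (hy : ∀ i, y i ∈ hpts 𝔸.o U) {i : Fin p} {j : Fin q}
    {z : 𝔸.A ⊗[k] V} {z' : 𝔸.A ⊗[k] U} (hz : z ∈ hpts 𝔸.c V) (hz' : z' ∈ hpts 𝔸.o U)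
    (hxi : x i = θ • z) (hyj : y j = θ • z') : extM 𝔸.A φ x y = 0 := by
  have hy' : ∀ l, Function.update y j z' l ∈ hpts 𝔸.o U := fun l => by
    by_cases h : l = j
    · subst h; simpa using hz'
    · simpa [Function.update_of_ne h] using hy l
  have := extM_moveO φ hθ (y := Function.update y j z') hx hy' j
  have e : (fun l => if l = j then θ • Function.update y j z' l else Function.update y j z' l) =
      y := by
    funext l
    by_cases h : l = j
    · subst h; simp [hyj]
    · simp [h]
  rw [e] at this
  rw [this]
  refine smul_extM_eq_zeroC hθ hθθ φ _ (fun l => parPt_mem_hptsC D (hx l)) i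
    (z := (D * D).negOnePow • parPt 𝔸 D V z)
    (Submodule.smul_of_tower_mem _ _ (parPt_mem_hptsC D hz)) ?_
  rw [hxi, parPt_coeff_smul hθ]

theorem extM_eq_zeroOO {p q : ℕ} (φ : Bi k V U W p q)
    {x : Fin p → 𝔸.A ⊗[k] V} {y : Fin q → 𝔸.A ⊗[k] U} (hx : ∀ i, x i ∈ hpts 𝔸.c V)
    (hy : ∀ i, y i ∈ hpts 𝔸.o U) {i j : Fin q} (hij : i < j)
    {z z' : 𝔸.A ⊗[k] U} (hz : z ∈ hpts 𝔸.o U) (hz' : z' ∈ hpts 𝔸.o U)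
    (hyi : y i = θ • z) (hyj : y j = θ • z') : extM 𝔸.A φ x y = 0 := by
  have hy' : ∀ l, Function.update y j z' l ∈ hpts 𝔸.o U := fun l => by
    by_cases h : l = j
    · subst h; simpa using hz'
    · simpa [Function.update_of_ne h] using hy l
  have := extM_moveO φ hθ (y := Function.update y j z') hx hy' j
  have e : (fun l => if l = j then θ • Function.update y j z' l else Function.update y j z' l) =
      y := by
    funext l
    by_cases h : l = j
    · subst h; simp [hyj]
    · simp [h]
  rw [e] at this
  rw [this]
  refine smul_extM_eq_zeroO hθ hθθ φ (fun l => parPt_mem_hptsC D (hx l)) (fun l => ?_) i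
    (z := (D * D).negOnePow • parPt 𝔸 D U z)
    (Submodule.smul_of_tower_mem _ _ (parPt_mem_hptsO D hz)) ?_
  · split_ifs
    · exact parPt_mem_hptsO D (hy' l)
    · exact hy' l
  · rw [if_pos hij, Function.update_of_ne hij.ne, hyi, parPt_coeff_smul hθ]

end Zero

theorem smul_mem_hptsC {D : ℤ} {θ : 𝔸.A} (hθ : θ ∈ 𝔸.c D) {z : 𝔸.A ⊗[k] V}
    (hz : z ∈ hpts 𝔸.c V) : θ • z ∈ hpts 𝔸.c V := by
  induction hz using Submodule.span_induction with
  | mem z hz =>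
    obtain ⟨r, a, v, h1, rfl⟩ := hz
    exact Submodule.subset_span ⟨_, _, v, 𝔸.mul_c hθ h1, by rw [TensorProduct.smul_tmul']; rfl⟩
  | zero => rw [smul_zero]; exact zero_mem _
  | add x y _ _ hx hy => rw [smul_add]; exact add_mem hx hy
  | smul r x _ hx => rw [smul_comm]; exact Submodule.smul_mem _ _ hx

theorem smul_mem_hptsO {D : ℤ} {θ : 𝔸.A} (hθ : θ ∈ 𝔸.c D) {z : 𝔸.A ⊗[k] V}
    (hz : z ∈ hpts 𝔸.o V) : θ • z ∈ hpts 𝔸.o V := by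
  induction hz using Submodule.span_induction with
  | mem z hz =>
    obtain ⟨r, a, v, h1, rfl⟩ := hz
    exact Submodule.subset_span ⟨_, _, v, 𝔸.mul_o (𝔸.c_le _ hθ) h1,
      by rw [TensorProduct.smul_tmul']; rfl⟩
  | zero => rw [smul_zero]; exact zero_mem _
  | add x y _ _ hx hy => rw [smul_add]; exact add_mem hx hy
  | smul r x _ hx => rw [smul_comm]; exact Submodule.smul_mem _ _ hx

theorem piecewise_mem {M : Type*} [AddCommGroup M] [Module k M] {n : ℕ} (S : Submodule k M)
    (s : Finset (Fin n)) {a b : M} (ha : a ∈ S)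
    (hb : b ∈ S) (i : Fin n) : s.piecewise (fun _ => a) (fun _ => b) i ∈ S := by
  by_cases h : i ∈ s <;> simp [h, ha, hb]

/-- The multilinear map obtained by fixing the open arguments. -/
def Bi.fixOpen {p q : ℕ} (F : Bi k V U W p q) (y : Fin q → U) :
    MultilinearMap k (fun _ : Fin p => V) W :=
  LinearMap.compMultilinearMap
    (⟨⟨fun φ => φ y, fun _ _ => rfl⟩, fun _ _ => rfl⟩ :
      MultilinearMap k (fun _ : Fin q => U) W →ₗ[k] W) F

theorem Bi.fixOpen_apply {p q : ℕ} (F : Bi k V U W p q) (x : Fin p → V) (y : Fin q → U) :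
    F.fixOpen y x = F x y := rfl

/-- Expansion of a bi-multilinear map along a square zero coefficient. -/
theorem extM_expand {p q : ℕ} (φ : Bi k V U W p q) {D : ℤ} {θ : 𝔸.A} (hθ : θ ∈ 𝔸.c D)
    (hθθ : θ * θ = 0) {x z : 𝔸.A ⊗[k] V} {y t : 𝔸.A ⊗[k] U} (hx : x ∈ hpts 𝔸.c V)
    (hz : z ∈ hpts 𝔸.c V) (hy : y ∈ hpts 𝔸.o U) (ht : t ∈ hpts 𝔸.o U) :
    extM 𝔸.A φ (fun _ => x + θ • z) (fun _ => y + θ • t) =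
      extM 𝔸.A φ (fun _ => x) (fun _ => y) +
      (∑ i, extM 𝔸.A φ (Function.update (fun _ => x) i (θ • z)) (fun _ => y)) +
      ∑ i, extM 𝔸.A φ (fun _ => x) (Function.update (fun _ => y) i (θ • t)) := by
  have hθz := smul_mem_hptsC hθ hz
  have hθt := smul_mem_hptsO hθ ht
  have two : ∀ {n : ℕ} {s : Finset (Fin n)}, 2 ≤ s.card → ∃ i j, i < j ∧ i ∈ s ∧ j ∈ s := by
    intro n s hs
    obtain ⟨i, hi, j, hj, hij⟩ := Finset.one_lt_card.1 hs
    rcases lt_or_gt_of_ne hij with h | h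
    · exact ⟨i, j, h, hi, hj⟩
    · exact ⟨j, i, h, hj, hi⟩
  have hupd : ∀ i l, Function.update (fun _ : Fin p => x) i (θ • z) l ∈ hpts 𝔸.c V := by
    intro i l
    by_cases h : l = i
    · subst h; simpa using hθz
    · simpa [Function.update_of_ne h] using hx
  have e1 : (fun _ : Fin p => x + θ • z) = (fun _ => x) + fun _ => θ • z := rfl
  have e2 : (fun _ : Fin q => y + θ • t) = (fun _ => y) + fun _ => θ • t := rfl
  -- Terms with two or more slots `θ • t` vanish; the constant and the linear term remain.
  have E1 : extM 𝔸.A φ (fun _ => x) (fun _ => y + θ • t) = extM 𝔸.A φ (fun _ => x) (fun _ => y) +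
      ∑ i, extM 𝔸.A φ (fun _ => x) (Function.update (fun _ => y) i (θ • t)) := by
    rw [e2, MultilinearMap.map_add_eq_map_add_linearDeriv_add, MultilinearMap.linearDeriv_apply,
      add_eq_left]
    refine Finset.sum_eq_zero fun s hs => ?_
    obtain ⟨i, j, hij, hi, hj⟩ := two (Finset.mem_filter.1 hs).2
    exact extM_eq_zeroOO hθ hθθ φ (fun _ => hx)
      (piecewise_mem (hpts 𝔸.o U) s hθt hy) hij ht ht
      (by simp [hi]) (by simp [hj])
  -- Here a closed argument already carries `θ`, so no open slot may carry it as well.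
  have E2 : ∀ i, extM 𝔸.A φ (Function.update (fun _ => x) i (θ • z)) (fun _ => y + θ • t) =
      extM 𝔸.A φ (Function.update (fun _ => x) i (θ • z)) (fun _ => y) := by
    intro i
    have : (fun _ : Fin q => y + θ • t) = (fun _ => θ • t) + fun _ => y := by
      funext l; exact add_comm _ _
    rw [this, MultilinearMap.map_add_univ, Finset.sum_eq_single ∅]
    · simp
    · intro s _ hs
      obtain ⟨j, hj⟩ := Finset.nonempty_iff_ne_empty.2 hs
      exact extM_eq_zeroCO hθ hθθ φ (hupd i) (piecewise_mem (hpts 𝔸.o U) s hθt hy)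
        (i := i) (j := j) hz ht (by simp) (by simp [hj])
    · simp
  rw [← Bi.fixOpen_apply, e1, MultilinearMap.map_add_eq_map_add_linearDeriv_add,
    MultilinearMap.linearDeriv_apply]
  simp only [Bi.fixOpen_apply, E1, E2]
  rw [add_right_comm _ (∑ i, extM 𝔸.A φ (fun _ => x) _), add_eq_left]
  refine Finset.sum_eq_zero fun s hs => ?_
  obtain ⟨i, j, hij, hi, hj⟩ := two (Finset.mem_filter.1 hs).2
  exact extM_eq_zeroCC hθ hθθ φ _ (piecewise_mem (hpts 𝔸.c V) s hθz hx) hij hz hz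
    (by simp [hi]) (by simp [hj])

end Move

/-! ## Evaluation of families on points -/

theorem sum_range_extend {M : Type*} [AddCommMonoid M] {N B : ℕ} (h : N ≤ B) (f : ℕ → M)
    (hf : ∀ p, N ≤ p → f p = 0) : ∑ p ∈ Finset.range N, f p = ∑ p ∈ Finset.range B, f p :=
  Finset.sum_subset (Finset.range_mono h) fun p _ hp => hf p (by simpa using hp)

/-- A marked position `i` among `q` open arguments leaves `i` on the left and `j` on the right, `q =
i + 1 + j`. The vanishing for `N ≤ q` allows `i` and `j` to run independently. -/
theorem sum_range_triangle {M : Type*} [AddCommMonoid M] (N : ℕ) (H : ℕ → ℕ → M)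
    (hH : ∀ q i, N ≤ q → H q i = 0) :
    ∑ q ∈ Finset.range N, ∑ i ∈ Finset.range q, H q i =
      ∑ i ∈ Finset.range N, ∑ j ∈ Finset.range N, H (i + 1 + j) i := by
  have : ∀ i ∈ Finset.range N, ∑ j ∈ Finset.range N, H (i + 1 + j) i =
      ∑ q ∈ Finset.Ico (i + 1) N, H q i := by
    intro i hi
    rw [Finset.sum_Ico_eq_sum_range]
    exact (sum_range_extend (Nat.sub_le _ _) _ fun p hp => hH _ _ (by omega)).symm
  rw [Finset.sum_congr rfl this]
  apply Finset.sum_comm'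
  intro q i
  simp only [Finset.mem_range, Finset.mem_Ico]
  omega

theorem sum_reorder {M : Type*} [AddCommMonoid M] (s t : Finset ℕ) (G : ℕ → ℕ → ℕ → ℕ → M) :
    ∑ n ∈ s, ∑ m ∈ s, ∑ i ∈ t, ∑ j ∈ t, G n m i j =
      ∑ i ∈ t, ∑ j ∈ t, ∑ n ∈ s, ∑ m ∈ s, G n m i j := by
  have h1 : ∀ n, ∑ m ∈ s, ∑ i ∈ t, ∑ j ∈ t, G n m i j =
      ∑ i ∈ t, ∑ j ∈ t, ∑ m ∈ s, G n m i j := by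
    intro n
    rw [Finset.sum_comm]
    exact Finset.sum_congr rfl fun i _ => Finset.sum_comm
  rw [Finset.sum_congr rfl fun n _ => h1 n, Finset.sum_comm]
  exact Finset.sum_congr rfl fun i _ => Finset.sum_comm

section Ev

variable {k : Type u} [Field k] (𝔸 : TestAlg k) {V U W V' U' : GradedSpace k}

/-- The value of a closed family on a point. -/
def evC (f : ClosedMaps k V W) (x : 𝔸.A ⊗[k] V) : 𝔸.A ⊗[k] W :=
  ∑ p ∈ Finset.range 𝔸.N, ((p.factorial : k)⁻¹) • extC 𝔸 f p fun _ => x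

/-- The value of a mixed family on a point. -/
def evF (g : MixedMaps k V U W) (x : 𝔸.A ⊗[k] V) (y : 𝔸.A ⊗[k] U) : 𝔸.A ⊗[k] W :=
  ∑ p ∈ Finset.range 𝔸.N, ∑ q ∈ Finset.range 𝔸.N,
    ((p.factorial : k)⁻¹) • extF 𝔸 g p q (fun _ => x) fun _ => y

variable {𝔸} {x : 𝔸.A ⊗[k] V} {y : 𝔸.A ⊗[k] U} (hx : x ∈ cPts 𝔸 V 0) (hy : y ∈ oPts 𝔸 U 0)

include hx in
theorem extC_of_le (f : ClosedMaps k V W) {p : ℕ} (hp : 𝔸.N ≤ p) : extC 𝔸 f p (fun _ => x) = 0 := by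
  rw [← extF_toMixed (U := V) f _ Fin.elim0]
  exact extM_eq_zero_of_le (by simpa using hp) _ (fun _ => hx) fun i => i.elim0

include hx hy in
theorem extF_of_le (g : MixedMaps k V U W) {p q : ℕ} (hp : 𝔸.N ≤ p + q) :
    extF 𝔸 g p q (fun _ => x) (fun _ => y) = 0 :=
  extM_eq_zero_of_le hp _ (fun _ => hx) fun _ => hy

include hx in
-- The truncation bound may be enlarged at will, since terms with `𝔸.N` or more arguments vanish.
-- Later reindexings need room beyond `𝔸.N`.
theorem evC_eq (f : ClosedMaps k V W) {B : ℕ} (hB : 𝔸.N ≤ B) : evC 𝔸 f x =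
    ∑ p ∈ Finset.range B, ((p.factorial : k)⁻¹) • extC 𝔸 f p fun _ => x :=
  sum_range_extend hB _ fun p hp => by rw [extC_of_le hx f hp, smul_zero]

include hx hy in
theorem evF_eq (g : MixedMaps k V U W) {B B' : ℕ} (hB : 𝔸.N ≤ B) (hB' : 𝔸.N ≤ B') : evF 𝔸 g x y =
    ∑ p ∈ Finset.range B, ∑ q ∈ Finset.range B',
      ((p.factorial : k)⁻¹) • extF 𝔸 g p q (fun _ => x) fun _ => y := by
  unfold evF
  rw [sum_range_extend hB]
  · refine Finset.sum_congr rfl fun p _ => sum_range_extend hB' _ fun q hq => ?_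
    rw [extF_of_le hx hy g (by omega), smul_zero]
  · intro p hp
    refine Finset.sum_eq_zero fun q _ => ?_
    rw [extF_of_le hx hy g (by omega), smul_zero]

theorem evF_toMixed (f : ClosedMaps k V W) (x : 𝔸.A ⊗[k] V) (y : 𝔸.A ⊗[k] U) :
    evF 𝔸 (f.toMixed U) x y = evC 𝔸 f x := by
  unfold evF evC
  refine Finset.sum_congr rfl fun p hp => ?_
  rw [Finset.sum_eq_single 0, extF_toMixed]
  · intro q _ hq
    obtain ⟨q, rfl⟩ := Nat.exists_eq_succ_of_ne_zero hq
    have : extF 𝔸 (f.toMixed U) p (q + 1) = 0 := extM_zero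
    rw [this]; simp
  · intro h
    have := Finset.mem_range.1 hp
    exact absurd (Finset.mem_range.2 (by omega)) h

include hx in
theorem evC_mem {f : ClosedMaps k V W} {s : ℤ} (hf : f.HasDegree s) (h0 : f 0 = 0) :
    evC 𝔸 f x ∈ cPts 𝔸 W s :=
  sum_mem fun _ _ => Submodule.smul_mem _ _ (extC_mem hf h0 fun _ => hx)

include hx hy in
theorem evF_mem {g : MixedMaps k V U W} {s : ℤ} (hg : g.HasDegree s) (h0 : g 0 0 = 0) :
    evF 𝔸 g x y ∈ oPts 𝔸 W s :=
  sum_mem fun _ _ => sum_mem fun _ _ =>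
    Submodule.smul_mem _ _ (extF_mem hg h0 (fun _ => hx) fun _ => hy)

theorem compTerm_const {n m i j : ℕ} (b : Fin n → Fin (i + j)) (h : Fin m → Fin j)
    (F : Bi k (𝔸.A ⊗[k] V') (𝔸.A ⊗[k] U') (𝔸.A ⊗[k] W) i j) (f : ClosedMaps k V V')
    (g : MixedMaps k V U U') (x : 𝔸.A ⊗[k] V) (y : 𝔸.A ⊗[k] U) :
    compTerm b h F (extC 𝔸 f) (extF 𝔸 g) (fun _ => x) (fun _ => y) =
      F (fun a => extC 𝔸 f (size b (Fin.castAdd j a)) fun _ => x)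
        (fun a => extF 𝔸 g (size b (Fin.natAdd i a)) (size h a) (fun _ => x) fun _ => y) := rfl

/-- Pigeonhole: fewer letters than blocks leave an empty block. As the inner maps have no component
of arity zero, such terms of a composition vanish. -/
theorem exists_size_eq_zero {n j : ℕ} (b : Fin n → Fin j) {i : ℕ} (e : Fin i → Fin j)
    (he : Function.Injective e) (h : n < i) : ∃ a, size b (e a) = 0 := by
  by_contra! h'
  have h1 : i ≤ ∑ a, size b (e a) := by
    calc i = ∑ _a : Fin i, 1 := by simp
      _ ≤ _ := Finset.sum_le_sum fun a _ => Nat.one_le_iff_ne_zero.2 (h' a)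
  have h2 : ∑ a, size b (e a) ≤ ∑ a, size b a := by
    have := Finset.sum_map Finset.univ ⟨e, he⟩ (size b)
    rw [Function.Embedding.coeFn_mk] at this
    rw [← this]
    exact Finset.sum_le_sum_of_subset (Finset.subset_univ _)
  rw [sum_size] at h2
  omega

theorem exists_sizes_eq_zero {n m i j : ℕ} (b : Fin n → Fin (i + j)) (h : Fin m → Fin j)
    (hj : n + m < j) : ∃ a, size b (Fin.natAdd i a) = 0 ∧ size h a = 0 := by
  by_contra! h'
  have h1 : j ≤ ∑ a : Fin j, (size b (Fin.natAdd i a) + size h a) := by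
    calc j = ∑ _a : Fin j, 1 := by simp
      _ ≤ _ := Finset.sum_le_sum fun a _ => by
        by_cases h0 : size b (Fin.natAdd i a) = 0
        · have := h' a h0; omega
        · omega
  have h2 : ∑ a : Fin j, size b (Fin.natAdd i a) ≤ ∑ a, size b a := by
    rw [Fin.sum_univ_add]; omega
  rw [Finset.sum_add_distrib, sum_size] at h1
  rw [sum_size] at h2
  omega

theorem extC_zero {f : ClosedMaps k V W} (h0 : f 0 = 0) {p : ℕ} (hp : p = 0)
    (x : Fin p → 𝔸.A ⊗[k] V) : extC 𝔸 f p x = 0 := by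
  subst hp; unfold extC; rw [h0, map_zero]; rfl

theorem extF_zero {g : MixedMaps k V U W} (h0 : g 0 0 = 0) {p q : ℕ} (hp : p = 0) (hq : q = 0)
    (x : Fin p → 𝔸.A ⊗[k] V) (y : Fin q → 𝔸.A ⊗[k] U) : extF 𝔸 g p q x y = 0 := by
  subst hp hq; unfold extF; rw [h0, extM_zero]; rfl

theorem sum_piFinset_append {M : Type*} [AddCommMonoid M] {i j : ℕ} (s : Finset ℕ)
    (Φ : (Fin (i + j) → ℕ) → M) :
    ∑ κ ∈ Fintype.piFinset (fun _ : Fin (i + j) => s), Φ κ =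
      ∑ κ ∈ Fintype.piFinset (fun _ : Fin i => s), ∑ κ' ∈ Fintype.piFinset (fun _ : Fin j => s),
        Φ (Fin.append κ κ') := by
  rw [← Finset.sum_product']
  refine (Finset.sum_nbij' (fun z => Fin.append z.1 z.2)
    (fun κ => (fun a => κ (Fin.castAdd j a), fun a => κ (Fin.natAdd i a))) ?_ ?_ ?_ ?_ ?_).symm
  · rintro ⟨κ, κ'⟩ h
    rw [Finset.mem_product, Fintype.mem_piFinset, Fintype.mem_piFinset] at h
    rw [Fintype.mem_piFinset]
    intro a
    refine Fin.addCases (fun a => ?_) (fun a => ?_) a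
    · rw [Fin.append_left]; exact h.1 a
    · rw [Fin.append_right]; exact h.2 a
  · intro κ h
    rw [Fintype.mem_piFinset] at h
    rw [Finset.mem_product, Fintype.mem_piFinset, Fintype.mem_piFinset]
    exact ⟨fun a => h _, fun a => h _⟩
  · rintro ⟨κ, κ'⟩ _
    simp
  · intro κ _
    exact Fin.append_castAdd_natAdd
  · intros; rfl

theorem sum_piFinset_two {M : Type*} [AddCommMonoid M] (s : Finset ℕ) (Φ : (Fin 2 → ℕ) → M) :
    ∑ κ ∈ Fintype.piFinset (fun _ : Fin 2 => s), Φ κ = ∑ p ∈ s, ∑ q ∈ s, Φ ![p, q] := by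
  rw [← Finset.sum_product']
  refine (Finset.sum_nbij' (fun z => ![z.1, z.2]) (fun κ => (κ 0, κ 1)) ?_ ?_ ?_ ?_ ?_).symm
  · rintro ⟨p, q⟩ h
    simpa [Fintype.mem_piFinset, Fin.forall_fin_two] using h
  · intro κ h
    simpa [Fintype.mem_piFinset, Fin.forall_fin_two] using h
  · intros; rfl
  · intro κ _
    funext a
    fin_cases a <;> rfl
  · intros; rfl

theorem sum_piFinset_three {M : Type*} [AddCommMonoid M] (s : Finset ℕ) (Φ : (Fin 3 → ℕ) → M) :
    ∑ κ ∈ Fintype.piFinset (fun _ : Fin 3 => s), Φ κ =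
      ∑ p ∈ s, ∑ q ∈ s, ∑ r ∈ s, Φ ![p, q, r] := by
  have : ∑ p ∈ s, ∑ q ∈ s, ∑ r ∈ s, Φ ![p, q, r] =
      ∑ z ∈ s ×ˢ s ×ˢ s, Φ ![z.1, z.2.1, z.2.2] := by
    rw [Finset.sum_product]
    exact Finset.sum_congr rfl fun p _ => by rw [Finset.sum_product]
  rw [this]
  refine (Finset.sum_nbij' (fun z => ![z.1, z.2.1, z.2.2]) (fun κ => (κ 0, κ 1, κ 2))
    ?_ ?_ ?_ ?_ ?_).symm
  · rintro ⟨p, q, r⟩ h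
    simpa [Fintype.mem_piFinset, Fin.forall_fin_succ] using h
  · intro κ h
    simpa [Fintype.mem_piFinset, Fin.forall_fin_succ] using h
  · intros; rfl
  · intro κ _
    funext a
    fin_cases a <;> rfl
  · intros; rfl

variable [CharZero k]

include hx hy in
/-- Evaluation turns composition of families into composition of functions. -/
theorem evF_composeF (ν : MixedMaps k V' U' W) {f : ClosedMaps k V V'} {g : MixedMaps k V U U'}
    (hf : f.HasDegree 0) (hf0 : f 0 = 0) (hg : g.HasDegree 0) (hg0 : g 0 0 = 0) :
    evF 𝔸 (composeF ν f g) x y = evF 𝔸 ν (evC 𝔸 f x) (evF 𝔸 g x y) := by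
  set N := 𝔸.N with hN
  -- Fewer than `N + N` blocks, each of size less than `N`, contain fewer than `B` letters, so `B`
  -- bounds every total that can contribute.
  set B := (N + N) * N + N + 1 with hBdef
  have hNB : N ≤ B := by omega
  have hBij : ∀ {i j : ℕ}, i < N → j < N → (i + j) * N < B := by
    intro i j hi hj
    have : (i + j) * N ≤ (N + N) * N := Nat.mul_le_mul_right _ (by omega)
    omega
  have hBj : ∀ {j : ℕ}, j < N → j * N < B := by
    intro j hj
    have := hBij (i := 0) (by omega) hj
    simpa using this
  set T : ∀ (n m i j : ℕ), (Fin n → Fin (i + j)) → (Fin m → Fin j) → 𝔸.A ⊗[k] W :=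
    fun n m i j b h => extM 𝔸.A (ν i j) (fun a => extC 𝔸 f (size b (Fin.castAdd j a)) fun _ => x)
        (fun a => extF 𝔸 g (size b (Fin.natAdd i a)) (size h a) (fun _ => x) fun _ => y) with hT
  have hTn : ∀ n m i j b h, n < i → T n m i j b h = 0 := by
    intro n m i j b h hi
    obtain ⟨a, ha⟩ := exists_size_eq_zero b (Fin.castAdd j) (Fin.castAdd_injective i j) hi
    simp only [hT]
    rw [MultilinearMap.map_coord_zero _ a]
    · rfl
    · exact extC_zero hf0 ha _
  have hTm : ∀ n m i j b h, n + m < j → T n m i j b h = 0 := by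
    intro n m i j b h hi
    obtain ⟨a, ha, ha'⟩ := exists_sizes_eq_zero b h hi
    simp only [hT]
    rw [MultilinearMap.map_coord_zero _ a]
    exact extF_zero hg0 ha ha' _ _
  have hTN : ∀ n m i j b h, N ≤ i + j → T n m i j b h = 0 := fun n m i j b h hij =>
    extM_eq_zero_of_le hij _ (fun a => extC_mem hf hf0 fun _ => hx)
      fun a => extF_mem hg hg0 (fun _ => hx) fun _ => hy
  -- The ranges of `i` and `j` in a composition depend on `n` and `m`. Both they and the fixed range
  -- `N` may be extended to a common one, because the additional terms vanish by pigeonhole or by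
  -- nilpotence.
  have step1 : ∀ n m, extF 𝔸 (composeF ν f g) n m (fun _ => x) (fun _ => y) =
      ∑ i ∈ Finset.range N, ∑ j ∈ Finset.range N, ((i.factorial : k)⁻¹) •
        ∑ b : Fin n → Fin (i + j), ∑ h ∈ segments m j, T n m i j b h := by
    intro n m
    unfold extF
    rw [extM_composeF ν f g (fun _ => hx) (fun _ => hy)]
    simp only [compTerm_const]
    set S : ℕ → ℕ → 𝔸.A ⊗[k] W := fun i j => ((i.factorial : k)⁻¹) •
      ∑ b : Fin n → Fin (i + j), ∑ h ∈ segments m j, T n m i j b h with hS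
    have hSz : ∀ i j, (n < i ∨ n + m < j ∨ N ≤ i + j) → S i j = 0 := by
      intro i j h
      simp only [hS]
      rw [Finset.sum_eq_zero, smul_zero]
      intro b _
      refine Finset.sum_eq_zero fun h' _ => ?_
      rcases h with h | h | h
      · exact hTn _ _ _ _ _ _ h
      · exact hTm _ _ _ _ _ _ h
      · exact hTN _ _ _ _ _ _ h
    have : ∀ i j, (∑ b : Fin n → Fin (i + j), ∑ h ∈ segments m j,
        ((i.factorial : k)⁻¹) • T n m i j b h) = S i j := by
      intro i j
      simp only [hS, Finset.smul_sum]
    refine (Finset.sum_congr rfl fun i _ => Finset.sum_congr rfl fun j _ => this i j).trans ?_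
    change _ = ∑ i ∈ Finset.range N, ∑ j ∈ Finset.range N, S i j
    rw [sum_range_extend (show n + 1 ≤ n + m + 1 + N by omega), sum_range_extend
      (show N ≤ n + m + 1 + N by omega) fun i => ∑ j ∈ Finset.range N, S i j]
    · refine Finset.sum_congr rfl fun i _ => ?_
      rw [sum_range_extend (show n + m + 1 ≤ n + m + 1 + N by omega), sum_range_extend
        (show N ≤ n + m + 1 + N by omega)]
      · exact fun j hj => hSz i j (by omega)
      · exact fun j hj => hSz i j (by omega)
    · exact fun i hi => Finset.sum_eq_zero fun j _ => hSz i j (by omega)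
    · exact fun i hi => Finset.sum_eq_zero fun j _ => hSz i j (by omega)
  rw [evF_eq hx hy _ hNB hNB]
  simp only [step1]
  simp only [Finset.smul_sum (s := Finset.range N)]
  rw [sum_reorder]
  unfold evF
  refine Finset.sum_congr rfl fun i hi => Finset.sum_congr rfl fun j hj => ?_
  have hi := Finset.mem_range.1 hi
  have hj := Finset.mem_range.1 hj
  set Φ : (Fin (i + j) → ℕ) → (Fin j → ℕ) → 𝔸.A ⊗[k] W := fun κ κ' =>
    extM 𝔸.A (ν i j) (fun a => extC 𝔸 f (κ (Fin.castAdd j a)) fun _ => x)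
        (fun a => extF 𝔸 g (κ (Fin.natAdd i a)) (κ' a) (fun _ => x) fun _ => y) with hΦ
  have hΦ' : ∀ κ κ' a, N ≤ κ' a → Φ κ κ' = 0 := by
    intro κ κ' a ha
    simp only [hΦ]
    rw [MultilinearMap.map_coord_zero _ a]
    exact extF_of_le hx hy g (by omega)
  have hΦ'' : ∀ κ a κ', N ≤ κ a → Φ κ κ' = 0 := by
    intro κ a κ'
    refine Fin.addCases (fun a ha => ?_) (fun a ha => ?_) a
    · simp only [hΦ]
      rw [MultilinearMap.map_coord_zero _ a]
      · rfl
      · exact extC_of_le hx f ha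
    · simp only [hΦ]
      rw [MultilinearMap.map_coord_zero _ a]
      exact extF_of_le hx hy g (by omega)
  -- With `i`, `j` and the closed blocks fixed, the sum over all segmentations becomes a free sum
  -- over the segment sizes. `sum_blocks` then does the same for the closed blocks and turns `1 /
  -- n!` into the product of the inverse factorials of the block sizes.
  have step2 : ∑ n ∈ Finset.range B, ∑ m ∈ Finset.range B, ((n.factorial : k)⁻¹) •
      ((i.factorial : k)⁻¹) • ∑ b : Fin n → Fin (i + j), ∑ h ∈ segments m j, T n m i j b h =
      ((i.factorial : k)⁻¹) • ∑ n ∈ Finset.range B, ((n.factorial : k)⁻¹) •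
        ∑ b : Fin n → Fin (i + j), ∑ κ' ∈ Fintype.piFinset (fun _ : Fin j => Finset.range N),
          Φ (size b) κ' := by
    rw [Finset.smul_sum]
    refine Finset.sum_congr rfl fun n _ => ?_
    rw [smul_comm, ← Finset.smul_sum, ← Finset.smul_sum, Finset.sum_comm]
    refine congrArg _ (congrArg _ (Finset.sum_congr rfl fun b _ => ?_))
    exact sum_range_segments N B (hBj hj) (Φ (size b)) (hΦ' _)
  rw [step2, sum_blocks N B (hBij hi hj) (fun κ => ∑ κ' ∈ Fintype.piFinset
    (fun _ : Fin j => Finset.range N), Φ κ κ') fun κ a ha =>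
      Finset.sum_eq_zero fun κ' _ => hΦ'' κ a κ' ha, sum_piFinset_append]
  congr 1
  unfold extF evC
  -- The other side is expanded multilinearly: inserting the series for `f` and `g` into `i + j`
  -- slots gives a sum over the same sizes with the same factorials.
  rw [← Bi.fixOpen_apply, MultilinearMap.map_sum_finset]
  refine Finset.sum_congr rfl fun κ _ => ?_
  rw [MultilinearMap.map_smul_univ, Bi.fixOpen_apply, MultilinearMap.map_sum_finset,
    Finset.smul_sum]
  refine Finset.sum_congr rfl fun κ₁ _ => ?_
  simp only [← Finset.smul_sum]
  rw [MultilinearMap.map_smul_univ, MultilinearMap.map_sum_finset, smul_smul, Fin.prod_univ_add]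
  simp only [Fin.append_left, Fin.append_right]
  refine congrArg _ (Finset.sum_congr rfl fun κ' _ => ?_)
  have e1 : ∀ a, extC 𝔸 f (Fin.append κ κ₁ (Fin.castAdd j a)) (fun _ => x) =
      extC 𝔸 f (κ a) fun _ => x := fun a => by rw [Fin.append_left]
  have e2 : ∀ a q, extF 𝔸 g (Fin.append κ κ₁ (Fin.natAdd i a)) q (fun _ => x) (fun _ => y) =
      extF 𝔸 g (κ₁ a) q (fun _ => x) fun _ => y := fun a q => by rw [Fin.append_right]
  simp only [hΦ, e1, e2]
  rfl

include hx in
theorem evC_composeC (ν : ClosedMaps k V' W) {f : ClosedMaps k V V'}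
    (hf : f.HasDegree 0) (hf0 : f 0 = 0) :
    evC 𝔸 (composeC ν f) x = evC 𝔸 ν (evC 𝔸 f x) := by
  have := evF_composeF hx (zero_mem (oPts 𝔸 V 0)) (ν.toMixed V') hf hf0
    (g := (0 : MixedMaps k V V V')) (fun _ _ _ _ _ _ _ _ => zero_mem _) rfl
  rwa [composeF_toMixed, evF_toMixed, evF_toMixed] at this

/-! ### Insertion -/

omit [CharZero k] in
include hx hy in
-- By symmetry a special closed argument may be put first, whatever its position. The `p + 1` equal
-- terms obtained in this way turn `1 / (p + 1)!` into `1 / p!`.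
theorem extM_update_eq_cons {p q : ℕ} {φ : Bi k V U W (p + 1) q} (hφ : BiSymmetric φ)
    {z : 𝔸.A ⊗[k] V} (hz : z ∈ cPts 𝔸 V 0) (i : Fin (p + 1)) :
    extM 𝔸.A φ (Function.update (fun _ => x) i z) (fun _ => y) =
      extM 𝔸.A φ (Fin.cons z fun _ => x) fun _ => y := by
  have h : ∀ l, (Fin.cons z (fun _ => x) : Fin (p + 1) → 𝔸.A ⊗[k] V) l ∈ cPts 𝔸 V 0 := fun l => by
    refine Fin.cases ?_ (fun l => ?_) l
    · exact hz
    · exact hx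
  rw [← extM_symm hφ h (fun _ => hy) (Equiv.swap 0 i)]
  congr 2
  funext l
  by_cases hl : l = i
  · subst hl; simp
  · rw [Function.update_of_ne hl, Function.comp_apply]
    by_cases h0 : l = 0
    · subst h0
      rw [Equiv.swap_apply_left]
      obtain ⟨i, rfl⟩ := Fin.exists_succ_eq.2 (Ne.symm hl)
      rfl
    · rw [Equiv.swap_apply_of_ne_of_ne h0 hl]
      obtain ⟨l, rfl⟩ := Fin.exists_succ_eq.2 h0
      rfl

omit [CharZero k] in
theorem append_const_eq_update {α : Type*} (i j : ℕ) (a b : α) :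
    Fin.append (Fin.append (fun _ : Fin i => a) (fun _ : Fin 1 => b)) (fun _ : Fin j => a) =
      Function.update (fun _ => a) ⟨i, by omega⟩ b := by
  funext l
  refine Fin.addCases (fun l => ?_) (fun l => ?_) l
  · rw [Fin.append_left]
    refine Fin.addCases (fun l => ?_) (fun l => ?_) l
    · rw [Fin.append_left, Function.update_of_ne]
      intro h
      have := congrArg Fin.val h
      simp at this
      omega
    · rw [Fin.append_right]
      have : Fin.castAdd j (Fin.natAdd i l) = ⟨i, by omega⟩ := by
        apply Fin.ext; simp
      rw [this, Function.update_self]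
  · rw [Fin.append_right, Function.update_of_ne]
    intro h
    have := congrArg Fin.val h
    simp at this
    omega

include hx hy in
/-- Insertion of families is the first order variation of evaluation. -/
theorem evF_insertF {D : ℤ} (hD : Odd D) {f : MixedMaps k V U W} (hf : f.IsSymmetric) {l : ClosedMaps k V V}
    (hl : l.HasDegree D) (hl0 : l 0 = 0) {ν : MixedMaps k V U U} (hν : ν.HasDegree D)
    (hν0 : ν 0 0 = 0) {θ : 𝔸.A} (hθ : θ ∈ 𝔸.c D) (hθθ : θ * θ = 0) :
    evF 𝔸 f (x + θ • evC 𝔸 l x) (y + θ • evF 𝔸 ν x y) =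
      evF 𝔸 f x y + θ • evF 𝔸 (insertF f l ν) x y := by
  set N := 𝔸.N with hN
  set B := 3 * N + N + 2 with hB
  have hNB : N ≤ B := by omega
  set z := evC 𝔸 l x with hz
  set t := evF 𝔸 ν x y with ht
  have hzm : z ∈ cPts 𝔸 V D := evC_mem hx hl hl0
  have htm : t ∈ oPts 𝔸 U D := evF_mem hx hy hν hν0
  have hθz : θ • z ∈ cPts 𝔸 V 0 := smul_mem_cPts hθ (sub_self D).symm hzm
  have hθt : θ • t ∈ oPts 𝔸 U 0 := smul_mem_oPts hθ (sub_self D).symm htm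
  -- the first order term in the closed arguments
  set G : ℕ → ℕ → 𝔸.A ⊗[k] W := fun p q => extF 𝔸 f (p + 1) q (Fin.cons (θ • z) fun _ => x) fun _ => y
    with hG
  have hGz : ∀ p q, N ≤ p + 1 + q → G p q = 0 := fun p q h => by
    refine extM_eq_zero_of_le h _ (fun i => ?_) fun _ => hy
    refine Fin.cases ?_ (fun l => ?_) i
    · exact hθz
    · exact hx
  -- The first order term with `θ • t` at position `i` of `q` open arguments. Open positions are not
  -- interchangeable, so `i` has to be recorded; the value outside the range is a convention.
  set H : ℕ → ℕ → ℕ → 𝔸.A ⊗[k] W := fun p q i => if h : i < q then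
    extF 𝔸 f p q (fun _ => x) (Function.update (fun _ => y) ⟨i, h⟩ (θ • t)) else 0 with hH
  have hupd : ∀ (q : ℕ) (i l : Fin q), Function.update (fun _ => y) i (θ • t) l ∈ oPts 𝔸 U 0 := by
    intro q i l
    by_cases h : l = i
    · subst h; simpa using hθt
    · simpa [Function.update_of_ne h] using hy
  have hHz : ∀ p q i, N ≤ p + q → H p q i = 0 := by
    intro p q i h
    simp only [hH]
    split_ifs with hi
    · exact extM_eq_zero_of_le h _ (fun _ => hx) (hupd q _)
    · rfl
  have lhs : evF 𝔸 f (x + θ • z) (y + θ • t) = evF 𝔸 f x y +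
      ((∑ p ∈ Finset.range N, ∑ q ∈ Finset.range N, ((p.factorial : k)⁻¹) • G p q) +
      ∑ p ∈ Finset.range N, ((p.factorial : k)⁻¹) • ∑ q ∈ Finset.range N,
        ∑ i ∈ Finset.range q, H p q i) := by
    have e : ∀ p q, extF 𝔸 f p q (fun _ => x + θ • z) (fun _ => y + θ • t) =
        extF 𝔸 f p q (fun _ => x) (fun _ => y) + ((p : k) • G (p - 1) q +
          ∑ i ∈ Finset.range q, H p q i) := by
      intro p q
      unfold extF
      rw [extM_expand (f p q) hθ hθθ (pts_le_hpts _ _ hx) (pts_le_hpts _ _ hzm)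
        (pts_le_hpts _ _ hy) (pts_le_hpts _ _ htm), add_assoc]
      congr 2
      · cases p with
        | zero => simp
        | succ p =>
          rw [Finset.sum_congr rfl fun i _ => extM_update_eq_cons hx hy (hf _ _) hθz i]
          rw [Finset.sum_const, Finset.card_univ, Fintype.card_fin, Nat.cast_smul_eq_nsmul]
          rfl
      · rw [Finset.sum_range]
        refine Finset.sum_congr rfl fun i _ => ?_
        simp only [hH, i.2, dif_pos]
        rfl
    -- The closed range has length `N + 1`: the variation lowers the number of unvaried closed
    -- arguments by one, and after the shift exactly `N` terms are left.
    rw [evF_eq (add_mem hx hθz) (add_mem hy hθt) f (B := N + 1) (B' := N) (Nat.le_succ _) le_rfl,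
      evF_eq hx hy f (B := N + 1) (B' := N) (Nat.le_succ _) le_rfl]
    simp only [e, smul_add, Finset.sum_add_distrib]
    congr 2
    · rw [Finset.sum_range_succ']
      simp only [Nat.cast_zero, zero_smul, smul_zero, Finset.sum_const_zero, add_zero,
        Nat.add_sub_cancel]
      refine Finset.sum_congr rfl fun p _ => Finset.sum_congr rfl fun q _ => ?_
      rw [smul_smul, Nat.factorial_succ]
      congr 1
      have : ((p + 1 : ℕ) : k) ≠ 0 := Nat.cast_ne_zero.2 (Nat.succ_ne_zero p)
      push_cast at this ⊢
      field_simp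
    · rw [Finset.sum_range_succ, Finset.sum_congr rfl fun p _ => Finset.smul_sum.symm]
      rw [add_eq_left]
      refine Finset.sum_eq_zero fun q _ => ?_
      rw [Finset.sum_eq_zero, smul_zero]
      exact fun i _ => hHz _ _ _ (by omega)
  have pi2 : ∀ Ψ : (Fin 2 → ℕ) → 𝔸.A ⊗[k] W,
      ∑ κ ∈ Fintype.piFinset (fun _ : Fin 2 => Finset.range N),
      (∏ a, ((κ a).factorial : k)⁻¹) • Ψ κ = ∑ r ∈ Finset.range N, ∑ p ∈ Finset.range N,
        ((p.factorial : k)⁻¹) • ((r.factorial : k)⁻¹) • Ψ ![p, r] := by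
    intro Ψ
    rw [sum_piFinset_two, Finset.sum_comm]
    refine Finset.sum_congr rfl fun r _ => Finset.sum_congr rfl fun p _ => ?_
    rw [Fin.prod_univ_two, smul_smul]
    rfl
  -- `sum_blocks` decouples the two block sizes. Summing over `κ 0` rebuilds `θ • z` from the series
  -- of `l`, and `κ 1` counts the remaining closed arguments.
  have rhsC : ∑ n ∈ Finset.range B, ∑ m ∈ Finset.range B, ((n.factorial : k)⁻¹) •
      ∑ b : Fin n → Fin 2, insTermC b (extF 𝔸 f) (extCθ θ l) (fun _ => x) (fun _ : Fin m => y) =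
      ∑ p ∈ Finset.range N, ∑ q ∈ Finset.range N, ((p.factorial : k)⁻¹) • G p q := by
    set Φ : ℕ → (Fin 2 → ℕ) → 𝔸.A ⊗[k] W := fun m κ => extF 𝔸 f (κ 1 + 1) m
      (Fin.cons (θ • extC 𝔸 l (κ 0) fun _ => x) fun _ => x) fun _ => y with hΦ
    have hΦz : ∀ m κ a, N ≤ κ a → Φ m κ = 0 := by
      intro m κ
      refine Fin.forall_fin_two.2 ⟨fun h => ?_, fun h => ?_⟩
      · simp only [hΦ]
        rw [extC_of_le hx l h, smul_zero]
        exact ((extF 𝔸 f (κ 1 + 1) m).fixOpen fun _ => y).map_coord_zero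
          (m := Fin.cons 0 fun _ => x) 0 (Fin.cons_zero _ _)
      · refine extM_eq_zero_of_le (show N ≤ κ 1 + 1 + m by omega) _ (fun i => ?_) fun _ => hy
        refine Fin.cases ?_ (fun l => ?_) i
        · exact smul_mem_cPts hθ (sub_self D).symm (extC_mem hl hl0 fun _ => hx)
        · exact hx
    have hG' : ∀ r m, G r m = ∑ p ∈ Finset.range N, ((p.factorial : k)⁻¹) • Φ m ![p, r] := by
      intro r m
      set L : 𝔸.A ⊗[k] V →ₗ[k] 𝔸.A ⊗[k] W :=
        ((extF 𝔸 f (r + 1) m).fixOpen fun _ => y).toLinearMap (Fin.cons 0 fun _ => x) 0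
      have hL : ∀ z, L z = extF 𝔸 f (r + 1) m (Fin.cons z fun _ => x) fun _ => y := by
        intro z
        simp only [L, MultilinearMap.toLinearMap_apply, Fin.update_cons_zero]
        rfl
      simp only [hG, hΦ, ← hL, hz, evC, Finset.smul_sum, map_sum]
      refine Finset.sum_congr rfl fun p _ => ?_
      rw [smul_comm, map_smul]
      rfl
    rw [Finset.sum_comm]
    have e : ∀ m, ∑ n ∈ Finset.range B, ((n.factorial : k)⁻¹) • ∑ b : Fin n → Fin 2,
        insTermC b (extF 𝔸 f) (extCθ θ l) (fun _ => x) (fun _ : Fin m => y) =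
        ∑ r ∈ Finset.range N, ((r.factorial : k)⁻¹) • G r m := by
      intro m
      refine (sum_blocks N B (by omega) (Φ m) (hΦz m)).trans ?_
      rw [pi2]
      refine Finset.sum_congr rfl fun r _ => ?_
      rw [hG', Finset.smul_sum]
      exact Finset.sum_congr rfl fun p _ => smul_comm _ _ _
    rw [Finset.sum_congr rfl fun m _ => e m, Finset.sum_comm]
    refine Finset.sum_congr rfl fun p _ => (sum_range_extend hNB _ fun q hq => ?_).symm
    rw [hGz _ _ (by omega), smul_zero]
  -- The sizes of block `1` and of segment `1` sum to the series of `ν`, that is to `θ • t`;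
  -- segments `0` and `2` count the open arguments to its left and right.
  have rhsO : ∑ n ∈ Finset.range B, ∑ m ∈ Finset.range B, ((n.factorial : k)⁻¹) •
      ∑ b : Fin n → Fin 2, ∑ h ∈ segments m 3,
        insTermO b h (extF 𝔸 f) (extFθ θ ν) (fun _ => x) (fun _ => y) =
      ∑ p ∈ Finset.range N, ((p.factorial : k)⁻¹) • ∑ q ∈ Finset.range N,
        ∑ i ∈ Finset.range q, H p q i := by
    set Φ : (Fin 2 → ℕ) → (Fin 3 → ℕ) → 𝔸.A ⊗[k] W := fun κ κ' =>
      extF 𝔸 f (κ 0) (κ' 0 + 1 + κ' 2) (fun _ => x) (Fin.append (Fin.append (fun _ => y)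
        (fun _ : Fin 1 => θ • extF 𝔸 ν (κ 1) (κ' 1) (fun _ => x) fun _ => y)) fun _ => y) with hΦ
    have hν' : ∀ p q, θ • extF 𝔸 ν p q (fun _ => x) (fun _ => y) ∈ oPts 𝔸 U 0 := fun p q =>
      smul_mem_oPts hθ (sub_self D).symm (extF_mem hν hν0 (fun _ => hx) fun _ => hy)
    have hΦN : ∀ κ κ', N ≤ κ 0 + (κ' 0 + 1 + κ' 2) → Φ κ κ' = 0 := by
      intro κ κ' h
      refine extM_eq_zero_of_le h _ (fun _ => hx) fun i => ?_
      refine Fin.addCases (fun i => ?_) (fun i => ?_) i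
      · rw [Fin.append_left]
        refine Fin.addCases (fun i => ?_) (fun i => ?_) i
        · rw [Fin.append_left]; exact hy
        · rw [Fin.append_right]; exact hν' _ _
      · rw [Fin.append_right]; exact hy
    have hΦν : ∀ κ κ', N ≤ κ 1 + κ' 1 → Φ κ κ' = 0 := by
      intro κ κ' h
      simp only [hΦ]
      rw [extF_of_le hx hy ν h, smul_zero]
      refine MultilinearMap.map_coord_zero _ (Fin.castAdd _ (Fin.natAdd _ 0)) ?_
      rw [Fin.append_left, Fin.append_right]
    have hΦ1 : ∀ κ κ' a, N ≤ κ' a → Φ κ κ' = 0 := by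
      intro κ κ' a h
      fin_cases a
      · exact hΦN _ _ (by change N ≤ κ' 0 at h; omega)
      · exact hΦν _ _ (by change N ≤ κ' 1 at h; omega)
      · exact hΦN _ _ (by change N ≤ κ' 2 at h; omega)
    have hΦ2 : ∀ κ κ' a, N ≤ κ a → Φ κ κ' = 0 := by
      intro κ κ'
      exact Fin.forall_fin_two.2 ⟨fun h => hΦN _ _ (by omega), fun h => hΦν _ _ (by omega)⟩
    have hH' : ∀ p i j, H p (i + 1 + j) i = ∑ r ∈ Finset.range N, ∑ s ∈ Finset.range N,
        ((r.factorial : k)⁻¹) • Φ ![p, r] ![i, s, j] := by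
      intro p i j
      set L : 𝔸.A ⊗[k] U →ₗ[k] 𝔸.A ⊗[k] W :=
        (extF 𝔸 f p (i + 1 + j) fun _ => x).toLinearMap (fun _ => y) ⟨i, by omega⟩
      have hL : ∀ z, L z = extF 𝔸 f p (i + 1 + j) (fun _ => x) (Fin.append (Fin.append (fun _ => y)
        (fun _ : Fin 1 => z)) fun _ => y) := by
        intro z
        simp only [L, MultilinearMap.toLinearMap_apply, append_const_eq_update]
      have hLH : H p (i + 1 + j) i = L (θ • t) := by
        simp only [hH]
        rw [dif_pos (by omega)]
        rfl
      rw [hLH, ht, evF]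
      simp only [Finset.smul_sum, map_sum]
      refine Finset.sum_congr rfl fun r _ => Finset.sum_congr rfl fun s _ => ?_
      rw [smul_comm, map_smul, hL]
      rfl
    have step : ∑ n ∈ Finset.range B, ∑ m ∈ Finset.range B, ((n.factorial : k)⁻¹) •
        ∑ b : Fin n → Fin 2, ∑ h ∈ segments m 3,
          insTermO b h (extF 𝔸 f) (extFθ θ ν) (fun _ => x) (fun _ => y) =
        ∑ n ∈ Finset.range B, ((n.factorial : k)⁻¹) • ∑ b : Fin n → Fin 2,
          ∑ κ' ∈ Fintype.piFinset (fun _ : Fin 3 => Finset.range N), Φ (size b) κ' := by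
      refine Finset.sum_congr rfl fun n _ => ?_
      rw [← Finset.smul_sum, Finset.sum_comm]
      refine congrArg _ (Finset.sum_congr rfl fun b _ => ?_)
      exact sum_range_segments N B (by omega) (Φ (size b)) (hΦ1 _)
    rw [step, sum_blocks N B (by omega) (fun κ => ∑ κ' ∈ Fintype.piFinset
      (fun _ : Fin 3 => Finset.range N), Φ κ κ') fun κ a ha =>
        Finset.sum_eq_zero fun κ' _ => hΦ2 κ κ' a ha, pi2, Finset.sum_comm]
    refine Finset.sum_congr rfl fun p _ => ?_
    rw [← Finset.smul_sum, sum_range_triangle N (H p) fun q i hq => hHz p q i (by omega)]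
    congr 1
    simp only [hH', sum_piFinset_three, Finset.smul_sum]
    rw [Finset.sum_comm]
    refine Finset.sum_congr rfl fun i _ => ?_
    rw [Finset.sum_comm (s := Finset.range N) (t := Finset.range N) (f := fun j r =>
      ∑ s ∈ Finset.range N, ((r.factorial : k)⁻¹) • Φ ![p, r] ![i, s, j])]
    exact Finset.sum_congr rfl fun r _ => Finset.sum_comm
  rw [lhs, evF_eq hx hy (insertF f l ν) hNB hNB, Finset.smul_sum]
  congr 1
  rw [← rhsC, ← rhsO, ← Finset.sum_add_distrib]
  refine Finset.sum_congr rfl fun n _ => ?_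
  rw [← Finset.sum_add_distrib, Finset.smul_sum]
  refine Finset.sum_congr rfl fun m _ => ?_
  rw [← smul_add, ← smul_extM_insertF f l ν hD hθ (fun _ => hx) (fun _ => hy), smul_comm]
  rfl

end Ev

/-! ### Closed insertion, change of test algebra, recovery of a family from its values -/

section Extraction

variable {k : Type u} [Field k] {𝔸 : TestAlg k} {V U W V' U' : GradedSpace k}

theorem evC_insertC [CharZero k] {x : 𝔸.A ⊗[k] V} (hx : x ∈ cPts 𝔸 V 0) {D : ℤ} (hD : Odd D)
    {f : ClosedMaps k V W} (hf : f.IsSymmetric) {l : ClosedMaps k V V} (hl : l.HasDegree D)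
    (hl0 : l 0 = 0) {θ : 𝔸.A} (hθ : θ ∈ 𝔸.c D) (hθθ : θ * θ = 0) :
    evC 𝔸 f (x + θ • evC 𝔸 l x) = evC 𝔸 f x + θ • evC 𝔸 (insertC f l) x := by
  have := evF_insertF hx (zero_mem (oPts 𝔸 V 0)) hD (hf.toMixed (U := V)) hl hl0
    (ν := (0 : MixedMaps k V V V)) (fun _ _ _ _ _ _ _ _ => zero_mem _) rfl hθ hθθ
  rwa [insertF_toMixed, evF_toMixed, evF_toMixed, evF_toMixed] at this

theorem evF_inclPt (D : ℤ) {x : 𝔸.A ⊗[k] V} {y : 𝔸.A ⊗[k] U} (hx : x ∈ cPts 𝔸 V 0)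
    (hy : y ∈ oPts 𝔸 U 0) (g : MixedMaps k V U W) :
    evF (𝔸.adjoin D) g (inclPt 𝔸 D V x) (inclPt 𝔸 D U y) = inclPt 𝔸 D W (evF 𝔸 g x y) := by
  rw [evF_eq hx hy g (B := (𝔸.adjoin D).N) (B' := (𝔸.adjoin D).N) (Nat.le_add_left _ _)
    (Nat.le_add_left _ _)]
  simp only [map_sum, map_smul]
  refine Finset.sum_congr rfl fun p _ => Finset.sum_congr rfl fun q _ => ?_
  congr 1
  exact (extM_algHom (𝔸.incl D) (g p q) _ _).symm

theorem evC_inclPt (D : ℤ) {x : 𝔸.A ⊗[k] V} (hx : x ∈ cPts 𝔸 V 0) (f : ClosedMaps k V W) :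
    evC (𝔸.adjoin D) f (inclPt 𝔸 D V x) = inclPt 𝔸 D W (evC 𝔸 f x) := by
  have := evF_inclPt D hx (zero_mem (oPts 𝔸 V 0)) (f.toMixed V)
  rwa [evF_toMixed, evF_toMixed] at this

/-! ### Families are determined by their values on points -/

/-- The family obtained by fixing the first closed argument. -/
def MixedMaps.contract (R : MixedMaps k V U W) (v : V) : MixedMaps k V U W :=
  fun p q => (R (p + 1) q).curryLeft v

theorem extM_contract (R : MixedMaps k V U W) (v : V) {p q : ℕ} (θ : 𝔸.A) (x : Fin p → 𝔸.A ⊗[k] V)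
    (y : Fin q → 𝔸.A ⊗[k] U) : extM 𝔸.A (R (p + 1) q) (Fin.cons (θ ⊗ₜ v) x) y =
      θ • extM 𝔸.A (R.contract v p q) x y := by
  have : θ ⊗ₜ[k] v = θ • ((1 : 𝔸.A) ⊗ₜ[k] v) := by rw [TensorProduct.smul_tmul', smul_eq_mul, mul_one]
  rw [this, extM_smul_first, extM_cons_one]
  rfl

theorem letter_tmul_mem {d : ℤ} {v : V} (hv : v ∈ V.deg d) :
    𝔸.letter d ⊗ₜ[k] v ∈ cPts (𝔸.adjoin d) V 0 :=
  tmul_mem_pts (𝔸.letter_I) (𝔸.letter_c) hv (by ring)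

theorem MixedMaps.IsSymmetric.contract {R : MixedMaps k V U W} (hR : R.IsSymmetric) {d : ℤ} {v : V}
    (hv : v ∈ V.deg d) : (R.contract v).IsSymmetric := by
  intro p q
  refine biSymmetric_of_pts _ fun 𝔸 x y hx hy σ => ?_
  apply letter_smul_inj (D := d)
  unfold inclPt
  rw [extM_algHom, extM_algHom]
  have h := extM_cons_comp_perm (hR (p + 1) q) (letter_tmul_mem (𝔸 := 𝔸) hv)
    (fun i => inclPt_mem_cPts (hx i)) (fun i => inclPt_mem_oPts (hy i)) σ
  rw [extM_contract, extM_contract] at h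
  exact h

variable [CharZero k]

/-- Taylor expansion at `X + τ • (1 ⊗ v)` for a new letter `τ` of the degree of `v`: the coefficient
of `τ` is the value of the contracted family. Only `τ * τ = 0` matters, so `v` may have either
parity. -/
theorem evF_contract {R : MixedMaps k V U W} (hR : R.IsSymmetric)
    (h : ∀ (𝔸 : TestAlg k) (x : 𝔸.A ⊗[k] V) (y : 𝔸.A ⊗[k] U), x ∈ cPts 𝔸 V 0 → y ∈ oPts 𝔸 U 0 →
      evF 𝔸 R x y = 0) {d : ℤ} {v : V} (hv : v ∈ V.deg d) {x : 𝔸.A ⊗[k] V} {y : 𝔸.A ⊗[k] U}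
    (hx : x ∈ cPts 𝔸 V 0) (hy : y ∈ oPts 𝔸 U 0) : evF 𝔸 (R.contract v) x y = 0 := by
  apply letter_smul_inj (D := d)
  rw [← evF_inclPt d hx hy, map_zero, smul_zero]
  set 𝔹 := 𝔸.adjoin d
  set X := inclPt 𝔸 d V x
  set Y := inclPt 𝔸 d U y
  have hX : X ∈ cPts 𝔹 V 0 := inclPt_mem_cPts hx
  have hY : Y ∈ oPts 𝔹 U 0 := inclPt_mem_oPts hy
  set τ : 𝔹.A := 𝔸.letter d
  have hτ : τ ∈ 𝔹.c d := 𝔸.letter_c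
  have e1 : τ • ((1 : 𝔹.A) ⊗ₜ[k] v) = τ ⊗ₜ v := by
    rw [TensorProduct.smul_tmul', smul_eq_mul, mul_one]
  have hZ : τ • ((1 : 𝔹.A) ⊗ₜ[k] v) ∈ cPts 𝔹 V 0 := by
    rw [e1]
    exact letter_tmul_mem (𝔸 := 𝔸) hv
  have e : ∀ p q, extF 𝔹 R p q (fun _ => X + τ • ((1 : 𝔹.A) ⊗ₜ[k] v)) (fun _ => Y) =
      extF 𝔹 R p q (fun _ => X) (fun _ => Y) +
        (p : k) • τ • extF 𝔹 (R.contract v) (p - 1) q (fun _ => X) fun _ => Y := by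
    intro p q
    have := extM_expand (R p q) hτ 𝔸.letter_mul_letter (pts_le_hpts _ _ hX)
      (Submodule.subset_span ⟨0, 1, v, 𝔹.one_c, rfl⟩ : (1 : 𝔹.A) ⊗ₜ[k] v ∈ hpts 𝔹.c V)
      (pts_le_hpts _ _ hY) (zero_mem _)
    simp only [smul_zero, add_zero] at this
    unfold extF
    rw [this, add_assoc]
    congr 1
    rw [Finset.sum_eq_zero (s := Finset.univ) (f := fun j => extM 𝔹.A (R p q) (fun _ => X)
      (Function.update (fun _ => Y) j 0)) fun j _ => MultilinearMap.map_update_zero _ _ _, add_zero]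
    cases p with
    | zero => simp
    | succ p =>
      rw [Finset.sum_congr rfl fun i _ => extM_update_eq_cons hX hY (hR _ _) hZ i]
      rw [Finset.sum_const, Finset.card_univ, Fintype.card_fin, Nat.cast_smul_eq_nsmul, e1,
        extM_contract]
      rfl
  have h1 := h 𝔹 _ _ (add_mem hX hZ) hY
  have h2 := h 𝔹 _ _ hX hY
  rw [evF_eq (add_mem hX hZ) hY R (B := 𝔹.N + 1) (B' := 𝔹.N) (Nat.le_succ _) le_rfl] at h1
  rw [evF_eq hX hY R (B := 𝔹.N + 1) (B' := 𝔹.N) (Nat.le_succ _) le_rfl] at h2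
  simp only [e, smul_add, Finset.sum_add_distrib, h2, zero_add] at h1
  rw [Finset.sum_range_succ'] at h1
  simp only [Nat.cast_zero, zero_smul, smul_zero, Finset.sum_const_zero, add_zero]  at h1
  rw [← h1, evF]
  simp only [Finset.smul_sum]
  refine Finset.sum_congr rfl fun p _ => Finset.sum_congr rfl fun q _ => ?_
  rw [smul_smul, smul_comm, Nat.factorial_succ]
  congr 1
  have : ((p + 1 : ℕ) : k) ≠ 0 := Nat.cast_ne_zero.2 (Nat.succ_ne_zero p)
  push_cast at this ⊢
  field_simp

omit [CharZero k] in
-- The point is `x = 0` and `y = ∑ η t ⊗ o t` with the elementary matrices as coefficients. The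
-- corner entry of the value keeps only the word `o₀ ⋯ o_{m-1}` in this order, hence equals `R 0 m c
-- o`.
theorem open_eq_zero_of_evF {R : MixedMaps k V U W}
    (h : ∀ (𝔸 : TestAlg k) (x : 𝔸.A ⊗[k] V) (y : 𝔸.A ⊗[k] U), x ∈ cPts 𝔸 V 0 → y ∈ oPts 𝔸 U 0 →
      evF 𝔸 R x y = 0) {m : ℕ} (e : Fin m → ℤ) (c : Fin 0 → V) {o : Fin m → U}
    (ho : ∀ i, o i ∈ U.deg (e i)) : R 0 m c o = 0 := by
  set 𝔸 := TestAlg.openAlg k (TestAlg.weight e) with h𝔸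
  let η : Fin m → 𝔸.A := TestAlg.openLetter k
  have hη : ∀ t, η t ⊗ₜ[k] o t ∈ oPts 𝔸 U 0 := fun t => by
    refine tmul_mem_pts (TestAlg.openLetter_I _ t) (TestAlg.openLetter_o _ t) (ho t) ?_
    rw [TestAlg.weight_succ, add_zero]
  set y : 𝔸.A ⊗[k] U := ∑ t, η t ⊗ₜ[k] o t with hy
  have key := h 𝔸 0 y (zero_mem _) (sum_mem fun t _ => hη t)
  let lam : 𝔸.A →ₗ[k] k := Matrix.entryLinearMap k k 0 (Fin.last m)
  have hlam : ∀ {q} (u : Fin q → Fin m), lam (List.ofFn fun t => η (u t)).prod =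
      if q = m ∧ ∀ t, (u t : ℕ) = t then 1 else 0 := fun u => TestAlg.prod_openLetter_last u
  have h0 : ∀ q, (TensorProduct.lid k W) (lam.rTensor W (extF 𝔸 R 0 q (fun _ => 0) fun _ => y)) =
      if q = m then R 0 m c o else 0 := by
    intro q
    unfold extF
    rw [hy, MultilinearMap.map_sum]
    simp only [map_sum]
    have e1 : ∀ u : Fin q → Fin m, (TensorProduct.lid k W) (lam.rTensor W
        (extM 𝔸.A (R 0 q) (fun _ => 0) fun i => η (u i) ⊗ₜ[k] o (u i))) =
        if q = m ∧ ∀ t, (u t : ℕ) = t then R 0 q c fun i => o (u i) else 0 := by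
      intro u
      rw [show (fun _ : Fin 0 => (0 : 𝔸.A ⊗[k] V)) = fun i => (Fin.elim0 i : 𝔸.A) ⊗ₜ[k] c i from
        Subsingleton.elim _ _, extM_tmul, List.ofFn_zero, List.prod_nil, one_mul,
        LinearMap.rTensor_tmul, TensorProduct.lid_tmul, hlam]
      split_ifs <;> simp
    rw [Finset.sum_congr rfl fun u _ => e1 u]
    by_cases hq : q = m
    · subst hq
      rw [if_pos rfl, Finset.sum_eq_single (fun t => t)]
      · simp
      · intro u _ hu
        refine if_neg fun hh => hu (funext fun t => Fin.ext (hh.2 t))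
      · simp
    · rw [if_neg hq]
      exact Finset.sum_eq_zero fun u _ => if_neg fun hh => hq hh.1
  unfold evF at key
  rw [Finset.sum_eq_single 0] at key
  · have := congrArg (TensorProduct.lid k W ∘ lam.rTensor W) key
    simp only [Function.comp_apply, map_sum, map_zero, h0, Nat.factorial_zero,
      Nat.cast_one, inv_one, one_smul] at this
    rw [Finset.sum_ite_eq' (Finset.range 𝔸.N) m, if_pos] at this
    · exact this
    · exact Finset.mem_range.2 (Nat.lt_succ_self m)
  · intro p _ hp
    obtain ⟨p, rfl⟩ := Nat.exists_eq_succ_of_ne_zero hp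
    refine Finset.sum_eq_zero fun q _ => ?_
    have : extF 𝔸 R (p + 1) q (fun _ => 0) = 0 := MultilinearMap.map_coord_zero _ 0 rfl
    rw [this]
    simp
  · intro hN
    exact absurd (Finset.mem_range.2 (Nat.succ_pos m)) hN

/-- A graded symmetric family which vanishes on all points is zero. -/
theorem MixedMaps.eq_zero_of_evF {R : MixedMaps k V U W} (hR : R.IsSymmetric)
    (h : ∀ (𝔸 : TestAlg k) (x : 𝔸.A ⊗[k] V) (y : 𝔸.A ⊗[k] U), x ∈ cPts 𝔸 V 0 → y ∈ oPts 𝔸 U 0 →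
      evF 𝔸 R x y = 0) : R = 0 := by
  funext n m
  refine bi_ext_homogeneous _ _ fun d e c o hc ho => ?_
  change R n m c o = 0
  -- Contracting the first closed argument keeps both hypotheses and lowers `n`; the case without
  -- closed arguments is settled by the open letters.
  induction n generalizing R with
  | zero => exact open_eq_zero_of_evF h e c ho
  | succ n ih =>
    have := ih (hR.contract (hc 0)) (fun 𝔸 x y hx hy => evF_contract hR h (hc 0) hx hy)
      (fun i => d i.succ) (fun i => c i.succ) fun i => hc i.succ
    change R (n + 1) m (Fin.cons (c 0) fun i => c i.succ) o = 0 at this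
    have hcc : (Fin.cons (c 0) fun i => c i.succ : Fin (n + 1) → V) = c := Fin.cons_self_tail c
    rwa [hcc] at this

end Extraction

/-! ## Pairs of graded spaces and families between them -/

/-- A pair of graded spaces, for closed and open arguments. -/
structure GPair (k : Type u) [Field k] : Type (max u (v + 1)) where
  C : GradedSpace.{u, v} k
  O : GradedSpace.{u, v} k

section Pair

variable {k : Type u} [Field k]

/-- The families of maps between pairs of graded spaces, without components of arity zero and
graded symmetric in the closed arguments. -/
def famSubmodule (S : GPair.{u, v} k) (T : GPair.{u, w} k) :
    Submodule k (ClosedMaps k S.C T.C × MixedMaps k S.C S.O T.O) where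
  carrier := {F | (F.1 0 = 0 ∧ F.2 0 0 = 0) ∧ F.1.IsSymmetric ∧ F.2.IsSymmetric}
  zero_mem' := ⟨⟨rfl, rfl⟩, fun _ _ _ _ _ => by simp, fun _ _ _ _ _ _ _ => by simp⟩
  add_mem' := by
    rintro F G ⟨⟨h1, h2⟩, h3, h4⟩ ⟨⟨h1', h2'⟩, h3', h4'⟩
    refine ⟨⟨?_, ?_⟩, fun p d c hc σ => ?_, fun p q d c o hc σ => ?_⟩
    · change F.1 0 + G.1 0 = 0
      rw [h1, h1', add_zero]
    · change F.2 0 0 + G.2 0 0 = 0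
      rw [h2, h2', add_zero]
    · change F.1 p c + G.1 p c = _ • (F.1 p _ + G.1 p _)
      rw [h3 p d c hc σ, h3' p d c hc σ, smul_add]
    · change F.2 p q c o + G.2 p q c o = _ • (F.2 p q _ o + G.2 p q _ o)
      rw [h4 p q d c o hc σ, h4' p q d c o hc σ, smul_add]
  smul_mem' := by
    rintro t F ⟨⟨h1, h2⟩, h3, h4⟩
    refine ⟨⟨?_, ?_⟩, fun p d c hc σ => ?_, fun p q d c o hc σ => ?_⟩
    · change t • F.1 0 = 0
      rw [h1, smul_zero]
    · change t • F.2 0 0 = 0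
      rw [h2, smul_zero]
    · change t • F.1 p c = _ • t • F.1 p _
      rw [h3 p d c hc σ, smul_comm]
    · change t • F.2 p q c o = _ • t • F.2 p q _ o
      rw [h4 p q d c o hc σ, smul_comm]

/-- The type of families of maps. -/
abbrev Fam (S : GPair.{u, v} k) (T : GPair.{u, w} k) : Type _ := famSubmodule S T

variable {S : GPair.{u, v} k} {T : GPair.{u, w} k} {R : GPair.{u, x} k}

namespace Fam

variable (F G : Fam S T)

theorem zero_c : F.1.1 0 = 0 := F.2.1.1
theorem zero_o : F.1.2 0 0 = 0 := F.2.1.2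
theorem symm_c : F.1.1.IsSymmetric := F.2.2.1
theorem symm_o : F.1.2.IsSymmetric := F.2.2.2

/-- All maps of the family are homogeneous of degree `s`. -/
def HasDeg (s : ℤ) : Prop := F.1.1.HasDegree s ∧ F.1.2.HasDegree s

variable {F G}

theorem HasDeg.add {s : ℤ} (hF : F.HasDeg s) (hG : G.HasDeg s) : (F + G).HasDeg s :=
  ⟨fun p d c hc => add_mem (hF.1 p d c hc) (hG.1 p d c hc),
    fun p q d e c o hc ho => add_mem (hF.2 p q d e c o hc ho) (hG.2 p q d e c o hc ho)⟩

theorem HasDeg.smul {s : ℤ} (t : k) (hF : F.HasDeg s) : (t • F).HasDeg s :=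
  ⟨fun p d c hc => Submodule.smul_mem _ t (hF.1 p d c hc),
    fun p q d e c o hc ho => Submodule.smul_mem _ t (hF.2 p q d e c o hc ho)⟩

theorem HasDeg.sub {s : ℤ} (hF : F.HasDeg s) (hG : G.HasDeg s) : (F - G).HasDeg s :=
  ⟨fun p d c hc => sub_mem (hF.1 p d c hc) (hG.1 p d c hc),
    fun p q d e c o hc ho => sub_mem (hF.2 p q d e c o hc ho) (hG.2 p q d e c o hc ho)⟩

variable (F G)

theorem composeC_zero {V V' W : GradedSpace k} {ν : ClosedMaps k V' W} (h : ν 0 = 0)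
    (f : ClosedMaps k V V') : composeC ν f 0 = 0 := by
  ext c
  rw [composeC_apply ν f (d := Fin.elim0) fun i => i.elim0]
  simp [closedCompose, h]

theorem composeF_zero {V V' U U' W : GradedSpace k} {ν : MixedMaps k V' U' W} (h : ν 0 0 = 0)
    (f : ClosedMaps k V V') (g : MixedMaps k V U U') : composeF ν f g 0 0 = 0 := by
  ext c o
  rw [composeF_apply ν f g (d := Fin.elim0) (e := Fin.elim0) (fun i => i.elim0) fun i => i.elim0]
  simp [mixedCompose, h]

theorem insertF_zero {V U W : GradedSpace k} (f : MixedMaps k V U W) {l : ClosedMaps k V V}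
    (hl : l 0 = 0) {ν : MixedMaps k V U U} (hν : ν 0 0 = 0) : insertF f l ν 0 0 = 0 := by
  ext c o
  rw [insertF_apply f l ν (d := Fin.elim0) (e := Fin.elim0) (fun i => i.elim0) fun i => i.elim0]
  have h0 : ∀ {j : ℕ} (b : Fin 0 → Fin j) (a : Fin j), size b a = 0 := by
    intro j b a; simp [size, block]
  unfold mixedInsert
  rw [Finset.sum_eq_zero, Finset.sum_eq_zero, add_zero]
  · rfl
  · intro b _
    refine Finset.sum_eq_zero fun h _ => ?_
    rw [MultilinearMap.map_coord_zero _ (Fin.castAdd _ (Fin.natAdd _ 0)), smul_zero]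
    rw [Fin.append_left, Fin.append_right]
    exact ν.apply_zero hν (h0 _ _) (h0 _ _) _ _
  · intro b _
    rw [f.eq_zero_of_mem _ _ 0 (l.apply_zero hl (h0 _ _) _), smul_zero]

theorem insertC_zero {V W : GradedSpace k} (f : ClosedMaps k V W) {l : ClosedMaps k V V}
    (hl : l 0 = 0) : insertC f l 0 = 0 := by
  unfold insertC MixedMaps.toClosed
  rw [insertF_zero (f.toMixed V) hl (ν := (0 : MixedMaps k V V V)) rfl]
  ext; rfl

/-- The composition of families. -/
def comp (G : Fam T R) (F : Fam S T) : Fam S R :=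
  ⟨(composeC G.1.1 F.1.1, composeF G.1.2 F.1.1 F.1.2),
    ⟨⟨composeC_zero G.zero_c _, composeF_zero G.zero_o _ _⟩, composeC_symm _ F.symm_c,
      composeF_symm _ F.symm_c F.symm_o⟩⟩

/-- The insertion of a family of odd degree. -/
def ins (F : Fam S T) (Q : Fam S S) {D : ℤ} (hD : Odd D) (hQ : Q.HasDeg D) : Fam S T :=
  ⟨(insertC F.1.1 Q.1.1, insertF F.1.2 Q.1.1 Q.1.2),
    ⟨⟨insertC_zero _ Q.zero_c, insertF_zero _ Q.zero_c Q.zero_o⟩,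
      insertC_symm hD F.symm_c Q.symm_c hQ.1 Q.zero_c,
      insertF_symm hD F.symm_o Q.symm_c hQ.1 Q.zero_c Q.symm_o hQ.2 Q.zero_o⟩⟩

variable {F G}

theorem HasDeg.comp {G : Fam T R} {F : Fam S T} {s : ℤ} (hG : G.HasDeg s) (hF : F.HasDeg 0) :
    (G.comp F).HasDeg s :=
  ⟨composeC_degree hG.1 hF.1, composeF_degree hG.2 hF.1 hF.2⟩

theorem HasDeg.ins {F : Fam S T} {s : ℤ} (hF : F.HasDeg s) {Q : Fam S S} {D : ℤ} (hD : Odd D)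
    (hQ : Q.HasDeg D) : (F.ins Q hD hQ).HasDeg (s + D) :=
  ⟨(insertF_degree hF.1.toMixed hQ.1 (fun _ _ _ _ _ _ _ _ => zero_mem _)).toClosed,
    insertF_degree hF.2 hQ.1 hQ.2⟩

end Fam

/-! ### Points of pairs -/

variable (𝔸 : TestAlg k)

/-- The space containing the points of a pair. -/
abbrev PT (S : GPair.{u, v} k) : Type _ := (𝔸.A ⊗[k] S.C) × (𝔸.A ⊗[k] S.O)

/-- The points of degree `s` of a pair. -/
def Pts (S : GPair.{u, v} k) (s : ℤ) : Submodule k (PT 𝔸 S) := (cPts 𝔸 S.C s).prod (oPts 𝔸 S.O s)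

variable {𝔸}

/-- The value of a family on a point. -/
def ev (F : Fam S T) (z : PT 𝔸 S) : PT 𝔸 T := (evC 𝔸 F.1.1 z.1, evF 𝔸 F.1.2 z.1 z.2)

theorem smul_mem_Pts {t : ℤ} {b : 𝔸.A} (hb : b ∈ 𝔸.c t) {s s' : ℤ} (hs : s' = s - t)
    {z : PT 𝔸 S} (hz : z ∈ Pts 𝔸 S s) : b • z ∈ Pts 𝔸 S s' :=
  ⟨smul_mem_cPts hb hs hz.1, smul_mem_oPts hb hs hz.2⟩

theorem ev_mem {F : Fam S T} {s : ℤ} (hF : F.HasDeg s) {z : PT 𝔸 S} (hz : z ∈ Pts 𝔸 S 0) :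
    ev F z ∈ Pts 𝔸 T s :=
  ⟨evC_mem hz.1 hF.1 F.zero_c, evF_mem hz.1 hz.2 hF.2 F.zero_o⟩

theorem ev_add (F G : Fam S T) (z : PT 𝔸 S) : ev (F + G) z = ev F z + ev G z := by
  refine Prod.ext ?_ ?_
  · change evC 𝔸 (F.1.1 + G.1.1) z.1 = evC 𝔸 F.1.1 z.1 + evC 𝔸 G.1.1 z.1
    unfold evC extC
    simp only [Pi.add_apply, map_add, add_apply, smul_add, Finset.sum_add_distrib]
  · change evF 𝔸 (F.1.2 + G.1.2) z.1 z.2 = evF 𝔸 F.1.2 z.1 z.2 + evF 𝔸 G.1.2 z.1 z.2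
    unfold evF extF
    simp only [Pi.add_apply, extM_add, add_apply, smul_add, Finset.sum_add_distrib]

theorem ev_smul (t : k) (F : Fam S T) (z : PT 𝔸 S) : ev (t • F) z = t • ev F z := by
  refine Prod.ext ?_ ?_
  · change evC 𝔸 (t • F.1.1) z.1 = t • evC 𝔸 F.1.1 z.1
    unfold evC extC
    simp only [Pi.smul_apply, map_smul, smul_apply, Finset.smul_sum]
    exact Finset.sum_congr rfl fun p _ => smul_comm _ _ _
  · change evF 𝔸 (t • F.1.2) z.1 z.2 = t • evF 𝔸 F.1.2 z.1 z.2
    unfold evF extF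
    simp only [Pi.smul_apply, extM_smul, smul_apply, Finset.smul_sum]
    exact Finset.sum_congr rfl fun p _ => Finset.sum_congr rfl fun q _ => smul_comm _ _ _

theorem ev_neg (F : Fam S T) (z : PT 𝔸 S) : ev (-F) z = -ev F z := by
  rw [← neg_one_smul k F, ev_smul]
  exact neg_one_smul k (ev F z)

theorem ev_sub (F G : Fam S T) (z : PT 𝔸 S) : ev (F - G) z = ev F z - ev G z := by
  rw [sub_eq_add_neg F G, ev_add, ev_neg, sub_eq_add_neg]

theorem ev_zero (z : PT 𝔸 S) : ev (0 : Fam S T) z = 0 := by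
  rw [← zero_smul k (0 : Fam S T), ev_smul, zero_smul]

/-- The inclusion of points along the adjunction of a letter. -/
def inclP (𝔸 : TestAlg k) (D : ℤ) (S : GPair.{u, v} k) : PT 𝔸 S →ₗ[k] PT (𝔸.adjoin D) S :=
  (inclPt 𝔸 D S.C).prodMap (inclPt 𝔸 D S.O)

theorem inclP_mem {D s : ℤ} {z : PT 𝔸 S} (hz : z ∈ Pts 𝔸 S s) :
    inclP 𝔸 D S z ∈ Pts (𝔸.adjoin D) S s :=
  ⟨inclPt_mem_cPts hz.1, inclPt_mem_oPts hz.2⟩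

theorem ev_inclP (D : ℤ) (F : Fam S T) {z : PT 𝔸 S} (hz : z ∈ Pts 𝔸 S 0) :
    ev F (inclP 𝔸 D S z) = inclP 𝔸 D T (ev F z) :=
  Prod.ext (evC_inclPt D hz.1 _) (evF_inclPt D hz.1 hz.2 _)

theorem letter_smul_injP {D : ℤ} {z z' : PT 𝔸 S}
    (h : 𝔸.letter D • inclP 𝔸 D S z = 𝔸.letter D • inclP 𝔸 D S z') : z = z' :=
  Prod.ext (letter_smul_inj (congrArg Prod.fst h)) (letter_smul_inj (congrArg Prod.snd h))

variable [CharZero k]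

theorem ev_comp (G : Fam T R) {F : Fam S T} (hF : F.HasDeg 0) {z : PT 𝔸 S} (hz : z ∈ Pts 𝔸 S 0) :
    ev (G.comp F) z = ev G (ev F z) :=
  Prod.ext (evC_composeC hz.1 _ hF.1 F.zero_c)
    (evF_composeF hz.1 hz.2 _ hF.1 F.zero_c hF.2 F.zero_o)

theorem ev_ins (F : Fam S T) {Q : Fam S S} {D : ℤ} (hD : Odd D) (hQ : Q.HasDeg D) {z : PT 𝔸 S}
    (hz : z ∈ Pts 𝔸 S 0) {θ : 𝔸.A} (hθ : θ ∈ 𝔸.c D) (hθθ : θ * θ = 0) :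
    ev F (z + θ • ev Q z) = ev F z + θ • ev (F.ins Q hD hQ) z :=
  Prod.ext (evC_insertC hz.1 hD F.symm_c hQ.1 Q.zero_c hθ hθθ)
    (evF_insertF hz.1 hz.2 hD F.symm_o hQ.1 Q.zero_c hQ.2 Q.zero_o hθ hθθ)

/-- The difference of two families is again a family and evaluates to zero. Its closed component is
treated as a mixed one, to which the same vanishing criterion applies. -/
theorem Fam.ext_ev {F G : Fam S T}
    (h : ∀ (𝔸 : TestAlg k) (z : PT 𝔸 S), z ∈ Pts 𝔸 S 0 → ev F z = ev G z) : F = G := by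
  rw [← sub_eq_zero]
  set K := F - G with hK
  have hz : ∀ (𝔸 : TestAlg k) (z : PT 𝔸 S), z ∈ Pts 𝔸 S 0 → ev K z = 0 := fun 𝔸 z hz => by
    rw [hK, ev_sub, h 𝔸 z hz, sub_self]
  have h2 : K.1.2 = 0 := MixedMaps.eq_zero_of_evF K.symm_o fun 𝔸 x y hx hy =>
    congrArg Prod.snd (hz 𝔸 (x, y) ⟨hx, hy⟩)
  have h1 : K.1.1.toMixed S.O = 0 := MixedMaps.eq_zero_of_evF K.symm_c.toMixed fun 𝔸 x y hx hy => by
    rw [evF_toMixed]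
    exact congrArg Prod.fst (hz 𝔸 (x, y) ⟨hx, hy⟩)
  refine Subtype.ext (Prod.ext (funext fun p => ?_) h2)
  ext c
  exact congrArg (fun φ : MixedMaps k S.C S.O T.C => φ p 0 c Fin.elim0) h1

end Pair

section Linear

variable {k : Type u} [Field k]

/-! ## Linear maps between pairs -/

/-- Pairs of linear maps. -/
abbrev LPair (S : GPair.{u, v} k) (T : GPair.{u, w} k) : Type _ :=
  (S.C →ₗ[k] T.C) × (S.O →ₗ[k] T.O)

variable {S : GPair.{u, v} k} {T : GPair.{u, w} k} {R : GPair.{u, x} k}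

namespace LPair

/-- Both maps are homogeneous of degree `s`. -/
def HasDeg (L : LPair S T) (s : ℤ) : Prop := GradedSpace.HasDeg L.1 s ∧ GradedSpace.HasDeg L.2 s

/-- Composition of pairs of linear maps. -/
def comp (M : LPair T R) (L : LPair S T) : LPair S R := (M.1 ∘ₗ L.1, M.2 ∘ₗ L.2)

/-- The identity. -/
def id (S : GPair.{u, v} k) : LPair S S := (LinearMap.id, LinearMap.id)

theorem HasDeg.comp {M : LPair T R} {L : LPair S T} {s t r : ℤ} (hM : M.HasDeg t)
    (hL : L.HasDeg s) (h : r = s + t) : (M.comp L).HasDeg r := by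
  subst h
  refine ⟨fun d x hx => ?_, fun d x hx => ?_⟩
  · rw [← add_assoc]; exact hM.1 _ _ (hL.1 _ _ hx)
  · rw [← add_assoc]; exact hM.2 _ _ (hL.2 _ _ hx)

theorem HasDeg.add {M L : LPair S T} {s : ℤ} (hM : M.HasDeg s) (hL : L.HasDeg s) :
    (M + L).HasDeg s :=
  ⟨fun d x hx => add_mem (hM.1 d x hx) (hL.1 d x hx),
    fun d x hx => add_mem (hM.2 d x hx) (hL.2 d x hx)⟩

theorem HasDeg.sub {M L : LPair S T} {s : ℤ} (hM : M.HasDeg s) (hL : L.HasDeg s) :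
    (M - L).HasDeg s :=
  ⟨fun d x hx => sub_mem (hM.1 d x hx) (hL.1 d x hx),
    fun d x hx => sub_mem (hM.2 d x hx) (hL.2 d x hx)⟩

theorem HasDeg.id : (id S).HasDeg 0 :=
  ⟨fun d x hx => by rw [add_zero]; exact hx, fun d x hx => by rw [add_zero]; exact hx⟩

end LPair

variable {𝔸 : TestAlg k}

/-- The action of a pair of linear maps on points. -/
def ap (L : LPair S T) (z : PT 𝔸 S) : PT 𝔸 T := (L.1.lTensor 𝔸.A z.1, L.2.lTensor 𝔸.A z.2)

theorem ap_add_pt (L : LPair S T) (z z' : PT 𝔸 S) : ap L (z + z') = ap L z + ap L z' :=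
  Prod.ext (map_add _ _ _) (map_add _ _ _)

theorem ap_zero_pt (L : LPair S T) : ap L (0 : PT 𝔸 S) = 0 :=
  Prod.ext (map_zero _) (map_zero _)

theorem ap_smul (L : LPair S T) (a : 𝔸.A) (z : PT 𝔸 S) : ap L (a • z) = a • ap L z :=
  Prod.ext (lTensor_smul _ _ _) (lTensor_smul _ _ _)

theorem ap_add (L M : LPair S T) (z : PT 𝔸 S) : ap (L + M) z = ap L z + ap M z := by
  refine Prod.ext ?_ ?_
  · change (L.1 + M.1).lTensor 𝔸.A z.1 = _
    rw [LinearMap.lTensor_add]; rfl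
  · change (L.2 + M.2).lTensor 𝔸.A z.2 = _
    rw [LinearMap.lTensor_add]; rfl

theorem ap_zero (z : PT 𝔸 S) : ap (0 : LPair S T) z = 0 := by
  refine Prod.ext ?_ ?_
  · change (0 : S.C →ₗ[k] T.C).lTensor 𝔸.A z.1 = _
    rw [LinearMap.lTensor_zero]; rfl
  · change (0 : S.O →ₗ[k] T.O).lTensor 𝔸.A z.2 = _
    rw [LinearMap.lTensor_zero]; rfl

theorem ap_id (z : PT 𝔸 S) : ap (LPair.id S) z = z :=
  Prod.ext (LinearMap.lTensor_id_apply _ _ _) (LinearMap.lTensor_id_apply _ _ _)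

theorem ap_comp (M : LPair T R) (L : LPair S T) (z : PT 𝔸 S) : ap (M.comp L) z = ap M (ap L z) :=
  Prod.ext (LinearMap.lTensor_comp_apply _ _ _ _) (LinearMap.lTensor_comp_apply _ _ _ _)

theorem ap_mem {L : LPair S T} {s : ℤ} (hL : L.HasDeg s) {z : PT 𝔸 S} (hz : z ∈ Pts 𝔸 S 0) :
    ap L z ∈ Pts 𝔸 T s :=
  ⟨lTensor_mem_pts L.1 hL.1 (by ring) hz.1, lTensor_mem_pts L.2 hL.2 (by ring) hz.2⟩

/-! ### Linear maps as families -/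

/-- A linear map as a closed family. -/
def linC {V W : GradedSpace k} (a : V →ₗ[k] W) : ClosedMaps k V W
  | 1 => MultilinearMap.ofSubsingleton k V W (0 : Fin 1) a
  | 0 => 0
  | _ + 2 => 0

/-- A linear map as a mixed family. -/
def linO {V U W : GradedSpace k} (b : U →ₗ[k] W) : MixedMaps k V U W
  | 0, 1 => MultilinearMap.constOfIsEmpty k (fun _ : Fin 0 => V)
      (MultilinearMap.ofSubsingleton k U W (0 : Fin 1) b)
  | 0, 0 => 0
  | 0, _ + 2 => 0
  | _ + 1, _ => 0

/-- A pair of linear maps as a family. -/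
def Fam.lin (L : LPair S T) : Fam S T :=
  ⟨(linC L.1, linO L.2), ⟨⟨rfl, rfl⟩, by
    rintro (_ | _ | p) d c hc σ
    · simp [linC]
    · rw [Subsingleton.elim (α := Equiv.Perm (Fin 1)) σ 1]
      simp [permSign]
    · simp [linC], by
    rintro (_ | p) (_ | _ | q) d c o hc σ
    · simp [linO]
    · simp [permSign, linO]
    · simp [linO]
    · simp [linO]
    · simp [linO]
    · simp [linO]⟩⟩

theorem Fam.lin_hasDeg {L : LPair S T} {s : ℤ} (hL : L.HasDeg s) : (Fam.lin L).HasDeg s := by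
  constructor
  · rintro (_ | _ | p) d c hc
    · exact zero_mem _
    · rw [Fin.sum_univ_one]; exact hL.1 _ _ (hc 0)
    · exact zero_mem _
  · rintro (_ | p) (_ | _ | q) d e c o hc ho
    · exact zero_mem _
    · rw [Fin.sum_univ_zero, zero_add, Fin.sum_univ_one]; exact hL.2 _ _ (ho 0)
    · exact zero_mem _
    · exact zero_mem _
    · exact zero_mem _
    · exact zero_mem _

theorem extA_ofSubsingleton {V W : GradedSpace k} (a : V →ₗ[k] W) (x : 𝔸.A ⊗[k] V) :
    extA k 𝔸.A V W 1 (MultilinearMap.ofSubsingleton k V W (0 : Fin 1) a) (fun _ => x) =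
      a.lTensor 𝔸.A x := by
  have : (MultilinearMap.ofSubsingleton k (𝔸.A ⊗[k] V) (𝔸.A ⊗[k] W) (0 : Fin 1)).symm
      (extA k 𝔸.A V W 1 (MultilinearMap.ofSubsingleton k V W (0 : Fin 1) a)) = a.lTensor 𝔸.A := by
    refine TensorProduct.ext' fun b v => ?_
    have := extA_tmul (MultilinearMap.ofSubsingleton k V W (0 : Fin 1) a) (fun _ => b) fun _ => v
    refine this.trans ?_
    simp
  exact LinearMap.congr_fun this x

theorem ev_lin (L : LPair S T) {z : PT 𝔸 S} (hz : z ∈ Pts 𝔸 S 0) : ev (Fam.lin L) z = ap L z := by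
  refine Prod.ext ?_ ?_
  · change evC 𝔸 (linC L.1) z.1 = _
    rw [evC_eq hz.1 _ (B := 𝔸.N + 2) (by omega), Finset.sum_eq_single 1]
    · rw [Nat.factorial_one, Nat.cast_one, inv_one, one_smul]
      exact extA_ofSubsingleton L.1 z.1
    · rintro (_ | _ | p) _ hp
      · simp [extC, linC]
      · exact absurd rfl hp
      · simp [extC, linC]
    · intro h
      exact absurd (Finset.mem_range.2 (by omega)) h
  · change evF 𝔸 (linO L.2) z.1 z.2 = _
    rw [evF_eq hz.1 hz.2 _ (B := 𝔸.N + 2) (B' := 𝔸.N + 2) (by omega) (by omega),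
      Finset.sum_eq_single 0, Finset.sum_eq_single 1]
    · rw [Nat.factorial_zero, Nat.cast_one, inv_one, one_smul]
      refine Eq.trans ?_ (extA_ofSubsingleton L.2 z.2)
      change extM 𝔸.A _ _ _ = _
      unfold extM
      rw [LinearMap.compMultilinearMap_apply, extA_zero _ _ Fin.elim0]
      simp only [extScalar, TensorProduct.lift.tmul, smulBi_apply, one_smul]
      rfl
    · rintro (_ | _ | q) _ hq
      · simp [extF, linO, extM_zero]
      · exact absurd rfl hq
      · simp [extF, linO, extM_zero]
    · intro h
      exact absurd (Finset.mem_range.2 (by omega)) h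
    · rintro (_ | p) _ hp
      · exact absurd rfl hp
      · refine Finset.sum_eq_zero fun q _ => ?_
        simp [extF, linO, extM_zero]
    · intro h
      exact absurd (Finset.mem_range.2 (by omega)) h

/-- The linear part of a family. -/
def Fam.linear (F : Fam S T) : LPair S T := (F.1.1.linear, F.1.2.linear)

/-! ### Linear substitutions -/

/-- The substitution of linear maps in a bi-multilinear map. -/
def Bi.precomp {V U W V₁ U₁ : GradedSpace k} {p q : ℕ} (φ : Bi k V U W p q) (a : V₁ →ₗ[k] V)
    (b : U₁ →ₗ[k] U) : Bi k V₁ U₁ W p q := φ.conj LinearMap.id (fun _ => a) (fun _ => b)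

/-- The substitution of linear maps of degree zero. -/
def Fam.precomp (F : Fam T R) (L : LPair S T) (hL : L.HasDeg 0) : Fam S R :=
  ⟨(fun p => (F.1.1 p).compLinearMap fun _ => L.1, fun p q => Bi.precomp (F.1.2 p q) L.1 L.2),
    ⟨⟨by ext c; simp [F.zero_c], by
      ext c o
      change F.1.2 0 0 _ _ = 0
      rw [F.zero_o]; rfl⟩,
    fun p d c hc σ => F.symm_c p d (fun i => L.1 (c i)) (fun i => by
      have := hL.1 _ _ (hc i); rwa [add_zero] at this) σ,
    fun p q d c o hc σ => F.symm_o p q d (fun i => L.1 (c i)) (fun i => L.2 (o i)) (fun i => by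
      have := hL.1 _ _ (hc i); rwa [add_zero] at this) σ⟩⟩

theorem ev_precomp (F : Fam T R) (L : LPair S T) (hL : L.HasDeg 0) (z : PT 𝔸 S) :
    ev (F.precomp L hL) z = ev F (ap L z) := by
  refine Prod.ext ?_ ?_
  · change evC 𝔸 _ _ = evC 𝔸 _ _
    unfold evC
    refine Finset.sum_congr rfl fun p _ => ?_
    congr 1
    rw [← extF_toMixed (U := S.O) _ _ Fin.elim0, ← extF_toMixed (U := S.O) _ _ Fin.elim0]
    refine Eq.trans ?_ ((extM_conj (Bi.ofClosed S.O (F.1.1 p)) LinearMap.id (fun _ => L.1)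
      (fun _ => LinearMap.id) (fun _ => z.1) Fin.elim0).trans ?_)
    · rfl
    · rw [LinearMap.lTensor_id_apply]
      congr 1
      exact Subsingleton.elim _ _
  · change evF 𝔸 _ _ _ = evF 𝔸 _ _ _
    unfold evF
    refine Finset.sum_congr rfl fun p _ => Finset.sum_congr rfl fun q _ => ?_
    congr 1
    refine (extM_conj (F.1.2 p q) LinearMap.id (fun _ => L.1) (fun _ => L.2) (fun _ => z.1)
      fun _ => z.2).trans ?_
    rw [LinearMap.lTensor_id_apply]
    rfl

end Linear

/-! ## Derivations defined by linear maps of degree zero -/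

section Der

variable {k : Type u} [Field k] {V U W : GradedSpace k}

/-- The sum of the substitutions of a linear map in one of the arguments. -/
def Bi.der {p q : ℕ} (φ : Bi k V U W p q) (a : V →ₗ[k] V) (b : U →ₗ[k] U) : Bi k V U W p q :=
  (∑ i, φ.conj LinearMap.id (Function.update (fun _ => LinearMap.id) i a) fun _ => LinearMap.id) +
    ∑ i, φ.conj LinearMap.id (fun _ => LinearMap.id) (Function.update (fun _ => LinearMap.id) i b)

theorem update_id_apply {M : Type*} [AddCommGroup M] [Module k M] {p : ℕ} (i : Fin p)
    (a : M →ₗ[k] M) (c : Fin p → M) : (fun j => (Function.update (fun _ => LinearMap.id) i a :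
      Fin p → M →ₗ[k] M) j (c j)) = Function.update c i (a (c i)) := by
  funext j
  by_cases h : j = i
  · subst h; simp
  · simp [Function.update_of_ne h]

theorem update_id_lTensor {𝔸 : TestAlg k} {M : Type*} [AddCommGroup M] [Module k M] {p : ℕ}
    (i : Fin p) (a : M →ₗ[k] M) (c : Fin p → 𝔸.A ⊗[k] M) :
    (fun j => ((Function.update (fun _ => LinearMap.id) i a : Fin p → M →ₗ[k] M) j).lTensor 𝔸.A
      (c j)) = Function.update c i (a.lTensor 𝔸.A (c i)) := by
  funext j
  by_cases h : j = i
  · subst h; simp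
  · simp [Function.update_of_ne h]

theorem Bi.der_apply {p q : ℕ} (φ : Bi k V U W p q) (a : V →ₗ[k] V) (b : U →ₗ[k] U) (c : Fin p → V)
    (o : Fin q → U) : φ.der a b c o = (∑ i, φ (Function.update c i (a (c i))) o) +
      ∑ i, φ c (Function.update o i (b (o i))) := by
  unfold Bi.der
  rw [add_apply, add_apply, bi_sum_apply, bi_sum_apply]
  simp only [Bi.conj_apply, update_id_apply, LinearMap.id_apply]

theorem extM_der {𝔸 : TestAlg k} {p q : ℕ} (φ : Bi k V U W p q) (a : V →ₗ[k] V) (b : U →ₗ[k] U)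
    (x : Fin p → 𝔸.A ⊗[k] V) (y : Fin q → 𝔸.A ⊗[k] U) : extM 𝔸.A (φ.der a b) x y =
      (∑ i, extM 𝔸.A φ (Function.update x i (a.lTensor 𝔸.A (x i))) y) +
      ∑ i, extM 𝔸.A φ x (Function.update y i (b.lTensor 𝔸.A (y i))) := by
  unfold Bi.der
  rw [extM_add, add_apply, add_apply, extM_sum, extM_sum, bi_sum_apply, bi_sum_apply]
  simp only [extM_conj, update_id_lTensor, LinearMap.lTensor_id, LinearMap.id_apply]

theorem BiSymmetric.der {p q : ℕ} {φ : Bi k V U W p q} (hφ : BiSymmetric φ) {a : V →ₗ[k] V}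
    (ha : GradedSpace.HasDeg a 0) {b : U →ₗ[k] U} (hb : GradedSpace.HasDeg b 0) :
    BiSymmetric (φ.der a b) := by
  refine biSymmetric_of_pts _ fun 𝔸 x y hx hy σ => ?_
  rw [extM_der, extM_der]
  have hup : ∀ i j, Function.update x i (a.lTensor 𝔸.A (x i)) j ∈ cPts 𝔸 V 0 := fun i j => by
    by_cases h : j = i
    · subst h
      rw [Function.update_self]
      exact lTensor_mem_pts a ha (by norm_num) (hx _)
    · rw [Function.update_of_ne h]; exact hx _
  have hup' : ∀ i j, Function.update y i (b.lTensor 𝔸.A (y i)) j ∈ oPts 𝔸 U 0 := fun i j => by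
    by_cases h : j = i
    · subst h
      rw [Function.update_self]
      exact lTensor_mem_pts b hb (by norm_num) (hy _)
    · rw [Function.update_of_ne h]; exact hy _
  congr 1
  · rw [← Equiv.sum_comp σ fun i => extM 𝔸.A φ (Function.update x i (a.lTensor 𝔸.A (x i))) y]
    refine Finset.sum_congr rfl fun i _ => ?_
    rw [← extM_symm hφ (hup _) hy σ]
    congr 2
    funext j
    by_cases h : j = i
    · subst h; simp
    · rw [Function.update_of_ne h, Function.comp_apply, Function.comp_apply,
        Function.update_of_ne fun h' => h (σ.injective h')]
  · exact Finset.sum_congr rfl fun i _ => extM_symm hφ hx (hup' i) σ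

/-- The derivation of a mixed family. -/
def MixedMaps.der (g : MixedMaps k V U W) (a : V →ₗ[k] V) (b : U →ₗ[k] U) : MixedMaps k V U W :=
  fun p q => Bi.der (g p q) a b

/-- The derivation of a closed family. -/
def ClosedMaps.der (f : ClosedMaps k V W) (a : V →ₗ[k] V) : ClosedMaps k V W :=
  ((f.toMixed V).der a LinearMap.id).toClosed

theorem ClosedMaps.der_apply (f : ClosedMaps k V W) (a : V →ₗ[k] V) {p : ℕ} (c : Fin p → V) :
    f.der a p c = ∑ i, f p (Function.update c i (a (c i))) := by
  unfold ClosedMaps.der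
  rw [MixedMaps.toClosed_apply _ c Fin.elim0]
  unfold MixedMaps.der
  rw [Bi.der_apply, Fin.sum_univ_zero, add_zero]
  rfl

theorem ClosedMaps.toMixed_der (f : ClosedMaps k V W) (a : V →ₗ[k] V) (b : U →ₗ[k] U) :
    (f.toMixed U).der a b = (f.der a).toMixed U := by
  funext p q
  ext c o
  unfold MixedMaps.der
  rw [Bi.der_apply]
  cases q with
  | zero =>
    rw [Fin.sum_univ_zero, add_zero]
    exact (f.der_apply a c).symm
  | succ q => simp [ClosedMaps.toMixed]

variable {𝔸 : TestAlg k}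

theorem parPt_even {M : Type*} [AddCommGroup M] [Module k M] {D : ℤ} (hD : Even D)
    (z : 𝔸.A ⊗[k] M) : parPt 𝔸 D M z = z := by
  unfold parPt TestAlg.parD
  rw [if_pos hD]
  exact LinearMap.rTensor_id_apply _ _ _

/-- First order expansion in `ε`. Having degree zero, `ε` passes all coefficients without sign, so
that the variation is the plain sum of substitutions in single slots. -/
theorem evF_der {x : 𝔸.A ⊗[k] V} {y : 𝔸.A ⊗[k] U} (hx : x ∈ cPts 𝔸 V 0) (hy : y ∈ oPts 𝔸 U 0)
    (g : MixedMaps k V U W) {a : V →ₗ[k] V} (ha : GradedSpace.HasDeg a 0) {b : U →ₗ[k] U}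
    (hb : GradedSpace.HasDeg b 0) {ε : 𝔸.A} (hε : ε ∈ 𝔸.c 0) (hεε : ε * ε = 0) :
    evF 𝔸 g (x + ε • a.lTensor 𝔸.A x) (y + ε • b.lTensor 𝔸.A y) =
      evF 𝔸 g x y + ε • evF 𝔸 (g.der a b) x y := by
  have hax : a.lTensor 𝔸.A x ∈ cPts 𝔸 V 0 := lTensor_mem_pts a ha (by norm_num) hx
  have hby : b.lTensor 𝔸.A y ∈ oPts 𝔸 U 0 := lTensor_mem_pts b hb (by norm_num) hy
  have hx' := pts_le_hpts _ _ hx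
  have hy' := pts_le_hpts _ _ hy
  have hax' := pts_le_hpts _ _ hax
  have hby' := pts_le_hpts _ _ hby
  unfold evF
  rw [Finset.smul_sum, ← Finset.sum_add_distrib]
  refine Finset.sum_congr rfl fun p _ => ?_
  rw [Finset.smul_sum, ← Finset.sum_add_distrib]
  refine Finset.sum_congr rfl fun q _ => ?_
  rw [smul_comm ε, ← smul_add]
  congr 1
  unfold extF MixedMaps.der
  rw [extM_expand (g p q) hε hεε hx' hax' hy' hby', extM_der, smul_add, Finset.smul_sum,
    Finset.smul_sum, add_assoc]
  refine congrArg₂ _ rfl (congrArg₂ _ (Finset.sum_congr rfl fun i _ => ?_)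
    (Finset.sum_congr rfl fun i _ => ?_))
  · have := extM_moveC (g p q) hε (fun _ => y) (x := Function.update (fun _ => x) i
      (a.lTensor 𝔸.A x)) (fun j => by
        by_cases h : j = i
        · subst h; simpa using hax'
        · simpa [Function.update_of_ne h] using hx') i
    simp only [parPt_even (show Even (0 : ℤ) from ⟨0, rfl⟩), ite_self] at this
    rw [← this]
    congr 2
    funext j
    by_cases h : j = i
    · subst h; simp
    · simp [h]
  · have := extM_moveO (g p q) hε (x := fun _ => x) (y := Function.update (fun _ => y) i
      (b.lTensor 𝔸.A y)) (fun _ => hx') (fun j => by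
        by_cases h : j = i
        · subst h; simpa using hby'
        · simpa [Function.update_of_ne h] using hy') i
    simp only [parPt_even (show Even (0 : ℤ) from ⟨0, rfl⟩), ite_self] at this
    rw [← this]
    congr 1
    funext j
    by_cases h : j = i
    · subst h; simp
    · simp [h]

variable {S : GPair.{u, v} k} {T : GPair.{u, w} k}

/-- The derivation of a family. -/
def Fam.der (F : Fam S T) (L : LPair S S) (hL : L.HasDeg 0) : Fam S T :=
  ⟨(F.1.1.der L.1, F.1.2.der L.1 L.2), ⟨⟨by
    ext c
    rw [ClosedMaps.der_apply, Fin.sum_univ_zero]; rfl, by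
    ext c o
    unfold MixedMaps.der
    rw [Bi.der_apply, Fin.sum_univ_zero, Fin.sum_univ_zero, add_zero]; rfl⟩,
    MixedMaps.IsSymmetric.toClosed fun p q => BiSymmetric.der (F.symm_c.toMixed p q) hL.1
      LPair.HasDeg.id.1,
    fun p q => BiSymmetric.der (F.symm_o p q) hL.1 hL.2⟩⟩

theorem ev_der (F : Fam S T) {L : LPair S S} (hL : L.HasDeg 0) {z : PT 𝔸 S} (hz : z ∈ Pts 𝔸 S 0)
    {ε : 𝔸.A} (hε : ε ∈ 𝔸.c 0) (hεε : ε * ε = 0) :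
    ev F (z + ε • ap L z) = ev F z + ε • ev (F.der L hL) z := by
  refine Prod.ext ?_ (evF_der hz.1 hz.2 _ hL.1 hL.2 hε hεε)
  have := evF_der hz.1 hz.2 (F.1.1.toMixed S.O) hL.1 hL.2 hε hεε
  rwa [ClosedMaps.toMixed_der, evF_toMixed, evF_toMixed, evF_toMixed] at this

end Der

/-! ## The weight filtration of families -/

section Weight

variable {k : Type u} [Field k] {S : GPair.{u, v} k} {T : GPair.{u, w} k} {R : GPair.{u, x} k}

/-- The components of weight less than `N` agree, where the map with `p` closed arguments has weight
`2p - 2` if its values are closed, and the map with `p` closed and `q` open arguments has weight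
`2p + q - 1` if its values are open. -/
def Fam.Agree (N : ℕ) (F G : Fam S T) : Prop :=
  (∀ p, 2 * p < N + 2 → F.1.1 p = G.1.1 p) ∧ ∀ p q, 2 * p + q < N + 1 → F.1.2 p q = G.1.2 p q

namespace Fam

theorem Agree.refl (N : ℕ) (F : Fam S T) : Agree N F F := ⟨fun _ _ => rfl, fun _ _ _ => rfl⟩

theorem Agree.symm {N : ℕ} {F G : Fam S T} (h : Agree N F G) : Agree N G F :=
  ⟨fun p hp => (h.1 p hp).symm, fun p q hp => (h.2 p q hp).symm⟩

theorem Agree.trans {N : ℕ} {F G K : Fam S T} (h : Agree N F G) (h' : Agree N G K) : Agree N F K :=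
  ⟨fun p hp => (h.1 p hp).trans (h'.1 p hp), fun p q hp => (h.2 p q hp).trans (h'.2 p q hp)⟩

theorem Agree.mono {N M : ℕ} {F G : Fam S T} (h : Agree N F G) (hM : M ≤ N) : Agree M F G :=
  ⟨fun p hp => h.1 p (by omega), fun p q hp => h.2 p q (by omega)⟩

theorem Agree.add {N : ℕ} {F G F' G' : Fam S T} (h : Agree N F G) (h' : Agree N F' G') :
    Agree N (F + F') (G + G') :=
  ⟨fun p hp => congrArg₂ (· + ·) (h.1 p hp) (h'.1 p hp),
    fun p q hp => congrArg₂ (· + ·) (h.2 p q hp) (h'.2 p q hp)⟩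

theorem Agree.sub {N : ℕ} {F G F' G' : Fam S T} (h : Agree N F G) (h' : Agree N F' G') :
    Agree N (F - F') (G - G') :=
  ⟨fun p hp => congrArg₂ (· - ·) (h.1 p hp) (h'.1 p hp),
    fun p q hp => congrArg₂ (· - ·) (h.2 p q hp) (h'.2 p q hp)⟩

theorem Agree.smul {N : ℕ} {F G : Fam S T} (t : k) (h : Agree N F G) : Agree N (t • F) (t • G) :=
  ⟨fun p hp => congrArg (t • ·) (h.1 p hp), fun p q hp => congrArg (t • ·) (h.2 p q hp)⟩

theorem Agree.sub_zero {N : ℕ} {F G : Fam S T} (h : Agree N F G) : Agree N (F - G) 0 := by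
  have := h.sub (Agree.refl N G)
  rwa [sub_self G] at this

theorem agree_zero (F G : Fam S T) : Agree 0 F G := by
  refine ⟨fun p hp => ?_, fun p q hp => ?_⟩
  · obtain rfl : p = 0 := by omega
    rw [F.zero_c, G.zero_c]
  · obtain ⟨rfl, rfl⟩ : p = 0 ∧ q = 0 := by omega
    rw [F.zero_o, G.zero_o]

theorem eq_of_agree {F G : Fam S T} (h : ∀ N, Agree N F G) : F = G :=
  Subtype.ext (Prod.ext (funext fun p => (h (2 * p)).1 p (by omega))
    (funext fun p => funext fun q => (h (2 * p + q)).2 p q (by omega)))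

theorem part_apply_zero (F : Fam S T) {n : ℕ} (c : Fin n → S.C) (h : n = 0) : F.1.1 n c = 0 :=
  F.1.1.apply_zero F.zero_c h c

/-- One block can be at most the total minus the minimal sizes of all other blocks. -/
theorem add_sum_le {j : ℕ} (t c : Fin j → ℕ) (h : ∀ a, c a ≤ t a) (a : Fin j) :
    t a + ∑ a, c a ≤ ∑ a, t a + c a := by
  rw [← Finset.add_sum_erase _ c (Finset.mem_univ a), ← Finset.add_sum_erase _ t (Finset.mem_univ a)]
  have := Finset.sum_le_sum fun a' (_ : a' ∈ Finset.univ.erase a) => h a'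
  omega

theorem sum_const_one (j r : ℕ) : ∑ _a : Fin j, r = j * r := by simp

theorem size_sum_add {n m i j : ℕ} (b : Fin n → Fin (i + j)) (h : Fin m → Fin j) :
    (∑ a, 2 * size b (Fin.castAdd j a)) + ∑ a, (2 * size b (Fin.natAdd i a) + size h a) =
      2 * n + m := by
  have h1 := sum_size b
  have h2 := sum_size h
  rw [Fin.sum_univ_add] at h1
  rw [Finset.sum_add_distrib, ← Finset.mul_sum, ← Finset.mul_sum, ← add_assoc, ← mul_add, h1, h2]

/-- A term of a composition vanishes unless all its blocks are nonempty. -/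
theorem mixed_term_congr {F F' : Fam T R} {G G' : Fam S T} {n m i j : ℕ} {b : Fin n → Fin (i + j)}
    {h : Fin m → Fin j} {c : Fin n → S.C} {o : Fin m → S.O}
    (H : (∀ a, 1 ≤ size b (Fin.castAdd j a)) →
      (∀ a, 1 ≤ 2 * size b (Fin.natAdd i a) + size h a) →
      F.1.2 i j
          (fun a => G.1.1 (size b (Fin.castAdd j a)) (part b (Fin.castAdd j a) c))
          (fun a => G.1.2 (size b (Fin.natAdd i a)) (size h a) (part b (Fin.natAdd i a) c)
            (part h a o)) =
      F'.1.2 i j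
          (fun a => G'.1.1 (size b (Fin.castAdd j a)) (part b (Fin.castAdd j a) c))
          (fun a => G'.1.2 (size b (Fin.natAdd i a)) (size h a) (part b (Fin.natAdd i a) c)
            (part h a o))) :
      F.1.2 i j
          (fun a => G.1.1 (size b (Fin.castAdd j a)) (part b (Fin.castAdd j a) c))
          (fun a => G.1.2 (size b (Fin.natAdd i a)) (size h a) (part b (Fin.natAdd i a) c)
            (part h a o)) =
      F'.1.2 i j
          (fun a => G'.1.1 (size b (Fin.castAdd j a)) (part b (Fin.castAdd j a) c))
          (fun a => G'.1.2 (size b (Fin.natAdd i a)) (size h a) (part b (Fin.natAdd i a) c)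
            (part h a o)) := by
  by_cases h1 : ∀ a, 1 ≤ size b (Fin.castAdd j a)
  · by_cases h2 : ∀ a, 1 ≤ 2 * size b (Fin.natAdd i a) + size h a
    · exact H h1 h2
    · push Not at h2
      obtain ⟨a, ha⟩ := h2
      rw [MultilinearMap.map_coord_zero _ a, MultilinearMap.map_coord_zero _ a]
      · exact G'.1.2.apply_zero G'.zero_o (by omega) (by omega) _ _
      · exact G.1.2.apply_zero G.zero_o (by omega) (by omega) _ _
  · push Not at h1
    obtain ⟨a, ha⟩ := h1
    rw [F.1.2.eq_zero_of_mem _ _ a (G.part_apply_zero _ (by omega)),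
      F'.1.2.eq_zero_of_mem _ _ a (G'.part_apply_zero _ (by omega))]

/-- Blocks that contribute are nonempty, so the outer component does not exceed the arguments in
weight. -/
theorem Agree.comp_left {N : ℕ} {F F' : Fam T R} (h : Agree N F F') (G : Fam S T) :
    Agree N (F.comp G) (F'.comp G) := by
  refine ⟨fun n hn => multilinear_ext_homogeneous _ _ fun d c hc => ?_,
    fun n m hn => bi_ext_homogeneous _ _ fun d e c o hc ho => ?_⟩
  · refine (composeC_apply _ _ hc).trans (Eq.trans ?_ (composeC_apply _ _ hc).symm)
    unfold closedCompose
    refine Finset.sum_congr rfl fun j hj => ?_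
    rw [h.1 j (by have := Finset.mem_range.1 hj; omega)]
  · refine (composeF_apply _ _ _ hc ho).trans (Eq.trans ?_ (composeF_apply _ _ _ hc ho).symm)
    unfold mixedCompose
    refine Finset.sum_congr rfl fun i hi => Finset.sum_congr rfl fun j hj =>
      Finset.sum_congr rfl fun b _ => Finset.sum_congr rfl fun s _ => ?_
    congr 2
    refine mixed_term_congr fun h1 h2 => ?_
    have e1 := Finset.sum_le_sum fun a (_ : a ∈ Finset.univ) => h1 a
    have e2 := Finset.sum_le_sum fun a (_ : a ∈ Finset.univ) => h2 a
    have e3 := size_sum_add b s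
    rw [← Finset.mul_sum] at e3
    rw [sum_const_one] at e1 e2
    rw [h.2 i j (by omega)]

/-- Without linear part, an outer map shares the inputs among blocks in such a way that each inner
component has strictly smaller weight. The delicate case is a single closed input of a map with open
value: there is no second block, but a closed value is weighted one lower than an open value with
the same closed arguments. -/
theorem Agree.comp_right {N : ℕ} {F : Fam T R} (hF : Agree 1 F 0) {G G' : Fam S T}
    (h : Agree N G G') : Agree (N + 1) (F.comp G) (F.comp G') := by
  refine ⟨fun n hn => multilinear_ext_homogeneous _ _ fun d c hc => ?_,
    fun n m hn => bi_ext_homogeneous _ _ fun d e c o hc ho => ?_⟩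
  · refine (composeC_apply _ _ hc).trans (Eq.trans ?_ (composeC_apply _ _ hc).symm)
    unfold closedCompose
    refine Finset.sum_congr rfl fun j hj => Finset.sum_congr rfl fun b _ => ?_
    congr 2
    by_cases hj2 : j < 2
    · rw [hF.1 j (by omega)]; rfl
    by_cases h1 : ∀ a, 1 ≤ size b a
    · congr 1
      funext a
      have e1 := add_sum_le _ _ h1 a
      rw [sum_size, sum_const_one] at e1
      rw [h.1 (size b a) (by omega)]
    · push Not at h1
      obtain ⟨a, ha⟩ := h1
      rw [MultilinearMap.map_coord_zero _ a (G.part_apply_zero _ (by omega)),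
        MultilinearMap.map_coord_zero _ a (G'.part_apply_zero _ (by omega))]
  · refine (composeF_apply _ _ _ hc ho).trans (Eq.trans ?_ (composeF_apply _ _ _ hc ho).symm)
    unfold mixedCompose
    refine Finset.sum_congr rfl fun i hi => Finset.sum_congr rfl fun j hj =>
      Finset.sum_congr rfl fun b _ => Finset.sum_congr rfl fun s _ => ?_
    congr 2
    refine mixed_term_congr fun h1 h2 => ?_
    by_cases hij : 2 * i + j < 2
    · rw [hF.2 i j hij]; rfl
    have h1' : ∀ a, 2 ≤ 2 * size b (Fin.castAdd j a) := fun a => by have := h1 a; omega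
    have e1 := Finset.sum_le_sum fun a (_ : a ∈ Finset.univ) => h1' a
    have e2 := Finset.sum_le_sum fun a (_ : a ∈ Finset.univ) => h2 a
    have e3 := size_sum_add b s
    rw [sum_const_one] at e1 e2
    congr 1
    · congr 1
      funext a
      have e4 := add_sum_le _ _ h1' a
      rw [sum_const_one] at e4
      have := a.2
      rw [h.1 _ (by omega)]
    · funext a
      have e4 := add_sum_le _ _ h2 a
      rw [sum_const_one] at e4
      rw [h.2 _ _ (by omega)]

theorem Agree.ins_left {N : ℕ} {F F' : Fam S T} (h : Agree N F F') (Q : Fam S S) {D : ℤ}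
    (hD : Odd D) (hQ : Q.HasDeg D) : Agree N (F.ins Q hD hQ) (F'.ins Q hD hQ) := by
  refine ⟨fun n hn => multilinear_ext_homogeneous _ _ fun d c hc => ?_,
    fun n m hn => bi_ext_homogeneous _ _ fun d e c o hc ho => ?_⟩
  · refine (insertC_apply _ _ hc).trans (Eq.trans ?_ (insertC_apply _ _ hc).symm)
    unfold closedInsert
    refine Finset.sum_congr rfl fun b _ => ?_
    have e := sum_size b
    rw [Fin.sum_univ_two] at e
    congr 1
    by_cases h0 : size b 0 = 0
    · rw [Q.part_apply_zero _ h0, MultilinearMap.map_coord_zero _ 0 rfl,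
        MultilinearMap.map_coord_zero _ 0 rfl]
    · rw [h.1 _ (by omega)]
  · refine (insertF_apply _ _ _ hc ho).trans (Eq.trans ?_ (insertF_apply _ _ _ hc ho).symm)
    unfold mixedInsert
    refine congrArg₂ _ (Finset.sum_congr rfl fun b _ => ?_) (Finset.sum_congr rfl fun b _ =>
      Finset.sum_congr rfl fun s _ => ?_)
    · have e := sum_size b
      rw [Fin.sum_univ_two] at e
      congr 1
      by_cases h0 : size b 0 = 0
      · rw [F.1.2.eq_zero_of_mem _ _ 0 (Q.part_apply_zero _ h0),
          F'.1.2.eq_zero_of_mem _ _ 0 (Q.part_apply_zero _ h0)]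
      · rw [h.2 _ _ (by omega)]
    · have e := sum_size b
      have e' := sum_size s
      rw [Fin.sum_univ_two] at e
      rw [Fin.sum_univ_three] at e'
      congr 1
      by_cases h0 : size b 1 = 0 ∧ size s 1 = 0
      · have h0' : ∀ c o, Q.1.2 (size b 1) (size s 1) c o = 0 :=
          fun c o => Q.1.2.apply_zero Q.zero_o h0.1 h0.2 c o
        rw [MultilinearMap.map_coord_zero _ (Fin.castAdd _ (Fin.natAdd _ 0)),
          MultilinearMap.map_coord_zero _ (Fin.castAdd _ (Fin.natAdd _ 0))]
        · rw [Fin.append_left, Fin.append_right, h0']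
        · rw [Fin.append_left, Fin.append_right, h0']
      · rw [h.2 _ _ (by omega)]

/-- If `F` vanishes below weight `N`, then in weight `N` only the linear part of `Q` is seen, since
a nonlinear component of `Q` is paired with a component of `F` of smaller weight. Passing from a
vector field to its linear part is thus a perturbation of higher weight. -/
theorem Agree.ins_right {N : ℕ} {F : Fam S T} (hF : Agree N F 0) {Q Q' : Fam S S} {D : ℤ}
    (hD : Odd D) (hQ : Q.HasDeg D) (hQ' : Q'.HasDeg D) (h : Agree 1 Q Q') :
    Agree (N + 1) (F.ins Q hD hQ) (F.ins Q' hD hQ') := by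
  refine ⟨fun n hn => multilinear_ext_homogeneous _ _ fun d c hc => ?_,
    fun n m hn => bi_ext_homogeneous _ _ fun d e c o hc ho => ?_⟩
  · refine (insertC_apply _ _ hc).trans (Eq.trans ?_ (insertC_apply _ _ hc).symm)
    unfold closedInsert
    refine Finset.sum_congr rfl fun b _ => ?_
    have e := sum_size b
    rw [Fin.sum_univ_two] at e
    congr 1
    by_cases h0 : size b 0 < 2
    · rw [h.1 _ (by omega)]
    · rw [hF.1 _ (by omega)]; rfl
  · refine (insertF_apply _ _ _ hc ho).trans (Eq.trans ?_ (insertF_apply _ _ _ hc ho).symm)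
    unfold mixedInsert
    refine congrArg₂ _ (Finset.sum_congr rfl fun b _ => ?_) (Finset.sum_congr rfl fun b _ =>
      Finset.sum_congr rfl fun s _ => ?_)
    · have e := sum_size b
      rw [Fin.sum_univ_two] at e
      congr 1
      by_cases h0 : size b 0 < 2
      · rw [h.1 _ (by omega)]
      · rw [hF.2 _ _ (by omega)]; rfl
    · have e := sum_size b
      have e' := sum_size s
      rw [Fin.sum_univ_two] at e
      rw [Fin.sum_univ_three] at e'
      congr 1
      by_cases h0 : 2 * size b 1 + size s 1 < 2
      · rw [h.2 _ _ h0]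
      · rw [hF.2 _ _ (by omega)]; rfl

/-! ### Successive approximation -/

/-- Consecutive approximations agree to growing order, so every component becomes constant. The
limit collects the stable components and agrees with each stage to the order of that stage. -/
theorem exists_limit (P : ℕ → Fam S T → Prop) {F₀ : Fam S T} (h₀ : P 0 F₀)
    (step : ∀ n F, P n F → ∃ F', P (n + 1) F' ∧ Agree n F F') :
    ∃ F : Fam S T, ∀ n, ∃ F', P n F' ∧ Agree n F F' := by
  choose! φ hφ hφ' using step
  let a : ℕ → Fam S T := fun n => Nat.rec F₀ (fun n F => φ n F) n
  have ha : ∀ n, P n (a n) := fun n => by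
    induction n with
    | zero => exact h₀
    | succ n ih => exact hφ n _ ih
  have hs : ∀ n, Agree n (a n) (a (n + 1)) := fun n => hφ' n _ (ha n)
  have hle : ∀ n m, Agree n (a n) (a (n + m)) := fun n m => by
    induction m with
    | zero => exact Agree.refl _ _
    | succ m ih => exact ih.trans ((hs (n + m)).mono (by omega))
  have hle' : ∀ n m, n ≤ m → Agree n (a n) (a m) := fun n m h => by
    obtain ⟨m, rfl⟩ := Nat.exists_eq_add_of_le h
    exact hle n m
  -- Stages `2 * p` and `2 * p + q` are late enough for these components to be final.
  refine ⟨⟨(fun p => (a (2 * p)).1.1 p, fun p q => (a (2 * p + q)).1.2 p q),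
    ⟨⟨(a 0).zero_c, (a 0).zero_o⟩, fun p => (a _).symm_c p, fun p q => (a _).symm_o p q⟩⟩,
    fun n => ⟨a n, ha n, ⟨fun p hp => ?_, fun p q hp => ?_⟩⟩⟩
  · change (a (2 * p)).1.1 p = (a n).1.1 p
    rcases le_total n (2 * p) with h | h
    · exact ((hle' _ _ h).1 p hp).symm
    · exact (hle' _ _ h).1 p (by omega)
  · change (a (2 * p + q)).1.2 p q = (a n).1.2 p q
    rcases le_total n (2 * p + q) with h | h
    · exact ((hle' _ _ h).2 p q hp).symm
    · exact (hle' _ _ h).2 p q (by omega)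

theorem HasDeg.of_agree {F : Fam S T} {s : ℤ} (h : ∀ n, ∃ F' : Fam S T, F'.HasDeg s ∧ Agree n F F') :
    F.HasDeg s := by
  refine ⟨fun p => ?_, fun p q => ?_⟩
  · obtain ⟨F', h1, h2⟩ := h (2 * p)
    rw [h2.1 p (by omega)]
    exact h1.1 p
  · obtain ⟨F', h1, h2⟩ := h (2 * p + q)
    rw [h2.2 p q (by omega)]
    exact h1.2 p q

end Fam
end Weight

/-! ## Odd vector fields -/

section Operators

variable {k : Type u} [Field k] {S : GPair.{u, v} k} {T : GPair.{u, w} k} {R : GPair.{u, x} k}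

namespace Fam

/-- The identity family. -/
def id (S : GPair.{u, v} k) : Fam S S := lin (LPair.id S)

theorem id_hasDeg : (id S).HasDeg 0 := lin_hasDeg LPair.HasDeg.id

theorem ev_id {𝔸 : TestAlg k} {z : PT 𝔸 S} (hz : z ∈ Pts 𝔸 S 0) : ev (id S) z = z := by
  unfold id
  rw [ev_lin _ hz, ap_id]

/-- The components of weight zero are exactly the linear ones; those of arity zero are absent by
definition. -/
theorem agree_one_iff (F G : Fam S T) : Agree 1 F G ↔ F.linear = G.linear := by
  constructor
  · intro h
    refine Prod.ext ?_ ?_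
    · change (MultilinearMap.ofSubsingleton k S.C T.C (0 : Fin 1)).symm (F.1.1 1) = _
      rw [h.1 1 (by omega)]
      rfl
    · change (MultilinearMap.ofSubsingleton k S.O T.O (0 : Fin 1)).symm (F.1.2 0 1 Fin.elim0) = _
      rw [h.2 0 1 (by omega)]
      rfl
  · intro h
    refine ⟨fun p hp => ?_, fun p q hp => ?_⟩
    · obtain rfl | rfl : p = 0 ∨ p = 1 := by omega
      · rw [F.zero_c, G.zero_c]
      · exact (MultilinearMap.ofSubsingleton k S.C T.C (0 : Fin 1)).symm.injective
          (congrArg Prod.fst h)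
    · obtain ⟨rfl, rfl⟩ | ⟨rfl, rfl⟩ : (p = 0 ∧ q = 0) ∨ (p = 0 ∧ q = 1) := by omega
      · rw [F.zero_o, G.zero_o]
      · refine MultilinearMap.ext fun c => ?_
        rw [Subsingleton.elim c Fin.elim0]
        exact (MultilinearMap.ofSubsingleton k S.O T.O (0 : Fin 1)).symm.injective
          (congrArg Prod.snd h)

theorem linear_lin (L : LPair S T) : (lin L).linear = L := by
  refine Prod.ext ?_ ?_ <;> (ext c; rfl)

theorem linear_add (F G : Fam S T) : (F + G).linear = F.linear + G.linear := rfl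

theorem linear_sub (F G : Fam S T) : (F - G).linear = F.linear - G.linear := rfl

theorem linear_comp (G : Fam T R) (F : Fam S T) : (G.comp F).linear = G.linear.comp F.linear := by
  refine Prod.ext (GradedSpace.ext_hom _ _ fun r x hx => ?_)
    (GradedSpace.ext_hom _ _ fun r x hx => ?_)
  · exact (composeC_apply G.1.1 F.1.1 (d := fun _ => r) (c := fun _ => x) fun _ => hx).trans
      (closedCompose_one _ _ _ _)
  · exact (composeF_apply G.1.2 F.1.1 F.1.2 (d := Fin.elim0) (e := fun _ => r) (c := Fin.elim0)
      (o := fun _ => x) (fun i => i.elim0) fun _ => hx).trans (mixedCompose_one _ _ _ _ _ _ _)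

theorem linear_ins (F : Fam S T) (Q : Fam S S) {D : ℤ} (hD : Odd D) (hQ : Q.HasDeg D) :
    (F.ins Q hD hQ).linear = F.linear.comp Q.linear := by
  refine Prod.ext (GradedSpace.ext_hom _ _ fun r x hx => ?_)
    (GradedSpace.ext_hom _ _ fun r x hx => ?_)
  · exact (insertC_apply F.1.1 Q.1.1 (d := fun _ => r) (c := fun _ => x) fun _ => hx).trans
      (closedInsert_one _ _ Q.zero_c _ _)
  · exact (insertF_apply F.1.2 Q.1.1 Q.1.2 (d := Fin.elim0) (e := fun _ => r) (c := Fin.elim0)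
      (o := fun _ => x) (fun i => i.elim0) fun _ => hx).trans
      (mixedInsert_one _ _ _ Q.zero_c Q.zero_o _ _ _ _)

theorem HasDeg.linear {F : Fam S T} {s : ℤ} (hF : F.HasDeg s) : F.linear.HasDeg s := by
  refine ⟨fun r x hx => ?_, fun r x hx => ?_⟩
  · have := hF.1 1 (fun _ => r) (fun _ => x) (fun _ => hx)
    rwa [Fin.sum_univ_one] at this
  · have := hF.2 0 1 Fin.elim0 (fun _ => r) Fin.elim0 (fun _ => x) (fun i => i.elim0) (fun _ => hx)
    rwa [Fin.sum_univ_zero, zero_add, Fin.sum_univ_one] at this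

theorem linear_precomp (F : Fam T R) (L : LPair S T) (hL : L.HasDeg 0) :
    (F.precomp L hL).linear = F.linear.comp L := by
  refine Prod.ext ?_ ?_
  · ext c; rfl
  · ext c
    change F.1.2 0 1 _ _ = F.1.2 0 1 _ _
    congr 1
    exact congrArg _ (Subsingleton.elim _ _)

theorem HasDeg.precomp {F : Fam T R} {s : ℤ} (hF : F.HasDeg s) {L : LPair S T} (hL : L.HasDeg 0) :
    (F.precomp L hL).HasDeg s := by
  refine ⟨fun p d c hc => hF.1 p d (fun i => L.1 (c i)) fun i => ?_,
    fun p q d e c o hc ho => hF.2 p q d e (fun i => L.1 (c i)) (fun i => L.2 (o i)) (fun i => ?_)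
      fun i => ?_⟩
  · have := hL.1 _ _ (hc i); rwa [add_zero] at this
  · have := hL.1 _ _ (hc i); rwa [add_zero] at this
  · have := hL.2 _ _ (ho i); rwa [add_zero] at this

theorem Agree.precomp {N : ℕ} {F G : Fam T R} (h : Agree N F G) (L : LPair S T) (hL : L.HasDeg 0) :
    Agree N (F.precomp L hL) (G.precomp L hL) := by
  refine ⟨fun p hp => ?_, fun p q hp => ?_⟩
  · change (F.1.1 p).compLinearMap _ = (G.1.1 p).compLinearMap _
    rw [h.1 p hp]
  · change Bi.precomp (F.1.2 p q) _ _ = Bi.precomp (G.1.2 p q) _ _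
    rw [h.2 p q hp]

theorem precomp_sub (F G : Fam T R) (L : LPair S T) (hL : L.HasDeg 0) :
    (F - G).precomp L hL = F.precomp L hL - G.precomp L hL := by
  refine Subtype.ext (Prod.ext ?_ ?_)
  · funext p; ext c; rfl
  · funext p q; ext c o; rfl

end Fam

variable {𝔸 : TestAlg k}

theorem inclP_smul {D : ℤ} (a : 𝔸.A) (z : PT 𝔸 S) :
    inclP 𝔸 D S (a • z) = 𝔸.incl D a • inclP 𝔸 D S z :=
  Prod.ext (inclPt_smul a z.1) (inclPt_smul a z.2)

theorem TestAlg.anticomm {D D' : ℤ} (hD : Odd D) (hD' : Odd D') {θ τ : 𝔸.A} (hθ : θ ∈ 𝔸.c D)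
    (hτ : τ ∈ 𝔸.c D') : θ * τ = -(τ * θ) := by
  rw [𝔸.comm hθ (TestAlg.c_mem_o hτ), Int.negOnePow_odd _ (hD.mul hD'), Units.neg_smul, one_smul]

theorem neg_smul_pt (a : 𝔸.A) (z : PT 𝔸 S) : (-a) • z = -(a • z) := neg_smul a z

/-- A family of odd degree, considered as a vector field. -/
structure OddField (S : GPair.{u, v} k) where
  fam : Fam S S
  D : ℤ
  odd : Odd D
  hasDeg : fam.HasDeg D

namespace OddField

/-- The infinitesimal flow of an odd vector field. -/
def flow (Q : OddField S) (θ : 𝔸.A) (z : PT 𝔸 S) : PT 𝔸 S := z + θ • ev Q.fam z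

theorem flow_mem (Q : OddField S) {θ : 𝔸.A} (hθ : θ ∈ 𝔸.c Q.D) {z : PT 𝔸 S}
    (hz : z ∈ Pts 𝔸 S 0) : Q.flow θ z ∈ Pts 𝔸 S 0 :=
  add_mem hz (smul_mem_Pts hθ (sub_self _).symm (ev_mem Q.hasDeg hz))

/-- The vector field of a linear map of odd degree. -/
def ofLin (L : LPair S S) {D : ℤ} (hD : Odd D) (hL : L.HasDeg D) : OddField S :=
  ⟨Fam.lin L, D, hD, Fam.lin_hasDeg hL⟩

theorem flow_ofLin (L : LPair S S) {D : ℤ} (hD : Odd D) (hL : L.HasDeg D) (θ : 𝔸.A)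
    {z : PT 𝔸 S} (hz : z ∈ Pts 𝔸 S 0) : (ofLin L hD hL).flow θ z = z + θ • ap L z := by
  unfold flow ofLin
  rw [ev_lin _ hz]

variable [CharZero k]

/-- Flow identities determine a value only up to the factor `θ`; over the algebra with an adjoined
letter this loses nothing. -/
theorem Fam.ext_letter (D : ℤ) {F G : Fam S T} (h : ∀ (𝔸 : TestAlg k) (z : PT 𝔸 S),
    z ∈ Pts 𝔸 S 0 → ∀ θ ∈ 𝔸.c D, θ * θ = 0 → θ • ev F z = θ • ev G z) : F = G := by
  refine Fam.ext_ev fun 𝔸 z hz => letter_smul_injP (D := D) ?_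
  rw [← ev_inclP D F hz, ← ev_inclP D G hz]
  exact h (𝔸.adjoin D) _ (inclP_mem hz) _ 𝔸.letter_c 𝔸.letter_mul_letter

theorem Fam.ext_letters (D D' : ℤ) {F G : Fam S T} (h : ∀ (𝔸 : TestAlg k) (z : PT 𝔸 S),
    z ∈ Pts 𝔸 S 0 → ∀ θ ∈ 𝔸.c D, θ * θ = 0 → ∀ τ ∈ 𝔸.c D', τ * τ = 0 →
      θ • τ • ev F z = θ • τ • ev G z) : F = G := by
  refine Fam.ext_letter D' fun 𝔸 z hz τ hτ hττ => letter_smul_injP (D := D) ?_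
  rw [inclP_smul, inclP_smul, ← ev_inclP D F hz, ← ev_inclP D G hz]
  exact h (𝔸.adjoin D) _ (inclP_mem hz) _ 𝔸.letter_c 𝔸.letter_mul_letter _
    (𝔸.incl_c hτ) (by rw [← map_mul, hττ, map_zero])

theorem ev_flow (F : Fam S T) (Q : OddField S) {θ : 𝔸.A} (hθ : θ ∈ 𝔸.c Q.D) (hθθ : θ * θ = 0)
    {z : PT 𝔸 S} (hz : z ∈ Pts 𝔸 S 0) :
    ev F (Q.flow θ z) = ev F z + θ • ev (F.ins Q.fam Q.odd Q.hasDeg) z :=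
  ev_ins F Q.odd Q.hasDeg hz hθ hθθ

/-- The insertion of an odd vector field as a linear operator. -/
def op (Q : OddField S) (T : GPair.{u, w} k) : Fam S T →ₗ[k] Fam S T where
  toFun F := F.ins Q.fam Q.odd Q.hasDeg
  map_add' F G := by
    refine Fam.ext_letter Q.D fun 𝔸 z hz θ hθ hθθ => ?_
    have h := Q.ev_flow (F + G) hθ hθθ hz
    rw [ev_add, ev_add, Q.ev_flow F hθ hθθ hz, Q.ev_flow G hθ hθθ hz, add_add_add_comm] at h
    rw [ev_add, smul_add]
    exact (add_left_cancel h).symm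
  map_smul' t F := by
    refine Fam.ext_letter Q.D fun 𝔸 z hz θ hθ hθθ => ?_
    have h := Q.ev_flow (t • F) hθ hθθ hz
    rw [ev_smul, ev_smul, Q.ev_flow F hθ hθθ hz, smul_add] at h
    rw [RingHom.id_apply, ev_smul, smul_comm θ t]
    exact (add_left_cancel h).symm

theorem ev_flow_op (F : Fam S T) (Q : OddField S) {θ : 𝔸.A} (hθ : θ ∈ 𝔸.c Q.D) (hθθ : θ * θ = 0)
    {z : PT 𝔸 S} (hz : z ∈ Pts 𝔸 S 0) :
    ev F (Q.flow θ z) = ev F z + θ • ev (Q.op T F) z := ev_flow F Q hθ hθθ hz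

theorem ev_flow_flow (F : Fam S T) (Q H : OddField S) {θ τ : 𝔸.A} (hθ : θ ∈ 𝔸.c Q.D)
    (hθθ : θ * θ = 0) (hτ : τ ∈ 𝔸.c H.D) (hττ : τ * τ = 0) {z : PT 𝔸 S} (hz : z ∈ Pts 𝔸 S 0) :
    ev F (H.flow τ (Q.flow θ z)) = ev F z + θ • ev (Q.op T F) z + τ • ev (H.op T F) z +
      τ • θ • ev (Q.op T (H.op T F)) z := by
  rw [H.ev_flow_op F hτ hττ (Q.flow_mem hθ hz), Q.ev_flow_op _ hθ hθθ hz, Q.ev_flow_op _ hθ hθθ hz,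
    smul_add, add_assoc, add_assoc, add_assoc]

/-- The graded commutator of the operators of two vector fields. -/
def bracket (Q H : OddField S) (T : GPair.{u, w} k) : Fam S T →ₗ[k] Fam S T :=
  Q.op T ∘ₗ H.op T + H.op T ∘ₗ Q.op T

theorem bracket_apply (Q H : OddField S) (F : Fam S T) :
    Q.bracket H T F = Q.op T (H.op T F) + H.op T (Q.op T F) := rfl

/-- The graded commutator measures how far the two infinitesimal flows are from commuting. As both
parameters are odd, `θ * τ = -(τ * θ)` turns the difference of the two orders into the sum `Q H + H
Q`. -/
theorem ev_bracket (Q H : OddField S) (F : Fam S T) {θ τ : 𝔸.A} (hθ : θ ∈ 𝔸.c Q.D)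
    (hθθ : θ * θ = 0) (hτ : τ ∈ 𝔸.c H.D) (hττ : τ * τ = 0) {z : PT 𝔸 S} (hz : z ∈ Pts 𝔸 S 0) :
    ev F (H.flow τ (Q.flow θ z)) = ev F (Q.flow θ (H.flow τ z)) +
      τ • θ • ev (Q.bracket H T F) z := by
  rw [ev_flow_flow F Q H hθ hθθ hτ hττ hz, ev_flow_flow F H Q hτ hττ hθ hθθ hz, bracket_apply,
    ev_add, smul_add, smul_add, smul_smul θ τ, TestAlg.anticomm Q.odd H.odd hθ hτ, neg_smul_pt,
    ← smul_smul]
  abel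

/-- In this form the vanishing says that `F` takes equal values at two points, which persists under
composing `F` with any further map. -/
theorem bracket_eq_zero_iff (Q H : OddField S) (F : Fam S T) : Q.bracket H T F = 0 ↔
    ∀ (𝔸 : TestAlg k) (z : PT 𝔸 S), z ∈ Pts 𝔸 S 0 → ∀ θ ∈ 𝔸.c Q.D, θ * θ = 0 →
      ∀ τ ∈ 𝔸.c H.D, τ * τ = 0 →
        ev F (H.flow τ (Q.flow θ z)) = ev F (Q.flow θ (H.flow τ z)) := by
  constructor
  · intro h 𝔸 z hz θ hθ hθθ τ hτ hττ
    rw [ev_bracket Q H F hθ hθθ hτ hττ hz, h, ev_zero, smul_zero, smul_zero, add_zero]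
  · intro h
    refine Fam.ext_letters H.D Q.D fun 𝔸 z hz τ hτ hττ θ hθ hθθ => ?_
    have := ev_bracket Q H F hθ hθθ hτ hττ hz
    rw [h 𝔸 z hz θ hθ hθθ τ hτ hττ, left_eq_add] at this
    rw [this, ev_zero, smul_zero, smul_zero]

/-- An odd vector field of square zero defines an operator of square zero. -/
theorem op_op (Q : OddField S) (hQ : Q.op S Q.fam = 0) (F : Fam S T) : Q.op T (Q.op T F) = 0 := by
  refine Fam.ext_letters Q.D Q.D fun 𝔸 z hz θ hθ hθθ τ hτ hττ => ?_
  -- Square zero means that the value of `Q` is unchanged along its own flow. So two flows add up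
  -- and their order is irrelevant.
  have key : ∀ θ ∈ 𝔸.c Q.D, θ * θ = 0 → ∀ τ : 𝔸.A, Q.flow τ (Q.flow θ z) =
      z + θ • ev Q.fam z + τ • ev Q.fam z := fun θ hθ hθθ τ => by
    unfold flow
    have := Q.ev_flow_op Q.fam hθ hθθ hz
    unfold flow at this
    rw [this, hQ, ev_zero, smul_zero, add_zero]
  have h1 := ev_flow_flow F Q Q hθ hθθ hτ hττ hz
  have h2 := ev_flow_flow F Q Q hτ hττ hθ hθθ hz
  rw [key θ hθ hθθ] at h1
  rw [key τ hτ hττ, add_right_comm, h1, add_right_comm (ev F z)] at h2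
  have h3 := add_left_cancel h2
  rw [smul_smul τ θ, TestAlg.anticomm Q.odd Q.odd hτ hθ, neg_smul_pt, ← smul_smul,
    neg_eq_iff_add_eq_zero] at h3
  rw [ev_zero, smul_zero, smul_zero]
  -- Interchanging the anticommuting parameters changes the sign of the second order term, so twice
  -- this term vanishes.
  have h4 : (2 : k) • θ • τ • ev (Q.op T (Q.op T F)) z = 0 := by rw [two_smul]; exact h3
  exact (smul_eq_zero.1 h4).resolve_left two_ne_zero

theorem bracket_op (Q H : OddField S) (hQ : Q.op S Q.fam = 0) (F : Fam S T) :
    Q.bracket H T (Q.op T F) = Q.op T (Q.bracket H T F) := by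
  rw [bracket_apply, bracket_apply, map_add, op_op Q hQ, op_op Q hQ, map_zero, add_zero, zero_add]

/-- The bracket of linear vector fields is a derivation. -/
theorem bracket_ofLin {d h : LPair S S} {D D' : ℤ} (hD : Odd D) (hD' : Odd D') (hd : d.HasDeg D)
    (hh : h.HasDeg D') (hDD : D + D' = 0) (hκ : (d.comp h + h.comp d).HasDeg 0) (F : Fam S T) :
    (ofLin d hD hd).bracket (ofLin h hD' hh) T F = F.der (d.comp h + h.comp d) hκ := by
  refine Fam.ext_letters D' D fun 𝔸 z hz τ hτ hττ θ hθ hθθ => ?_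
  set d' := ofLin d hD hd
  set h' := ofLin h hD' hh
  have h1 := ev_bracket d' h' F hθ hθθ hτ hττ hz
  have hz1 := d'.flow_mem hθ hz
  have hz2 := h'.flow_mem hτ hz
  have hw := d'.flow_mem hθ hz2
  have hε : τ * θ ∈ 𝔸.c 0 := by
    have := 𝔸.mul_c hτ hθ
    rwa [show D' + D = 0 from by rw [add_comm]; exact hDD] at this
  have ha := TestAlg.anticomm hD hD' hθ hτ
  have e1 : τ * θ * θ = 0 := by rw [mul_assoc, hθθ, mul_zero]
  have e2 : τ * θ * τ = 0 := by rw [mul_assoc, ha, mul_neg, ← mul_assoc, hττ, zero_mul, neg_zero]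
  have hεε : τ * θ * (τ * θ) = 0 := by rw [← mul_assoc, e2, zero_mul]
  -- The commutator of two linear flows is the flow of `d h + h d` with the even parameter `τ * θ`
  -- of square zero, to which the expansion `ev_der` applies.
  have h2 : h'.flow τ (d'.flow θ z) = d'.flow θ (h'.flow τ z) +
      (τ * θ) • ap (d.comp h + h.comp d) (d'.flow θ (h'.flow τ z)) := by
    rw [flow_ofLin _ _ _ _ hz1, flow_ofLin _ _ _ _ hz, flow_ofLin _ _ _ _ hz2,
      flow_ofLin _ _ _ _ hz]
    simp only [ap_add_pt, ap_smul, smul_add, smul_smul, ← mul_assoc, e1, e2, zero_mul, zero_smul,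
      add_zero, ap_add, ap_comp]
    rw [ha, neg_smul_pt]
    abel
  rw [h2, ev_der F hκ hw hε hεε, add_right_inj, ev_flow_flow _ _ _ hτ hττ hθ hθθ hz] at h1
  simp only [smul_add, smul_smul, ← mul_assoc, e1, e2, zero_mul, zero_smul, add_zero] at h1
  rw [smul_smul, smul_smul]
  exact h1.symm

end OddField

/-! ### Inverses -/

/-- With `U = 1 + V` the equation `G = 1 - V ∘ G` is solved by iteration, because `V` has no linear
part and composing with it raises the order of agreement. The right inverse is of the same kind and
has a right inverse itself, hence is two-sided. -/
theorem Fam.exists_inverse [CharZero k] {U : Fam S S} (hU : U.HasDeg 0) (h : U.linear = LPair.id S) :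
    ∃ G : Fam S S, G.HasDeg 0 ∧ G.linear = LPair.id S ∧
      ∀ (𝔸 : TestAlg k) (z : PT 𝔸 S), z ∈ Pts 𝔸 S 0 → ev U (ev G z) = z ∧ ev G (ev U z) = z := by
  have main : ∀ {U : Fam S S}, U.HasDeg 0 → U.linear = LPair.id S → ∃ G : Fam S S, G.HasDeg 0 ∧
      G.linear = LPair.id S ∧ ∀ (𝔸 : TestAlg k) (z : PT 𝔸 S), z ∈ Pts 𝔸 S 0 →
        ev U (ev G z) = z := by
    intro U hU h
    have hid : (Fam.id S).linear = LPair.id S := Fam.linear_lin _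
    set V := U - Fam.id S with hV
    have hVd : V.HasDeg 0 := hU.sub Fam.id_hasDeg
    have hV1 : Fam.Agree 1 V 0 :=
      Fam.Agree.sub_zero ((Fam.agree_one_iff _ _).2 (h.trans hid.symm))
    obtain ⟨G, hG⟩ := Fam.exists_limit
      (fun n G => G.HasDeg 0 ∧ Fam.Agree n G (Fam.id S - V.comp G)) (F₀ := Fam.id S)
      ⟨Fam.id_hasDeg, Fam.agree_zero _ _⟩ fun n G hG => ⟨Fam.id S - V.comp G,
        ⟨Fam.id_hasDeg.sub (hVd.comp hG.1), (Fam.Agree.refl _ _).sub (hV1.comp_right hG.2)⟩, hG.2⟩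
    have hGd : G.HasDeg 0 := Fam.HasDeg.of_agree fun n => by
      obtain ⟨F', h1, h2⟩ := hG n
      exact ⟨F', h1.1, h2⟩
    have hfix : G = Fam.id S - V.comp G := Fam.eq_of_agree fun n => by
      obtain ⟨F', h1, h2⟩ := hG n
      exact h2.trans (h1.2.trans
        (((Fam.Agree.refl _ _).sub (hV1.comp_right h2.symm)).mono (Nat.le_succ n)))
    have hev : ∀ (𝔸 : TestAlg k) (z : PT 𝔸 S), z ∈ Pts 𝔸 S 0 → ev U (ev G z) = z := by
      intro 𝔸 z hz
      have h1 : ev G z = z - ev V (ev G z) := by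
        conv_lhs => rw [hfix]
        rw [ev_sub, ev_comp V hGd hz, Fam.ev_id hz]
      rw [hV, ev_sub, Fam.ev_id (ev_mem hGd hz)] at h1
      rw [← sub_eq_zero, ← sub_eq_zero.2 h1]
      abel
    refine ⟨G, hGd, ?_, hev⟩
    -- As `V` has no linear part, neither has `V ∘ G`, so the fixed point equation gives `G` the
    -- identity as linear part.
    have h1 := (Fam.agree_one_iff _ _).1
      ((hV1.comp_left G : Fam.Agree 1 (V.comp G) ((0 : Fam S S).comp G)))
    rw [hfix, Fam.linear_sub, hid, h1, Fam.linear_comp]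
    refine Prod.ext ?_ ?_ <;> (ext c; exact sub_zero _)
  obtain ⟨G, hG, hG1, hG2⟩ := main hU h
  obtain ⟨K, hK, -, hK2⟩ := main hG hG1
  refine ⟨G, hG, hG1, fun 𝔸 z hz => ⟨hG2 𝔸 z hz, ?_⟩⟩
  have h1 := hG2 𝔸 (ev K z) (ev_mem hK hz)
  rw [hK2 𝔸 z hz] at h1
  rw [h1, hK2 𝔸 z hz]

end Operators

/-! ### Composition of pairs of linear maps -/

section Retract

variable {k : Type u} [Field k] {S : GPair.{u, v} k} {T : GPair.{u, w} k} {R : GPair.{u, x} k}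
  {R' : GPair.{u, y} k}

namespace LPair

theorem comp_assoc (K : LPair R R') (M : LPair T R) (L : LPair S T) :
    (K.comp M).comp L = K.comp (M.comp L) := rfl

theorem comp_id (L : LPair S T) : L.comp (id S) = L := rfl

theorem id_comp (L : LPair S T) : (id T).comp L = L := rfl

theorem comp_zero (M : LPair T R) : M.comp (0 : LPair S T) = 0 :=
  Prod.ext (LinearMap.comp_zero _) (LinearMap.comp_zero _)

theorem zero_comp (L : LPair S T) : (0 : LPair T R).comp L = 0 := rfl

theorem comp_add (M : LPair T R) (L L' : LPair S T) : M.comp (L + L') = M.comp L + M.comp L' :=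
  Prod.ext (LinearMap.comp_add _ _ _) (LinearMap.comp_add _ _ _)

theorem add_comp (M M' : LPair T R) (L : LPair S T) : (M + M').comp L = M.comp L + M'.comp L := rfl

theorem comp_sub (M : LPair T R) (L L' : LPair S T) : M.comp (L - L') = M.comp L - M.comp L' :=
  Prod.ext (LinearMap.comp_sub _ _ _) (LinearMap.comp_sub _ _ _)

theorem sub_comp (M M' : LPair T R) (L : LPair S T) : (M - M').comp L = M.comp L - M'.comp L := rfl

end LPair

/-! ## The derivation of a projection -/

section Der

variable {V U W : GradedSpace k} {a : V →ₗ[k] V} {b : U →ₗ[k] U}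

/-- Slots killed by `a` contribute nothing and slots fixed by `a` reproduce the value: pure
arguments are eigenvectors, and `r` is the number of slots not killed. -/
theorem sum_update_of_pure {M M' : Type*} [AddCommGroup M] [Module k M] [AddCommGroup M']
    [Module k M'] {a : M →ₗ[k] M} {p : ℕ} (c : Fin p → M) (hc : ∀ i, a (c i) = 0 ∨ a (c i) = c i) :
    ∃ r : ℕ, r ≤ p ∧ (r = 0 → ∀ i, a (c i) = 0) ∧
      ∀ F : MultilinearMap k (fun _ : Fin p => M) M',
        ∑ i, F (Function.update c i (a (c i))) = (r : k) • F c := by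
  classical
  refine ⟨(Finset.univ.filter fun i => a (c i) ≠ 0).card,
    (Finset.card_le_univ _).trans_eq (Fintype.card_fin p), fun h i => ?_, fun F => ?_⟩
  · by_contra h'
    exact Finset.notMem_empty i ((Finset.card_eq_zero.1 h) ▸ Finset.mem_filter.2 ⟨Finset.mem_univ i, h'⟩)
  · rw [Nat.cast_smul_eq_nsmul, ← Finset.sum_const, Finset.sum_filter]
    refine Finset.sum_congr rfl fun i _ => ?_
    split_ifs with h
    · rw [(hc i).resolve_left h, Function.update_eq_self]
    · push Not at h
      rw [h]
      exact F.map_coord_zero i (Function.update_self _ _ _)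

theorem Bi.der_of_pure {p q : ℕ} {c : Fin p → V} {o : Fin q → U}
    (hc : ∀ i, a (c i) = 0 ∨ a (c i) = c i) (ho : ∀ i, b (o i) = 0 ∨ b (o i) = o i) :
    ∃ r : ℕ, r ≤ p + q ∧ (r = 0 → (∀ i, a (c i) = 0) ∧ ∀ i, b (o i) = 0) ∧
      ∀ φ : Bi k V U W p q, Bi.der φ a b c o = (r : k) • φ c o := by
  obtain ⟨r, h1, h2, h3⟩ := sum_update_of_pure (M' := W) c hc
  obtain ⟨r', h1', h2', h3'⟩ := sum_update_of_pure (M' := W) o ho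
  refine ⟨r + r', by omega, fun h => ⟨h2 (by omega), h2' (by omega)⟩, fun φ => ?_⟩
  rw [Bi.der_apply, h3', Nat.cast_add, add_smul]
  exact congrArg (· + _) (h3 (φ.fixOpen o))

theorem span_pure {M : Type*} [AddCommGroup M] [Module k M] {a : M →ₗ[k] M}
    (ha : ∀ x, a (a x) = a x) (x : M) :
    x ∈ Submodule.span k {x | a x = 0 ∨ a x = x} := by
  rw [← sub_add_cancel x (a x)]
  exact add_mem (Submodule.subset_span (Or.inl (by rw [map_sub, ha, sub_self])))
    (Submodule.subset_span (Or.inr (ha x)))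

theorem bi_eq_zero_of_pure (ha : ∀ x, a (a x) = a x) (hb : ∀ x, b (b x) = b x) {p q : ℕ}
    (φ : Bi k V U W p q) (h : ∀ c o, (∀ i, a (c i) = 0 ∨ a (c i) = c i) →
      (∀ i, b (o i) = 0 ∨ b (o i) = o i) → φ c o = 0) : φ = 0 := by
  ext c o
  exact bi_eq_of_span φ 0 _ _ (fun c o hc ho => h c o hc ho) c o (fun i => span_pure ha (c i))
    fun i => span_pure hb (o i)

variable [CharZero k]

/-- In characteristic zero the eigenvalue is invertible unless all arguments lie in the kernels, and
there `φ` vanishes by assumption. -/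
theorem bi_eq_zero_of_der (ha : ∀ x, a (a x) = a x) (hb : ∀ x, b (b x) = b x) {p q : ℕ}
    (φ : Bi k V U W p q) (h : Bi.der φ a b = 0)
    (h0 : ∀ c o, (∀ i, a (c i) = 0) → (∀ i, b (o i) = 0) → φ c o = 0) : φ = 0 := by
  refine bi_eq_zero_of_pure ha hb φ fun c o hc ho => ?_
  obtain ⟨r, -, h2, h3⟩ := Bi.der_of_pure (W := W) hc ho
  by_cases hr : r = 0
  · exact h0 c o (h2 hr).1 (h2 hr).2
  · have h4 := h3 φ
    rw [h] at h4
    exact (smul_eq_zero.1 h4.symm).resolve_left (Nat.cast_ne_zero.2 hr)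

/-- The iteration applies the factors `1 - der / (j + 1)`. An argument tuple of eigenvalue `r ≥ 1`
is killed by the factor `j + 1 = r`; eigenvalue zero is excluded by the hypothesis on `φ 0`. -/
theorem bi_eq_zero_of_iterate (ha : ∀ x, a (a x) = a x) (hb : ∀ x, b (b x) = b x) {p q : ℕ}
    (φ : ℕ → Bi k V U W p q)
    (hφ : ∀ j, φ (j + 1) = φ j - ((j + 1 : ℕ) : k)⁻¹ • Bi.der (φ j) a b)
    (h0 : ∀ c o, (∀ i, a (c i) = 0) → (∀ i, b (o i) = 0) → φ 0 c o = 0) {M : ℕ} (hM : p + q ≤ M) :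
    φ M = 0 := by
  refine bi_eq_zero_of_pure ha hb _ fun c o hc ho => ?_
  obtain ⟨r, hr, h2, h3⟩ := Bi.der_of_pure (W := W) hc ho
  have hs : ∀ j, φ (j + 1) c o = φ j c o - ((j + 1 : ℕ) : k)⁻¹ • (r : k) • φ j c o := fun j => by
    rw [hφ, sub_apply, sub_apply, smul_apply, smul_apply, h3]
  have hr0 : φ r c o = 0 := by
    cases r with
    | zero => exact h0 c o (h2 rfl).1 (h2 rfl).2
    | succ r =>
      rw [hs, smul_smul, inv_mul_cancel₀ (Nat.cast_ne_zero.2 r.succ_ne_zero), one_smul, sub_self]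
  have : ∀ j, r ≤ j → φ j c o = 0 := fun j hj => by
    induction j, hj using Nat.le_induction with
    | base => exact hr0
    | succ j _ ih => rw [hs, ih, smul_zero, smul_zero, sub_zero]
  exact this M (hr.trans hM)

end Der

/-! ### The derivation of a projection acting on families -/

theorem update_mem_deg {V : GradedSpace k} {a : V →ₗ[k] V} (ha : GradedSpace.HasDeg a 0) {p : ℕ}
    {d : Fin p → ℤ} {c : Fin p → V} (hc : ∀ i, c i ∈ V.deg (d i)) (i j : Fin p) :
    Function.update c i (a (c i)) j ∈ V.deg (d j) := by
  by_cases h : j = i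
  · subst h
    rw [Function.update_self]
    have := ha _ _ (hc j)
    rwa [add_zero] at this
  · rw [Function.update_of_ne h]; exact hc j

namespace Fam

theorem HasDeg.der {F : Fam S T} {s : ℤ} (hF : F.HasDeg s) {L : LPair S S} (hL : L.HasDeg 0) :
    (F.der L hL).HasDeg s := by
  refine ⟨fun p d c hc => ?_, fun p q d e c o hc ho => ?_⟩
  · change F.1.1.der L.1 p c ∈ _
    rw [ClosedMaps.der_apply]
    exact sum_mem fun i _ => hF.1 p d _ (update_mem_deg hL.1 hc i)
  · change Bi.der (F.1.2 p q) L.1 L.2 c o ∈ _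
    rw [Bi.der_apply]
    exact add_mem (sum_mem fun i _ => hF.2 p q d e _ _ (update_mem_deg hL.1 hc i) ho)
      (sum_mem fun i _ => hF.2 p q d e _ _ hc (update_mem_deg hL.2 ho i))

theorem Agree.der_zero {N : ℕ} {F : Fam S T} (hF : Agree N F 0) {L : LPair S S} (hL : L.HasDeg 0) :
    Agree N (F.der L hL) 0 := by
  refine ⟨fun p hp => ?_, fun p q hp => ?_⟩
  · ext c
    change F.1.1.der L.1 p c = 0
    rw [ClosedMaps.der_apply, hF.1 p hp]
    exact Finset.sum_eq_zero fun _ _ => rfl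
  · ext c o
    change Bi.der (F.1.2 p q) L.1 L.2 c o = 0
    rw [Bi.der_apply, hF.2 p q hp]
    exact (congrArg₂ _ (Finset.sum_eq_zero fun _ _ => rfl) (Finset.sum_eq_zero fun _ _ => rfl)).trans
      (add_zero 0)

theorem precomp_add (F G : Fam T R) (L : LPair S T) (hL : L.HasDeg 0) :
    (F + G).precomp L hL = F.precomp L hL + G.precomp L hL := by
  refine Subtype.ext (Prod.ext ?_ ?_)
  · funext p; ext c; rfl
  · funext p q; ext c o; rfl

theorem precomp_smul (t : k) (F : Fam T R) (L : LPair S T) (hL : L.HasDeg 0) :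
    (t • F).precomp L hL = t • F.precomp L hL := by
  refine Subtype.ext (Prod.ext ?_ ?_)
  · funext p; ext c; rfl
  · funext p q; ext c o; rfl

theorem zero_precomp (L : LPair S T) (hL : L.HasDeg 0) : (0 : Fam T R).precomp L hL = 0 := by
  refine Subtype.ext (Prod.ext ?_ ?_)
  · funext p; ext c; rfl
  · funext p q; ext c o; rfl

theorem der_precomp (F : Fam T R) {L : LPair T T} (hL : L.HasDeg 0) {π : LPair S T}
    (hπ : π.HasDeg 0) (h : L.comp π = 0) : (F.der L hL).precomp π hπ = 0 := by
  have h1 : ∀ x, L.1 (π.1 x) = 0 := fun x => LinearMap.congr_fun (congrArg Prod.fst h) x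
  have h2 : ∀ x, L.2 (π.2 x) = 0 := fun x => LinearMap.congr_fun (congrArg Prod.snd h) x
  refine Subtype.ext (Prod.ext ?_ ?_)
  · funext p
    ext c
    change F.1.1.der L.1 p (fun i => π.1 (c i)) = 0
    rw [ClosedMaps.der_apply]
    exact Finset.sum_eq_zero fun i _ => MultilinearMap.map_coord_zero _ i
      ((Function.update_self _ _ _).trans (h1 _))
  · funext p q
    ext c o
    change Bi.der (F.1.2 p q) L.1 L.2 (fun i => π.1 (c i)) (fun i => π.2 (o i)) = 0
    rw [Bi.der_apply, Finset.sum_eq_zero, Finset.sum_eq_zero, add_zero]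
    · exact fun i _ => MultilinearMap.map_coord_zero _ i ((Function.update_self _ _ _).trans (h2 _))
    · exact fun i _ => F.1.2.eq_zero_of_mem _ _ i ((Function.update_self _ _ _).trans (h1 _))

end Fam

/-- Complementary projections of degree zero. -/
structure IsSplitting (κ π : LPair S S) : Prop where
  κ_deg : κ.HasDeg 0
  π_deg : π.HasDeg 0
  sum : κ + π = LPair.id S
  κ_π : κ.comp π = 0

namespace IsSplitting

variable {κ π : LPair S S} (hs : IsSplitting κ π)
include hs

theorem κ_κ : κ.comp κ = κ := by
  have := congrArg (LPair.comp κ) hs.sum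
  rwa [LPair.comp_add, hs.κ_π, add_zero, LPair.comp_id] at this

theorem κ_κ_c (x : S.C) : κ.1 (κ.1 x) = κ.1 x := LinearMap.congr_fun (congrArg Prod.fst hs.κ_κ) x

theorem κ_κ_o (x : S.O) : κ.2 (κ.2 x) = κ.2 x := LinearMap.congr_fun (congrArg Prod.snd hs.κ_κ) x

theorem π_c {x : S.C} (hx : κ.1 x = 0) : π.1 x = x := by
  have : κ.1 x + π.1 x = x := LinearMap.congr_fun (congrArg Prod.fst hs.sum) x
  rwa [hx, zero_add] at this

theorem π_o {x : S.O} (hx : κ.2 x = 0) : π.2 x = x := by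
  have : κ.2 x + π.2 x = x := LinearMap.congr_fun (congrArg Prod.snd hs.sum) x
  rwa [hx, zero_add] at this

theorem vanish_o {F : Fam S T} (hF : F.precomp π hs.π_deg = 0) {p q : ℕ} (c : Fin p → S.C)
    (o : Fin q → S.O) (hc : ∀ i, κ.1 (c i) = 0) (ho : ∀ i, κ.2 (o i) = 0) : F.1.2 p q c o = 0 := by
  have h : F.1.2 p q (fun i => π.1 (c i)) (fun i => π.2 (o i)) = 0 :=
    congrArg (fun F : Fam S T => F.1.2 p q c o) hF
  rwa [funext fun i => hs.π_c (hc i), funext fun i => hs.π_o (ho i)] at h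

theorem vanish_c {F : Fam S T} (hF : F.precomp π hs.π_deg = 0) {p q : ℕ} (c : Fin p → S.C)
    (o : Fin q → S.O) (hc : ∀ i, κ.1 (c i) = 0) : F.1.1.toMixed S.O p q c o = 0 := by
  cases q with
  | zero =>
    have h : F.1.1 p (fun i => π.1 (c i)) = 0 := congrArg (fun F : Fam S T => F.1.1 p c) hF
    rwa [funext fun i => hs.π_c (hc i)] at h
  | succ q => rfl

variable [CharZero k]

/-- The derivation is injective on the families vanishing on the image of the projection. -/
theorem agree_zero_of_der {F : Fam S T} (hF : F.precomp π hs.π_deg = 0) {N : ℕ}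
    (h : Fam.Agree N (F.der κ hs.κ_deg) 0) : Fam.Agree N F 0 := by
  refine ⟨fun p hp => ?_, fun p q hp => ?_⟩
  · have h1 : F.1.1.toMixed S.O p 0 = 0 := by
      refine bi_eq_zero_of_der hs.κ_κ_c hs.κ_κ_o _ ?_ fun c o hc ho => hs.vanish_c hF c o hc
      have h2 := congrFun (congrFun (ClosedMaps.toMixed_der (U := S.O) F.1.1 κ.1 κ.2) p) 0
      refine h2.trans ?_
      ext c o
      exact congrArg (fun φ : MultilinearMap k (fun _ : Fin p => S.C) T.C => φ c) (h.1 p hp)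
    ext c
    exact congrArg (fun φ : Bi k S.C S.O T.C p 0 => φ c Fin.elim0) h1
  · exact bi_eq_zero_of_der hs.κ_κ_c hs.κ_κ_o _ (h.2 p q hp) fun c o hc ho => hs.vanish_o hF c o hc ho

/-- The derivation is surjective on the families vanishing on the image of the projection. -/
theorem exists_der_agree {E : Fam S T →ₗ[k] Fam S T} (hE : ∀ F, E F = F.der κ hs.κ_deg) {s : ℤ}
    {F : Fam S T} (hFs : F.HasDeg s) (hF : F.precomp π hs.π_deg = 0) {N : ℕ}
    (hFN : Fam.Agree N F 0) : ∃ X : Fam S T, X.HasDeg s ∧ X.precomp π hs.π_deg = 0 ∧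
      Fam.Agree N X 0 ∧ Fam.Agree (N + 1) (E X) F := by
  -- The remainders `r n = ∏ (1 - E / j) F` over `1 ≤ j ≤ n`. Each `F - r n` lies in the image of
  -- `E`, and in bounded weight `r n` vanishes for large `n`, so no explicit inverse of `E` is
  -- needed.
  let r : ℕ → Fam S T := fun n => Nat.rec F (fun j G => G - ((j + 1 : ℕ) : k)⁻¹ • E G) n
  have hr : ∀ j, r (j + 1) = r j - ((j + 1 : ℕ) : k)⁻¹ • E (r j) := fun j => rfl
  have hP : ∀ j, (r j).HasDeg s ∧ (r j).precomp π hs.π_deg = 0 ∧ Fam.Agree N (r j) 0 := fun j => by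
    induction j with
    | zero => exact ⟨hFs, hF, hFN⟩
    | succ j ih =>
      rw [hr, hE]
      refine ⟨ih.1.sub ((ih.1.der _).smul _), ?_, ?_⟩
      · rw [Fam.precomp_sub, Fam.precomp_smul, ih.2.1, Fam.der_precomp _ _ _ hs.κ_π, smul_zero]
        exact sub_zero (0 : Fam S T)
      · have := ih.2.2.sub ((ih.2.2.der_zero hs.κ_deg).smul ((j + 1 : ℕ) : k)⁻¹)
        rwa [smul_zero, sub_zero (0 : Fam S T)] at this
  have hX : ∀ j, ∃ X : Fam S T, (X.HasDeg s ∧ X.precomp π hs.π_deg = 0 ∧ Fam.Agree N X 0) ∧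
      E X = F - r j := fun j => by
    induction j with
    | zero =>
      refine ⟨0, ⟨?_, Fam.zero_precomp _ _, Fam.Agree.refl _ _⟩, by rw [map_zero]; exact (sub_self F).symm⟩
      have := hFs.sub hFs
      rwa [sub_self F] at this
    | succ j ih =>
      obtain ⟨X, ⟨h1, h2, h3⟩, h4⟩ := ih
      refine ⟨X + ((j + 1 : ℕ) : k)⁻¹ • r j, ⟨h1.add ((hP j).1.smul _), ?_, ?_⟩, ?_⟩
      · rw [Fam.precomp_add, Fam.precomp_smul, h2, (hP j).2.1, smul_zero, add_zero]
      · have := h3.add ((hP j).2.2.smul ((j + 1 : ℕ) : k)⁻¹)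
        rwa [smul_zero, add_zero (0 : Fam S T)] at this
      · rw [map_add, map_smul, h4, hr]
        abel
  -- Components of weight at most `N` have at most `N + 2` arguments, hence no larger eigenvalue.
  obtain ⟨X, ⟨h1, h2, h3⟩, h4⟩ := hX (N + 2)
  refine ⟨X, h1, h2, h3, ?_⟩
  have hz : Fam.Agree (N + 1) (r (N + 2)) 0 := by
    refine ⟨fun p hp => ?_, fun p q hp => ?_⟩
    · have h5 := bi_eq_zero_of_iterate hs.κ_κ_c hs.κ_κ_o
        (fun j => (r j).1.1.toMixed S.O p 0) (fun j => ?_) (fun c o hc _ => hs.vanish_c hF c o hc)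
        (M := N + 2) (by omega)
      · ext c
        exact congrArg (fun φ : Bi k S.C S.O T.C p 0 => φ c Fin.elim0) h5
      · have h2 := congrFun (congrFun (ClosedMaps.toMixed_der (U := S.O) (r j).1.1 κ.1 κ.2) p) 0
        change _ = _ - _ • ((r j).1.1.toMixed S.O).der κ.1 κ.2 p 0
        rw [h2, hr, hE]
        ext c o
        rfl
    · refine bi_eq_zero_of_iterate hs.κ_κ_c hs.κ_κ_o
        (fun j => (r j).1.2 p q) (fun j => ?_) (fun c o hc ho => hs.vanish_o hF c o hc ho)
        (M := N + 2) (by omega)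
      simp only [hr, hE]
      rfl
  rw [h4]
  have := (Fam.Agree.refl (N + 1) F).sub hz
  rwa [sub_zero F] at this

end IsSplitting

end Retract

/-! ## Homotopy retracts -/

section Retract

variable {k : Type u} [Field k] {S : GPair.{u, v} k} {T : GPair.{u, w} k}

theorem odd_neg_one : Odd (-1 : ℤ) := ⟨-1, rfl⟩

theorem Fam.map_sub (L : Fam S T →ₗ[k] Fam S T) (F G : Fam S T) : L (F - G) = L F - L G :=
  eq_sub_of_add_eq (a := L (F - G)) (b := L F) (c := L G) ((L.map_add (F - G) G).symm.trans (congrArg L (sub_add_cancel F G)))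

section

variable [CharZero k]

theorem Fam.Agree.op {n : ℕ} {F G : Fam S T} (h : Fam.Agree n F G) (Q : OddField S) :
    Fam.Agree n (Q.op T F) (Q.op T G) := h.ins_left Q.fam Q.odd Q.hasDeg

theorem Fam.HasDeg.op {F : Fam S T} {s : ℤ} (h : F.HasDeg s) (Q : OddField S) :
    (Q.op T F).HasDeg (s + Q.D) := h.ins Q.odd Q.hasDeg

theorem OddField.linear_op (F : Fam S T) (Q : OddField S) :
    (Q.op T F).linear = F.linear.comp Q.fam.linear := Fam.linear_ins F Q.fam Q.odd Q.hasDeg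

end

/-- A vector field of degree one together with a contraction of its linear part onto the image of a
projection which is preserved by the vector field. -/
structure Retract (S : GPair.{u, v} k) where
  Q : Fam S S
  Q_deg : Q.HasDeg 1
  h : LPair S S
  h_deg : h.HasDeg (-1)
  π : LPair S S
  π_deg : π.HasDeg 0
  sum : Q.linear.comp h + h.comp Q.linear + π = LPair.id S
  h_π : h.comp π = 0
  d_π : Q.linear.comp π = 0
  stable : ∀ (𝔸 : TestAlg k) (z : PT 𝔸 S), z ∈ Pts 𝔸 S 0 → ap h (ev Q (ap π z)) = 0

namespace Retract

variable (ρ : Retract S)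

/-- The differential. -/
def d : LPair S S := ρ.Q.linear

theorem d_deg : ρ.d.HasDeg 1 := ρ.Q_deg.linear

/-- The vector field. -/
def field : OddField S := ⟨ρ.Q, 1, odd_one, ρ.Q_deg⟩

/-- The linear part of the vector field. -/
def lfield : OddField S := OddField.ofLin ρ.d odd_one ρ.d_deg

/-- The contraction as a vector field. -/
def hfield : OddField S := OddField.ofLin ρ.h odd_neg_one ρ.h_deg

theorem isSplitting : IsSplitting (ρ.d.comp ρ.h + ρ.h.comp ρ.d) ρ.π where
  κ_deg := (ρ.d_deg.comp ρ.h_deg (by norm_num)).add (ρ.h_deg.comp ρ.d_deg (by norm_num))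
  π_deg := ρ.π_deg
  sum := ρ.sum
  κ_π := by
    rw [LPair.add_comp, LPair.comp_assoc, LPair.comp_assoc, ρ.h_π]
    unfold d
    rw [ρ.d_π, LPair.comp_zero, LPair.comp_zero, add_zero]

variable {𝔸 : TestAlg k}

theorem hflow_eq {τ : 𝔸.A} {z : PT 𝔸 S} (hz : z ∈ Pts 𝔸 S 0) (h : ap ρ.h z = 0) :
    ρ.hfield.flow τ z = z := by
  unfold hfield
  rw [OddField.flow_ofLin _ _ _ _ hz, h, smul_zero, add_zero]

theorem ap_h_π (z : PT 𝔸 S) : ap ρ.h (ap ρ.π z) = 0 := by rw [← ap_comp, ρ.h_π, ap_zero]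

variable [CharZero k]

/-- The derivation by the linear part of the vector field and the contraction. -/
def E (T : GPair.{u, w} k) : Fam S T →ₗ[k] Fam S T := ρ.lfield.bracket ρ.hfield T

/-- The perturbed derivation. -/
def N (T : GPair.{u, w} k) : Fam S T →ₗ[k] Fam S T := ρ.field.bracket ρ.hfield T

theorem E_apply (F : Fam S T) : ρ.E T F = F.der _ ρ.isSplitting.κ_deg :=
  OddField.bracket_ofLin odd_one odd_neg_one ρ.d_deg ρ.h_deg (by norm_num) _ F

/-- On families vanishing below weight `n` the vector field acts in weight `n` through its linear
part, so `E` is the leading part of the perturbed derivation. -/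
theorem agree_N_E {n : ℕ} {X : Fam S T} (h : Fam.Agree n X 0) :
    Fam.Agree (n + 1) (ρ.N T X) (ρ.E T X) := by
  have hQ : Fam.Agree 1 ρ.Q (Fam.lin ρ.d) :=
    (Fam.agree_one_iff _ _).2 (Fam.linear_lin _).symm
  have key : ∀ {X : Fam S T}, Fam.Agree n X 0 →
      Fam.Agree (n + 1) (ρ.field.op T X) (ρ.lfield.op T X) := fun h =>
    h.ins_right odd_one ρ.Q_deg (Fam.lin_hasDeg ρ.d_deg) hQ
  have h1 := h.op ρ.hfield
  rw [map_zero] at h1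
  exact (key h1).add ((key h).op ρ.hfield)

theorem agree_N {n : ℕ} {F G : Fam S T} (h : Fam.Agree n F G) :
    Fam.Agree n (ρ.N T F) (ρ.N T G) := by
  unfold N
  rw [OddField.bracket_apply, OddField.bracket_apply]
  exact ((h.op ρ.hfield).op ρ.field).add ((h.op ρ.field).op ρ.hfield)

theorem N_deg {F : Fam S T} {s : ℤ} (h : F.HasDeg s) : (ρ.N T F).HasDeg s := by
  have h1 : (ρ.field.op T (ρ.hfield.op T F)).HasDeg (s + -1 + 1) := (h.op ρ.hfield).op ρ.field
  have h2 : (ρ.hfield.op T (ρ.field.op T F)).HasDeg (s + 1 + -1) := (h.op ρ.field).op ρ.hfield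
  rw [neg_add_cancel_right] at h1
  rw [add_neg_cancel_right] at h2
  unfold N
  rw [OddField.bracket_apply]
  exact h1.add h2

/-- The contraction vanishes at points of the image of `π` and, by `stable`, also after flowing
along `Q` from there. Its flow is then trivial at both places, so the two flows commute on the
image. -/
theorem N_precomp (F : Fam S T) : (ρ.N T F).precomp ρ.π ρ.π_deg = 0 := by
  refine OddField.Fam.ext_letters (-1) 1 fun 𝔸 z hz τ hτ hττ θ hθ hθθ => ?_
  have hz' : ap ρ.π z ∈ Pts 𝔸 S 0 := ap_mem ρ.π_deg hz
  have h1 := OddField.ev_bracket ρ.field ρ.hfield F hθ hθθ hτ hττ hz'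
  rw [ρ.hflow_eq hz' (ρ.ap_h_π z), ρ.hflow_eq (ρ.field.flow_mem hθ hz'), left_eq_add] at h1
  · rw [ev_precomp, ev_zero, smul_zero, smul_zero]
    exact h1
  · unfold OddField.flow
    rw [ap_add_pt, ap_smul, ρ.ap_h_π]
    unfold field
    dsimp only
    rw [ρ.stable 𝔸 z hz, smul_zero, add_zero]

/-- The linear part is `b (d h + h d) = b (1 - π) = 0`. This starts the successive approximation. -/
theorem N_lin_linear {b : LPair S T} (hb : b.comp ρ.π = b) : (ρ.N T (Fam.lin b)).linear = 0 := by
  have h1 : (ρ.N T (Fam.lin b)).linear = b.comp (ρ.Q.linear.comp ρ.h + ρ.h.comp ρ.Q.linear) := by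
    have e1 : ρ.field.fam.linear = ρ.Q.linear := rfl
    have e2 : ρ.hfield.fam.linear = ρ.h := Fam.linear_lin ρ.h
    unfold N
    rw [OddField.bracket_apply, Fam.linear_add, OddField.linear_op, OddField.linear_op,
      OddField.linear_op, OddField.linear_op, Fam.linear_lin, e1, e2, LPair.comp_add,
      LPair.comp_assoc, LPair.comp_assoc, add_comm]
  have h2 := congrArg (LPair.comp b) ρ.sum
  rw [LPair.comp_add, hb, LPair.comp_id, add_eq_right] at h2
  rw [h1, h2]

/-- Every linear map which factors over the projection extends to an invariant family. -/
theorem exists_extension {b : LPair S T} (hb0 : b.HasDeg 0) (hb : b.comp ρ.π = b) :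
    ∃ p : Fam S T, p.HasDeg 0 ∧ p.linear = b ∧
      p.precomp ρ.π ρ.π_deg = (Fam.lin b).precomp ρ.π ρ.π_deg ∧ ρ.N T p = 0 := by
  obtain ⟨p, hp⟩ := Fam.exists_limit (fun n F => F.HasDeg 0 ∧
    F.precomp ρ.π ρ.π_deg = (Fam.lin b).precomp ρ.π ρ.π_deg ∧ Fam.Agree 1 F (Fam.lin b) ∧
    Fam.Agree (n + 1) (ρ.N T F) 0) (F₀ := Fam.lin b)
    ⟨Fam.lin_hasDeg hb0, rfl, Fam.Agree.refl _ _, (Fam.agree_one_iff _ _).2 (ρ.N_lin_linear hb)⟩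
    fun n F hF => by
      -- The error `N F` vanishes below weight `n + 1` and on the image of `π`, so its leading part
      -- is `E X`. Subtracting `X` improves the error by one weight without changing the restriction
      -- or the linear part.
      obtain ⟨X, h1, h2, h3, h4⟩ := ρ.isSplitting.exists_der_agree ρ.E_apply (ρ.N_deg hF.1)
        (ρ.N_precomp F) hF.2.2.2
      refine ⟨F - X, ⟨?_, ?_, ?_, ?_⟩, ?_⟩
      · have := hF.1.sub h1
        exact this
      · rw [Fam.precomp_sub, h2, hF.2.1]
        exact sub_zero ((Fam.lin b).precomp ρ.π ρ.π_deg)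
      · have := hF.2.2.1.sub (h3.mono (Nat.le_add_left 1 n))
        rwa [sub_zero (Fam.lin b)] at this
      · rw [Fam.map_sub]
        have := (Fam.Agree.refl (n + 1 + 1) (ρ.N T F)).sub ((ρ.agree_N_E h3).trans h4)
        rwa [sub_self (ρ.N T F)] at this
      · have := (Fam.Agree.refl n F).sub (h3.mono (Nat.le_succ n)).symm
        rwa [sub_zero F] at this
  refine ⟨p, Fam.HasDeg.of_agree fun n => ?_, ?_, ?_, ?_⟩
  · obtain ⟨F', h1, h2⟩ := hp n
    exact ⟨F', h1.1, h2⟩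
  · obtain ⟨F', h1, h2⟩ := hp 1
    rw [(Fam.agree_one_iff _ _).1 (h2.trans h1.2.2.1), Fam.linear_lin]
  · refine Fam.eq_of_agree fun n => ?_
    obtain ⟨F', h1, h2⟩ := hp n
    rw [← h1.2.1]
    exact h2.precomp _ _
  · refine Fam.eq_of_agree fun n => ?_
    obtain ⟨F', h1, h2⟩ := hp n
    exact (ρ.agree_N h2).trans (h1.2.2.2.mono (Nat.le_succ n))

/-- Invariant families are determined by their restriction to the image of the projection. -/
theorem eq_zero_of_N {F : Fam S T} (h : ρ.N T F = 0) (hπ : F.precomp ρ.π ρ.π_deg = 0) : F = 0 := by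
  refine Fam.eq_of_agree fun n => ?_
  induction n with
  | zero => exact Fam.agree_zero _ _
  | succ n ih =>
    -- The lowest component of `F` is killed by `E` and vanishes on the image of `π`, hence is zero.
    refine ρ.isSplitting.agree_zero_of_der hπ ?_
    rw [← ρ.E_apply F, ← h]
    exact (ρ.agree_N_E ih).symm

end Retract
end Retract

/-! ## Complexes of graded vector spaces -/

section Complexes

variable {k : Type u} [Field k]

namespace GradedSpace

variable {V : GradedSpace.{u, v} k} {W : GradedSpace.{u, w} k} {X : GradedSpace.{u, x} k}

theorem proj_comp {L : V →ₗ[k] W} {t : ℤ} (hL : HasDeg L t) {r r' : ℤ} (h : r' = r + t) (x : V) :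
    W.proj r' (L x) = L (V.proj r x) := by
  subst h
  refine LinearMap.congr_fun (ext_hom (W.proj (r + t) ∘ₗ L) (L ∘ₗ V.proj r) fun q x hx => ?_) x
  rw [LinearMap.comp_apply, LinearMap.comp_apply]
  by_cases h : q = r
  · subst h
    rw [proj_same hx, proj_same (hL _ _ hx)]
  · rw [proj_ne h hx, map_zero, proj_ne (fun h' => h (add_right_cancel h')) (hL _ _ hx)]

theorem hpart_comp_left {L : W →ₗ[k] X} {t : ℤ} (hL : HasDeg L t) (b : V →ₗ[k] W) {s r : ℤ}
    (h : r = s + t) : hpart (L ∘ₗ b) r = L ∘ₗ hpart b s := by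
  refine ext_hom _ _ fun q x hx => ?_
  rw [hpart_apply _ _ hx, LinearMap.comp_apply, LinearMap.comp_apply, hpart_apply _ _ hx]
  exact proj_comp hL (by rw [h, add_assoc]) _

theorem hpart_comp_right (b : W →ₗ[k] X) {L : V →ₗ[k] W} {t : ℤ} (hL : HasDeg L t) {s r : ℤ}
    (h : r = t + s) : hpart (b ∘ₗ L) r = hpart b s ∘ₗ L := by
  refine ext_hom _ _ fun q x hx => ?_
  rw [hpart_apply _ _ hx, LinearMap.comp_apply, LinearMap.comp_apply, hpart_apply _ _ (hL _ _ hx),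
    h, add_assoc]

theorem hpart_of_hasDeg {L : V →ₗ[k] W} {s : ℤ} (hL : HasDeg L s) : hpart L s = L :=
  ext_hom _ _ fun q x hx => by rw [hpart_apply _ _ hx, proj_same (hL _ _ hx)]

/-- Over a field the surjection onto the range has a section, and this extends from the range to the
whole space. -/
theorem exists_generalized_inverse (d : V →ₗ[k] V) : ∃ s : V →ₗ[k] V, d ∘ₗ s ∘ₗ d = d := by
  obtain ⟨g, hg⟩ := d.rangeRestrict.exists_rightInverse_of_surjective d.range_rangeRestrict
  obtain ⟨s, hs⟩ := g.exists_extend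
  refine ⟨s, LinearMap.ext fun x => ?_⟩
  have h1 : s (d x) = g (d.rangeRestrict x) := LinearMap.congr_fun hs (d.rangeRestrict x)
  have h2 := LinearMap.congr_fun hg (d.rangeRestrict x)
  rw [LinearMap.comp_apply, LinearMap.comp_apply, h1]
  exact congrArg Subtype.val h2

/-- The part `s` of degree -1 of a generalized inverse still satisfies `d s d = d`. Then `s d s`
satisfies `h d h = h` as well, and the factor `1 - s d` forces `h h = 0` without spoiling the other
identities. -/
theorem exists_contraction {d : V →ₗ[k] V} (hd : HasDeg d 1) (hdd : ∀ x, d (d x) = 0) :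
    ∃ h : V →ₗ[k] V, HasDeg h (-1) ∧ (∀ x, h (h x) = 0) ∧ (∀ x, d (h (d x)) = d x) ∧
      ∀ x, h (d (h x)) = h x := by
  obtain ⟨s₀, hs₀⟩ := exists_generalized_inverse d
  have h1 : ∀ x, d (hpart s₀ (-1) (d x)) = d x := by
    have := congrArg (fun L => hpart L 1) hs₀
    rw [hpart_of_hasDeg hd, hpart_comp_left hd _ (s := 0) (by norm_num),
      hpart_comp_right s₀ hd (s := -1) (by norm_num)] at this
    exact fun x => LinearMap.congr_fun this x
  have hsd : HasDeg (hpart s₀ (-1)) (-1) := hpart_hasDeg _ _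
  generalize hpart s₀ (-1) = s at h1 hsd
  have deg1 : ∀ r, ∀ x ∈ V.deg r, s (d (s x)) ∈ V.deg (r + -1) := fun r x hx => by
    have := hsd _ _ (hd _ _ (hsd r x hx))
    rwa [neg_add_cancel_right] at this
  have deg0 : ∀ r, ∀ x ∈ V.deg r, s (d x) ∈ V.deg r := fun r x hx => by
    have := hsd _ _ (hd r x hx)
    rwa [add_neg_cancel_right] at this
  refine ⟨(s ∘ₗ d ∘ₗ s) ∘ₗ (LinearMap.id - s ∘ₗ d), fun r x hx => ?_, fun x => ?_, fun x => ?_,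
    fun x => ?_⟩
  · exact deg1 r _ (sub_mem hx (deg0 r x hx))
  all_goals
    simp only [LinearMap.comp_apply, LinearMap.sub_apply, LinearMap.id_apply, map_sub, h1, hdd,
      map_zero, sub_zero, sub_self]

/-- The hypotheses make `π' f π` a bijection between the images of the two projections, and `b` is
its inverse preceded by `π'`. All identities involve maps of degree zero, so they survive passing to
the part of degree zero of `b`. -/
theorem exists_homotopy_inverse {f : V →ₗ[k] W} (hf : HasDeg f 0) {π : V →ₗ[k] V}
    {π' : W →ₗ[k] W} (hπ : HasDeg π 0) (hπ' : HasDeg π' 0)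
    (hππ : ∀ x, π (π x) = π x) (hππ' : ∀ x, π' (π' x) = π' x)
    (inj : ∀ x, π' (f (π x)) = 0 → π x = 0) (surj : ∀ x', ∃ x, π' x' = π' (f (π x))) :
    ∃ b : W →ₗ[k] V, HasDeg b 0 ∧ (∀ x, π (b x) = b x) ∧ (∀ x, b (π' x) = b x) ∧
      (∀ x, b (π' (f (π x))) = π x) ∧ ∀ x, π' (f (π (b x))) = π' x := by
  obtain ⟨b₀, h1, h2, h3, h4⟩ : ∃ b : W →ₗ[k] V, (∀ x, π (b x) = b x) ∧ (∀ x, b (π' x) = b x) ∧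
      (∀ x, b (π' (f (π x))) = π x) ∧ ∀ x, π' (f (π (b x))) = π' x := by
    let g : LinearMap.range π →ₗ[k] LinearMap.range π' :=
      (π'.rangeRestrict ∘ₗ f) ∘ₗ (LinearMap.range π).subtype
    have hgi : Function.Injective g := by
      rw [← LinearMap.ker_eq_bot, LinearMap.ker_eq_bot']
      rintro ⟨_, x, rfl⟩ hx
      exact Subtype.ext (inj x (congrArg Subtype.val hx))
    have hgs : Function.Surjective g := by
      rintro ⟨_, x', rfl⟩
      obtain ⟨x, hx⟩ := surj x'
      exact ⟨⟨π x, x, rfl⟩, Subtype.ext hx.symm⟩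
    let e := LinearEquiv.ofBijective g ⟨hgi, hgs⟩
    have he : ∀ x, e.symm (π'.rangeRestrict (f (π x))) = π.rangeRestrict x := fun x => by
      rw [LinearEquiv.symm_apply_eq]; rfl
    have hr : ∀ x, π'.rangeRestrict (π' x) = π'.rangeRestrict x := fun x => Subtype.ext (hππ' x)
    have hr' : ∀ z : LinearMap.range π, π z = z := by
      rintro ⟨_, x, rfl⟩
      exact hππ x
    refine ⟨(LinearMap.range π).subtype ∘ₗ e.symm.toLinearMap ∘ₗ π'.rangeRestrict, fun x => ?_,
      fun x => ?_, fun x => ?_, fun x => ?_⟩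
    · exact hr' _
    · change ((e.symm (π'.rangeRestrict (π' x)) : LinearMap.range π) : V) = _
      rw [hr]; rfl
    · change ((e.symm (π'.rangeRestrict (π' (f (π x)))) : LinearMap.range π) : V) = _
      rw [hr, he]; rfl
    · change π' (f (π (e.symm (π'.rangeRestrict x) : LinearMap.range π))) = π' x
      rw [hr']
      exact congrArg Subtype.val (e.apply_symm_apply (π'.rangeRestrict x))
  have c1 : π ∘ₗ b₀ = b₀ := LinearMap.ext h1
  have c2 : b₀ ∘ₗ π' = b₀ := LinearMap.ext h2
  have c3 : b₀ ∘ₗ (π' ∘ₗ f ∘ₗ π) = π := LinearMap.ext h3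
  have c4 : (π' ∘ₗ f ∘ₗ π) ∘ₗ b₀ = π' := LinearMap.ext h4
  have hg : HasDeg (π' ∘ₗ f ∘ₗ π) 0 := fun r x hx => by
    have := hπ' _ _ (hf _ _ (hπ _ _ hx))
    rwa [add_zero, add_zero] at this
  have e1 := congrArg (fun L => hpart L 0) c1
  have e2 := congrArg (fun L => hpart L 0) c2
  have e3 := congrArg (fun L => hpart L 0) c3
  have e4 := congrArg (fun L => hpart L 0) c4
  rw [hpart_comp_left hπ _ (s := 0) (by norm_num)] at e1
  rw [hpart_comp_right _ hπ' (s := 0) (by norm_num)] at e2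
  rw [hpart_comp_right _ hg (s := 0) (by norm_num), hpart_of_hasDeg hπ] at e3
  rw [hpart_comp_left hg _ (s := 0) (by norm_num), hpart_of_hasDeg hπ'] at e4
  exact ⟨hpart b₀ 0, hpart_hasDeg _ _, LinearMap.congr_fun e1, LinearMap.congr_fun e2,
    LinearMap.congr_fun e3, LinearMap.congr_fun e4⟩

end GradedSpace

/-! ### The cohomology of algebras -/

namespace OCHA

variable {H : OCHA.{u, v} k} {H' : OCHA.{u, w} k}

theorem Hom.cocycle_eq (F : Hom H H') (hF : Function.Injective F.cohomologyMap) (x : H.C × H.O)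
    (hx : H.differential x = 0) (h : ∃ y, F.linear x = H'.differential y) :
    ∃ y, x = H.differential y := by
  obtain ⟨y, hy⟩ := h
  have h1 : F.cohomologyMap (Submodule.Quotient.mk ⟨x, hx⟩) = 0 := by
    refine (Submodule.Quotient.mk_eq_zero _).2 ?_
    exact ⟨y, hy.symm⟩
  have h2 := hF (h1.trans (map_zero _).symm)
  obtain ⟨z, hz⟩ := (Submodule.Quotient.mk_eq_zero _).1 h2
  exact ⟨z, hz.symm⟩

theorem Hom.exists_cocycle (F : Hom H H') (hF : Function.Surjective F.cohomologyMap)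
    (x' : H'.C × H'.O) (hx' : H'.differential x' = 0) :
    ∃ x y, H.differential x = 0 ∧ x' = F.linear x + H'.differential y := by
  obtain ⟨q, hq⟩ := hF (Submodule.Quotient.mk ⟨x', hx'⟩)
  obtain ⟨⟨x, hx⟩, rfl⟩ := Submodule.Quotient.mk_surjective _ q
  obtain ⟨y, hy⟩ := (Submodule.Quotient.eq _).1 hq.symm
  refine ⟨x, y, hx, ?_⟩
  have h1 : H'.differential y = x' - F.linear x := hy
  rw [h1]
  abel

/-- A morphism whose composition with `F` is homotopic to the identity inverts `F` on cohomology. -/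
theorem Hom.comp_eq_id (F : Hom H H') (G : Hom H' H)
    (h : ∀ x, H.differential x = 0 → ∃ y, G.linear (F.linear x) = x + H.differential y) :
    G.cohomologyMap ∘ₗ F.cohomologyMap = LinearMap.id := by
  refine LinearMap.ext fun q => ?_
  obtain ⟨⟨x, hx⟩, rfl⟩ := Submodule.Quotient.mk_surjective _ q
  obtain ⟨y, hy⟩ := h x hx
  refine (Submodule.Quotient.eq _).2 ⟨y, ?_⟩
  change H.differential y = G.linear (F.linear x) - x
  rw [hy, add_sub_cancel_left]

end OCHA
end Complexes

/-! ## Transfer of morphisms -/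

section Transfer

variable {k : Type u} [Field k] {S : GPair.{u, v} k} {T : GPair.{u, w} k} {R : GPair.{u, x} k}
  {𝔸 : TestAlg k}

theorem inclP_ap {D : ℤ} (L : LPair S T) (z : PT 𝔸 S) :
    inclP 𝔸 D T (ap L z) = ap L (inclP 𝔸 D S z) := by
  have key : ∀ {M M' : Type _} [AddCommGroup M] [Module k M] [AddCommGroup M'] [Module k M']
      (L : M →ₗ[k] M') (z : 𝔸.A ⊗[k] M),
      inclPt 𝔸 D M' (L.lTensor 𝔸.A z) = L.lTensor (𝔸.adjoin D).A (inclPt 𝔸 D M z) := by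
    intro M M' _ _ _ _ L z
    induction z with
    | zero => simp
    | tmul a m => rfl
    | add x y hx hy => rw [map_add, map_add, map_add, map_add, hx, hy]
  exact Prod.ext (key L.1 z.1) (key L.2 z.2)

/-- The vector field of a family of degree one. -/
def OddField.one (Q : Fam S S) (hQ : Q.HasDeg 1) : OddField S := ⟨Q, 1, odd_one, hQ⟩

theorem flow_mem {Q : Fam S S} (hQ : Q.HasDeg 1) {θ : 𝔸.A} (hθ : θ ∈ 𝔸.c 1) {z : PT 𝔸 S}
    (hz : z ∈ Pts 𝔸 S 0) : z + θ • ev Q z ∈ Pts 𝔸 S 0 := (OddField.one Q hQ).flow_mem hθ hz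

/-- A contraction of the linear part of a vector field of square zero onto the image of the
projection `π = 1 - dh - hd`. -/
structure Contraction (Q : Fam S S) (h π : LPair S S) : Prop where
  h_deg : h.HasDeg (-1)
  h_h : h.comp h = 0
  d_h_d : Q.linear.comp (h.comp Q.linear) = Q.linear
  h_d_h : h.comp (Q.linear.comp h) = h
  sum : Q.linear.comp h + h.comp Q.linear + π = LPair.id S
  d_d : Q.linear.comp Q.linear = 0

namespace Contraction

variable {Q : Fam S S} {h π : LPair S S} (c : Contraction Q h π)
include c

theorem d_π : Q.linear.comp π = 0 := by
  have := congrArg (LPair.comp Q.linear) c.sum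
  rwa [LPair.comp_add, LPair.comp_add, c.d_h_d, ← LPair.comp_assoc Q.linear Q.linear, c.d_d,
    LPair.zero_comp, zero_add, LPair.comp_id, add_eq_left] at this

theorem π_h : π.comp h = 0 := by
  have := congrArg (fun L : LPair S S => L.comp h) c.sum
  simp only [LPair.add_comp, LPair.comp_assoc, c.h_h, c.h_d_h, LPair.comp_zero, zero_add,
    LPair.id_comp] at this
  rwa [add_eq_left] at this

theorem π_d : π.comp Q.linear = 0 := by
  have := congrArg (fun L : LPair S S => L.comp Q.linear) c.sum
  simp only [LPair.add_comp, LPair.comp_assoc, c.d_d, c.d_h_d, LPair.comp_zero, add_zero,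
    LPair.id_comp] at this
  rwa [add_eq_left] at this

theorem π_π : π.comp π = π := by
  have := congrArg (LPair.comp π) c.sum
  rwa [LPair.comp_add, LPair.comp_add, ← LPair.comp_assoc, ← LPair.comp_assoc, c.π_d, c.π_h,
    LPair.zero_comp, LPair.zero_comp, zero_add, zero_add, LPair.comp_id] at this

theorem π_deg (hQ : Q.HasDeg 1) : π.HasDeg 0 := by
  rw [show π = LPair.id S - (Q.linear.comp h + h.comp Q.linear) from by
    rw [← c.sum, add_sub_cancel_left]]
  exact LPair.HasDeg.id.sub ((hQ.linear.comp c.h_deg (by norm_num)).add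
    (c.h_deg.comp hQ.linear (by norm_num)))

end Contraction

/-- The linear algebra of a homotopy equivalence between contractions. -/
structure LinearInverse (Q : Fam S S) (h π : LPair S S) (Q' : Fam T T) (h' π' : LPair T T)
    (f : LPair S T) (b : LPair T S) : Prop where
  f_deg : f.HasDeg 0
  b_deg : b.HasDeg 0
  f_d : f.comp Q.linear = Q'.linear.comp f
  π_b : π.comp b = b
  b_π : b.comp π' = b
  b_f : b.comp (π'.comp (f.comp π)) = π
  f_b : π'.comp (f.comp (π.comp b)) = π'

namespace LinearInverse

variable {Q : Fam S S} {h π : LPair S S} {Q' : Fam T T} {h' π' : LPair T T}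
    {f : LPair S T} {b : LPair T S} (e : LinearInverse Q h π Q' h' π' f b)
include e

theorem b_f_π : b.comp (f.comp π) = π := by
  rw [← e.b_π, LPair.comp_assoc, e.b_f]

theorem b_f_b : b.comp (f.comp b) = b := by
  have h1 := congrArg (fun L : LPair S S => L.comp b) e.b_f_π
  simp only [LPair.comp_assoc, e.π_b] at h1
  exact h1

theorem d_b (c : Contraction Q h π) : Q.linear.comp b = 0 := by
  rw [← e.π_b, ← LPair.comp_assoc, c.d_π, LPair.zero_comp]

theorem b_d (c' : Contraction Q' h' π') : b.comp Q'.linear = 0 := by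
  rw [← e.b_π, LPair.comp_assoc, c'.π_d, LPair.comp_zero]

theorem d_f_b (c : Contraction Q h π) : Q'.linear.comp (f.comp b) = 0 := by
  rw [← LPair.comp_assoc, ← e.f_d, LPair.comp_assoc, e.d_b c, LPair.comp_zero]

/-- The contraction `h' (1 - f b)` replaces the image of `π'` by the image of `f b`. The two
projections differ by the homotopy `d' h' f b = f b - π'`, which follows from `π' f b = π'`. -/
theorem sum (c : Contraction Q h π) (c' : Contraction Q' h' π') :
    Q'.linear.comp (h' - h'.comp (f.comp b)) + (h' - h'.comp (f.comp b)).comp Q'.linear +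
      f.comp b = LPair.id T := by
  have A := congrArg (fun L : LPair T T => L.comp (f.comp b)) c'.sum
  simp only [LPair.add_comp, LPair.comp_assoc, e.d_f_b c, LPair.comp_zero, add_zero,
    LPair.id_comp] at A
  have hf := e.f_b
  rw [e.π_b] at hf
  rw [hf] at A
  rw [LPair.comp_sub, LPair.sub_comp, LPair.comp_assoc, LPair.comp_assoc, e.b_d c',
    LPair.comp_zero, LPair.comp_zero, sub_zero,
    eq_sub_of_add_eq A, ← c'.sum]
  abel

theorem h_f_π : (h' - h'.comp (f.comp b)).comp (f.comp π) = 0 := by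
  rw [LPair.sub_comp, LPair.comp_assoc, LPair.comp_assoc, e.b_f_π, sub_self]

end LinearInverse

variable [CharZero k]

theorem ev_op (F : Fam S T) {Q : Fam S S} (hQ : Q.HasDeg 1) {θ : 𝔸.A} (hθ : θ ∈ 𝔸.c 1)
    (hθθ : θ * θ = 0) {z : PT 𝔸 S} (hz : z ∈ Pts 𝔸 S 0) :
    ev F (z + θ • ev Q z) = ev F z + θ • ev ((OddField.one Q hQ).op T F) z :=
  OddField.ev_flow_op F (OddField.one Q hQ) hθ hθθ hz

/-- Differentiating a linear map along `Q` composes it with `Q`. This presents `h ∘ Q` and `π ∘ Q`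
as families, whatever the degree of the linear map. -/
theorem ev_op_lin (L : LPair S T) {Q : Fam S S} (hQ : Q.HasDeg 1) {z : PT 𝔸 S}
    (hz : z ∈ Pts 𝔸 S 0) : ev ((OddField.one Q hQ).op T (Fam.lin L)) z = ap L (ev Q z) := by
  refine letter_smul_injP (D := 1) ?_
  have hz' := inclP_mem (D := 1) hz
  have h := ev_op (Fam.lin L) hQ 𝔸.letter_c 𝔸.letter_mul_letter hz'
  rw [ev_lin _ (flow_mem hQ 𝔸.letter_c hz'), ev_lin _ hz', ap_add_pt, ap_smul, add_right_inj] at h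
  rw [← ev_inclP 1 _ hz, ← h, inclP_ap, ev_inclP 1 _ hz]

/-- A morphism is the same as a map carrying one flow to the other. In this form morphisms compose
and are inverted like functions. -/
theorem eq_comp_of_flow {Q : Fam S S} (hQ : Q.HasDeg 1) {Q' : Fam T T} {F : Fam S T}
    (hF : F.HasDeg 0) (h : ∀ (𝔸 : TestAlg k) (z : PT 𝔸 S), z ∈ Pts 𝔸 S 0 → ∀ θ ∈ 𝔸.c 1, θ * θ = 0 →
      ev F (z + θ • ev Q z) = ev F z + θ • ev Q' (ev F z)) :
    (OddField.one Q hQ).op T F = Q'.comp F := by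
  refine OddField.Fam.ext_letter 1 fun 𝔸 z hz θ hθ hθθ => ?_
  have h1 := ev_op F hQ hθ hθθ hz
  rw [h 𝔸 z hz θ hθ hθθ, add_right_inj] at h1
  rw [← h1, ev_comp _ hF hz]

theorem flow_of_eq_comp {Q : Fam S S} (hQ : Q.HasDeg 1) {Q' : Fam T T} {F : Fam S T}
    (hF : F.HasDeg 0) (h : (OddField.one Q hQ).op T F = Q'.comp F) {z : PT 𝔸 S}
    (hz : z ∈ Pts 𝔸 S 0) {θ : 𝔸.A} (hθ : θ ∈ 𝔸.c 1) (hθθ : θ * θ = 0) :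
    ev F (z + θ • ev Q z) = ev F z + θ • ev Q' (ev F z) := by
  rw [ev_op F hQ hθ hθθ hz, h, ev_comp _ hF hz]

namespace Contraction

variable {Q : Fam S S} {h π : LPair S S} (c : Contraction Q h π)
include c

/-- The minimal model: a vector field on the image of the projection together with its embedding,
which extends the inclusion. -/
theorem exists_minimal_model (hQ : Q.HasDeg 1) (hQQ : (OddField.one Q hQ).op S Q = 0) :
    ∃ I M : Fam S S, I.HasDeg 0 ∧ M.HasDeg 1 ∧ I.linear = π ∧
      (∀ (𝔸 : TestAlg k) (z : PT 𝔸 S), z ∈ Pts 𝔸 S 0 → ev I (ap π z) = ev I z) ∧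
      (∀ (𝔸 : TestAlg k) (z : PT 𝔸 S), z ∈ Pts 𝔸 S 0 → ap π (ev M z) = ev M z) ∧
      ∀ (𝔸 : TestAlg k) (z : PT 𝔸 S), z ∈ Pts 𝔸 S 0 → ∀ θ ∈ 𝔸.c 1, θ * θ = 0 →
        ev I (z + θ • ev M z) = ev I z + θ • ev Q (ev I z) := by
  have hπ := c.π_deg hQ
  have hd := hQ.linear
  have dh_deg : (Q.linear.comp h).HasDeg 0 := hd.comp c.h_deg (by norm_num)
  -- `W y = π y + d h y + h Q y` has linear part `π + d h + h d = 1`, and it reduces to `π y` on the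
  -- locus `h y = 0`, `h Q y = 0`.
  set W : Fam S S := Fam.lin (π + Q.linear.comp h) + (OddField.one Q hQ).op S (Fam.lin h) with hW
  have hWd : W.HasDeg 0 := (Fam.lin_hasDeg (hπ.add dh_deg)).add
    (by have := (Fam.lin_hasDeg c.h_deg).op (T := S) (OddField.one Q hQ); exact this)
  have hWl : W.linear = LPair.id S := by
    rw [hW, Fam.linear_add, OddField.linear_op, Fam.linear_lin, Fam.linear_lin, ← c.sum]
    change π + Q.linear.comp h + h.comp Q.linear = _
    abel
  have hWe : ∀ (𝔸 : TestAlg k) (z : PT 𝔸 S), z ∈ Pts 𝔸 S 0 →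
      ev W z = ap π z + ap Q.linear (ap h z) + ap h (ev Q z) := fun 𝔸 z hz => by
    rw [hW, ev_add, ev_lin _ hz, ev_op_lin _ hQ hz, ap_add, ap_comp]
  obtain ⟨V, hV, hVl, hVW⟩ := Fam.exists_inverse hWd hWl
  have zero2 : ∀ {L L' : LPair S S}, L.comp L' = 0 → ∀ {𝔸 : TestAlg k} (z : PT 𝔸 S),
      ap L (ap L' z) = 0 := fun e 𝔸 z => by rw [← ap_comp, e, ap_zero]
  have ππ : ∀ {𝔸 : TestAlg k} (z : PT 𝔸 S), ap π (ap π z) = ap π z := fun z => by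
    rw [← ap_comp, c.π_π]
  have hI0 : (V.precomp π hπ).HasDeg 0 := hV.precomp hπ
  -- A point of the locus is recovered from its projection: `W y = π z`, hence `y = W⁻¹ (π z)`.
  have hI : ∀ (𝔸 : TestAlg k) (z y : PT 𝔸 S), z ∈ Pts 𝔸 S 0 → y ∈ Pts 𝔸 S 0 →
      ap π y = ap π z → ap h y = 0 → ap h (ev Q y) = 0 → ev (V.precomp π hπ) z = y := by
    intro 𝔸 z y hz hy h1 h2 h3
    have h4 := hWe 𝔸 y hy
    rw [h2, h3, ap_zero_pt, add_zero, add_zero, h1] at h4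
    rw [ev_precomp, ← h4, (hVW 𝔸 y hy).2]
  -- Conversely `W y = π z` puts `y` on the locus: `π` gives `π y = π z`, then `h` gives `h y = h d
  -- h y = 0`, and `h Q y = 0` is what remains.
  have hI' : ∀ (𝔸 : TestAlg k) (z : PT 𝔸 S), z ∈ Pts 𝔸 S 0 →
      ap π (ev (V.precomp π hπ) z) = ap π z ∧ ap h (ev (V.precomp π hπ) z) = 0 ∧
        ap h (ev Q (ev (V.precomp π hπ) z)) = 0 := by
    intro 𝔸 z hz
    have h1 : ev W (ev (V.precomp π hπ) z) = ap π z := by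
      rw [ev_precomp, (hVW 𝔸 _ (ap_mem hπ hz)).1]
    rw [hWe 𝔸 _ (ev_mem hI0 hz)] at h1
    generalize ev (V.precomp π hπ) z = y at h1
    have e1 := congrArg (ap π) h1
    rw [ap_add_pt, ap_add_pt, ππ, ππ, zero2 c.π_d, zero2 c.π_h, add_zero, add_zero] at e1
    rw [e1, add_assoc, add_eq_left] at h1
    have e2 := congrArg (ap h) h1
    rw [ap_add_pt, ← ap_comp, ← ap_comp, LPair.comp_assoc, c.h_d_h, zero2 c.h_h, add_zero,
      ap_zero_pt] at e2
    rw [e2, ap_zero_pt, zero_add] at h1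
    exact ⟨e1, e2, h1⟩
  have hM0 : (((OddField.one Q hQ).op S (Fam.lin π)).comp (V.precomp π hπ)).HasDeg 1 := by
    have := ((Fam.lin_hasDeg hπ).op (T := S) (OddField.one Q hQ)).comp hI0
    rwa [zero_add] at this
  have hMe : ∀ (𝔸 : TestAlg k) (z : PT 𝔸 S), z ∈ Pts 𝔸 S 0 →
      ev (((OddField.one Q hQ).op S (Fam.lin π)).comp (V.precomp π hπ)) z =
        ap π (ev Q (ev (V.precomp π hπ) z)) := fun 𝔸 z hz => by
    rw [ev_comp _ hI0 hz, ev_op_lin _ hQ (ev_mem hI0 hz)]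
  refine ⟨V.precomp π hπ, ((OddField.one Q hQ).op S (Fam.lin π)).comp (V.precomp π hπ), hI0, hM0,
    ?_, fun 𝔸 z hz => ?_, fun 𝔸 z hz => ?_, fun 𝔸 z hz θ hθ hθθ => ?_⟩
  · rw [Fam.linear_precomp, hVl, LPair.id_comp]
  · rw [ev_precomp, ev_precomp, ππ]
  · rw [hMe 𝔸 z hz, ππ]
  -- The flow of `Q` stays on the locus: `h` of the velocity is `h Q y = 0`, and `Q` is constant
  -- along its flow. The flowed point is therefore identified by its projection, which moves with
  -- velocity `M z = π Q (I z)`.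
  · obtain ⟨h1, h2, h3⟩ := hI' 𝔸 z hz
    have hy := ev_mem hI0 hz
    refine hI 𝔸 _ _ (flow_mem hM0 hθ hz) (flow_mem hQ hθ hy) ?_ ?_ ?_
    · rw [ap_add_pt, ap_add_pt, ap_smul, ap_smul, h1, hMe 𝔸 z hz, ππ]
    · rw [ap_add_pt, ap_smul, h2, h3, smul_zero, add_zero]
    · rw [ev_op Q hQ hθ hθθ hy, hQQ, ev_zero, smul_zero, add_zero, h3]

end Contraction

namespace LinearInverse

variable {Q : Fam S S} {h π : LPair S S} {Q' : Fam T T} {h' π' : LPair T T}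
    {f : LPair S T} {b : LPair T S} (e : LinearInverse Q h π Q' h' π' f b)
include e

/-- The inverse of a quasi-isomorphism of vector fields of square zero. -/
theorem exists_inverse (hQ : Q.HasDeg 1) (hQQ : (OddField.one Q hQ).op S Q = 0)
    (hQ' : Q'.HasDeg 1) (hQQ' : (OddField.one Q' hQ').op T Q' = 0) (c : Contraction Q h π)
    (c' : Contraction Q' h' π') {F : Fam S T} (hF : F.HasDeg 0) (hFl : F.linear = f)
    (hFQ : (OddField.one Q hQ).op T F = Q'.comp F) :
    ∃ G : Fam T S, G.HasDeg 0 ∧ G.linear = b ∧ (OddField.one Q' hQ').op S G = Q.comp G := by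
  obtain ⟨I, M, hI, hM, hIl, hIπ, hMπ, hIM⟩ := c.exists_minimal_model hQ hQQ
  have hπ := c.π_deg hQ
  have hfb : (f.comp b).HasDeg 0 := e.f_deg.comp e.b_deg (by norm_num)
  have hfπ : (f.comp π).HasDeg 0 := e.f_deg.comp hπ (by norm_num)
  have hF1 : (F.comp I).HasDeg 0 := hF.comp hI
  have hF1M : ∀ (𝔸 : TestAlg k) (z : PT 𝔸 S), z ∈ Pts 𝔸 S 0 → ∀ θ ∈ 𝔸.c 1, θ * θ = 0 →
      ev (F.comp I) (z + θ • ev M z) = ev (F.comp I) z + θ • ev Q' (ev (F.comp I) z) := by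
    intro 𝔸 z hz θ hθ hθθ
    rw [ev_comp _ hI (flow_mem hM hθ hz), ev_comp _ hI hz, hIM 𝔸 z hz θ hθ hθθ,
      flow_of_eq_comp hQ hF hFQ (ev_mem hI hz) hθ hθθ]
  -- the change of coordinates
  set U : Fam T T := (F.comp I).precomp b e.b_deg + Fam.id T - Fam.lin (f.comp b) with hU
  have hU0 : U.HasDeg 0 := ((hF1.precomp e.b_deg).add Fam.id_hasDeg).sub (Fam.lin_hasDeg hfb)
  have hUl : U.linear = LPair.id T := by
    rw [hU, Fam.linear_sub, Fam.linear_add, Fam.linear_precomp, Fam.linear_comp, hFl, hIl,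
      LPair.comp_assoc, e.π_b, Fam.linear_lin]
    change f.comp b + (Fam.lin (LPair.id T)).linear - _ = _
    rw [Fam.linear_lin, add_sub_cancel_left]
  -- On the image of `f π` the two linear terms of `U` cancel because `b f π = π`. So `U` carries
  -- the linear embedding `f π` to `F ∘ I`.
  have hUe : ∀ (𝔸 : TestAlg k) (z : PT 𝔸 S), z ∈ Pts 𝔸 S 0 →
      ev U (ap (f.comp π) z) = ev (F.comp I) z := by
    intro 𝔸 z hz
    have hz' := ap_mem hfπ hz
    rw [hU, ev_sub, ev_add, ev_precomp, Fam.ev_id hz', ev_lin _ hz', ← ap_comp, ← ap_comp,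
      LPair.comp_assoc, e.b_f_π, add_sub_cancel_right, ev_comp _ hI (ap_mem hπ hz), hIπ 𝔸 z hz,
      ev_comp _ hI hz]
  obtain ⟨V, hV, hVl, hVU⟩ := Fam.exists_inverse hU0 hUl
  -- the vector field in the new coordinates
  set P : Fam T T := ((OddField.one Q' hQ').op T V).comp U with hP
  have hP1 : P.HasDeg 1 := by
    have := (hV.op (T := T) (OddField.one Q' hQ')).comp hU0
    rwa [zero_add] at this
  have hPl : P.linear = Q'.linear := by
    rw [hP, Fam.linear_comp, OddField.linear_op, hVl, hUl]
    rfl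
  have hPv : ∀ (𝔸 : TestAlg k) (z : PT 𝔸 T), z ∈ Pts 𝔸 T 0 →
      ev P z = ev ((OddField.one Q' hQ').op T V) (ev U z) := fun 𝔸 z hz => ev_comp _ hU0 hz
  have hPe : ∀ (𝔸 : TestAlg k) (z : PT 𝔸 T), z ∈ Pts 𝔸 T 0 → ∀ θ ∈ 𝔸.c 1, θ * θ = 0 →
      z + θ • ev P z = ev V (ev U z + θ • ev Q' (ev U z)) := by
    intro 𝔸 z hz θ hθ hθθ
    rw [ev_op V hQ' hθ hθθ (ev_mem hU0 hz), (hVU 𝔸 z hz).2, hPv 𝔸 z hz]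
  -- `P` is `Q'` transported by `U⁻¹ = V`, and vanishing of the square does not depend on
  -- coordinates.
  have hPP : (OddField.one P hP1).op T P = 0 := by
    refine OddField.Fam.ext_letter 1 fun 𝔸 z hz θ hθ hθθ => ?_
    have h1 := ev_op P hP1 hθ hθθ hz
    have hw := flow_mem hP1 hθ hz
    have hw' := flow_mem hQ' hθ (ev_mem hU0 hz)
    rw [hPv 𝔸 _ hw, hPe 𝔸 z hz θ hθ hθθ, (hVU 𝔸 _ hw').1,
      ev_op _ hQ' hθ hθθ (ev_mem hU0 hz), OddField.op_op (OddField.one Q' hQ') hQQ', ev_zero,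
      smul_zero, add_zero, ← hPv 𝔸 z hz, left_eq_add] at h1
    rw [h1, ev_zero, smul_zero]
  -- In the new coordinates `F ∘ I` is the linear map `f π`, and it carries the flow of `M` to that
  -- of `P`. Comparing velocities gives the restriction of `P`.
  have hPM : ∀ (𝔸 : TestAlg k) (z : PT 𝔸 S), z ∈ Pts 𝔸 S 0 →
      ev P (ap (f.comp π) z) = ap (f.comp π) (ev M z) := by
    have h1 : P.precomp (f.comp π) hfπ = (OddField.one M hM).op T (Fam.lin (f.comp π)) := by
      refine OddField.Fam.ext_letter 1 fun 𝔸 z hz θ hθ hθθ => ?_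
      have hz' := ap_mem hfπ hz
      have h2 := hPe 𝔸 _ hz' θ hθ hθθ
      have hw := flow_mem hM hθ hz
      rw [hUe 𝔸 z hz, ← hF1M 𝔸 z hz θ hθ hθθ, ← hUe 𝔸 _ hw, (hVU 𝔸 _ (ap_mem hfπ hw)).2,
        ap_add_pt, ap_smul, add_right_inj] at h2
      rw [ev_precomp, ev_op_lin _ hM hz, h2]
    intro 𝔸 z hz
    rw [← ev_precomp _ _ hfπ, h1, ev_op_lin _ hM hz]
  have hbM : ∀ (𝔸 : TestAlg k) (z : PT 𝔸 T), ap (f.comp b) z = ap (f.comp π) (ap b z) :=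
    fun 𝔸 z => by rw [← ap_comp, LPair.comp_assoc, e.π_b]
  -- the retract
  let ρ : Retract T :=
    { Q := P
      Q_deg := hP1
      h := h' - h'.comp (f.comp b)
      h_deg := c'.h_deg.sub (c'.h_deg.comp hfb (by norm_num))
      π := f.comp b
      π_deg := hfb
      sum := by rw [hPl]; exact e.sum c c'
      h_π := by
        rw [LPair.sub_comp, LPair.comp_assoc, LPair.comp_assoc, e.b_f_b, sub_self]
      d_π := by rw [hPl]; exact e.d_f_b c
      stable := fun 𝔸 z hz => by
        rw [hbM, hPM 𝔸 _ (ap_mem e.b_deg hz), ← ap_comp, e.h_f_π, ap_zero] }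
  have hbπ : b.comp ρ.π = b := e.b_f_b
  obtain ⟨p, hp, hpl, hpπ, hpN⟩ := ρ.exists_extension e.b_deg hbπ
  have hpe : ∀ (𝔸 : TestAlg k) (z : PT 𝔸 T), z ∈ Pts 𝔸 T 0 → ev p (ap (f.comp b) z) = ap b z := by
    intro 𝔸 z hz
    have h1 := congrArg (fun G : Fam T S => ev G z) hpπ
    simp only [ev_precomp] at h1
    refine h1.trans ?_
    rw [ev_lin _ (ap_mem hfb hz), ← ap_comp]
    exact congrArg (fun L : LPair T S => ap L z) hbπ
  have hpe' : ∀ (𝔸 : TestAlg k) (z : PT 𝔸 S), z ∈ Pts 𝔸 S 0 →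
      ev p (ap (f.comp π) z) = ap π z := by
    intro 𝔸 z hz
    have h1 := hpe 𝔸 _ (ap_mem hfπ hz)
    rwa [← ap_comp, ← ap_comp, e.b_f_π, LPair.comp_assoc, e.b_f_π] at h1
  -- Uniqueness is applied to the difference. Both sides are killed by `N`: the first because `P`
  -- has square zero and so commutes with its bracket, the second because `N p = 0` equates values
  -- of `p`. On the image of `f b` both equal `M ∘ b`, since `p` inverts the embedding there.
  have hpM : (OddField.one P hP1).op S p = M.comp p := by
    rw [← sub_eq_zero]
    refine ρ.eq_zero_of_N ?_ ?_
    · rw [Fam.map_sub]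
      have h1 : ρ.N S ((OddField.one P hP1).op S p) = 0 := by
        refine (OddField.bracket_op ρ.field ρ.hfield hPP p).trans ?_
        change (OddField.one P hP1).op S (ρ.N S p) = 0
        rw [hpN, map_zero]
      have h2 : ρ.N S (M.comp p) = 0 := by
        refine (OddField.bracket_eq_zero_iff _ _ _).2 fun 𝔸 z hz θ hθ hθθ τ hτ hττ => ?_
        rw [ev_comp _ hp (ρ.hfield.flow_mem hτ (ρ.field.flow_mem hθ hz)),
          ev_comp _ hp (ρ.field.flow_mem hθ (ρ.hfield.flow_mem hτ hz)),
          (OddField.bracket_eq_zero_iff _ _ _).1 hpN 𝔸 z hz θ hθ hθθ τ hτ hττ]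
      rw [h1, h2]
      exact sub_zero (0 : Fam T S)
    · suffices h : ((OddField.one P hP1).op S p).precomp ρ.π ρ.π_deg =
          (M.comp p).precomp ρ.π ρ.π_deg by
        rw [Fam.precomp_sub, h]
        exact sub_self ((M.comp p).precomp ρ.π ρ.π_deg)
      refine OddField.Fam.ext_letter 1 fun 𝔸 z hz θ hθ hθθ => ?_
      have hbz := ap_mem e.b_deg hz
      have hw := ap_mem hfb hz
      have h1 := ev_op p hP1 hθ hθθ hw
      rw [hpe 𝔸 z hz, hbM, hPM 𝔸 _ hbz, ← ap_smul, ← ap_add_pt, hpe' 𝔸 _ (flow_mem hM hθ hbz),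
        ap_add_pt, ap_smul, hMπ 𝔸 _ hbz, ← ap_comp π b, e.π_b, add_right_inj] at h1
      rw [ev_precomp, ev_precomp]
      change θ • ev ((OddField.one P hP1).op S p) (ap (f.comp b) z) =
        θ • ev (M.comp p) (ap (f.comp b) z)
      rw [ev_comp _ hp hw, hpe 𝔸 z hz, hbM, ← h1]
  -- `V` carries the flow of `Q'` to that of `P`, `p` carries it on to `M`, and `I` to `Q`.
  refine ⟨I.comp (p.comp V), hI.comp (hp.comp hV), ?_, eq_comp_of_flow hQ' (hI.comp (hp.comp hV))
    fun 𝔸 z hz θ hθ hθθ => ?_⟩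
  · rw [Fam.linear_comp, Fam.linear_comp, hIl, hpl, hVl, LPair.comp_id, e.π_b]
  · have hVz := ev_mem hV hz
    have hpz := ev_mem hp hVz
    have hw := flow_mem hQ' hθ hz
    have h1 := hPe 𝔸 _ hVz θ hθ hθθ
    rw [(hVU 𝔸 z hz).1] at h1
    rw [ev_comp _ (hp.comp hV) hw, ev_comp _ hV hw, ← h1, flow_of_eq_comp hP1 hp hpM hVz hθ hθθ,
      hIM 𝔸 _ hpz θ hθ hθθ, ev_comp _ (hp.comp hV) hz, ev_comp _ hV hz]

end LinearInverse
end Transfer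

/-! ## Open-closed homotopy algebras as vector fields -/

section Main

variable {k : Type u} [Field k]

namespace OCHA

/-- The underlying pair of graded spaces. -/
def pair (H : OCHA.{u, v} k) : GPair.{u, v} k := ⟨H.C, H.O⟩

/-- The structure maps as a family. -/
def fam (H : OCHA.{u, v} k) : Fam H.pair H.pair :=
  ⟨(H.l, H.n), ⟨⟨H.l_zero, H.n_zero⟩, H.l_symm, H.n_symm⟩⟩

theorem fam_deg (H : OCHA.{u, v} k) : H.fam.HasDeg 1 := ⟨H.l_degree, H.n_degree⟩

theorem ins_fam (H : OCHA.{u, v} k) : H.fam.ins H.fam odd_one H.fam_deg = 0 := by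
  refine Subtype.ext (Prod.ext ?_ ?_)
  · funext p
    refine multilinear_ext_homogeneous _ _ fun d c hc => ?_
    exact (insertC_apply H.l H.l hc).trans (H.l_rel p d c hc)
  · funext p q
    refine bi_ext_homogeneous _ _ fun d e c o hc ho => ?_
    exact (insertF_apply H.n H.l H.n hc ho).trans (H.n_rel p q d e c o hc ho)

variable {H : OCHA.{u, v} k} {H' : OCHA.{u, w} k} {H'' : OCHA.{u, x} k}

/-- The components of a morphism as a family. -/
def Hom.fam (F : Hom H H') : Fam H.pair H'.pair :=
  ⟨(F.f, F.g), ⟨⟨F.f_zero, F.g_zero⟩, F.f_symm, F.g_symm⟩⟩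

theorem Hom.fam_deg (F : Hom H H') : F.fam.HasDeg 0 := ⟨F.f_degree, F.g_degree⟩

theorem Hom.ins_fam (F : Hom H H') : F.fam.ins H.fam odd_one H.fam_deg = H'.fam.comp F.fam := by
  refine Subtype.ext (Prod.ext ?_ ?_)
  · funext p
    refine multilinear_ext_homogeneous _ _ fun d c hc => ?_
    exact (insertC_apply F.f H.l hc).trans ((F.f_rel p d c hc).trans
      (composeC_apply H'.l F.f hc).symm)
  · funext p q
    refine bi_ext_homogeneous _ _ fun d e c o hc ho => ?_
    exact (insertF_apply F.g H.l H.n hc ho).trans ((F.g_rel p q _ _ c o hc ho).trans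
      (composeF_apply H'.n F.f F.g hc ho).symm)

/-- The morphism defined by a family. -/
def Hom.ofFam (F : Fam H.pair H'.pair) (hF : F.HasDeg 0)
    (h : F.ins H.fam odd_one H.fam_deg = H'.fam.comp F) : Hom H H' where
  f := F.1.1
  g := F.1.2
  f_zero := F.zero_c
  g_zero := F.zero_o
  f_degree := hF.1
  g_degree := hF.2
  f_symm := F.symm_c
  g_symm := F.symm_o
  f_rel p _ c hc := (insertC_apply F.1.1 H.l hc).symm.trans
    ((congrArg (fun F : Fam H.pair H'.pair => F.1.1 p c) h).trans (composeC_apply H'.l F.1.1 hc))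
  g_rel p q _ _ c o hc ho := (insertF_apply F.1.2 H.l H.n hc ho).symm.trans
    ((congrArg (fun F : Fam H.pair H'.pair => F.1.2 p q c o) h).trans
      (composeF_apply H'.n F.1.1 F.1.2 hc ho))

/-- The linear map of the direct sums defined by a pair of linear maps. -/
def total (L : LPair H.pair H'.pair) : H.C × H.O →ₗ[k] H'.C × H'.O :=
  L.1.prodMap L.2

theorem linear_comp_linear (H : OCHA.{u, v} k) : H.fam.linear.comp H.fam.linear = 0 := by
  have h := H.differential_comp_self
  refine Prod.ext (LinearMap.ext fun x => ?_) (LinearMap.ext fun x => ?_)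
  · exact congrArg Prod.fst (LinearMap.congr_fun h (x, 0))
  · exact congrArg Prod.snd (LinearMap.congr_fun h (0, x))

theorem Hom.linear_comp_linear (F : Hom H H') :
    F.fam.linear.comp H.fam.linear = H'.fam.linear.comp F.fam.linear := by
  have h := F.linear_comp_differential
  refine Prod.ext (LinearMap.ext fun x => ?_) (LinearMap.ext fun x => ?_)
  · exact congrArg Prod.fst (LinearMap.congr_fun h (x, 0))
  · exact congrArg Prod.snd (LinearMap.congr_fun h (0, x))

theorem exists_contraction (H : OCHA.{u, v} k) : ∃ h π : LPair H.pair H.pair,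
    Contraction H.fam h π := by
  have hd := H.fam_deg.linear
  have hdd := H.linear_comp_linear
  obtain ⟨h₁, a1, a2, a3, a4⟩ := GradedSpace.exists_contraction hd.1
    fun x => LinearMap.congr_fun (congrArg Prod.fst hdd) x
  obtain ⟨h₂, b1, b2, b3, b4⟩ := GradedSpace.exists_contraction hd.2
    fun x => LinearMap.congr_fun (congrArg Prod.snd hdd) x
  exact ⟨(h₁, h₂), LPair.id _ - (H.fam.linear.comp (h₁, h₂) + LPair.comp (h₁, h₂) H.fam.linear),
    ⟨a1, b1⟩, Prod.ext (LinearMap.ext a2) (LinearMap.ext b2),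
    Prod.ext (LinearMap.ext a3) (LinearMap.ext b3), Prod.ext (LinearMap.ext a4) (LinearMap.ext b4),
    add_sub_cancel _ _, hdd⟩

/-- The images of `π` and `π'` consist of one representative for each cohomology class, so being a
quasi-isomorphism is bijectivity of `π' f π` between them. This is shown on the direct sum and then
restricted to the closed and open summands, where the inverses are taken. -/
theorem Hom.exists_linearInverse (F : Hom H H') (hF : F.IsQuasiIso) {h π : LPair H.pair H.pair}
    (c : Contraction H.fam h π) {h' π' : LPair H'.pair H'.pair} (c' : Contraction H'.fam h' π') :
    ∃ b : LPair H'.pair H.pair, LinearInverse H.fam h π H'.fam h' π' F.fam.linear b := by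
  have hπ := c.π_deg H.fam_deg
  have hπ' := c'.π_deg H'.fam_deg
  have hf := F.fam_deg.linear
  have ππ := c.π_π
  have ππ' := c'.π_π
  have dπ := c.d_π
  have dπ' := c'.d_π
  have fd := F.linear_comp_linear
  -- pointwise identities on the direct sum
  have hsum : ∀ x : H.C × H.O, H.differential (total h x) + total h (H.differential x) + total π x =
      x := fun x => Prod.ext (LinearMap.congr_fun (congrArg Prod.fst c.sum) x.1)
        (LinearMap.congr_fun (congrArg Prod.snd c.sum) x.2)
  have hsum' : ∀ x : H'.C × H'.O, H'.differential (total h' x) + total h' (H'.differential x) +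
      total π' x = x := fun x => Prod.ext (LinearMap.congr_fun (congrArg Prod.fst c'.sum) x.1)
        (LinearMap.congr_fun (congrArg Prod.snd c'.sum) x.2)
  have hdπ : ∀ x : H.C × H.O, H.differential (total π x) = 0 := fun x =>
    Prod.ext (LinearMap.congr_fun (congrArg Prod.fst dπ) x.1)
      (LinearMap.congr_fun (congrArg Prod.snd dπ) x.2)
  have hdπ' : ∀ x : H'.C × H'.O, H'.differential (total π' x) = 0 := fun x =>
    Prod.ext (LinearMap.congr_fun (congrArg Prod.fst dπ') x.1)
      (LinearMap.congr_fun (congrArg Prod.snd dπ') x.2)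
  have hπd : ∀ x : H.C × H.O, total π (H.differential x) = 0 := fun x =>
    Prod.ext (LinearMap.congr_fun (congrArg Prod.fst c.π_d) x.1)
      (LinearMap.congr_fun (congrArg Prod.snd c.π_d) x.2)
  have hπd' : ∀ x : H'.C × H'.O, total π' (H'.differential x) = 0 := fun x =>
    Prod.ext (LinearMap.congr_fun (congrArg Prod.fst c'.π_d) x.1)
      (LinearMap.congr_fun (congrArg Prod.snd c'.π_d) x.2)
  have hππ : ∀ x : H.C × H.O, total π (total π x) = total π x := fun x =>
    Prod.ext (LinearMap.congr_fun (congrArg Prod.fst ππ) x.1)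
      (LinearMap.congr_fun (congrArg Prod.snd ππ) x.2)
  have hππ' : ∀ x : H'.C × H'.O, total π' (total π' x) = total π' x := fun x =>
    Prod.ext (LinearMap.congr_fun (congrArg Prod.fst ππ') x.1)
      (LinearMap.congr_fun (congrArg Prod.snd ππ') x.2)
  have hfd : ∀ x, F.linear (H.differential x) = H'.differential (F.linear x) :=
    LinearMap.congr_fun F.linear_comp_differential
  -- The cocycle `f π x` is `d' h' f π x` when its projection vanishes. Then `π x` is exact, and `π`
  -- kills exact elements.
  have inj : ∀ x : H.C × H.O, total π' (F.linear (total π x)) = 0 → total π x = 0 := by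
    intro x hx
    have h1 := hsum' (F.linear (total π x))
    rw [hx, ← hfd, hdπ, map_zero, map_zero, add_zero, add_zero] at h1
    obtain ⟨y, hy⟩ := F.cocycle_eq hF.1 _ (hdπ x) ⟨_, h1.symm⟩
    rw [← hππ, hy, hπd]
  have surj : ∀ x' : H'.C × H'.O, ∃ x : H.C × H.O, total π' x' = total π' (F.linear (total π x)) := by
    intro x'
    obtain ⟨x, y, hx, hy⟩ := F.exists_cocycle hF.2 _ (hdπ' x')
    refine ⟨x, ?_⟩
    have h1 := hsum x
    rw [hx, map_zero, add_zero] at h1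
    have h2 := congrArg (total π') hy
    rw [hππ', map_add, hπd', add_zero, ← h1, map_add, hfd, map_add, hπd', zero_add] at h2
    exact h2
  obtain ⟨b₁, a1, a2, a3, a4, a5⟩ := GradedSpace.exists_homotopy_inverse hf.1 hπ.1 hπ'.1
    (fun x => LinearMap.congr_fun (congrArg Prod.fst ππ) x)
    (fun x => LinearMap.congr_fun (congrArg Prod.fst ππ') x)
    (fun x hx => congrArg Prod.fst (inj (x, 0) (Prod.ext hx (by
      change π'.2 (F.fam.linear.2 (π.2 0)) = 0
      rw [map_zero, map_zero, map_zero]))))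
    fun x' => by
      obtain ⟨x, hx⟩ := surj (x', 0)
      exact ⟨x.1, congrArg Prod.fst hx⟩
  obtain ⟨b₂, b1, b2, b3, b4, b5⟩ := GradedSpace.exists_homotopy_inverse hf.2 hπ.2 hπ'.2
    (fun x => LinearMap.congr_fun (congrArg Prod.snd ππ) x)
    (fun x => LinearMap.congr_fun (congrArg Prod.snd ππ') x)
    (fun x hx => congrArg Prod.snd (inj (0, x) (Prod.ext (by
      change π'.1 (F.fam.linear.1 (π.1 0)) = 0
      rw [map_zero, map_zero, map_zero]) hx)))
    fun x' => by
      obtain ⟨x, hx⟩ := surj (0, x')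
      exact ⟨x.2, congrArg Prod.snd hx⟩
  exact ⟨(b₁, b₂), hf, ⟨a1, b1⟩, fd, Prod.ext (LinearMap.ext a2) (LinearMap.ext b2),
    Prod.ext (LinearMap.ext a3) (LinearMap.ext b3), Prod.ext (LinearMap.ext a4) (LinearMap.ext b4),
    Prod.ext (LinearMap.ext a5) (LinearMap.ext b5)⟩

theorem Hom.isQuasiIso_of_inverse (F : Hom H H') (G : Hom H' H)
    (h1 : G.cohomologyMap ∘ₗ F.cohomologyMap = LinearMap.id)
    (h2 : F.cohomologyMap ∘ₗ G.cohomologyMap = LinearMap.id) : G.IsQuasiIso :=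
  Function.bijective_iff_has_inverse.2
    ⟨F.cohomologyMap, LinearMap.congr_fun h2, LinearMap.congr_fun h1⟩

variable [CharZero k]

/-- Quasi-isomorphisms have inverses up to homotopy. -/
theorem Hom.exists_inverse (F : Hom H H') (hF : F.IsQuasiIso) : ∃ G : Hom H' H,
    G.cohomologyMap ∘ₗ F.cohomologyMap = LinearMap.id ∧
      F.cohomologyMap ∘ₗ G.cohomologyMap = LinearMap.id := by
  obtain ⟨h, π, c⟩ := H.exists_contraction
  obtain ⟨h', π', c'⟩ := H'.exists_contraction
  obtain ⟨b, e⟩ := F.exists_linearInverse hF c c'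
  obtain ⟨G, hG, hGl, hGQ⟩ := e.exists_inverse H.fam_deg H.ins_fam H'.fam_deg H'.ins_fam c c'
    F.fam_deg rfl F.ins_fam
  let G' : Hom H' H := Hom.ofFam G hG hGQ
  have hb : ∀ x, G'.linear x = total b x := fun x => by rw [← hGl]; rfl
  have hGF : G'.cohomologyMap ∘ₗ F.cohomologyMap = LinearMap.id := by
    -- For a cocycle, `x = d h x + π x`. The linear part `b` kills `f d h x = d' f h x` and sends `f
    -- π x` to `π x`, so the composite differs from `x` by `d (-h x)`.
    refine Hom.comp_eq_id F G' fun x hx => ⟨-total h x, ?_⟩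
    have h1 : total b (F.linear (total π x)) = total π x :=
      Prod.ext (LinearMap.congr_fun (congrArg Prod.fst e.b_f_π) x.1)
        (LinearMap.congr_fun (congrArg Prod.snd e.b_f_π) x.2)
    have h2 : H.differential (total h x) + total h (H.differential x) + total π x = x :=
      Prod.ext (LinearMap.congr_fun (congrArg Prod.fst c.sum) x.1)
        (LinearMap.congr_fun (congrArg Prod.snd c.sum) x.2)
    have h3 : ∀ y : H'.C × H'.O, total b (H'.differential y) = 0 := fun y =>
      Prod.ext (LinearMap.congr_fun (congrArg Prod.fst (e.b_d c')) y.1)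
        (LinearMap.congr_fun (congrArg Prod.snd (e.b_d c')) y.2)
    rw [hx, map_zero, add_zero] at h2
    have h4 : F.linear (H.differential (total h x)) = H'.differential (F.linear (total h x)) :=
      LinearMap.congr_fun F.linear_comp_differential _
    have h5 : G'.linear (F.linear x) = total π x := by
      conv_lhs => rw [← h2]
      rw [hb, map_add, map_add, h4, h3, zero_add, h1]
    rw [h5, map_neg]
    exact eq_add_neg_of_add_eq ((add_comm _ _).trans h2)
  refine ⟨G', hGF, ?_⟩
  -- A left inverse of a surjection is also a right inverse.
  refine LinearMap.ext fun y => ?_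
  obtain ⟨x, rfl⟩ := hF.2 y
  exact congrArg F.cohomologyMap (LinearMap.congr_fun hGF x)

theorem QuasiIsomorphic.symm {H H' : OCHA.{u, v} k} (h : H.QuasiIsomorphic H') :
    H'.QuasiIsomorphic H := by
  obtain ⟨F, hF⟩ := h
  obtain ⟨G, h1, h2⟩ := F.exists_inverse hF
  exact ⟨G, F.isQuasiIso_of_inverse G h1 h2⟩

theorem QuasiIsomorphic.refl (H : OCHA.{u, v} k) : H.QuasiIsomorphic H := by
  let F : Hom H H := Hom.ofFam (Fam.id H.pair) Fam.id_hasDeg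
    (eq_comp_of_flow H.fam_deg Fam.id_hasDeg fun 𝔸 z hz θ hθ hθθ => by
      rw [Fam.ev_id hz, Fam.ev_id (flow_mem H.fam_deg hθ hz)])
  have hF : F.cohomologyMap ∘ₗ F.cohomologyMap = LinearMap.id :=
    Hom.comp_eq_id F F fun x _ => ⟨0, by
      have hl : ∀ x, F.linear x = x := fun x =>
        congrArg (fun L : LPair H.pair H.pair => total L x) (Fam.linear_lin (LPair.id H.pair))
      rw [hl, hl, map_zero, add_zero]⟩
  exact ⟨F, F.isQuasiIso_of_inverse F hF hF⟩

theorem QuasiIsomorphic.trans {H H' H'' : OCHA.{u, v} k} (h : H.QuasiIsomorphic H')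
    (h' : H'.QuasiIsomorphic H'') : H.QuasiIsomorphic H'' := by
  obtain ⟨F, hF⟩ := h
  obtain ⟨G, hG⟩ := h'
  have hd := G.fam_deg.comp F.fam_deg
  let K : Hom H H'' := Hom.ofFam (G.fam.comp F.fam) hd
    (eq_comp_of_flow H.fam_deg hd fun 𝔸 z hz θ hθ hθθ => by
      rw [ev_comp _ F.fam_deg (flow_mem H.fam_deg hθ hz), ev_comp _ F.fam_deg hz,
        flow_of_eq_comp H.fam_deg F.fam_deg F.ins_fam hz hθ hθθ,
        flow_of_eq_comp H'.fam_deg G.fam_deg G.ins_fam (ev_mem F.fam_deg hz) hθ hθθ])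
  have hK : ⇑K.cohomologyMap = G.cohomologyMap ∘ F.cohomologyMap := by
    funext q
    obtain ⟨⟨x, hx⟩, rfl⟩ := Submodule.Quotient.mk_surjective _ q
    have hl : K.linear x = G.linear (F.linear x) :=
      congrArg (fun L : LPair H.pair H''.pair => total L x) (Fam.linear_comp G.fam F.fam)
    exact congrArg Submodule.Quotient.mk (Subtype.ext hl)
  refine ⟨K, ?_⟩
  unfold Hom.IsQuasiIso
  rw [hK]
  exact Function.Bijective.comp hG hF

end OCHA
end Main

end Ocha

end

theorem corollary4p5 {k : Type u} [Field k] [CharZero k] :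
    (∀ (H : Ocha.OCHA.{u, v} k) (H' : Ocha.OCHA.{u, w} k) (F : Ocha.OCHA.Hom H H'),
      F.IsQuasiIso →
        ∃ G : Ocha.OCHA.Hom H' H, G.IsQuasiIso ∧
          G.cohomologyMap ∘ₗ F.cohomologyMap = LinearMap.id ∧
          F.cohomologyMap ∘ₗ G.cohomologyMap = LinearMap.id) ∧
    Equivalence (fun H H' : Ocha.OCHA.{u, v} k => H.QuasiIsomorphic H') := by
  refine ⟨fun H H' F hF => ?_, fun H => Ocha.OCHA.QuasiIsomorphic.refl H,
    Ocha.OCHA.QuasiIsomorphic.symm, Ocha.OCHA.QuasiIsomorphic.trans⟩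
  obtain ⟨G, h1, h2⟩ := F.exists_inverse hF
  exact ⟨G, F.isQuasiIso_of_inverse G h1 h2, h1, h2⟩
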